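/- **Theorem (non-$p$-robust stable minimisation on general polygonal meshes).** *Setting.* Let $\gamma\in(0,1]$ and $p\in\mathbb N$. Let $\Omega\subset\mathbb R^2$ be a bounded Lipschitz polygonal domain and let $\mathcal T_h$ be a finite conforming mesh of $\Omega$ into open polygonal elements $K$, each bounded by a simple closed polygonal curve (consecutive edges may be aligned; two distinct mesh edges meet at most at common end points), of diameter $h_K$, such that each $K$ is star-shaped with respect to a ball $B(K)$ of radius at least $\gamma h_K$ and each edge of $K$ has length at least $\gamma h_K$. Let $\widetilde{\mathcal T}_h$ be the triangulation obtained by joining the centre of $B(K)$ with the vertices of $K$, for every $K$. Let $\nu$ be a vertex of $\mathcal T_h$, let $\omega^\nu$ be the (interior of the) union of the closed elements having $\nu$ as a vertex, and let $\widetilde{\mathcal T}_h^\nu$ be the set of triangles of $\widetilde{\mathcal T}_h$ contained in these elements. Set $\widetilde H^1(\omega^\nu)=\{v\in H^1(\omega^\nu):\int_{\omega^\nu}v=0\}$ if $\nu\in\Omega$, and $\widetilde H^1(\omega^\nu)=\{v\in H^1(\omega^\nu): v|_e=0$ for every mesh edge $e\subset\partial\Omega$ having $\nu$ as an end point$\}$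 if $\nu\in\partial\Omega$. Let $\mathbb P_q(\widetilde{\mathcal T}_h^\nu)$ be the piecewise polynomials of degree at most $q$, and let $\mathbb{RT}_p(\widetilde{\mathcal T}_h^\nu)$ be the vector fields that belong to $[\mathbb P_p]^2+\boldsymbol x\,\mathbb P_p$ on each triangle. For $\boldsymbol G_h\in\mathbb{RT}_p(\widetilde{\mathcal T}_h^\nu)$ and $r_h\in\mathbb P_p(\widetilde{\mathcal T}_h^\nu)$ let, with $\|\cdot\|$ the $L^2(\omega^\nu)$ norm, $$m_h^{\rm g}=\min_{v_h\in\mathbb P_{p+2}(\widetilde{\mathcal T}_h^\nu)\cap\widetilde H^1(\omega^\nu)}\|\boldsymbol G_h-\nabla v_h\|,\qquad m^{\rm g}=\min_{v\in\widetilde H^1(\omega^\nu)}\|\boldsymbol G_h-\nabla v\|,$$ $$m_h^{\rm d}=\min_{\substack{\boldsymbol\tau_h\in\mathbb{RT}_p(\widetilde{\mathcal T}_h^\nu)\cap\boldsymbol H(\mathrm{div},\omega^\nu)\\ \mathrm{div}\,\boldsymbol\tau_h=r_h}}\|\boldsymbol\tau_h+\boldsymbol G_h\|,\qquad m^{\rm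 d}=\min_{\substack{\boldsymbol\tau\in\boldsymbol H(\mathrm{div},\omega^\nu)\\ \mathrm{div}\,\boldsymbol\tau=r_h}}\|\boldsymbol\tau+\boldsymbol G_h\|.$$ *Claim.* There is a constant $C(p,\gamma)>0$, depending only on $p$ and $\gamma$ (not on $\Omega$, the mesh, the vertex $\nu$, or the data $\boldsymbol G_h$ and $r_h$), such that the four minima are attained and $$m_h^{\rm g}\le C(p,\gamma)\,m^{\rm g},\qquad m_h^{\rm d}\le C(p,\gamma)\,m^{\rm d}.$$ -/

import Mathlib

open MeasureTheory Set Filter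
open scoped Topology ContDiff ENNReal

noncomputable section

namespace PatchMin

/-- The Euclidean plane. -/
abbrev Plane : Type := EuclideanSpace ℝ (Fin 2)

/-! ### Lipschitz domains -/

/-- Bounded Lipschitz domain of the plane: near each boundary point, in suitable orthonormal
coordinates, `Ω` is the strict epigraph of a Lipschitz function. -/
structure IsLipschitzDomain (Ω : Set Plane) : Prop where
  isOpen : IsOpen Ω
  isBounded : Bornology.IsBounded Ω
  isConnected : IsConnected Ω
  locally_epigraph : ∀ x ∈ frontier Ω, ∃ r : ℝ, 0 < r ∧ ∃ (e : Plane ≃ₗᵢ[ℝ] Plane)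
    (L : NNReal) (f : ℝ → ℝ), LipschitzWith L f ∧
      ∀ y ∈ Metric.ball x r, (y ∈ Ω ↔ f (e y 0) < e y 1)

/-! ### Polygonal meshes -/

/-- An open polygonal element: a nonempty bounded open set whose boundary is a simple closed
polygonal curve (consecutive edges may be aligned). -/
structure Element where
  /-- The open set itself. -/
  carrier : Set Plane
  isOpen : IsOpen carrier
  isBounded : Bornology.IsBounded carrier
  nonempty : carrier.Nonempty
  /-- The number of vertices. -/
  n : ℕ
  three_le : 3 ≤ n
  /-- The vertices, in cyclic order. -/
  poly : Polygon Plane n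
  vertices_injective : Function.Injective poly.vertices
  frontier_eq : frontier carrier = poly.boundary ℝ
  simple : ∀ i j, i ≠ j → poly.edgeSet ℝ i ∩ poly.edgeSet ℝ j ⊆
    {poly i, poly (finRotate n i)} ∩ {poly j, poly (finRotate n j)}

namespace Element

variable (K : Element)

/-- The vertices of an element. -/
def vertexSet : Set Plane := range K.poly.vertices

/-- The first end point of the `i`-th edge. -/
def src (i : Fin K.n) : Plane := K.poly i

/-- The second end point of the `i`-th edge. -/
def tgt (i : Fin K.n) : Plane := K.poly (finRotate K.n i)

/-- The `i`-th (closed) edge. -/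
def edge (i : Fin K.n) : Set Plane := K.poly.edgeSet ℝ i

end Element

/-- A conforming polygonal mesh of `Ω` with regularity parameter `γ`, together with the ball
`B(K)` chosen in each element `K`. -/
structure Mesh (Ω : Set Plane) (γ : ℝ) where
  /-- The number of elements. -/
  N : ℕ
  /-- The elements. -/
  elem : Fin N → Element
  subset : ∀ k, (elem k).carrier ⊆ Ω
  disjoint : ∀ k l, k ≠ l → Disjoint (elem k).carrier (elem l).carrier
  cover : ⋃ k, closure (elem k).carrier = closure Ω
  /-- Two edges of the mesh either coincide or meet at most at common end points. -/
  conforming : ∀ k l i j, (elem k).edge i = (elem l).edge j ∨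
    (elem k).edge i ∩ (elem l).edge j ⊆
      {(elem k).src i, (elem k).tgt i} ∩ {(elem l).src j, (elem l).tgt j}
  /-- The centre of the ball `B(K)`. -/
  center : Fin N → Plane
  /-- The radius of the ball `B(K)`. -/
  radius : Fin N → ℝ
  radius_pos : ∀ k, 0 < radius k
  radius_ge : ∀ k, γ * Metric.diam (elem k).carrier ≤ radius k
  /-- Each element is star-shaped with respect to its ball. -/
  starShaped : ∀ k, ∀ y ∈ Metric.ball (center k) (radius k), StarConvex ℝ y (elem k).carrier
  /-- The mesh has no small edges. -/
  edge_ge : ∀ k i, γ * Metric.diam (elem k).carrier ≤ dist ((elem k).src i) ((elem k).tgt i)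

namespace Mesh

variable {Ω : Set Plane} {γ : ℝ} (M : Mesh Ω γ)

/-- The vertices of the mesh. -/
def vertexSet : Set Plane := {ν | ∃ k, ν ∈ (M.elem k).vertexSet}

/-- The open triangle of the subtriangulation spanned by the centre of the ball of the `k`-th
element and by the `i`-th edge of this element. -/
def tri (k : Fin M.N) (i : Fin (M.elem k).n) : Set Plane :=
  interior (convexHull ℝ {M.center k, (M.elem k).src i, (M.elem k).tgt i})

/-- The (indices of the) elements that share the vertex `ν`. -/
def patch (ν : Plane) : Set (Fin M.N) := {k | ν ∈ (M.elem k).vertexSet}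

/-- The vertex patch `ω^ν`, as an open set: the interior of the union of the closed elements
that share the vertex `ν`. -/
def omega (ν : Plane) : Set Plane := interior (⋃ k ∈ M.patch ν, closure (M.elem k).carrier)

end Mesh

/-! ### Polynomial spaces -/

/-- `v` coincides on `D` with a polynomial of degree at most `q`. -/
def IsPolyOn (q : ℕ) (D : Set Plane) (v : Plane → ℝ) : Prop :=
  ∃ P : MvPolynomial (Fin 2) ℝ, P.totalDegree ≤ q ∧ ∀ x ∈ D, v x = MvPolynomial.eval (⇑x) P

/-- `τ` coincides on `D` with an element of `[ℙ_q]² + x ℙ_q`. -/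
def IsRTOn (q : ℕ) (D : Set Plane) (τ : Plane → Plane) : Prop :=
  ∃ (A : Fin 2 → MvPolynomial (Fin 2) ℝ) (B : MvPolynomial (Fin 2) ℝ),
    (∀ i, (A i).totalDegree ≤ q) ∧ B.totalDegree ≤ q ∧
    ∀ x ∈ D, ∀ i, τ x i = MvPolynomial.eval (⇑x) (A i) + x i * MvPolynomial.eval (⇑x) B

namespace Mesh

variable {Ω : Set Plane} {γ : ℝ} (M : Mesh Ω γ)

/-- Piecewise polynomials of degree at most `q` over the subtriangulation of the patch of `ν`.
As for all functions here, the values on null sets are irrelevant. -/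
def IsPiecewisePoly (q : ℕ) (ν : Plane) (v : Plane → ℝ) : Prop :=
  ∀ k ∈ M.patch ν, ∀ i, IsPolyOn q (M.tri k i) v

/-- Piecewise Raviart-Thomas functions over the subtriangulation of the patch of `ν`. -/
def IsPiecewiseRT (q : ℕ) (ν : Plane) (τ : Plane → Plane) : Prop :=
  ∀ k ∈ M.patch ν, ∀ i, IsRTOn q (M.tri k i) τ

end Mesh

/-! ### Sobolev spaces -/

/-- Smooth functions with compact support in `D`. -/
def IsTest (D : Set Plane) (φ : Plane → ℝ) : Prop :=
  ContDiff ℝ ∞ φ ∧ HasCompactSupport φ ∧ tsupport φ ⊆ D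

/-- The `L²(D)` norm of a vector field (it is finite in all uses). -/
def l2norm (D : Set Plane) (F : Plane → Plane) : ℝ := (eLpNorm F 2 (volume.restrict D)).toReal

/-- `v` belongs to `H¹(D)` and `g` is its weak gradient. -/
structure IsH1 (D : Set Plane) (v : Plane → ℝ) (g : Plane → Plane) : Prop where
  memLp : MemLp v 2 (volume.restrict D)
  memLp_grad : MemLp g 2 (volume.restrict D)
  weakGrad : ∀ φ, IsTest D φ → ∫ x in D, v x • gradient φ x = - ∫ x in D, φ x • g x

/-- `τ` belongs to `H(div, D)` and `r`, assumed to be in `L²(D)`, is its weak divergence. -/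
structure IsHdiv (D : Set Plane) (τ : Plane → Plane) (r : Plane → ℝ) : Prop where
  memLp : MemLp τ 2 (volume.restrict D)
  memLp_div : MemLp r 2 (volume.restrict D)
  weakDiv : ∀ φ, IsTest D φ → ∫ x in D, inner ℝ (τ x) (gradient φ x) = - ∫ x in D, r x * φ x

/-- For `v ∈ H¹(D)` with weak gradient `g`, where `D` is an open triangle having `[a, b]` as one of
its edges, the trace of `v` on `[a, b]` vanishes: `v` is the limit in `H¹(D)` of functions that are
smooth up to the boundary and whose restrictions to `[a, b]` tend to zero in `L²`. -/
def HasZeroTrace (D : Set Plane) (a b : Plane) (v : Plane → ℝ) (g : Plane → Plane) : Prop :=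
  ∃ φ : ℕ → Plane → ℝ, (∀ m, ContDiff ℝ ∞ (φ m)) ∧
    Tendsto (fun m => eLpNorm (fun x => φ m x - v x) 2 (volume.restrict D)) atTop (𝓝 0) ∧
    Tendsto (fun m => eLpNorm (fun x => gradient (φ m) x - g x) 2 (volume.restrict D))
      atTop (𝓝 0) ∧
    Tendsto (fun m => eLpNorm (fun t : ℝ => φ m (AffineMap.lineMap a b t)) 2
      (volume.restrict (Icc (0 : ℝ) 1))) atTop (𝓝 0)

namespace Mesh

variable {Ω : Set Plane} {γ : ℝ} (M : Mesh Ω γ)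

/-- `v`, with weak gradient `g`, belongs to the space `H̃¹(ω^ν)`: zero mean value over the patch
if `ν` is an interior vertex; zero trace on the boundary edges that contain `ν` if `ν` is a
boundary vertex (the trace is taken from the triangle of the subtriangulation having this edge). -/
def IsHtilde (ν : Plane) (v : Plane → ℝ) (g : Plane → Plane) : Prop :=
  IsH1 (M.omega ν) v g ∧
  (ν ∈ Ω → ∫ x in M.omega ν, v x = 0) ∧
  (ν ∈ frontier Ω → ∀ k i, ((M.elem k).src i = ν ∨ (M.elem k).tgt i = ν) →
    (M.elem k).edge i ⊆ frontier Ω →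
    HasZeroTrace (M.tri k i) ((M.elem k).src i) ((M.elem k).tgt i) v g)

/-! ### The minimisation problems on the patch of `ν` -/

/-- Values of `‖G - ∇v‖` for `v ∈ H̃¹(ω^ν)`. -/
def contGrad (ν : Plane) (G : Plane → Plane) : Set ℝ :=
  {m | ∃ v g, M.IsHtilde ν v g ∧ m = l2norm (M.omega ν) (fun x => G x - g x)}

/-- Values of `‖G - ∇v‖` for piecewise polynomials `v ∈ H̃¹(ω^ν)` of degree at most `p + 2`. -/
def discGrad (p : ℕ) (ν : Plane) (G : Plane → Plane) : Set ℝ :=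
  {m | ∃ v g, M.IsHtilde ν v g ∧ M.IsPiecewisePoly (p + 2) ν v ∧
    m = l2norm (M.omega ν) (fun x => G x - g x)}

/-- Values of `‖τ + G‖` for `τ ∈ H(div, ω^ν)` with `div τ = r`. -/
def contDiv (ν : Plane) (G : Plane → Plane) (r : Plane → ℝ) : Set ℝ :=
  {m | ∃ τ, IsHdiv (M.omega ν) τ r ∧ m = l2norm (M.omega ν) (fun x => τ x + G x)}

/-- Values of `‖τ + G‖` for piecewise Raviart-Thomas `τ ∈ H(div, ω^ν)` of order `p` with
`div τ = r`. -/
def discDiv (p : ℕ) (ν : Plane) (G : Plane → Plane) (r : Plane → ℝ) : Set ℝ :=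
  {m | ∃ τ, IsHdiv (M.omega ν) τ r ∧ M.IsPiecewiseRT p ν τ ∧
    m = l2norm (M.omega ν) (fun x => τ x + G x)}

/-- The continuous minimum `m^g`. -/
def mg (ν : Plane) (G : Plane → Plane) : ℝ := sInf (M.contGrad ν G)

/-- The discrete minimum `m_h^g`. -/
def mgh (p : ℕ) (ν : Plane) (G : Plane → Plane) : ℝ := sInf (M.discGrad p ν G)

/-- The continuous minimum `m^d`. -/
def md (ν : Plane) (G : Plane → Plane) (r : Plane → ℝ) : ℝ := sInf (M.contDiv ν G r)

/-- The discrete minimum `m_h^d`. -/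
def mdh (p : ℕ) (ν : Plane) (G : Plane → Plane) (r : Plane → ℝ) : ℝ := sInf (M.discDiv p ν G r)

end Mesh

end PatchMin

end

/-!
The subtriangulation of a vertex patch has at most `N(γ)` triangles, and these are shape regular
with a constant that depends on `γ` only. An element is the disjoint union, up to null sets, of
the triangles spanned by the centre of its ball and its edges (`Mesh.closure_eq`,
`Mesh.disjoint_openTri`). Because the element is star-shaped with respect to the ball, the
distance of the centre from the line through an edge is at least the radius, which gives a lower
bound for the area (`Mesh.radius_mul_le_area`) and thereby shape regularity
(`Mesh.shapeRegular_tz`). The number of triangles in an element, and of elements at a vertex, is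
bounded by comparing areas with that of a disc; for elements at a vertex, one triangle at this
vertex is taken from each and scaled down to a common size (`Mesh.card_patchIndex_le`).

On a patch, one constant for all shapes comes from compactness of a trivial kind: there are only
finitely many ways to glue at most `N(γ)` copies of the reference triangle along their edges. Each
triangle is mapped to the reference triangle, by the adjoint of the affine map for gradients
(`gradPull`) and by the Piola map for fields (`piolaPull`). The divergence-free fields and the
gradients of functions in `H¹` become subspaces of `L²` of the union of the reference triangles
that depend on the gluing only (`DivCond`, `GradCond`). If `W` is a closed subspace of a normed
space and `X` is finite-dimensional, then `X ∩ W` approximates elements of `X` as well as `W`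
does, up to a constant (`exists_approx_inf`): the quotient by `W` restricted to `X` is open onto
its range. The maximum of the constants over all gluings, multiplied by powers of the shape
regularity constant and of `N(γ)`, is the constant sought (`exists_div_stable`,
`exists_grad_stable`).

That the subspaces of gradients are closed follows from the Poincaré inequality on each triangle
(`exists_poincare`) and from the finite dimension of the piecewise constants (`isClosed_map_snd`).
That the intersection of these subspaces with the polynomial fields consists of gradients of
polynomials is `WeakGrad.exists_peval`; as the fields in `ℝT_p` have degree `p + 1`, this is where
the degree `p + 2` of the potentials comes from.

Traces are never constructed. Only a necessary condition for two functions, or two fields, to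
match on a common edge is imposed: certain integrals over the two triangles agree for the test
functions that meet the edges of a triangle in the middle half of this edge only (`pairing`,
`etest`, `traceForm`). It is continuous in the pair of a function and its weak gradient, or in a
divergence-free field, and can be transported by affine maps. This enlarges the continuous spaces,
which does no harm, since for polynomials the condition amounts to pointwise equality on the whole
edge (`Triangulation.Glue.peval_eq`, `Triangulation.Glue.cross_eq`), and piecewise polynomials
with this property have a weak gradient or a weak divergence on the patch
(`Triangulation.weakGrad_paste`, `Triangulation.weakDiv_paste`).

The problem with a prescribed divergence `r` is reduced to the divergence-free one by subtracting
a Raviart-Thomas field with divergence `r`, which exists by `Triangulation.exists_pdiv_eq`. A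
piecewise polynomial orthogonal to all divergences of conforming Raviart-Thomas fields is zero:
testing with fields with zero normal component on the boundary of one triangle shows that it is
constant there, and testing with the fields attached to the edges shows that the constants vanish.

The minima are attained because a closed convex set in a Hilbert space has a point closest to a
given one (`exists_isLeast_norm_add`).
-/


noncomputable section

namespace PatchMin

/-! ### Triangles and barycentric coordinates -/

/-- The planar cross product as a linear form in its second argument. -/
def crossL (u : Plane) : Plane →L[ℝ] ℝ :=
  u 0 • EuclideanSpace.proj (𝕜 := ℝ) (1 : Fin 2) - u 1 • EuclideanSpace.proj (𝕜 := ℝ) (0 : Fin 2)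

/-- The planar cross product. -/
def cross (u w : Plane) : ℝ := u 0 * w 1 - u 1 * w 0

@[simp] lemma crossL_apply (u w : Plane) : crossL u w = cross u w := by
  simp [crossL, cross]

/-- Twice the signed area of the triangle with vertices `z 0`, `z 1`, `z 2`. -/
def area (z : Fin 3 → Plane) : ℝ := cross (z 1 - z 0) (z 2 - z 0)

/-- The differential of the `i`-th barycentric coordinate. -/
def dbary (z : Fin 3 → Plane) (i : Fin 3) : Plane →L[ℝ] ℝ :=
  (area z)⁻¹ • crossL (z (i + 2) - z (i + 1))

/-- The `i`-th barycentric coordinate with respect to the triangle `z`. -/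
def bary (z : Fin 3 → Plane) (i : Fin 3) (x : Plane) : ℝ := dbary z i (x - z (i + 1))

/-- The open triangle with vertices `z 0`, `z 1`, `z 2`. -/
def openTri (z : Fin 3 → Plane) : Set Plane := {x | ∀ i, 0 < bary z i x}

/-- The closed triangle with vertices `z 0`, `z 1`, `z 2`. -/
def closedTri (z : Fin 3 → Plane) : Set Plane := {x | ∀ i, 0 ≤ bary z i x}

lemma cross_smul_right (u : Plane) (c : ℝ) (w : Plane) : cross u (c • w) = c * cross u w := by
  simp [cross]; ring

lemma cross_add_right (u v w : Plane) : cross u (v + w) = cross u v + cross u w := by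
  simp [cross]; ring

/-- Lagrange's identity: the cross product and the inner product have squares that add up to the
product of the squared norms. -/
lemma abs_cross_le (u w : Plane) : |cross u w| ≤ ‖u‖ * ‖w‖ := by
  rw [EuclideanSpace.norm_eq, EuclideanSpace.norm_eq, ← Real.sqrt_mul (by positivity)]
  apply Real.abs_le_sqrt
  simp [Fin.sum_univ_two, cross]
  nlinarith [sq_nonneg (u 0 * w 0 + u 1 * w 1)]

lemma bary_add (z : Fin 3 → Plane) (i : Fin 3) (x v : Plane) :
    bary z i (x + v) = bary z i x + dbary z i v := by
  simp only [bary, ← map_add]; congr 1; abel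

lemma hasFDerivAt_bary (z : Fin 3 → Plane) (i : Fin 3) (x : Plane) :
    HasFDerivAt (bary z i) (dbary z i) x := by
  have := (dbary z i).hasFDerivAt (x := x - z (i + 1))
  exact this.comp x ((hasFDerivAt_id x).sub_const _)

lemma contDiff_bary (z : Fin 3 → Plane) (i : Fin 3) {n : WithTop ℕ∞} : ContDiff ℝ n (bary z i) :=
  (dbary z i).contDiff.comp (contDiff_id.sub contDiff_const)

lemma continuous_bary (z : Fin 3 → Plane) (i : Fin 3) : Continuous (bary z i) :=
  (contDiff_bary z i (n := 0)).continuous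

lemma bary_vertex {z : Fin 3 → Plane} (hz : area z ≠ 0) (i k : Fin 3) :
    bary z i (z k) = if i = k then 1 else 0 := by
  fin_cases i <;> fin_cases k <;>
    simp [bary, dbary, inv_mul_eq_div, div_eq_iff hz] <;> simp [area, cross] <;> ring

lemma sum_bary {z : Fin 3 → Plane} (hz : area z ≠ 0) (x : Plane) :
    bary z 0 x + bary z 1 x + bary z 2 x = 1 := by
  simp only [bary, dbary, smul_apply, smul_eq_mul, ← mul_add, crossL_apply]
  rw [inv_mul_eq_div, div_eq_iff hz]
  simp [area, cross]; ring

lemma sum_bary_smul {z : Fin 3 → Plane} (hz : area z ≠ 0) (x : Plane) :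
    bary z 0 x • z 0 + bary z 1 x • z 1 + bary z 2 x • z 2 = x := by
  ext k
  have h : ∀ a b c : ℝ, (area z)⁻¹ * a * z 0 k + (area z)⁻¹ * b * z 1 k + (area z)⁻¹ * c * z 2 k
      = (a * z 0 k + b * z 1 k + c * z 2 k) / area z := by intros; field_simp
  simp only [bary, dbary, smul_apply, smul_eq_mul, PiLp.add_apply,
    PiLp.smul_apply, crossL_apply, h]
  rw [div_eq_iff hz]
  fin_cases k <;> simp [area, cross] <;> ring

lemma sum_dbary {z : Fin 3 → Plane} (hz : area z ≠ 0) (v : Plane) :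
    dbary z 0 v + dbary z 1 v + dbary z 2 v = 0 := by
  have h1 := sum_bary hz (0 + v); have h0 := sum_bary hz 0
  simp only [bary_add] at h1; linarith

lemma sum_dbary_smul {z : Fin 3 → Plane} (hz : area z ≠ 0) (v : Plane) :
    dbary z 0 v • z 0 + dbary z 1 v • z 1 + dbary z 2 v • z 2 = v := by
  have h1 := sum_bary_smul hz (0 + v); have h0 := sum_bary_smul hz 0
  simp only [bary_add, add_smul] at h1
  calc _ = (bary z 0 0 • z 0 + dbary z 0 v • z 0 + (bary z 1 0 • z 1 + dbary z 1 v • z 1) +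
      (bary z 2 0 • z 2 + dbary z 2 v • z 2)) -
      (bary z 0 0 • z 0 + bary z 1 0 • z 1 + bary z 2 0 • z 2) := by abel
    _ = v := by rw [h1, h0]; simp

/-- An affine function is determined by its values at the vertices of a triangle; here the affine
function is a barycentric coordinate of another triangle. -/
lemma bary_eq_sum {z : Fin 3 → Plane} (hz : area z ≠ 0) (w : Fin 3 → Plane) (k : Fin 3)
    (x : Plane) : bary w k x =
      bary z 0 x * bary w k (z 0) + bary z 1 x * bary w k (z 1) + bary z 2 x * bary w k (z 2) := by
  have h := sum_bary hz x
  have e : x - w (k + 1) = bary z 0 x • (z 0 - w (k + 1)) + bary z 1 x • (z 1 - w (k + 1)) +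
      bary z 2 x • (z 2 - w (k + 1)) := by
    have : x - w (k + 1) = (bary z 0 x • z 0 + bary z 1 x • z 1 + bary z 2 x • z 2) -
        (bary z 0 x + bary z 1 x + bary z 2 x) • w (k + 1) := by
      rw [sum_bary_smul hz, h, one_smul]
    rw [this]; module
  conv_lhs => rw [bary, e]
  simp [bary]

lemma isOpen_openTri (z : Fin 3 → Plane) : IsOpen (openTri z) := by
  simp only [openTri, ofPred_forall]
  exact isOpen_iInter_of_finite fun i => isOpen_lt continuous_const (continuous_bary z i)

lemma isClosed_closedTri (z : Fin 3 → Plane) : IsClosed (closedTri z) := by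
  simp only [closedTri, ofPred_forall]
  exact isClosed_iInter fun i => isClosed_le continuous_const (continuous_bary z i)

lemma openTri_subset_closedTri (z : Fin 3 → Plane) : openTri z ⊆ closedTri z :=
  fun _ h i => (h i).le

lemma measurableSet_openTri (z : Fin 3 → Plane) : MeasurableSet (openTri z) :=
  (isOpen_openTri z).measurableSet

lemma bary_combo (z : Fin 3 → Plane) (i : Fin 3) (x y : Plane) {s t : ℝ} (h : s + t = 1) :
    bary z i (s • x + t • y) = s * bary z i x + t * bary z i y := by
  have : s • x + t • y - z (i + 1) = s • (x - z (i + 1)) + t • (y - z (i + 1)) := by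
    have : z (i + 1) = (s + t) • z (i + 1) := by rw [h, one_smul]
    conv_lhs => rw [this]
    module
  simp only [bary, this, map_add, map_smul, smul_eq_mul]

lemma convex_openTri (z : Fin 3 → Plane) : Convex ℝ (openTri z) := by
  intro x hx y hy s t hs ht hst i
  rw [bary_combo z i x y hst]
  rcases hs.eq_or_lt with rfl | hs
  · have : t = 1 := by linarith
    simpa [this] using hy i
  · exact add_pos_of_pos_of_nonneg (mul_pos hs (hx i)) (mul_nonneg ht (hy i).le)

lemma convex_closedTri (z : Fin 3 → Plane) : Convex ℝ (closedTri z) := by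
  intro x hx y hy s t hs ht hst i
  rw [bary_combo z i x y hst]
  exact add_nonneg (mul_nonneg hs (hx i)) (mul_nonneg ht (hy i))

lemma bary_line (z : Fin 3 → Plane) (i : Fin 3) (x y : Plane) (t : ℝ) :
    bary z i (AffineMap.lineMap x y t) = (1 - t) * bary z i x + t * bary z i y := by
  rw [AffineMap.lineMap_apply_module, bary_combo z i x y (by ring)]

lemma mem_closedTri_vertex {z : Fin 3 → Plane} (hz : area z ≠ 0) (k : Fin 3) :
    z k ∈ closedTri z := by
  intro i; rw [bary_vertex hz]; split_ifs <;> norm_num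

lemma closedTri_eq_convexHull {z : Fin 3 → Plane} (hz : area z ≠ 0) :
    closedTri z = convexHull ℝ (range z) := by
  apply Subset.antisymm
  · intro x hx
    rw [← sum_bary_smul hz x]
    have := (convex_convexHull ℝ (range z)).sum_mem (t := Finset.univ) (w := fun i => bary z i x)
      (z := z) (fun i _ => hx i) (by rw [Fin.sum_univ_three]; exact sum_bary hz x)
      (fun i _ => subset_convexHull ℝ _ (mem_range_self i))
    rwa [Fin.sum_univ_three] at this
  · refine convexHull_min ?_ (convex_closedTri z)
    rintro _ ⟨k, rfl⟩; exact mem_closedTri_vertex hz k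

lemma isCompact_closedTri {z : Fin 3 → Plane} (hz : area z ≠ 0) : IsCompact (closedTri z) := by
  rw [closedTri_eq_convexHull hz]; exact (finite_range z).isCompact_convexHull ℝ

lemma dbary_sub {z : Fin 3 → Plane} (hz : area z ≠ 0) (i k l : Fin 3) :
    dbary z i (z k - z l) = (if i = k then 1 else 0) - (if i = l then 1 else 0) := by
  rw [← bary_vertex hz, ← bary_vertex hz]
  simp only [bary, ← map_sub]; congr 1; abel

lemma interior_closedTri {z : Fin 3 → Plane} (hz : area z ≠ 0) :
    interior (closedTri z) = openTri z := by
  apply Subset.antisymm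
  · intro x hx i
    have h1 : 0 ≤ bary z i x := interior_subset hx i
    rcases h1.eq_or_lt with h0 | h0
    swap; · exact h0
    -- moving against the gradient of the vanishing coordinate leaves the closed triangle
    exfalso
    have hc : Tendsto (fun t : ℝ => x + t • (z (i + 1) - z i)) (𝓝[>] 0) (𝓝 x) := by
      have : Continuous fun t : ℝ => x + t • (z (i + 1) - z i) := by fun_prop
      simpa using (this.tendsto 0).mono_left nhdsWithin_le_nhds
    have := (hc.eventually (mem_interior_iff_mem_nhds.1 hx)).and self_mem_nhdsWithin
    obtain ⟨t, ht, ht0⟩ := this.exists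
    have := ht i
    rw [bary_add, ← h0, map_smul, dbary_sub hz] at this
    have hi : i ≠ i + 1 := by fin_cases i <;> decide
    simp [hi] at this
    exact absurd this (not_le.2 ht0)
  · exact interior_maximal (openTri_subset_closedTri z) (isOpen_openTri z)

lemma interior_convexHull_triple {a b c : Plane} (h : area ![a, b, c] ≠ 0) :
    interior (convexHull ℝ {a, b, c}) = openTri ![a, b, c] := by
  rw [← interior_closedTri h, closedTri_eq_convexHull h]
  congr 2
  ext x; simp [eq_comm]; tauto

/-! ### Oriented edges of a triangle -/

/-- Index of an oriented edge of a triangle: the opposite vertex and an orientation. -/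
abbrev OEdge : Type := Fin 3 × Bool

/-- First end point of an oriented edge. -/
def va (e : OEdge) : Fin 3 := if e.2 then e.1 + 1 else e.1 + 2

/-- Second end point of an oriented edge. -/
def vb (e : OEdge) : Fin 3 := if e.2 then e.1 + 2 else e.1 + 1

/-- Vertex opposite to an oriented edge. -/
abbrev vo (e : OEdge) : Fin 3 := e.1

lemma va_ne_vb (e : OEdge) : va e ≠ vb e := by revert e; decide
lemma va_ne_vo (e : OEdge) : va e ≠ vo e := by revert e; decide
lemma vb_ne_vo (e : OEdge) : vb e ≠ vo e := by revert e; decide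
lemma exists_oedge (i k : Fin 3) (h : i ≠ k) : ∃ e : OEdge, va e = i ∧ vb e = k := by
  revert i k; decide
lemma oedge_ext (e e' : OEdge) (h : va e = va e') (h' : vb e = vb e') : e = e' := by
  revert e e'; decide
lemma eq_va_or (e : OEdge) (i : Fin 3) : i = va e ∨ i = vb e ∨ i = vo e := by
  revert e i; decide

lemma sum_oedge {M : Type*} [AddCommMonoid M] (e : OEdge) (f : Fin 3 → M) :
    f 0 + f 1 + f 2 = f (va e) + f (vb e) + f (vo e) := by
  obtain ⟨i, b⟩ := e
  fin_cases i <;> cases b <;> simp [va, vb] <;> abel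

/-- Twice the area of the triangle, with the sign of the oriented edge. -/
def oarea (z : Fin 3 → Plane) (e : OEdge) : ℝ := cross (z (vb e) - z (va e)) (z (vo e) - z (va e))

lemma oarea_eq (z : Fin 3 → Plane) (e : OEdge) :
    oarea z e = if e.2 then area z else -area z := by
  obtain ⟨i, b⟩ := e
  fin_cases i <;> cases b <;> simp [oarea, va, vb, area, cross] <;> ring

lemma abs_oarea (z : Fin 3 → Plane) (e : OEdge) : |oarea z e| = |area z| := by
  rw [oarea_eq]; split_ifs <;> simp

/-- The relatively open edge. -/
def openEdge (z : Fin 3 → Plane) (e : OEdge) : Set Plane :=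
  {x | ∃ t ∈ Ioo (0 : ℝ) 1, x = AffineMap.lineMap (z (va e)) (z (vb e)) t}

lemma mem_openEdge_iff {z : Fin 3 → Plane} (hz : area z ≠ 0) (e : OEdge) (x : Plane) :
    x ∈ openEdge z e ↔ bary z (vo e) x = 0 ∧ 0 < bary z (va e) x ∧ 0 < bary z (vb e) x := by
  have h1 := va_ne_vb e; have h2 := va_ne_vo e; have h3 := vb_ne_vo e
  constructor
  · rintro ⟨t, ht, rfl⟩
    simp only [bary_line, bary_vertex hz]
    simp [h1, h1.symm, h2.symm, h3.symm, ht.1, ht.2]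
  · rintro ⟨h0, ha, hb⟩
    have hs := sum_bary hz x
    rw [sum_oedge e (fun i => bary z i x)] at hs
    refine ⟨bary z (vb e) x, ⟨hb, by linarith⟩, ?_⟩
    rw [AffineMap.lineMap_apply_module]
    conv_lhs => rw [← sum_bary_smul hz x, sum_oedge e (fun i => bary z i x • z i)]
    rw [h0, show bary z (va e) x = 1 - bary z (vb e) x by linarith]
    simp

/-- The boundary of a convex set is a null set. -/
lemma closedTri_sdiff_openTri_null {z : Fin 3 → Plane} (hz : area z ≠ 0) :
    volume (closedTri z \ openTri z) = 0 := by
  rw [← interior_closedTri hz]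
  have := (convex_closedTri z).addHaar_frontier volume
  rwa [(isClosed_closedTri z).frontier_eq] at this

/-! ### The reference triangle and the divergence theorem -/

/-- The vertices of the reference triangle. -/
def zref : Fin 3 → Plane := ![0, EuclideanSpace.single 0 1, EuclideanSpace.single 1 1]

/-- The open reference triangle. -/
abbrev refTri : Set Plane := openTri zref

/-- The linear part of the affine map from the reference triangle onto the triangle `z`. -/
def edgeMap (z : Fin 3 → Plane) : Plane →L[ℝ] Plane :=
  (EuclideanSpace.proj (𝕜 := ℝ) (0 : Fin 2)).smulRight (z 1 - z 0) +
    (EuclideanSpace.proj (𝕜 := ℝ) (1 : Fin 2)).smulRight (z 2 - z 0)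

/-- The inverse of `edgeMap z`. -/
def invMap (z : Fin 3 → Plane) : Plane →L[ℝ] Plane :=
  (dbary z 1).smulRight (EuclideanSpace.single 0 1) +
    (dbary z 2).smulRight (EuclideanSpace.single 1 1)

/-- The affine map from the reference triangle onto the triangle `z`. -/
def affMap (z : Fin 3 → Plane) (y : Plane) : Plane := z 0 + edgeMap z y

lemma edgeMap_apply (z : Fin 3 → Plane) (y : Plane) :
    edgeMap z y = y 0 • (z 1 - z 0) + y 1 • (z 2 - z 0) := by simp [edgeMap]

lemma area_zref : area zref = 1 := by simp [area, zref, cross]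

lemma area_zref_ne : area zref ≠ 0 := by rw [area_zref]; norm_num

lemma invMap_edgeMap {z : Fin 3 → Plane} (hz : area z ≠ 0) (y : Plane) :
    invMap z (edgeMap z y) = y := by
  rw [edgeMap_apply]
  ext i
  fin_cases i <;> simp [invMap, dbary_sub hz, -map_sub]

lemma edgeMap_invMap {z : Fin 3 → Plane} (hz : area z ≠ 0) (v : Plane) :
    edgeMap z (invMap z v) = v := by
  rw [edgeMap_apply]
  conv_rhs => rw [← sum_dbary_smul hz v]
  have := sum_dbary hz v
  have h0 : dbary z 0 v = -dbary z 1 v - dbary z 2 v := by linarith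
  simp [invMap, h0]
  module

lemma bary_affMap {z : Fin 3 → Plane} (hz : area z ≠ 0) (i : Fin 3) (y : Plane) :
    bary z i (affMap z y) = bary zref i y := by
  have h := bary_eq_sum area_zref_ne
  have h1 := sum_bary_smul area_zref_ne y
  have h2 := sum_bary area_zref_ne y
  have e0 : y 0 = bary zref 1 y := by
    conv_lhs => rw [← h1]
    simp [zref]
  have e1 : y 1 = bary zref 2 y := by
    conv_lhs => rw [← h1]
    simp [zref]
  rw [affMap, edgeMap_apply, bary_add, map_add, map_smul, map_smul, dbary_sub hz, dbary_sub hz,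
    bary_vertex hz, e0, e1]
  fin_cases i <;> simp
  linarith

lemma affMap_injective {z : Fin 3 → Plane} (hz : area z ≠ 0) : Function.Injective (affMap z) := by
  intro x y h
  have : edgeMap z x = edgeMap z y := by simpa [affMap] using h
  rw [← invMap_edgeMap hz x, this, invMap_edgeMap hz]

lemma affMap_surj {z : Fin 3 → Plane} (hz : area z ≠ 0) (x : Plane) :
    affMap z (invMap z (x - z 0)) = x := by simp [affMap, edgeMap_invMap hz]

/-- The inverse of `affMap z`. -/
def affInv (z : Fin 3 → Plane) (x : Plane) : Plane := invMap z (x - z 0)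

lemma affMap_affInv {z : Fin 3 → Plane} (hz : area z ≠ 0) (x : Plane) :
    affMap z (affInv z x) = x := affMap_surj hz x

lemma affInv_affMap {z : Fin 3 → Plane} (hz : area z ≠ 0) (x : Plane) :
    affInv z (affMap z x) = x := by simp [affInv, affMap, invMap_edgeMap hz]

lemma affMap_mem {z : Fin 3 → Plane} (hz : area z ≠ 0) (y : Plane) :
    affMap z y ∈ openTri z ↔ y ∈ refTri := by
  simp [openTri, bary_affMap hz]

lemma image_affMap {z : Fin 3 → Plane} (hz : area z ≠ 0) : affMap z '' refTri = openTri z := by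
  ext x; constructor
  · rintro ⟨y, hy, rfl⟩; exact (affMap_mem hz y).2 hy
  · intro hx
    refine ⟨affInv z x, ?_, affMap_affInv hz x⟩
    rwa [← affMap_mem hz, affMap_affInv hz]

lemma hasFDerivAt_affMap (z : Fin 3 → Plane) (y : Plane) :
    HasFDerivAt (affMap z) (edgeMap z) y := (edgeMap z).hasFDerivAt.const_add _

lemma contDiff_affMap (z : Fin 3 → Plane) {n : WithTop ℕ∞} : ContDiff ℝ n (affMap z) :=
  contDiff_const.add (edgeMap z).contDiff

lemma continuous_affMap (z : Fin 3 → Plane) : Continuous (affMap z) :=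
  (contDiff_affMap z (n := 0)).continuous

lemma contDiff_affInv (z : Fin 3 → Plane) {n : WithTop ℕ∞} : ContDiff ℝ n (affInv z) :=
  (invMap z).contDiff.comp (contDiff_id.sub contDiff_const)

lemma det_edgeMap (z : Fin 3 → Plane) : (edgeMap z).det = area z := by
  have : (edgeMap z).det = LinearMap.det (edgeMap z : Plane →ₗ[ℝ] Plane) := rfl
  rw [this, ← LinearMap.det_toMatrix (EuclideanSpace.basisFun (Fin 2) ℝ).toBasis,
    Matrix.det_fin_two]
  simp [LinearMap.toMatrix_apply, edgeMap_apply, area, cross]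
  ring

lemma setIntegral_openTri {E : Type*} [NormedAddCommGroup E] [NormedSpace ℝ E]
    {z : Fin 3 → Plane} (hz : area z ≠ 0) (f : Plane → E) :
    ∫ x in openTri z, f x = |area z| • ∫ y in refTri, f (affMap z y) := by
  rw [← image_affMap hz, integral_image_eq_integral_abs_det_fderiv_smul volume
    (measurableSet_openTri _) (fun y _ => (hasFDerivAt_affMap z y).hasFDerivWithinAt)
    (affMap_injective hz).injOn, det_edgeMap, integral_smul]

lemma integrableOn_openTri_iff {E : Type*} [NormedAddCommGroup E] [NormedSpace ℝ E]
    {z : Fin 3 → Plane} (hz : area z ≠ 0) (f : Plane → E) :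
    IntegrableOn f (openTri z) ↔ IntegrableOn (fun y => f (affMap z y)) refTri := by
  rw [← image_affMap hz, integrableOn_image_iff_integrableOn_abs_det_fderiv_smul volume
    (measurableSet_openTri _) (fun y _ => (hasFDerivAt_affMap z y).hasFDerivWithinAt)
    (affMap_injective hz).injOn, det_edgeMap]
  exact integrable_smul_iff (abs_ne_zero.2 hz) _

lemma mem_refTri (y : Plane) : y ∈ refTri ↔ 0 < y 0 ∧ 0 < y 1 ∧ y 0 + y 1 < 1 := by
  simp [openTri, Fin.forall_fin_succ, bary, dbary, area_zref]
  simp [zref, cross]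
  constructor
  · rintro ⟨h1, h2, h3⟩; refine ⟨h2, h3, ?_⟩; linarith
  · rintro ⟨h1, h2, h3⟩; refine ⟨?_, h1, h2⟩; linarith

lemma measurePreserving_pair :
    MeasurePreserving (fun p : ℝ × ℝ => (!₂[p.1, p.2] : Plane)) volume volume := by
  have h1 := (EuclideanSpace.volume_preserving_symm_measurableEquiv_toLp (Fin 2)).symm
  have h2 := (volume_preserving_finTwoArrow ℝ).symm
  exact h1.comp h2

lemma measurableEmbedding_pair :
    MeasurableEmbedding (fun p : ℝ × ℝ => (!₂[p.1, p.2] : Plane)) := by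
  have h1 := (MeasurableEquiv.toLp 2 (Fin 2 → ℝ)).measurableEmbedding
  have h2 := (MeasurableEquiv.finTwoArrow (α := ℝ)).symm.measurableEmbedding
  exact h1.comp h2

lemma integrableOn_openTri_of_continuous {z : Fin 3 → Plane} (hz : area z ≠ 0)
    {E : Type*} [NormedAddCommGroup E] {f : Plane → E} (hf : Continuous f) :
    IntegrableOn f (openTri z) :=
  (hf.continuousOn.integrableOn_compact (isCompact_closedTri hz)).mono_set
    (openTri_subset_closedTri z)

/-- Fubini's theorem on the reference triangle, which is the region between the graphs of `0` and
`1 - s`. -/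
lemma setIntegral_refTri {f : Plane → ℝ} (hf : Continuous f) :
    ∫ y in refTri, f y = ∫ s in (0 : ℝ)..1, ∫ t in (0 : ℝ)..(1 - s), f !₂[s, t] := by
  set S : Set (ℝ × ℝ) := (fun p : ℝ × ℝ => (!₂[p.1, p.2] : Plane)) ⁻¹' refTri with hS
  have hSm : MeasurableSet S := (measurableSet_openTri _).preimage measurePreserving_pair.measurable
  have hmem : ∀ p : ℝ × ℝ, p ∈ S ↔ 0 < p.1 ∧ 0 < p.2 ∧ p.1 + p.2 < 1 := by
    intro p; rw [hS, mem_preimage, mem_refTri]; simp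
  rw [← measurePreserving_pair.setIntegral_preimage_emb measurableEmbedding_pair, ← hS,
    ← integral_indicator hSm]
  have hint : Integrable (S.indicator fun p : ℝ × ℝ => f !₂[p.1, p.2]) := by
    rw [integrable_indicator_iff hSm, hS]
    have := (measurePreserving_pair.integrableOn_comp_preimage measurableEmbedding_pair).2
      (integrableOn_openTri_of_continuous area_zref_ne hf)
    exact this
  rw [Measure.volume_eq_prod, integral_prod _ hint, intervalIntegral.integral_of_le zero_le_one,
    ← integral_indicator measurableSet_Ioc]
  refine integral_congr_ae ?_
  have h1 : ∀ᵐ s : ℝ, s ≠ 1 := by simp [ae_iff]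
  filter_upwards [h1] with s hs1
  by_cases hs : s ∈ Ioc (0 : ℝ) 1
  · rw [indicator_of_mem hs, intervalIntegral.integral_of_le (by linarith [hs.2]),
      integral_Ioc_eq_integral_Ioo,
      ← integral_indicator measurableSet_Ioo]
    congr 1; ext t
    have : (s, t) ∈ S ↔ t ∈ Ioo 0 (1 - s) := by
      rw [hmem]; simp only [mem_Ioo]
      constructor
      · rintro ⟨_, h2, h3⟩; exact ⟨h2, by linarith⟩
      · rintro ⟨h2, h3⟩; exact ⟨hs.1, h2, by linarith⟩
    by_cases ht : t ∈ Ioo 0 (1 - s)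
    · rw [indicator_of_mem ht, indicator_of_mem (this.2 ht)]
    · rw [indicator_of_notMem ht, indicator_of_notMem (mt this.1 ht)]
  · rw [indicator_of_notMem hs]
    rw [← integral_zero ℝ ℝ (μ := volume)]
    congr 1; ext t
    refine indicator_of_notMem ?_ _
    rw [hmem]; rintro ⟨h1, h2, h3⟩
    exact hs ⟨h1, by simp at *; linarith⟩

/-- The fundamental theorem of calculus on the vertical lines of the reference triangle. -/
lemma integral_refTri_fderiv_snd {H : Plane → ℝ} (hH : ContDiff ℝ 1 H) :
    ∫ y in refTri, fderiv ℝ H y (EuclideanSpace.single 1 1) =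
      ∫ s in (0 : ℝ)..1, (H !₂[s, 1 - s] - H !₂[s, 0]) := by
  rw [setIntegral_refTri ((hH.continuous_fderiv one_ne_zero).clm_apply continuous_const)]
  congr 1; ext s
  have hp : ∀ t : ℝ,
      HasDerivAt (fun t : ℝ => (!₂[s, t] : Plane)) (EuclideanSpace.single 1 1) t := by
    intro t
    have h : (fun t : ℝ => (!₂[s, t] : Plane)) =
        fun t => !₂[s, 0] + t • (EuclideanSpace.single 1 1 : Plane) := by
      ext t i; fin_cases i <;> simp
    rw [h]
    simpa using
      ((hasDerivAt_id t).smul_const (EuclideanSpace.single 1 1 : Plane)).const_add !₂[s, 0]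
  have hd : ∀ t : ℝ, HasDerivAt (fun t : ℝ => H !₂[s, t])
      (fderiv ℝ H !₂[s, t] (EuclideanSpace.single 1 1)) t := fun t =>
    ((hH.differentiable one_ne_zero) _).hasFDerivAt.comp_hasDerivAt t (hp t)
  rw [intervalIntegral.integral_eq_sub_of_hasDerivAt (fun t _ => hd t)]
  refine Continuous.intervalIntegrable ?_ _ _
  have hc : Continuous fun t : ℝ => (!₂[s, t] : Plane) :=
    continuous_iff_continuousAt.2 fun t => (hp t).continuousAt
  exact ((hH.continuous_fderiv one_ne_zero).comp hc).clm_apply continuous_const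

/-- The reflection of the plane that exchanges the two coordinates. -/
def swapMap : Plane ≃ₗᵢ[ℝ] Plane := LinearIsometryEquiv.piLpCongrLeft 2 ℝ ℝ (Equiv.swap 0 1)

lemma swapMap_apply (y : Plane) : swapMap y = !₂[y 1, y 0] := by
  ext i; fin_cases i <;> simp [swapMap, LinearIsometryEquiv.piLpCongrLeft_apply, Equiv.piCongrLeft']

/-- The horizontal counterpart of `integral_refTri_fderiv_snd`, obtained by reflection. -/
lemma integral_refTri_fderiv_fst {H : Plane → ℝ} (hH : ContDiff ℝ 1 H) :
    ∫ y in refTri, fderiv ℝ H y (EuclideanSpace.single 0 1) =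
      ∫ s in (0 : ℝ)..1, (H !₂[1 - s, s] - H !₂[0, s]) := by
  have hs : ContDiff ℝ 1 (fun y => H (swapMap y)) :=
    hH.comp (swapMap.toContinuousLinearEquiv.contDiff)
  have h := integral_refTri_fderiv_snd hs
  simp only [swapMap_apply] at h
  simp only [Matrix.cons_val_zero, Matrix.cons_val_one] at h
  rw [← h]
  have hpre : swapMap ⁻¹' refTri = refTri := by
    ext y; rw [mem_preimage, mem_refTri, mem_refTri, swapMap_apply]
    simp; rw [add_comm (y 1)]; tauto
  rw [← swapMap.measurePreserving.setIntegral_preimage_emb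
    swapMap.toHomeomorph.measurableEmbedding, hpre]
  refine setIntegral_congr_fun (measurableSet_openTri _) fun y _ => ?_
  have e : (fun y : Plane => H !₂[y 1, y 0]) = H ∘ swapMap := by
    ext y; simp [swapMap_apply]
  have hf : HasFDerivAt (swapMap : Plane → Plane)
      (swapMap.toContinuousLinearEquiv : Plane →L[ℝ] Plane) y :=
    swapMap.toContinuousLinearEquiv.hasFDerivAt
  simp only [e]
  rw [((hH.differentiable one_ne_zero _).hasFDerivAt.comp y hf).fderiv]
  simp only [ContinuousLinearMap.comp_apply, ContinuousLinearEquiv.coe_coe,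
    LinearIsometryEquiv.coe_toContinuousLinearEquiv, swapMap_apply]
  congr 1
  ext i; fin_cases i <;> simp

/-- The divergence of a vector field. -/
def dv (F : Plane → Plane) (x : Plane) : ℝ :=
  LinearMap.trace ℝ Plane (fderiv ℝ F x : Plane →ₗ[ℝ] Plane)

lemma trace_eq (L : Plane →ₗ[ℝ] Plane) : LinearMap.trace ℝ Plane L =
    L (EuclideanSpace.single 0 1) 0 + L (EuclideanSpace.single 1 1) 1 := by
  rw [LinearMap.trace_eq_matrix_trace ℝ (EuclideanSpace.basisFun (Fin 2) ℝ).toBasis,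
    Matrix.trace_fin_two]
  simp [LinearMap.toMatrix_apply]

lemma fderiv_coord {F : Plane → Plane} {x : Plane} (hF : DifferentiableAt ℝ F x) (v : Plane)
    (i : Fin 2) : fderiv ℝ (fun x => F x i) x v = fderiv ℝ F x v i := by
  have h := (EuclideanSpace.proj (𝕜 := ℝ) i).hasFDerivAt.comp x hF.hasFDerivAt
  exact congrArg (fun L => L v) h.fderiv

lemma contDiff_coord {F : Plane → Plane} {n : WithTop ℕ∞} (hF : ContDiff ℝ n F) (i : Fin 2) :
    ContDiff ℝ n (fun x => F x i) :=
  (EuclideanSpace.proj (𝕜 := ℝ) i).contDiff.comp hF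

lemma continuous_dv {F : Plane → Plane} (hF : ContDiff ℝ 1 F) : Continuous (dv F) := by
  have : dv F = fun x => fderiv ℝ F x (EuclideanSpace.single 0 1) 0 +
      fderiv ℝ F x (EuclideanSpace.single 1 1) 1 := by ext x; exact trace_eq _
  rw [this]
  have h := hF.continuous_fderiv one_ne_zero
  have h2 : ∀ i : Fin 2, Continuous fun x => fderiv ℝ F x (EuclideanSpace.single i 1) i :=
    fun i => (EuclideanSpace.proj (𝕜 := ℝ) i).continuous.comp (h.clm_apply continuous_const)
  exact (h2 0).add (h2 1)

/-- The divergence theorem on the reference triangle, each edge being parametrised over the unit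
interval. -/
lemma integral_refTri_dv {G : Plane → Plane} (hG : ContDiff ℝ 1 G) :
    ∫ y in refTri, dv G y =
      (∫ t in (0 : ℝ)..1, (G !₂[1 - t, t] 0 + G !₂[1 - t, t] 1)) - (∫ t in (0 : ℝ)..1, G !₂[0, t] 0)
        - ∫ t in (0 : ℝ)..1, G !₂[t, 0] 1 := by
  have hd := hG.differentiable one_ne_zero
  have e : ∀ y, dv G y = fderiv ℝ (fun x => G x 0) y (EuclideanSpace.single 0 1) +
      fderiv ℝ (fun x => G x 1) y (EuclideanSpace.single 1 1) := by
    intro y; rw [fderiv_coord (hd y), fderiv_coord (hd y)]; exact trace_eq _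
  have hi : ∀ i : Fin 2, IntegrableOn (fun y => fderiv ℝ (fun x => G x i) y
      (EuclideanSpace.single i 1)) refTri := fun i =>
    integrableOn_openTri_of_continuous area_zref_ne
      (((contDiff_coord hG i).continuous_fderiv one_ne_zero).clm_apply continuous_const)
  simp only [e]
  rw [integral_add (hi 0) (hi 1), integral_refTri_fderiv_fst (contDiff_coord hG 0),
    integral_refTri_fderiv_snd (contDiff_coord hG 1)]
  have hp : Continuous fun t : ℝ × ℝ => (!₂[t.1, t.2] : Plane) := by fun_prop
  have hc : ∀ (i : Fin 2) (f g : ℝ → ℝ), Continuous f → Continuous g →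
      IntervalIntegrable (fun t => G !₂[f t, g t] i) volume 0 1 := fun i f g hf hg =>
    ((contDiff_coord hG i).continuous.comp (hp.comp (hf.prodMk hg))).intervalIntegrable _ _
  have h1 := fun i => hc i (fun t => 1 - t) (fun t => t) (by fun_prop) (by fun_prop)
  have h2 := fun i => hc i (fun t => t) (fun t => 1 - t) (by fun_prop) (by fun_prop)
  have h3 := fun i => hc i (fun _ => 0) (fun t => t) (by fun_prop) (by fun_prop)
  have h4 := fun i => hc i (fun t => t) (fun _ => 0) (by fun_prop) (by fun_prop)
  rw [intervalIntegral.integral_sub (h1 0) (h3 0), intervalIntegral.integral_sub (h2 1) (h4 1),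
    intervalIntegral.integral_add (h1 0) (h1 1)]
  have := intervalIntegral.integral_comp_sub_left (a := 0) (b := 1)
    (fun t => G !₂[t, 1 - t] 1) (1 : ℝ)
  simp at this
  rw [← this]; ring

/-- The flux of `F` through an oriented edge; the sign makes it the flux into the triangle,
independently of the orientation of the edge. -/
def flux (z : Fin 3 → Plane) (F : Plane → Plane) (e : OEdge) : ℝ :=
  oarea z e / |area z| * ∫ t in (0 : ℝ)..1, cross (z (vb e) - z (va e))
    (F (AffineMap.lineMap (z (va e)) (z (vb e)) t))

/-- Both the sign and the parametrisation are reversed. -/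
lemma flux_reverse (z : Fin 3 → Plane) (F : Plane → Plane) (i : Fin 3) :
    flux z F (i, false) = flux z F (i, true) := by
  have h := intervalIntegral.integral_comp_sub_left (a := 0) (b := 1)
    (fun t => cross (z (vb (i, true)) - z (va (i, true)))
      (F (AffineMap.lineMap (z (va (i, true))) (z (vb (i, true))) t))) (1 : ℝ)
  simp only [sub_zero, sub_self] at h
  unfold flux
  rw [← h, oarea_eq, oarea_eq]
  have : ∀ t : ℝ, cross (z (vb (i, false)) - z (va (i, false)))
      (F (AffineMap.lineMap (z (va (i, false))) (z (vb (i, false))) t)) =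
      -cross (z (vb (i, true)) - z (va (i, true)))
      (F (AffineMap.lineMap (z (va (i, true))) (z (vb (i, true))) (1 - t))) := by
    intro t
    rw [AffineMap.lineMap_apply_one_sub]
    simp [va, vb, cross]; ring
  simp only [this, intervalIntegral.integral_neg]
  simp; ring

/-- The pull-back `invMap z ∘ F ∘ affMap z` preserves divergences, since the trace is invariant
under conjugation. -/
lemma dv_pullback {z : Fin 3 → Plane} (hz : area z ≠ 0) {F : Plane → Plane} {y : Plane}
    (hF : DifferentiableAt ℝ F (affMap z y)) :
    dv (fun y => invMap z (F (affMap z y))) y = dv F (affMap z y) := by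
  have h : HasFDerivAt (fun y => invMap z (F (affMap z y)))
      ((invMap z).comp ((fderiv ℝ F (affMap z y)).comp (edgeMap z))) y :=
    (invMap z).hasFDerivAt.comp y (hF.hasFDerivAt.comp y (hasFDerivAt_affMap z y))
  unfold dv
  rw [h.fderiv]
  have e : ((invMap z).comp ((fderiv ℝ F (affMap z y)).comp (edgeMap z)) : Plane →ₗ[ℝ] Plane) =
    (invMap z : Plane →ₗ[ℝ] Plane) * ((fderiv ℝ F (affMap z y) : Plane →ₗ[ℝ] Plane) *
      (edgeMap z : Plane →ₗ[ℝ] Plane)) := rfl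
  have e2 : (edgeMap z : Plane →ₗ[ℝ] Plane) * (invMap z : Plane →ₗ[ℝ] Plane) = 1 := by
    ext1 v; exact edgeMap_invMap hz v
  rw [e, LinearMap.trace_mul_comm, mul_assoc, e2, mul_one]

/-- The divergence theorem on a triangle; every edge occurs with both orientations. -/
lemma setIntegral_dv {z : Fin 3 → Plane} (hz : area z ≠ 0) {F : Plane → Plane}
    (hF : ContDiff ℝ 1 F) : ∫ x in openTri z, dv F x = -(1 / 2) * ∑ e : OEdge, flux z F e := by
  set G : Plane → Plane := fun y => invMap z (F (affMap z y)) with hG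
  have hGc : ContDiff ℝ 1 G := (invMap z).contDiff.comp (hF.comp (contDiff_affMap z))
  -- the components of the pull-back, and minus their sum, are the normal components of `F` on the
  -- three edges, up to a factor
  have h0 : ∀ y, G y 0 = dbary z 1 (F (affMap z y)) := fun y => by simp [hG, invMap]
  have h1 : ∀ y, G y 1 = dbary z 2 (F (affMap z y)) := fun y => by simp [hG, invMap]
  have hs : ∀ y, G y 0 + G y 1 = -dbary z 0 (F (affMap z y)) := fun y => by
    have := sum_dbary hz (F (affMap z y)); rw [h0, h1]; linarith
  have hfl : ∀ i : Fin 3, flux z F (i, true) = |area z| * ∫ t in (0 : ℝ)..1,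
      dbary z i (F (AffineMap.lineMap (z (i + 1)) (z (i + 2)) t)) := by
    intro i
    simp only [flux, oarea_eq, va, vb, dbary, smul_apply, smul_eq_mul, crossL_apply, if_true,
      intervalIntegral.integral_const_mul]
    rw [← mul_assoc]; congr 1
    rcases abs_cases (area z) with h | h <;> rw [h.1] <;> field_simp
  have hA : |area z| • ∫ y in refTri, dv F (affMap z y) = |area z| * ∫ y in refTri, dv G y := by
    rw [smul_eq_mul]; congr 1
    refine setIntegral_congr_fun (measurableSet_openTri _) fun y _ => ?_
    exact (dv_pullback hz (hF.differentiable one_ne_zero _)).symm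
  rw [setIntegral_openTri hz, hA, integral_refTri_dv hGc]
  simp only [hs]
  simp only [h0, h1]
  -- the parametrisations of the three edges
  have p0 : ∀ t : ℝ, affMap z !₂[1 - t, t] = AffineMap.lineMap (z 1) (z 2) t := by
    intro t; simp [affMap, edgeMap_apply, AffineMap.lineMap_apply_module]; module
  have p1 : ∀ t : ℝ, affMap z !₂[0, t] = AffineMap.lineMap (z 2) (z 0) (1 - t) := by
    intro t; simp [affMap, edgeMap_apply, AffineMap.lineMap_apply_module]; module
  have p2 : ∀ t : ℝ, affMap z !₂[t, 0] = AffineMap.lineMap (z 0) (z 1) t := by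
    intro t; simp [affMap, edgeMap_apply, AffineMap.lineMap_apply_module]; module
  simp only [p0, p1, p2]
  have := intervalIntegral.integral_comp_sub_left (a := 0) (b := 1)
    (fun t => dbary z 1 (F (AffineMap.lineMap (z 2) (z 0) t))) (1 : ℝ)
  simp only [sub_zero, sub_self] at this
  rw [this, Fintype.sum_prod_type, Fin.sum_univ_three]
  simp only [Fintype.sum_bool, flux_reverse, hfl, intervalIntegral.integral_neg]
  have e1 : (1 : Fin 3) + 2 = 0 := rfl
  have e2 : (2 : Fin 3) + 2 = 1 := rfl
  have e3 : (2 : Fin 3) + 1 = 0 := rfl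
  have e4 : (1 : Fin 3) + 1 = 2 := rfl
  simp only [e1, e2, e3, e4, zero_add]
  ring

/-! ### Conforming triangulations -/

/-- A finite family of nondegenerate, pairwise disjoint open triangles that meet edge to edge: a
closed triangle that contains a relatively interior point of an edge of another triangle has this
edge as one of its own. Triangles may meet at a vertex in any way. -/
structure Triangulation (m : ℕ) where
  /-- The vertices of the triangles. -/
  z : Fin m → Fin 3 → Plane
  area_ne : ∀ j, area (z j) ≠ 0
  disj : ∀ j k, j ≠ k → Disjoint (openTri (z j)) (openTri (z k))
  conf : ∀ j e x, x ∈ openEdge (z j) e → ∀ k, k ≠ j → x ∈ closedTri (z k) →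
    ∃ e', z k (va e') = z j (va e) ∧ z k (vb e') = z j (vb e)

lemma bary_vo_eq {z : Fin 3 → Plane} (hz : area z ≠ 0) (e : OEdge) (x : Plane) :
    bary z (vo e) x = cross (z (vb e) - z (va e)) (x - z (va e)) / oarea z e := by
  rw [oarea_eq]
  obtain ⟨i, b⟩ := e
  cases b
  · simp only [va, vb, bary, dbary, smul_apply, smul_eq_mul, crossL_apply, cross]
    simp; field_simp; ring
  · simp only [va, vb, bary, dbary, smul_apply, smul_eq_mul, crossL_apply]
    simp; field_simp

lemma oarea_ne {z : Fin 3 → Plane} (hz : area z ≠ 0) (e : OEdge) : oarea z e ≠ 0 := by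
  rw [← abs_ne_zero, abs_oarea]; exact abs_ne_zero.2 hz

lemma vertex_injective {z : Fin 3 → Plane} (hz : area z ≠ 0) : Function.Injective z := by
  intro i k h
  have h1 := bary_vertex hz i i
  rw [h, bary_vertex hz] at h1
  by_contra hik
  simp [hik] at h1

/-- Equality of two integrals over the unit interval, from equality in its interior. -/
lemma unitIntegral_congr {f g : ℝ → ℝ} (h : ∀ t ∈ Ioo (0 : ℝ) 1, f t = g t) :
    ∫ t in (0 : ℝ)..1, f t = ∫ t in (0 : ℝ)..1, g t := by
  rw [intervalIntegral.integral_of_le zero_le_one, intervalIntegral.integral_of_le zero_le_one,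
    integral_Ioc_eq_integral_Ioo, integral_Ioc_eq_integral_Ioo]
  exact setIntegral_congr_fun measurableSet_Ioo h

namespace Triangulation

variable {m : ℕ} (T : Triangulation m)

/-- The open region covered by a triangulation. -/
def region : Set Plane := interior (⋃ j, closedTri (T.z j))

/-- Two oriented edges of different triangles coincide. -/
def Glue (f f' : Fin m × OEdge) : Prop :=
  f.1 ≠ f'.1 ∧ T.z f.1 (va f.2) = T.z f'.1 (va f'.2) ∧ T.z f.1 (vb f.2) = T.z f'.1 (vb f'.2)

variable {T}

lemma Glue.symm {f f' : Fin m × OEdge} (h : T.Glue f f') : T.Glue f' f :=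
  ⟨h.1.symm, h.2.1.symm, h.2.2.symm⟩

/-- Both sides are affine functions that vanish on the common edge. -/
lemma Glue.bary_vo {f f' : Fin m × OEdge} (h : T.Glue f f') (x : Plane) :
    bary (T.z f'.1) (vo f'.2) x = oarea (T.z f.1) f.2 / oarea (T.z f'.1) f'.2 *
      bary (T.z f.1) (vo f.2) x := by
  have h1 := oarea_ne (T.area_ne f.1) f.2
  rw [bary_vo_eq (T.area_ne _), bary_vo_eq (T.area_ne _), ← h.2.1, ← h.2.2]
  field_simp

lemma Glue.bary_vb {f f' : Fin m × OEdge} (h : T.Glue f f') (x : Plane) :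
    bary (T.z f'.1) (vb f'.2) x = bary (T.z f.1) (vb f.2) x +
      bary (T.z f.1) (vo f.2) x * bary (T.z f'.1) (vb f'.2) (T.z f.1 (vo f.2)) := by
  rw [bary_eq_sum (T.area_ne f.1), sum_oedge f.2 (fun i => bary (T.z f.1) i x *
    bary (T.z f'.1) (vb f'.2) (T.z f.1 i)), h.2.1, h.2.2, bary_vertex (T.area_ne _),
    bary_vertex (T.area_ne _)]
  simp [(va_ne_vb f'.2).symm]

lemma Glue.bary_va {f f' : Fin m × OEdge} (h : T.Glue f f') (x : Plane) :
    bary (T.z f'.1) (va f'.2) x = bary (T.z f.1) (va f.2) x +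
      bary (T.z f.1) (vo f.2) x * bary (T.z f'.1) (va f'.2) (T.z f.1 (vo f.2)) := by
  rw [bary_eq_sum (T.area_ne f.1), sum_oedge f.2 (fun i => bary (T.z f.1) i x *
    bary (T.z f'.1) (va f'.2) (T.z f.1 i)), h.2.1, h.2.2, bary_vertex (T.area_ne _),
    bary_vertex (T.area_ne _)]
  simp [(va_ne_vb f'.2)]

/-- Disjoint triangles lie on opposite sides of a common edge. -/
lemma Glue.opposite {f f' : Fin m × OEdge} (h : T.Glue f f') :
    oarea (T.z f.1) f.2 / oarea (T.z f'.1) f'.2 < 0 := by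
  by_contra hc
  have hne : oarea (T.z f.1) f.2 / oarea (T.z f'.1) f'.2 ≠ 0 :=
    div_ne_zero (oarea_ne (T.area_ne _) _) (oarea_ne (T.area_ne _) _)
  have hpos : 0 < oarea (T.z f.1) f.2 / oarea (T.z f'.1) f'.2 :=
    lt_of_le_of_ne (not_lt.1 hc) hne.symm
  -- points close to the midpoint of the edge and above it lie in both triangles
  set z := T.z f.1 with hzdef
  have hz : area z ≠ 0 := T.area_ne f.1
  set p : ℝ → Plane := fun s => AffineMap.lineMap
    (AffineMap.lineMap (z (va f.2)) (z (vb f.2)) (1 / 2 : ℝ)) (z (vo f.2)) s with hp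
  have ho : ∀ s, bary z (vo f.2) (p s) = s := fun s => by
    simp [hp, bary_line, bary_vertex hz, (va_ne_vo f.2).symm, (vb_ne_vo f.2).symm]
  have ha : ∀ s, bary z (va f.2) (p s) = (1 - s) / 2 := fun s => by
    simp [hp, bary_line, bary_vertex hz, (va_ne_vo f.2), (va_ne_vb f.2)]; ring
  have hb : ∀ s, bary z (vb f.2) (p s) = (1 - s) / 2 := fun s => by
    simp [hp, bary_line, bary_vertex hz, (vb_ne_vo f.2), (va_ne_vb f.2).symm]; ring
  have hpc : Continuous p := AffineMap.lineMap_continuous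
  have e1 : ∀ᶠ s in 𝓝[>] (0 : ℝ), 0 < bary (T.z f'.1) (va f'.2) (p s) := by
    refine Tendsto.eventually_const_lt (u := 0) (v := 1 / 2) (by norm_num) ?_
    have := ((continuous_bary (T.z f'.1) (va f'.2)).comp hpc).tendsto 0
    have hv : bary (T.z f'.1) (va f'.2) (p 0) = 1 / 2 := by
      rw [h.bary_va, ← hzdef, ho, ha]; simp
    simp only [Function.comp_def, hv] at this
    exact this.mono_left nhdsWithin_le_nhds
  have e2 : ∀ᶠ s in 𝓝[>] (0 : ℝ), 0 < bary (T.z f'.1) (vb f'.2) (p s) := by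
    refine Tendsto.eventually_const_lt (u := 0) (v := 1 / 2) (by norm_num) ?_
    have := ((continuous_bary (T.z f'.1) (vb f'.2)).comp hpc).tendsto 0
    have hv : bary (T.z f'.1) (vb f'.2) (p 0) = 1 / 2 := by
      rw [h.bary_vb, ← hzdef, ho, hb]; simp
    simp only [Function.comp_def, hv] at this
    exact this.mono_left nhdsWithin_le_nhds
  have e3 : ∀ᶠ s in 𝓝[>] (0 : ℝ), s < 1 :=
    nhdsWithin_le_nhds (Iio_mem_nhds zero_lt_one)
  obtain ⟨s, h1, h2, h3, hs⟩ := (e1.and (e2.and (e3.and self_mem_nhdsWithin))).exists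
  have hs0 : 0 < s := hs
  refine Set.disjoint_left.1 (T.disj _ _ h.1) (show p s ∈ openTri (T.z f.1) from ?_) ?_
  · intro i
    rcases eq_va_or f.2 i with rfl | rfl | rfl
    · rw [← hzdef, ha]; linarith
    · rw [← hzdef, hb]; linarith
    · rw [← hzdef, ho]; exact hs0
  · intro i
    rcases eq_va_or f'.2 i with rfl | rfl | rfl
    · exact h1
    · exact h2
    · rw [h.bary_vo, ← hzdef, ho]; exact mul_pos hpos hs0

/-- Two triangles glued to the same edge would lie on the same side of it and overlap. -/
lemma Glue.unique {f f' f'' : Fin m × OEdge} (h : T.Glue f f') (h' : T.Glue f f'') : f' = f'' := by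
  have hj : f'.1 = f''.1 := by
    by_contra hne
    have hg : T.Glue f' f'' := ⟨hne, h.2.1.symm.trans h'.2.1, h.2.2.symm.trans h'.2.2⟩
    have h1 := h.opposite; have h2 := h'.opposite; have h3 := hg.opposite
    have e : oarea (T.z f.1) f.2 / oarea (T.z f''.1) f''.2 =
        (oarea (T.z f.1) f.2 / oarea (T.z f'.1) f'.2) *
          (oarea (T.z f'.1) f'.2 / oarea (T.z f''.1) f''.2) := by
      have := oarea_ne (T.area_ne f'.1) f'.2
      field_simp
    have := mul_pos_of_neg_of_neg h1 h3
    linarith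
  obtain ⟨j', e'⟩ := f'; obtain ⟨j'', e''⟩ := f''
  simp only at hj; subst hj
  have hinj := vertex_injective (T.area_ne j')
  have := oedge_ext e' e'' (hinj (h.2.1.symm.trans h'.2.1)) (hinj (h.2.2.symm.trans h'.2.2))
  rw [this]

lemma isOpen_region : IsOpen T.region := isOpen_interior

lemma openTri_subset_region (j : Fin m) : openTri (T.z j) ⊆ T.region :=
  interior_maximal ((openTri_subset_closedTri _).trans (subset_iUnion_of_subset j subset_rfl))
    (isOpen_openTri _)

lemma Glue.openEdge_eq {f f' : Fin m × OEdge} (h : T.Glue f f') :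
    openEdge (T.z f.1) f.2 = openEdge (T.z f'.1) f'.2 := by
  simp only [openEdge, h.2.1, h.2.2]

/-- A neighbourhood of a point in the relative interior of a common edge is covered by the two
triangles. -/
lemma Glue.openEdge_subset {f f' : Fin m × OEdge} (h : T.Glue f f') :
    openEdge (T.z f.1) f.2 ⊆ T.region := by
  intro x hx
  have hx' := hx
  rw [h.openEdge_eq] at hx'
  obtain ⟨-, ha, hb⟩ := (mem_openEdge_iff (T.area_ne _) _ _).1 hx
  obtain ⟨-, ha', hb'⟩ := (mem_openEdge_iff (T.area_ne _) _ _).1 hx'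
  rw [region, mem_interior_iff_mem_nhds]
  have ev : ∀ (j : Fin m) (i : Fin 3), 0 < bary (T.z j) i x → ∀ᶠ y in 𝓝 x, 0 < bary (T.z j) i y :=
    fun j i hi => ((continuous_bary (T.z j) i).tendsto x).eventually_const_lt hi
  filter_upwards [ev _ _ ha, ev _ _ hb, ev _ _ ha', ev _ _ hb'] with y h1 h2 h3 h4
  rw [mem_iUnion]
  rcases le_or_gt 0 (bary (T.z f.1) (vo f.2) y) with h0 | h0
  · refine ⟨f.1, fun i => ?_⟩
    rcases eq_va_or f.2 i with rfl | rfl | rfl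
    exacts [h1.le, h2.le, h0]
  · refine ⟨f'.1, fun i => ?_⟩
    rcases eq_va_or f'.2 i with rfl | rfl | rfl
    · exact h3.le
    · exact h4.le
    · rw [h.bary_vo]; exact mul_nonneg_of_nonpos_of_nonpos h.opposite.le h0.le

/-- If the region contains a neighbourhood of a point in the relative interior of an edge, then a
second triangle contains this point, and by conformity it has the same edge. -/
lemma exists_glue {f : Fin m × OEdge} {x : Plane} (hx : x ∈ openEdge (T.z f.1) f.2)
    (hr : x ∈ T.region) : ∃ f', T.Glue f f' := by
  by_contra hno
  have hk : ∀ k, k ≠ f.1 → x ∉ closedTri (T.z k) := fun k hk hxk => by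
    obtain ⟨e', h1, h2⟩ := T.conf _ _ _ hx k hk hxk
    exact hno ⟨(k, e'), hk.symm, h1.symm, h2.symm⟩
  have hn : ∀ᶠ y in 𝓝 x, ∀ k, k ≠ f.1 → y ∉ closedTri (T.z k) := by
    rw [eventually_all]; intro k
    by_cases hkf : k = f.1
    · simp [hkf]
    · filter_upwards [(isClosed_closedTri (T.z k)).isOpen_compl.mem_nhds (hk k hkf)] with y hy _
      exact hy
  have : x ∈ interior (closedTri (T.z f.1)) := by
    rw [mem_interior_iff_mem_nhds]
    filter_upwards [hn, mem_interior_iff_mem_nhds.1 hr] with y h1 h2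
    obtain ⟨k, hk⟩ := mem_iUnion.1 h2
    by_cases hkf : k = f.1
    · rwa [← hkf]
    · exact absurd hk (h1 k hkf)
  rw [interior_closedTri (T.area_ne _)] at this
  have h0 := ((mem_openEdge_iff (T.area_ne _) _ _).1 hx).1
  exact absurd (this (vo f.2)) (by rw [h0]; simp)

lemma region_subset : T.region ⊆ ⋃ j, closedTri (T.z j) := interior_subset

lemma isBounded_region : Bornology.IsBounded T.region :=
  ((isCompact_iUnion fun j => isCompact_closedTri (T.area_ne j)).isBounded).subset region_subset

lemma measurableSet_region : MeasurableSet T.region := isOpen_region.measurableSet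

lemma volume_region_lt_top : volume T.region < ⊤ := isBounded_region.measure_lt_top

instance : IsFiniteMeasure (volume.restrict T.region) :=
  ⟨by rw [Measure.restrict_apply_univ]; exact volume_region_lt_top⟩

lemma volume_region_sdiff : volume (T.region \ ⋃ j, openTri (T.z j)) = 0 := by
  refine measure_mono_null (t := ⋃ j, closedTri (T.z j) \ openTri (T.z j)) ?_
    (measure_iUnion_null fun j => closedTri_sdiff_openTri_null (T.area_ne j))
  rintro x ⟨hx, hx'⟩
  obtain ⟨j, hj⟩ := mem_iUnion.1 (region_subset hx)
  exact mem_iUnion.2 ⟨j, hj, fun h => hx' (mem_iUnion.2 ⟨j, h⟩)⟩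

lemma iUnion_openTri_ae_eq : (⋃ j, openTri (T.z j) : Set Plane) =ᵐ[volume] T.region :=
  (ae_eq_set).2 ⟨by
    rw [sdiff_eq_empty.2 (iUnion_subset openTri_subset_region)]; simp, volume_region_sdiff⟩

lemma restrict_region : volume.restrict T.region = volume.restrict (⋃ j, openTri (T.z j)) :=
  (Measure.restrict_congr_set iUnion_openTri_ae_eq).symm

lemma restrict_region_eq_sum :
    volume.restrict T.region = Measure.sum fun j => volume.restrict (openTri (T.z j)) := by
  rw [restrict_region, Measure.restrict_iUnion (fun j k h => T.disj j k h)
    (fun j => measurableSet_openTri _)]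

lemma setIntegral_region {E : Type*} [NormedAddCommGroup E] [NormedSpace ℝ E] {f : Plane → E}
    (hf : IntegrableOn f T.region) : ∫ x in T.region, f x = ∑ j, ∫ x in openTri (T.z j), f x := by
  rw [restrict_region, integral_iUnion_fintype (fun j => measurableSet_openTri _)
    (fun j k h => T.disj j k h) fun j => hf.mono_set (openTri_subset_region j)]

/-- If the normal components of the fields `F j` match across common edges and vanish on all other
edges, then the integrals of the divergences add up to zero. -/
lemma sum_integral_dv_eq_zero {F : Fin m → Plane → Plane} (hF : ∀ j, ContDiff ℝ 1 (F j))
    (hglue : ∀ f f', T.Glue f f' → ∀ x ∈ openEdge (T.z f.1) f.2,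
      cross (T.z f.1 (vb f.2) - T.z f.1 (va f.2)) (F f.1 x) =
      cross (T.z f.1 (vb f.2) - T.z f.1 (va f.2)) (F f'.1 x))
    (hbd : ∀ f, (¬ ∃ f', T.Glue f f') → ∀ x ∈ openEdge (T.z f.1) f.2,
      cross (T.z f.1 (vb f.2) - T.z f.1 (va f.2)) (F f.1 x) = 0) :
    ∑ j, ∫ x in openTri (T.z j), dv (F j) x = 0 := by
  classical
  simp only [fun j => setIntegral_dv (T.area_ne j) (hF j), ← Finset.mul_sum]
  rw [← Fintype.sum_prod_type' (f := fun j e => flux (T.z j) (F j) e)]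
  have hflux0 : ∀ f : Fin m × OEdge, (¬ ∃ f', T.Glue f f') →
      flux (T.z f.1) (F f.1) f.2 = 0 := by
    intro f hf
    unfold flux
    rw [unitIntegral_congr (g := fun _ => 0) fun t ht => hbd f hf _ ⟨t, ht, rfl⟩]
    simp
  -- The fluxes cancel in pairs under the involution that exchanges the two copies of a common
  -- edge; on the other edges they vanish.
  let g : Fin m × OEdge → Fin m × OEdge := fun f => if h : ∃ f', T.Glue f f' then h.choose else f
  have hg : ∀ f, (∃ f', T.Glue f f') → T.Glue f (g f) := by
    intro f h; simp only [g, h, dif_pos]; exact h.choose_spec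
  have hg' : ∀ f, (¬ ∃ f', T.Glue f f') → g f = f := by
    intro f h; simp only [g, h, dif_neg, not_false_eq_true]
  rw [Finset.sum_involution (fun f _ => g f)]
  · simp
  · intro f _
    by_cases h : ∃ f', T.Glue f f'
    · have hgl := hg f h
      have hs : oarea (T.z f.1) f.2 / |area (T.z f.1)| =
          -(oarea (T.z (g f).1) (g f).2 / |area (T.z (g f).1)|) := by
        have := hgl.opposite
        rw [← abs_oarea _ f.2, ← abs_oarea _ (g f).2]
        rcases div_neg_iff.1 this with ⟨h1, h2⟩ | ⟨h1, h2⟩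
        · rw [abs_of_pos h1, abs_of_neg h2, div_self h1.ne', div_neg, div_self h2.ne]; norm_num
        · rw [abs_of_neg h1, abs_of_pos h2, div_self h2.ne', div_neg, div_self h1.ne]
      unfold flux
      rw [hs, unitIntegral_congr fun t ht => hglue f _ hgl _ ⟨t, ht, rfl⟩, hgl.2.1, hgl.2.2]
      ring
    · rw [hg' f h, hflux0 f h]; simp
  · intro f _ hf hgf
    by_cases h : ∃ f', T.Glue f f'
    · exact (hg f h).1 (by rw [hgf])
    · exact hf (hflux0 f h)
  · intros; simp
  · intro f _
    by_cases h : ∃ f', T.Glue f f'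
    · exact (hg (g f) ⟨f, (hg f h).symm⟩).unique (hg f h).symm
    · rw [hg' _ (by rwa [hg' f h]), hg' f h]

end Triangulation

/-! ### Weak divergences and their normal traces -/

/-- The pairing of a field `σ` and a function `ρ`, to be thought of as the divergence of `σ`, with
a test function. By the divergence theorem it depends only on the boundary values of the test
function. -/
def pairing (D : Set Plane) (σ : Plane → Plane) (ρ : Plane → ℝ) (φ : Plane → ℝ) : ℝ :=
  ∫ x in D, (fderiv ℝ φ x (σ x) + ρ x * φ x)

/-- `ρ` is the weak divergence of `σ` on `D`. -/
def WeakDiv (D : Set Plane) (σ : Plane → Plane) (ρ : Plane → ℝ) : Prop :=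
  ∀ φ, IsTest D φ → pairing D σ ρ φ = 0

lemma WeakDiv.mono {D D' : Set Plane} {σ : Plane → Plane} {ρ : Plane → ℝ} (hW : WeakDiv D σ ρ)
    (hD : MeasurableSet D) (h : D' ⊆ D) : WeakDiv D' σ ρ := by
  intro φ hφ
  have h0 := hW φ ⟨hφ.1, hφ.2.1, hφ.2.2.trans h⟩
  rw [pairing, setIntegral_eq_of_subset_of_forall_sdiff_eq_zero hD h] at h0
  · exact h0
  · intro x hx
    have hxs : x ∉ tsupport φ := fun hh => hx.2 (hφ.2.2 hh)
    rw [image_eq_zero_of_notMem_tsupport hxs, fderiv_of_notMem_tsupport ℝ hxs]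
    simp

lemma integrable_clm_apply {μ : Measure Plane} {σ : Plane → Plane} (hσ : Integrable σ μ)
    {L : Plane → Plane →L[ℝ] ℝ} (hL : Continuous L) {M : ℝ} (hM : ∀ x, ‖L x‖ ≤ M) :
    Integrable (fun x => L x (σ x)) μ := by
  refine (hσ.norm.const_mul M).mono' ?_ (Eventually.of_forall fun x => ?_)
  · exact isBoundedBilinearMap_apply.continuous.comp_aestronglyMeasurable
      (hL.aestronglyMeasurable.prodMk hσ.1)
  · exact ((L x).le_opNorm _).trans (mul_le_mul_of_nonneg_right (hM x) (norm_nonneg _))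

lemma exists_bound_fderiv {φ : Plane → ℝ} (hφ : ContDiff ℝ 1 φ) (hc : HasCompactSupport φ) :
    ∃ M, ∀ x, ‖fderiv ℝ φ x‖ ≤ M :=
  (hφ.continuous_fderiv one_ne_zero).bounded_above_of_compact_support (hc.fderiv ℝ)

lemma integrable_fderiv_apply {μ : Measure Plane} {σ : Plane → Plane} (hσ : Integrable σ μ)
    {φ : Plane → ℝ} (hφ : ContDiff ℝ 1 φ) (hc : HasCompactSupport φ) :
    Integrable (fun x => fderiv ℝ φ x (σ x)) μ := by
  obtain ⟨M, hM⟩ := exists_bound_fderiv hφ hc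
  exact integrable_clm_apply hσ (hφ.continuous_fderiv one_ne_zero) hM

lemma integrable_mul_test {μ : Measure Plane} {ρ : Plane → ℝ} (hρ : Integrable ρ μ)
    {φ : Plane → ℝ} (hφ : Continuous φ) (hc : HasCompactSupport φ) :
    Integrable (fun x => ρ x * φ x) μ := by
  obtain ⟨M, hM⟩ := hφ.bounded_above_of_compact_support hc
  exact hρ.mul_bdd (c := M) hφ.aestronglyMeasurable (Eventually.of_forall hM)

lemma integrable_pairing {μ : Measure Plane} {σ : Plane → Plane} {ρ : Plane → ℝ}
    (hσ : Integrable σ μ) (hρ : Integrable ρ μ)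
    {φ : Plane → ℝ} (hφ : ContDiff ℝ 1 φ) (hc : HasCompactSupport φ) :
    Integrable (fun x => fderiv ℝ φ x (σ x) + ρ x * φ x) μ :=
  (integrable_fderiv_apply hσ hφ hc).add (integrable_mul_test hρ hφ.continuous hc)

lemma pairing_sub {D : Set Plane} {σ : Plane → Plane} {ρ : Plane → ℝ}
    (hσ : IntegrableOn σ D) (hρ : IntegrableOn ρ D) {φ ψ : Plane → ℝ} (hφ : ContDiff ℝ 1 φ)
    (hc : HasCompactSupport φ) (hψ : ContDiff ℝ 1 ψ) (hc' : HasCompactSupport ψ) :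
    pairing D σ ρ (fun x => φ x - ψ x) = pairing D σ ρ φ - pairing D σ ρ ψ := by
  unfold pairing
  rw [← integral_sub (integrable_pairing hσ hρ hφ hc) (integrable_pairing hσ hρ hψ hc')]
  congr 1; ext x
  rw [fderiv_fun_sub (hφ.differentiable one_ne_zero x) (hψ.differentiable one_ne_zero x)]
  simp; ring

lemma exists_bound_deriv_smoothTransition :
    ∃ M, 0 ≤ M ∧ ∀ x, |deriv Real.smoothTransition x| ≤ M := by
  have hc : Continuous (deriv Real.smoothTransition) :=
    (Real.smoothTransition.contDiff (n := 1)).continuous_deriv le_rfl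
  obtain ⟨M, hM⟩ := (isCompact_Icc (a := (0 : ℝ)) (b := 1)).exists_bound_of_continuousOn
    hc.continuousOn
  refine ⟨max M 0, le_max_right _ _, fun x => ?_⟩
  by_cases hx : x ∈ Icc (0 : ℝ) 1
  · exact (hM x hx).trans (le_max_left _ _)
  · have : deriv Real.smoothTransition x = 0 := by
      rcases lt_or_ge x 0 with h | h
      · have : Real.smoothTransition =ᶠ[𝓝 x] fun _ => 0 := by
          filter_upwards [Iio_mem_nhds h] with y hy
          exact Real.smoothTransition.zero_of_nonpos (le_of_lt hy)
        rw [this.deriv_eq]; simp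
      · have h1 : 1 < x := by by_contra h'; exact hx ⟨h, not_lt.1 h'⟩
        have : Real.smoothTransition =ᶠ[𝓝 x] fun _ => 1 := by
          filter_upwards [Ioi_mem_nhds h1] with y hy
          exact Real.smoothTransition.one_of_one_le (le_of_lt hy)
        rw [this.deriv_eq]; simp
    rw [this]; simp

lemma deriv_smoothTransition_of_one_lt {x : ℝ} (h1 : 1 < x) :
    deriv Real.smoothTransition x = 0 := by
  have : Real.smoothTransition =ᶠ[𝓝 x] fun _ => 1 := by
    filter_upwards [Ioi_mem_nhds h1] with y hy
    exact Real.smoothTransition.one_of_one_le (le_of_lt hy)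
  rw [this.deriv_eq]; simp

/-- A test function that reaches up to one edge of a triangle is admissible in the definition of
the weak divergence if, on this edge, it vanishes or the field is tangential. -/
lemma pairing_eq_zero_of_edge {z : Fin 3 → Plane} {i : Fin 3} {σ : Plane → Plane}
    {ρ : Plane → ℝ} (hσ : IntegrableOn σ (openTri z)) (hρ : IntegrableOn ρ (openTri z))
    (hW : WeakDiv (openTri z) σ ρ) {u : Plane → ℝ} (hu : ContDiff ℝ ∞ u)
    (hc : HasCompactSupport u) (hs : ∀ x ∈ tsupport u, 0 < bary z i x → x ∈ openTri z) {C : ℝ}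
    (hC : ∀ x ∈ openTri z, |u x * dbary z i (σ x)| ≤ C * bary z i x * ‖σ x‖) :
    pairing (openTri z) σ ρ u = 0 := by
  have hu1 : ContDiff ℝ 1 u := hu.of_le (by exact_mod_cast le_top)
  obtain ⟨M, hM0, hM⟩ := exists_bound_deriv_smoothTransition
  -- cut off near the edge
  set w : ℕ → Plane → ℝ := fun n x => Real.smoothTransition (n * bary z i x - 1) with hw
  have hwc : ∀ n, ContDiff ℝ ∞ (w n) := fun n => by
    have h1 : ContDiff ℝ ∞ fun x => (n : ℝ) * bary z i x - 1 :=
      (contDiff_const.mul (contDiff_bary z i)).sub contDiff_const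
    exact (Real.smoothTransition.contDiff (n := (⊤ : ℕ∞))).comp h1
  have hwd : ∀ n x, HasFDerivAt (w n)
      ((deriv Real.smoothTransition (n * bary z i x - 1) * n) • dbary z i) x := fun n x => by
    have h1 : HasFDerivAt (fun x => (n : ℝ) * bary z i x - 1) ((n : ℝ) • dbary z i) x :=
      ((hasFDerivAt_bary z i x).const_mul (n : ℝ)).sub_const 1
    have h2 := ((Real.smoothTransition.contDiff (n := 1)).differentiable one_ne_zero
      (n * bary z i x - 1)).hasDerivAt
    have := h2.comp_hasFDerivAt x h1
    rwa [smul_smul] at this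
  have htest : ∀ n, 0 < n → IsTest (openTri z) fun x => w n x * u x := by
    intro n hn
    refine ⟨(hwc n).mul hu, hc.mul_left, fun x hx => ?_⟩
    refine hs x (closure_mono (Function.support_mul_subset_right _ _) hx) ?_
    have hcl : IsClosed {x | 1 ≤ (n : ℝ) * bary z i x} :=
      isClosed_le continuous_const (continuous_const.mul (continuous_bary z i))
    have : x ∈ {x | 1 ≤ (n : ℝ) * bary z i x} := by
      refine closure_minimal (fun y hy => ?_) hcl hx
      by_contra hlt
      refine hy ?_
      have : w n y = 0 := Real.smoothTransition.zero_of_nonpos (by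
        simp only [mem_ofPred_eq, not_le] at hlt; linarith)
      simp [this]
    have h1 : (1 : ℝ) ≤ n * bary z i x := this
    by_contra h2
    have : (n : ℝ) * bary z i x ≤ 0 := mul_nonpos_of_nonneg_of_nonpos (Nat.cast_nonneg n)
      (not_lt.1 h2)
    linarith
  have hzero : ∀ n, 0 < n → ∫ x in openTri z,
      (fderiv ℝ (fun x => w n x * u x) x (σ x) + ρ x * (w n x * u x)) = 0 :=
    fun n hn => hW _ (htest n hn)
  have hfd : ∀ n x, fderiv ℝ (fun x => w n x * u x) x (σ x) = w n x * fderiv ℝ u x (σ x) +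
      deriv Real.smoothTransition (n * bary z i x - 1) * n * (u x * dbary z i (σ x)) := by
    intro n x
    rw [show (fun x => w n x * u x) = w n * u from rfl,
      ((hwd n x).mul (hu1.differentiable one_ne_zero x).hasFDerivAt).fderiv]
    simp; ring
  have hw1 : ∀ n x, |w n x| ≤ 1 := fun n x => by
    rw [abs_of_nonneg (Real.smoothTransition.nonneg _)]; exact Real.smoothTransition.le_one _
  have hint := integrable_pairing hσ hρ hu1 hc
  -- Dominated convergence. The derivative of the cut-off has size `n`, but it lives where the
  -- barycentric coordinate is at most `2 / n`, so that the hypothesis `hC` gives a bound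
  -- independent of `n`.
  have hlim : Tendsto (fun n : ℕ => ∫ x in openTri z,
      (fderiv ℝ (fun x => w n x * u x) x (σ x) + ρ x * (w n x * u x))) atTop
      (𝓝 (pairing (openTri z) σ ρ u)) := by
    refine tendsto_integral_of_dominated_convergence
      (fun x => |fderiv ℝ u x (σ x)| + 2 * |C| * M * ‖σ x‖ + |ρ x * u x|) ?_ ?_ ?_ ?_
    · intro n
      exact (integrable_pairing hσ hρ (((hwc n).mul hu).of_le (by exact_mod_cast le_top))
        hc.mul_left).1
    · exact (((integrable_fderiv_apply hσ hu1 hc).abs).add (hσ.norm.const_mul _)).add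
        (integrable_mul_test hρ hu1.continuous hc).abs
    · intro n
      refine (ae_restrict_iff' (measurableSet_openTri z)).2 (Eventually.of_forall fun x hx => ?_)
      rw [hfd, Real.norm_eq_abs]
      refine (abs_add_le _ _).trans (add_le_add ((abs_add_le _ _).trans (add_le_add ?_ ?_)) ?_)
      · rw [abs_mul]; exact mul_le_of_le_one_left (abs_nonneg _) (hw1 n x)
      · rw [abs_mul]
        by_cases hn : (n : ℝ) * bary z i x - 1 ≤ 1
        · have hb := (hx i).le
          have h1 := hC x hx
          have h2 : C * bary z i x * ‖σ x‖ ≤ |C| * bary z i x * ‖σ x‖ := by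
            gcongr; exact le_abs_self C
          calc _ ≤ (M * n) * (|C| * bary z i x * ‖σ x‖) := by
                rw [abs_mul, Nat.abs_cast]
                exact mul_le_mul (mul_le_mul_of_nonneg_right (hM _) (Nat.cast_nonneg n))
                  (h1.trans h2) (abs_nonneg _) (by positivity)
            _ = (n * bary z i x) * (|C| * M * ‖σ x‖) := by ring
            _ ≤ 2 * (|C| * M * ‖σ x‖) := by
                refine mul_le_mul_of_nonneg_right (by linarith) (by positivity)
            _ = _ := by ring
        · rw [deriv_smoothTransition_of_one_lt (not_le.1 hn)]
          simp; positivity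
      · rw [abs_mul, abs_mul, abs_mul]
        exact mul_le_mul_of_nonneg_left (mul_le_of_le_one_left (abs_nonneg _) (hw1 n x))
          (abs_nonneg _)
    · refine (ae_restrict_iff' (measurableSet_openTri z)).2 (Eventually.of_forall fun x hx => ?_)
      refine tendsto_const_nhds.congr' ?_
      obtain ⟨N, hN⟩ := exists_nat_gt (2 / bary z i x)
      filter_upwards [eventually_ge_atTop N] with n hn
      have h2 : 1 < (n : ℝ) * bary z i x - 1 := by
        rw [div_lt_iff₀ (hx i)] at hN
        have : (N : ℝ) * bary z i x ≤ n * bary z i x :=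
          mul_le_mul_of_nonneg_right (by exact_mod_cast hn) (hx i).le
        linarith
      rw [hfd, deriv_smoothTransition_of_one_lt h2]
      have : w n x = 1 := Real.smoothTransition.one_of_one_le h2.le
      rw [this]; ring
  refine tendsto_nhds_unique hlim (tendsto_const_nhds.congr' ?_)
  filter_upwards [eventually_gt_atTop 0] with n hn
  exact (hzero n hn).symm

/-- A smooth function with compact support that vanishes on the line through an edge is bounded by
a multiple of the barycentric coordinate of this edge. -/
lemma exists_bound_of_vanish {z : Fin 3 → Plane} (hz : area z ≠ 0) (i : Fin 3) {u : Plane → ℝ}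
    (hu : ContDiff ℝ 1 u) (hc : HasCompactSupport u) (h0 : ∀ x, bary z i x = 0 → u x = 0) :
    ∃ C, ∀ x ∈ openTri z, |u x| ≤ C * bary z i x := by
  obtain ⟨K, hK⟩ := hu.lipschitzWith_of_hasCompactSupport hc one_ne_zero
  refine ⟨K * ‖z i - z (i + 1)‖, fun x hx => ?_⟩
  have hi : i ≠ i + 1 := by fin_cases i <;> decide
  have h1 : u (x + (-bary z i x) • (z i - z (i + 1))) = 0 := by
    refine h0 _ ?_
    rw [bary_add, map_smul, dbary_sub hz]; simp [hi]
  have h2 := hK.dist_le_mul x (x + (-bary z i x) • (z i - z (i + 1)))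
  rw [h1, Real.dist_eq, sub_zero, dist_self_add_right, norm_smul, norm_neg, Real.norm_eq_abs,
    abs_of_pos (hx i)] at h2
  linarith

/-- The pairing depends only on the values of the test function on the edge: it vanishes with them.
-/
lemma pairing_eq_zero_of_vanish {z : Fin 3 → Plane} (hz : area z ≠ 0) {i : Fin 3}
    {σ : Plane → Plane}
    {ρ : Plane → ℝ} (hσ : IntegrableOn σ (openTri z)) (hρ : IntegrableOn ρ (openTri z))
    (hW : WeakDiv (openTri z) σ ρ) {u : Plane → ℝ} (hu : ContDiff ℝ ∞ u)
    (hc : HasCompactSupport u) (hs : ∀ x ∈ tsupport u, 0 < bary z i x → x ∈ openTri z)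
    (h0 : ∀ x, bary z i x = 0 → u x = 0) :
    pairing (openTri z) σ ρ u = 0 := by
  obtain ⟨C, hC⟩ := exists_bound_of_vanish hz i (hu.of_le (by exact_mod_cast le_top)) hc h0
  refine pairing_eq_zero_of_edge hσ hρ hW hu hc hs (C := C * ‖dbary z i‖) fun x hx => ?_
  rw [abs_mul]
  calc _ ≤ (C * bary z i x) * (‖dbary z i‖ * ‖σ x‖) :=
        mul_le_mul (hC x hx) ((dbary z i).le_opNorm _) (abs_nonneg _)
          ((abs_nonneg _).trans (hC x hx))
    _ = _ := by ring

/-! ### Test functions that live on one edge -/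

/-- Admissible profiles along an edge. -/
def EdgeTest (a : ℝ → ℝ) : Prop := ContDiff ℝ ∞ a ∧ tsupport a ⊆ Icc (1 / 4) (3 / 4)

/-- A fixed cut-off function in the direction across an edge. -/
def edgeBump : ContDiffBump (0 : ℝ) := ⟨1 / 16, 1 / 8, by norm_num, by norm_num⟩

/-- The test function with profile `a` along the edge `e`; the parameter `δ` scales its extent
across the edge. -/
def etest (z : Fin 3 → Plane) (e : OEdge) (a : ℝ → ℝ) (δ : ℝ) (x : Plane) : ℝ :=
  a (bary z (vb e) x) * edgeBump (bary z (vo e) x / δ)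

lemma contDiff_etest (z : Fin 3 → Plane) (e : OEdge) {a : ℝ → ℝ} (ha : EdgeTest a) (δ : ℝ) :
    ContDiff ℝ ∞ (etest z e a δ) :=
  (ha.1.comp (contDiff_bary z _)).mul
    (edgeBump.contDiff.comp ((contDiff_bary z _).div_const δ))

/-- The region that contains the support of `etest z e a δ`. -/
def edgeZone (z : Fin 3 → Plane) (e : OEdge) (δ : ℝ) : Set Plane :=
  {x | bary z (vb e) x ∈ Icc (1 / 4 : ℝ) (3 / 4) ∧ |bary z (vo e) x| ≤ δ / 8}

lemma tsupport_etest_subset (z : Fin 3 → Plane) (e : OEdge) {a : ℝ → ℝ} (ha : EdgeTest a) {δ : ℝ}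
    (hδ : 0 < δ) : tsupport (etest z e a δ) ⊆ edgeZone z e δ := by
  refine closure_minimal (fun x hx => ?_) ?_
  · have h1 : a (bary z (vb e) x) ≠ 0 := fun h => hx (by simp [etest, h])
    have h2 : edgeBump (bary z (vo e) x / δ) ≠ 0 := fun h => hx (by simp [etest, h])
    refine ⟨ha.2 (subset_tsupport _ h1), ?_⟩
    have h3 : bary z (vo e) x / δ ∈ Function.support edgeBump := h2
    rw [edgeBump.support_eq, mem_ball_zero_iff, Real.norm_eq_abs, abs_div, abs_of_pos hδ,
      div_lt_iff₀ hδ] at h3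
    have : edgeBump.rOut = 1 / 8 := rfl
    rw [this] at h3; linarith
  · exact (isClosed_Icc.preimage (continuous_bary z _)).inter
      (isClosed_le (continuous_bary z _).abs continuous_const)

lemma isCompact_edgeZone {z : Fin 3 → Plane} (hz : area z ≠ 0) (e : OEdge) {δ : ℝ} (hδ : δ ≤ 1) :
    IsCompact (edgeZone z e δ) := by
  refine Metric.isCompact_of_isClosed_isBounded
    ((isClosed_Icc.preimage (continuous_bary z _)).inter
      (isClosed_le (continuous_bary z _).abs continuous_const)) ?_
  rw [Metric.isBounded_iff_subset_closedBall 0]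
  refine ⟨‖z (va e)‖ + ‖z (vb e)‖ + ‖z (vo e)‖, fun x hx => ?_⟩
  obtain ⟨⟨h1, h2⟩, h3⟩ := hx
  rw [abs_le] at h3
  have hs := sum_bary hz x
  rw [sum_oedge e (fun i => bary z i x)] at hs
  have ha : |bary z (va e) x| ≤ 1 := abs_le.2 ⟨by linarith, by linarith⟩
  have hb : |bary z (vb e) x| ≤ 1 := abs_le.2 ⟨by linarith, by linarith⟩
  have ho : |bary z (vo e) x| ≤ 1 := abs_le.2 ⟨by linarith, by linarith⟩
  rw [mem_closedBall_zero_iff]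
  conv_lhs => rw [← sum_bary_smul hz x, sum_oedge e (fun i => bary z i x • z i)]
  refine (norm_add_le _ _).trans (add_le_add ((norm_add_le _ _).trans (add_le_add ?_ ?_)) ?_) <;>
    rw [norm_smul, Real.norm_eq_abs] <;> exact mul_le_of_le_one_left (norm_nonneg _) ‹_›

lemma hasCompactSupport_etest {z : Fin 3 → Plane} (hz : area z ≠ 0) (e : OEdge) {a : ℝ → ℝ}
    (ha : EdgeTest a) {δ : ℝ} (hδ : 0 < δ) (hδ1 : δ ≤ 1) : HasCompactSupport (etest z e a δ) :=
  (isCompact_edgeZone hz e hδ1).of_isClosed_subset (isClosed_tsupport _)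
    (tsupport_etest_subset z e ha hδ)

/-- Within the edge zone, the half-plane on the inner side of the edge belongs to the triangle. -/
lemma edgeZone_inter {z : Fin 3 → Plane} (hz : area z ≠ 0) (e : OEdge) {δ : ℝ} (hδ1 : δ ≤ 1)
    {x : Plane} (hx : x ∈ edgeZone z e δ) (h0 : 0 < bary z (vo e) x) : x ∈ openTri z := by
  obtain ⟨⟨h1, h2⟩, h3⟩ := hx
  rw [abs_le] at h3
  have hs := sum_bary hz x
  rw [sum_oedge e (fun i => bary z i x)] at hs
  intro i
  rcases eq_va_or e i with rfl | rfl | rfl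
  · linarith
  · linarith
  · exact h0

lemma etest_of_bary_eq_zero {z : Fin 3 → Plane} {e : OEdge} {a : ℝ → ℝ} {δ : ℝ} {x : Plane}
    (h : bary z (vo e) x = 0) : etest z e a δ x = a (bary z (vb e) x) := by
  have : edgeBump (0 : ℝ) = 1 := edgeBump.one_of_mem_closedBall
    (Metric.mem_closedBall_self (edgeBump.rIn_pos.le))
  simp [etest, h, this]

namespace Triangulation

variable {m : ℕ} {T : Triangulation m}

/-- Close to the middle part of a common edge, everything belongs to the two triangles. -/
lemma Glue.exists_thin {f f' : Fin m × OEdge} (h : T.Glue f f') : ∃ δ : ℝ, 0 < δ ∧ δ ≤ 1 ∧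
    ∀ x ∈ edgeZone (T.z f.1) f.2 δ, bary (T.z f.1) (vo f.2) x < 0 → x ∈ openTri (T.z f'.1) := by
  set κ := |bary (T.z f'.1) (vb f'.2) (T.z f.1 (vo f.2))| with hκ
  set κ' := |bary (T.z f'.1) (va f'.2) (T.z f.1 (vo f.2))| with hκ'
  have hκ0 : 0 ≤ κ := abs_nonneg _
  have hκ0' : 0 ≤ κ' := abs_nonneg _
  -- by `Glue.bary_va` and `Glue.bary_vb`, the coordinates along the edge change by at most `1 / 8`
  -- from one triangle to the other within this distance of the edge
  refine ⟨1 / (1 + κ + κ'), by positivity, ?_, fun x hx h0 i => ?_⟩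
  · rw [div_le_one (by positivity)]; linarith
  obtain ⟨⟨h1, h2⟩, h3⟩ := hx
  have hδ : 1 / (1 + κ + κ') * (1 + κ + κ') = 1 := by field_simp
  set δ := 1 / (1 + κ + κ') with hδd
  have hδ0 : 0 < δ := by positivity
  have hs := sum_bary (T.area_ne f.1) x
  rw [sum_oedge f.2 (fun i => bary (T.z f.1) i x)] at hs
  have e1 : |bary (T.z f.1) (vo f.2) x * bary (T.z f'.1) (vb f'.2) (T.z f.1 (vo f.2))| ≤
      1 / 8 := by
    rw [abs_mul]
    calc _ ≤ δ / 8 * κ := mul_le_mul_of_nonneg_right h3 hκ0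
      _ ≤ 1 / 8 := by nlinarith
  have e2 : |bary (T.z f.1) (vo f.2) x * bary (T.z f'.1) (va f'.2) (T.z f.1 (vo f.2))| ≤
      1 / 8 := by
    rw [abs_mul]
    calc _ ≤ δ / 8 * κ' := mul_le_mul_of_nonneg_right h3 hκ0'
      _ ≤ 1 / 8 := by nlinarith
  rw [abs_le] at e1 e2
  rcases eq_va_or f'.2 i with rfl | rfl | rfl
  · rw [h.bary_va]; linarith
  · rw [h.bary_vb]; linarith
  · rw [h.bary_vo]; exact mul_pos_of_neg_of_neg h.opposite h0

/-- The normal traces of a field with a weak divergence match on a common edge. -/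
lemma pairing_etest_add_eq_zero {σ : Plane → Plane} {ρ : Plane → ℝ}
    (hσ : IntegrableOn σ T.region) (hρ : IntegrableOn ρ T.region) (hW : WeakDiv T.region σ ρ)
    {f f' : Fin m × OEdge} (h : T.Glue f f') {a : ℝ → ℝ} (ha : EdgeTest a) :
    pairing (openTri (T.z f.1)) σ ρ (etest (T.z f.1) f.2 a 1) +
      pairing (openTri (T.z f'.1)) σ ρ (etest (T.z f'.1) f'.2 a 1) = 0 := by
  obtain ⟨δ, hδ, hδ1, hthin⟩ := h.exists_thin
  have hz' := T.area_ne f'.1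
  have hz := T.area_ne f.1
  -- a test function of the whole region, supported in the two triangles and their common edge
  set Φ := etest (T.z f.1) f.2 a δ with hΦ
  have hΦc : ContDiff ℝ ∞ Φ := contDiff_etest _ _ ha _
  have hΦs : HasCompactSupport Φ := hasCompactSupport_etest hz _ ha hδ hδ1
  have le1 : (1 : WithTop ℕ∞) ≤ (⊤ : ℕ∞) := by exact_mod_cast le_top
  have hloc : ∀ x ∈ tsupport Φ, x ∈ openTri (T.z f.1) ∨ x ∈ openTri (T.z f'.1) ∨
      x ∈ openEdge (T.z f.1) f.2 := by
    intro x hx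
    have hx' := tsupport_etest_subset _ _ ha hδ hx
    rcases lt_trichotomy (bary (T.z f.1) (vo f.2) x) 0 with h0 | h0 | h0
    · exact Or.inr (Or.inl (hthin x hx' h0))
    · refine Or.inr (Or.inr ((mem_openEdge_iff hz _ _).2 ⟨h0, ?_, by linarith [hx'.1.1]⟩))
      have hs := sum_bary hz x
      rw [sum_oedge f.2 (fun i => bary (T.z f.1) i x)] at hs
      linarith [hx'.1.2]
    · exact Or.inl (edgeZone_inter hz _ hδ1 hx' h0)
  have htest : IsTest T.region Φ := by
    refine ⟨hΦc, hΦs, fun x hx => ?_⟩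
    rcases hloc x hx with h' | h' | h'
    · exact openTri_subset_region _ h'
    · exact openTri_subset_region _ h'
    · exact h.openEdge_subset h'
  have hsplit : pairing (openTri (T.z f.1)) σ ρ Φ + pairing (openTri (T.z f'.1)) σ ρ Φ = 0 := by
    have hI := integrable_pairing hσ hρ (hΦc.of_le le1) hΦs
    have h0 := hW Φ htest
    rw [pairing, setIntegral_eq_of_subset_of_ae_sdiff_eq_zero
      (s := openTri (T.z f.1) ∪ openTri (T.z f'.1)) measurableSet_region.nullMeasurableSet
      (union_subset (openTri_subset_region _) (openTri_subset_region _)),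
      setIntegral_union (T.disj _ _ h.1) (measurableSet_openTri _)
        (hI.mono_measure (Measure.restrict_mono (openTri_subset_region _) le_rfl))
        (hI.mono_measure (Measure.restrict_mono (openTri_subset_region _) le_rfl))] at h0
    · exact h0
    · have hnull : volume (closedTri (T.z f.1) \ openTri (T.z f.1)) = 0 :=
        closedTri_sdiff_openTri_null hz
      filter_upwards [measure_eq_zero_iff_ae_notMem.1 hnull] with x hx hxr
      have hxs : x ∉ tsupport Φ := by
        intro hxs
        rcases hloc x hxs with h' | h' | h'
        · exact hxr.2 (Or.inl h')
        · exact hxr.2 (Or.inr h')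
        · refine hx ⟨fun i => ?_, fun hh => hxr.2 (Or.inl hh)⟩
          obtain ⟨h1, h2, h3⟩ := (mem_openEdge_iff hz _ _).1 h'
          rcases eq_va_or f.2 i with rfl | rfl | rfl
          exacts [h2.le, h3.le, h1.ge]
      rw [image_eq_zero_of_notMem_tsupport hxs, fderiv_of_notMem_tsupport ℝ hxs]
      simp
  have mono := fun j => hσ.mono_set (openTri_subset_region (T := T) j)
  have mono' := fun j => hρ.mono_set (openTri_subset_region (T := T) j)
  have hWj : ∀ j, WeakDiv (openTri (T.z j)) σ ρ := fun j =>
    hW.mono measurableSet_region (openTri_subset_region j)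
  -- On the edge, the thin test function coincides with the standard one of either triangle.
  have c1 : pairing (openTri (T.z f.1)) σ ρ (etest (T.z f.1) f.2 a 1) =
      pairing (openTri (T.z f.1)) σ ρ Φ := by
    rw [← sub_eq_zero, ← pairing_sub (mono _) (mono' _)
      ((contDiff_etest _ _ ha _).of_le le1) (hasCompactSupport_etest hz _ ha one_pos le_rfl)
      (hΦc.of_le le1) hΦs]
    refine pairing_eq_zero_of_vanish hz (i := vo f.2) (mono _) (mono' _) (hWj _)
      ((contDiff_etest _ _ ha _).sub hΦc)
      ((hasCompactSupport_etest hz _ ha one_pos le_rfl).sub hΦs) ?_ ?_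
    · intro x hx h0
      rcases tsupport_sub _ _ hx with hx | hx
      · exact edgeZone_inter hz _ le_rfl (tsupport_etest_subset _ _ ha one_pos hx) h0
      · exact edgeZone_inter hz _ hδ1 (tsupport_etest_subset _ _ ha hδ hx) h0
    · intro x hx
      rw [etest_of_bary_eq_zero hx, hΦ, etest_of_bary_eq_zero hx, sub_self]
  have c2 : pairing (openTri (T.z f'.1)) σ ρ (etest (T.z f'.1) f'.2 a 1) =
      pairing (openTri (T.z f'.1)) σ ρ Φ := by
    rw [← sub_eq_zero, ← pairing_sub (mono _) (mono' _)
      ((contDiff_etest _ _ ha _).of_le le1) (hasCompactSupport_etest hz' _ ha one_pos le_rfl)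
      (hΦc.of_le le1) hΦs]
    refine pairing_eq_zero_of_vanish hz' (i := vo f'.2) (mono _) (mono' _) (hWj _)
      ((contDiff_etest _ _ ha _).sub hΦc)
      ((hasCompactSupport_etest hz' _ ha one_pos le_rfl).sub hΦs) ?_ ?_
    · intro x hx h0
      rcases tsupport_sub _ _ hx with hx | hx
      · exact edgeZone_inter hz' _ le_rfl (tsupport_etest_subset _ _ ha one_pos hx) h0
      · refine hthin x (tsupport_etest_subset _ _ ha hδ hx) ?_
        by_contra hc
        rw [h.bary_vo] at h0
        exact absurd h0 (not_lt.2 (mul_nonpos_of_nonpos_of_nonneg h.opposite.le (not_lt.1 hc)))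
    · intro x hx
      have hx0 : bary (T.z f.1) (vo f.2) x = 0 := by
        have := h.bary_vo x
        rw [hx] at this
        exact (mul_eq_zero.1 this.symm).resolve_left h.opposite.ne
      have hb := h.bary_vb x
      rw [hx0, zero_mul, add_zero] at hb
      rw [etest_of_bary_eq_zero hx, hΦ, etest_of_bary_eq_zero hx0, hb, sub_self]
  rw [c1, c2, hsplit]

end Triangulation

/-! ### Weak divergences, weak gradients and traces -/

lemma MemLp_two_integrableOn {E : Type*} [NormedAddCommGroup E] {D : Set Plane}
    (hD : volume D < ⊤) {f : Plane → E} (hf : MemLp f 2 (volume.restrict D)) :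
    IntegrableOn f D := by
  have : IsFiniteMeasure (volume.restrict D) := ⟨by rwa [Measure.restrict_apply_univ]⟩
  exact hf.integrable (by norm_num)

lemma contDiff_one_of_infty {E F : Type*} [NormedAddCommGroup E] [NormedSpace ℝ E]
    [NormedAddCommGroup F] [NormedSpace ℝ F] {φ : E → F} (h : ContDiff ℝ ∞ φ) :
    ContDiff ℝ 1 φ := h.of_le (by exact_mod_cast le_top)

/-- The definition of a weak divergence in terms of `pairing`. -/
lemma isHdiv_iff {D : Set Plane} (hD : volume D < ⊤) {τ : Plane → Plane} {r : Plane → ℝ} :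
    IsHdiv D τ r ↔ MemLp τ 2 (volume.restrict D) ∧ MemLp r 2 (volume.restrict D) ∧
      WeakDiv D τ r := by
  have key : MemLp τ 2 (volume.restrict D) → MemLp r 2 (volume.restrict D) → ∀ φ, IsTest D φ →
      (pairing D τ r φ = 0 ↔
        ∫ x in D, inner ℝ (τ x) (gradient φ x) = - ∫ x in D, r x * φ x) := by
    intro h1 h2 φ hφ
    have i1 := integrable_fderiv_apply (MemLp_two_integrableOn hD h1)
      (contDiff_one_of_infty hφ.1) hφ.2.1
    have i2 := integrable_mul_test (MemLp_two_integrableOn hD h2) hφ.1.continuous hφ.2.1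
    rw [pairing, integral_add i1 i2, add_eq_zero_iff_eq_neg]
    simp only [inner_gradient_right, conj_trivial]
  constructor
  · rintro ⟨h1, h2, h3⟩
    exact ⟨h1, h2, fun φ hφ => (key h1 h2 φ hφ).2 (h3 φ hφ)⟩
  · rintro ⟨h1, h2, h3⟩
    exact ⟨h1, h2, fun φ hφ => (key h1 h2 φ hφ).1 (h3 φ hφ)⟩

/-- `g` is the weak gradient of `v`, expressed through the fields `v d` with `d` constant. -/
def WeakGrad (D : Set Plane) (v : Plane → ℝ) (g : Plane → Plane) : Prop :=
  ∀ d : Plane, WeakDiv D (fun x => v x • d) (fun x => inner ℝ (g x) d)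

/-- The definition of a weak gradient in terms of `pairing`, direction by direction. -/
lemma isH1_iff {D : Set Plane} (hD : volume D < ⊤) {v : Plane → ℝ} {g : Plane → Plane} :
    IsH1 D v g ↔ MemLp v 2 (volume.restrict D) ∧ MemLp g 2 (volume.restrict D) ∧
      WeakGrad D v g := by
  have key : MemLp v 2 (volume.restrict D) → MemLp g 2 (volume.restrict D) → ∀ φ, IsTest D φ →
      ((∀ d : Plane, pairing D (fun x => v x • d) (fun x => inner ℝ (g x) d) φ = 0) ↔
        ∫ x in D, v x • gradient φ x = - ∫ x in D, φ x • g x) := by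
    intro h1 h2 φ hφ
    have hv := MemLp_two_integrableOn hD h1
    have hg := MemLp_two_integrableOn hD h2
    have hφ1 := contDiff_one_of_infty hφ.1
    have hgrad : Continuous (gradient φ) :=
      (InnerProductSpace.toDual ℝ Plane).symm.continuous.comp (hφ1.continuous_fderiv one_ne_zero)
    obtain ⟨M, hM⟩ := exists_bound_fderiv hφ1 hφ.2.1
    have i1 : IntegrableOn (fun x => v x • gradient φ x) D := by
      refine hv.smul_bdd M hgrad.aestronglyMeasurable (Eventually.of_forall fun x => ?_)
      rw [gradient, LinearIsometryEquiv.norm_map]; exact hM x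
    obtain ⟨M', hM'⟩ := hφ.1.continuous.bounded_above_of_compact_support hφ.2.1
    have i2 : IntegrableOn (fun x => φ x • g x) D :=
      hg.bdd_smul M' hφ.1.continuous.aestronglyMeasurable (Eventually.of_forall hM')
    have e : ∀ d : Plane, pairing D (fun x => v x • d) (fun x => inner ℝ (g x) d) φ =
        inner ℝ d (∫ x in D, v x • gradient φ x) + inner ℝ d (∫ x in D, φ x • g x) := by
      intro d
      rw [← integral_inner i1, ← integral_inner i2, ← integral_add (i1.const_inner d)
        (i2.const_inner d), pairing]
      congr 1; ext x
      rw [inner_smul_right, inner_smul_right, inner_gradient_right, map_smul, smul_eq_mul,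
        real_inner_comm, mul_comm (φ x)]
      simp
    constructor
    · intro h
      rw [← add_eq_zero_iff_eq_neg]
      refine ext_inner_left ℝ fun d => ?_
      rw [inner_add_right, ← e, h, inner_zero_right]
    · intro h d
      rw [e, h, inner_neg_right]; ring
  constructor
  · rintro ⟨h1, h2, h3⟩
    exact ⟨h1, h2, fun d φ hφ => (key h1 h2 φ hφ).2 (h3 φ hφ) d⟩
  · rintro ⟨h1, h2, h3⟩
    exact ⟨h1, h2, fun φ hφ => (key h1 h2 φ hφ).1 fun d => h3 d φ hφ⟩

lemma pairing_smul_add {D : Set Plane} {v : Plane → ℝ} {g : Plane → Plane}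
    (hv : IntegrableOn v D) (hg : IntegrableOn g D) {φ : Plane → ℝ} (hφ : ContDiff ℝ 1 φ)
    (hc : HasCompactSupport φ) (d d' : Plane) (c : ℝ) :
    pairing D (fun x => v x • (c • d + d')) (fun x => inner ℝ (g x) (c • d + d')) φ =
      c * pairing D (fun x => v x • d) (fun x => inner ℝ (g x) d) φ +
        pairing D (fun x => v x • d') (fun x => inner ℝ (g x) d') φ := by
  have hi := fun d => integrable_pairing (hv.smul_const d) (hg.inner_const (𝕜 := ℝ) d) hφ hc
  unfold pairing
  rw [← integral_const_mul, ← integral_add ((hi d).const_mul c) (hi d')]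
  congr 1; ext x
  simp [inner_add_right, inner_smul_right]; ring

/-- The product rule. -/
lemma dv_smul {φ : Plane → ℝ} {F : Plane → Plane} {x : Plane} (hφ : DifferentiableAt ℝ φ x)
    (hF : DifferentiableAt ℝ F x) :
    dv (fun x => φ x • F x) x = fderiv ℝ φ x (F x) + dv F x * φ x := by
  have h := hφ.hasFDerivAt.smul hF.hasFDerivAt
  have hx : F x = F x 0 • EuclideanSpace.single 0 1 + F x 1 • EuclideanSpace.single 1 1 := by
    ext i; fin_cases i <;> simp
  unfold dv
  rw [show (fun x => φ x • F x) = φ • F from rfl, h.fderiv, trace_eq, trace_eq]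
  conv_rhs => rw [hx]
  simp only [map_add, map_smul]
  simp; ring

lemma pairing_eq_integral_dv {D : Set Plane} {φ : Plane → ℝ} {F : Plane → Plane}
    (hφ : ContDiff ℝ 1 φ) (hF : ContDiff ℝ 1 F) :
    pairing D F (dv F) φ = ∫ x in D, dv (fun x => φ x • F x) x := by
  unfold pairing
  congr 1; ext x
  rw [dv_smul (hφ.differentiable one_ne_zero x) (hF.differentiable one_ne_zero x)]

lemma etest_eq_zero_on_edge {z : Fin 3 → Plane} (hz : area z ≠ 0) {e e' : OEdge} (he : e.1 ≠ e'.1)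
    {a : ℝ → ℝ} (ha : EdgeTest a) {x : Plane} (hx : x ∈ openEdge z e') : etest z e a 1 x = 0 := by
  by_contra h
  obtain ⟨⟨h1, h2⟩, h3⟩ := tsupport_etest_subset z e ha one_pos (subset_tsupport _ h)
  obtain ⟨h0, -, -⟩ := (mem_openEdge_iff hz _ _).1 hx
  rw [abs_le] at h3
  have hs := sum_bary hz x
  rw [sum_oedge e (fun i => bary z i x)] at hs
  rcases eq_va_or e (vo e') with hv | hv | hv
  · rw [hv] at h0; linarith
  · rw [hv] at h0; linarith
  · exact he hv.symm

/-- For smooth fields, the pairing with the test functions of an edge is the integral of the normal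
component over the edge. -/
lemma pairing_etest_smooth {z : Fin 3 → Plane} (hz : area z ≠ 0) (e : OEdge) {a : ℝ → ℝ}
    (ha : EdgeTest a) {F : Plane → Plane} (hF : ContDiff ℝ 1 F) :
    pairing (openTri z) F (dv F) (etest z e a 1) = -(oarea z e / |area z|) *
      ∫ t in (0 : ℝ)..1, a t * cross (z (vb e) - z (va e))
        (F (AffineMap.lineMap (z (va e)) (z (vb e)) t)) := by
  have hc := contDiff_one_of_infty (contDiff_etest z e ha 1)
  have hcF : ContDiff ℝ 1 fun x => etest z e a 1 x • F x := hc.smul hF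
  rw [pairing_eq_integral_dv hc hF, setIntegral_dv hz hcF]
  -- the test function vanishes on the two other edges
  have h0 : ∀ e' : OEdge, e.1 ≠ e'.1 →
      flux z (fun x => etest z e a 1 x • F x) e' = 0 := by
    intro e' he
    unfold flux
    rw [unitIntegral_congr (g := fun _ => 0)]
    · simp
    · intro t ht
      simp only [etest_eq_zero_on_edge hz he ha ⟨t, ht, rfl⟩]; simp [cross]
  -- the two orientations of the edge contribute equally
  have h1 : ∑ e' : OEdge, flux z (fun x => etest z e a 1 x • F x) e' =
      2 * flux z (fun x => etest z e a 1 x • F x) e := by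
    rw [Fintype.sum_prod_type, Finset.sum_eq_single e.1]
    · rw [Fintype.sum_bool, flux_reverse]
      obtain ⟨i, b⟩ := e
      cases b
      · rw [flux_reverse]; ring
      · ring
    · intro i _ hi
      rw [Fintype.sum_bool, h0 (i, true) hi.symm, h0 (i, false) hi.symm, add_zero]
    · simp
  have h2 : flux z (fun x => etest z e a 1 x • F x) e = (oarea z e / |area z|) *
      ∫ t in (0 : ℝ)..1, a t * cross (z (vb e) - z (va e))
        (F (AffineMap.lineMap (z (va e)) (z (vb e)) t)) := by
    unfold flux
    congr 1
    refine unitIntegral_congr fun t ht => ?_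
    have hx : AffineMap.lineMap (z (va e)) (z (vb e)) t ∈ openEdge z e := ⟨t, ht, rfl⟩
    rw [cross_smul_right, etest_of_bary_eq_zero ((mem_openEdge_iff hz _ _).1 hx).1, bary_line,
      bary_vertex hz, bary_vertex hz]
    simp [(va_ne_vb e).symm]
  rw [h1, h2]; ring

/-! ### Transport to the reference triangle -/

lemma etest_affMap {z : Fin 3 → Plane} (hz : area z ≠ 0) (e : OEdge) (a : ℝ → ℝ) (δ : ℝ)
    (y : Plane) : etest z e a δ (affMap z y) = etest zref e a δ y := by
  simp only [etest, bary_affMap hz]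

/-- The change of variables on a triangle. -/
lemma pairing_pullback {z : Fin 3 → Plane} (hz : area z ≠ 0) (σ : Plane → Plane) (ρ : Plane → ℝ)
    {φ : Plane → ℝ} (hφ : ContDiff ℝ 1 φ) :
    pairing (openTri z) σ ρ φ = |area z| * pairing refTri (fun y => invMap z (σ (affMap z y)))
      (fun y => ρ (affMap z y)) (fun y => φ (affMap z y)) := by
  unfold pairing
  rw [setIntegral_openTri hz, smul_eq_mul]
  congr 2; ext y
  have h : HasFDerivAt (fun y => φ (affMap z y)) ((fderiv ℝ φ (affMap z y)).comp (edgeMap z)) y :=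
    (hφ.differentiable one_ne_zero _).hasFDerivAt.comp y (hasFDerivAt_affMap z y)
  rw [h.fderiv, ContinuousLinearMap.comp_apply, edgeMap_invMap hz]

/-- `affMap z` as a homeomorphism. -/
def affHomeo {z : Fin 3 → Plane} (hz : area z ≠ 0) : Plane ≃ₜ Plane where
  toFun := affMap z
  invFun := affInv z
  left_inv := affInv_affMap hz
  right_inv := affMap_affInv hz
  continuous_toFun := continuous_affMap z
  continuous_invFun := (contDiff_affInv z (n := 0)).continuous

lemma IsTest.pushforward {z : Fin 3 → Plane} (hz : area z ≠ 0) {φ : Plane → ℝ}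
    (hφ : IsTest refTri φ) : IsTest (openTri z) fun x => φ (affInv z x) := by
  refine ⟨hφ.1.comp (contDiff_affInv z), hφ.2.1.comp_homeomorph (affHomeo hz).symm, fun x hx => ?_⟩
  have : affInv z x ∈ tsupport φ := by
    have := tsupport_comp_subset_preimage φ (f := affInv z) (contDiff_affInv z (n := 0)).continuous
    exact this hx
  have h2 := hφ.2.2 this
  rwa [← affMap_mem hz, affMap_affInv hz] at h2

lemma WeakDiv.pullback {z : Fin 3 → Plane} (hz : area z ≠ 0) {σ : Plane → Plane}
    {ρ : Plane → ℝ} (hW : WeakDiv (openTri z) σ ρ) :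
    WeakDiv refTri (fun y => invMap z (σ (affMap z y))) (fun y => ρ (affMap z y)) := by
  intro φ hφ
  have h := hW _ (hφ.pushforward hz)
  rw [pairing_pullback hz _ _ (contDiff_one_of_infty (hφ.pushforward hz).1)] at h
  simp only [affInv_affMap hz] at h
  exact (mul_eq_zero.1 h).resolve_left (abs_ne_zero.2 hz)

/-- The pull-back of a gradient to the reference triangle. -/
def gradPull (z : Fin 3 → Plane) (g : Plane → Plane) (y : Plane) : Plane :=
  ContinuousLinearMap.adjoint (edgeMap z) (g (affMap z y))

/-- The Piola pull-back of a vector field to the reference triangle. -/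
def piolaPull (z : Fin 3 → Plane) (τ : Plane → Plane) (y : Plane) : Plane :=
  |area z| • invMap z (τ (affMap z y))

lemma inner_gradPull (z : Fin 3 → Plane) (g : Plane → Plane) (y d : Plane) :
    inner ℝ (gradPull z g y) d = inner ℝ (g (affMap z y)) (edgeMap z d) := by
  rw [gradPull, ContinuousLinearMap.adjoint_inner_left]

lemma WeakGrad.pullback {z : Fin 3 → Plane} (hz : area z ≠ 0) {v : Plane → ℝ} {g : Plane → Plane}
    (h : WeakGrad (openTri z) v g) : WeakGrad refTri (fun y => v (affMap z y)) (gradPull z g) := by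
  intro d
  have := (h (edgeMap z d)).pullback hz
  simpa only [map_smul, invMap_edgeMap hz, inner_gradPull] using this

/-- Weak form of the trace of a function on an oriented edge, tested with a profile along the edge.
The factor makes it independent of the shape of the triangle. -/
def traceForm (z : Fin 3 → Plane) (e : OEdge) (a : ℝ → ℝ) (v : Plane → ℝ) (g : Plane → Plane) :
    ℝ :=
  |area z|⁻¹ * pairing (openTri z) (fun x => v x • (z (vo e) - z (va e)))
    (fun x => inner ℝ (g x) (z (vo e) - z (va e))) (etest z e a 1)

lemma affMap_zref (z : Fin 3 → Plane) (i : Fin 3) : affMap z (zref i) = z i := by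
  fin_cases i <;> simp [affMap, edgeMap_apply, zref]

lemma edgeMap_zref (z : Fin 3 → Plane) (i k : Fin 3) :
    edgeMap z (zref i - zref k) = z i - z k := by
  rw [← affMap_zref z i, ← affMap_zref z k, map_sub]; simp [affMap]

/-- The weak trace is invariant under affine maps, which justifies its normalisation. -/
lemma traceForm_pullback {z : Fin 3 → Plane} (hz : area z ≠ 0) (e : OEdge) {a : ℝ → ℝ}
    (ha : EdgeTest a) (v : Plane → ℝ) (g : Plane → Plane) :
    traceForm z e a v g = traceForm zref e a (fun y => v (affMap z y)) (gradPull z g) := by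
  unfold traceForm
  rw [pairing_pullback hz _ _ (contDiff_one_of_infty (contDiff_etest z e ha 1)), ← mul_assoc,
    inv_mul_cancel₀ (abs_ne_zero.2 hz), area_zref]
  simp only [etest_affMap hz, map_smul, inner_gradPull, edgeMap_zref]
  rw [← edgeMap_zref z, invMap_edgeMap hz]; simp

namespace Triangulation

variable {m : ℕ} {T : Triangulation m}

/-- The traces of a function with a weak gradient match on a common edge. -/
lemma traceForm_eq {v : Plane → ℝ} {g : Plane → Plane}
    (hv : IntegrableOn v T.region) (hg : IntegrableOn g T.region) (hW : WeakGrad T.region v g)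
    {f f' : Fin m × OEdge} (h : T.Glue f f') {a : ℝ → ℝ} (ha : EdgeTest a) :
    traceForm (T.z f.1) f.2 a v g = traceForm (T.z f'.1) f'.2 a v g := by
  have hz' := T.area_ne f'.1
  set α := oarea (T.z f.1) f.2 / oarea (T.z f'.1) f'.2 with hα
  set d := T.z f.1 (vo f.2) - T.z f.1 (va f.2) with hd
  set d' := T.z f'.1 (vo f'.2) - T.z f'.1 (va f'.2) with hd'
  have h1 := T.pairing_etest_add_eq_zero (hv.smul_const d) (hg.inner_const (𝕜 := ℝ) d) (hW d) h ha
  have hv' := hv.mono_set (openTri_subset_region (T := T) f'.1)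
  have hg' := hg.mono_set (openTri_subset_region (T := T) f'.1)
  have hc := contDiff_etest (T.z f'.1) f'.2 ha 1
  have hs := hasCompactSupport_etest hz' f'.2 ha one_pos le_rfl
  -- the difference `d - α d'` is tangential
  have ht : dbary (T.z f'.1) (vo f'.2) (d - α • d') = 0 := by
    have e1 : dbary (T.z f'.1) (vo f'.2) d = α := by
      have e2 : dbary (T.z f'.1) (vo f'.2) d = bary (T.z f'.1) (vo f'.2) (T.z f.1 (vo f.2)) -
          bary (T.z f'.1) (vo f'.2) (T.z f.1 (va f.2)) := by
        simp only [bary, ← map_sub, hd]; congr 1; abel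
      rw [e2, h.bary_vo, h.bary_vo, bary_vertex (T.area_ne _), bary_vertex (T.area_ne _), ← hα]
      simp [(va_ne_vo f.2).symm]
    rw [map_sub, map_smul, e1, hd', dbary_sub hz']
    simp [(va_ne_vo f'.2).symm]
  have h2 : pairing (openTri (T.z f'.1)) (fun x => v x • (d - α • d'))
      (fun x => inner ℝ (g x) (d - α • d')) (etest (T.z f'.1) f'.2 a 1) = 0 := by
    refine pairing_eq_zero_of_edge (i := vo f'.2) (C := 0) (hv'.smul_const _)
      (hg'.inner_const (𝕜 := ℝ) _)
      ((hW _).mono measurableSet_region (openTri_subset_region _)) hc hs (fun x hx h0 =>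
        edgeZone_inter hz' _ le_rfl (tsupport_etest_subset _ _ ha one_pos hx) h0) fun x _ => ?_
    rw [map_smul, ht]; simp
  have h3 := pairing_smul_add hv' hg' (contDiff_one_of_infty hc) hs d' (d - α • d') α
  rw [h2, add_zero, add_sub_cancel] at h3
  have hαv : -α = |area (T.z f.1)| / |area (T.z f'.1)| := by
    rw [← abs_oarea _ f.2, ← abs_oarea _ f'.2, ← abs_div, abs_of_neg h.opposite]
  rw [h3] at h1
  unfold traceForm
  have hz1 := abs_ne_zero.2 (T.area_ne f.1)
  have hz1' := abs_ne_zero.2 hz'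
  rw [eq_neg_of_add_eq_zero_left h1, ← neg_mul, hαv, hd']
  field_simp

end Triangulation

/-- Integration against a bounded function is continuous for convergence in `L²` on a finite
measure space. -/
lemma tendsto_integral_mul_of_L2 {α : Type*} [MeasurableSpace α] {μ : Measure α}
    [IsFiniteMeasure μ] {w f : α → ℝ} {F : ℕ → α → ℝ} (hw : AEStronglyMeasurable w μ) {M : ℝ}
    (hM : ∀ x, ‖w x‖ ≤ M) (hf : MemLp f 2 μ) (hF : ∀ n, MemLp (F n) 2 μ)
    (hlim : Tendsto (fun n => eLpNorm (fun x => F n x - f x) 2 μ) atTop (𝓝 0)) :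
    Tendsto (fun n => ∫ x, w x * F n x ∂μ) atTop (𝓝 (∫ x, w x * f x ∂μ)) := by
  have hi : ∀ {h : α → ℝ}, MemLp h 2 μ → Integrable (fun x => w x * h x) μ := fun hh =>
    (hh.integrable (by norm_num)).bdd_mul (c := M) hw (Eventually.of_forall hM)
  refine tendsto_integral_of_L1 _ (hi hf).1 (Eventually.of_forall fun n => hi (hF n)) ?_
  have hb : ∀ n, ∫⁻ x, ‖w x * F n x - w x * f x‖ₑ ∂μ ≤ ENNReal.ofReal M *
      (eLpNorm (fun x => F n x - f x) 2 μ *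
        μ univ ^ (1 / (1 : ℝ≥0∞).toReal - 1 / (2 : ℝ≥0∞).toReal)) := by
    intro n
    refine le_trans ?_ (mul_le_mul_right (eLpNorm_le_eLpNorm_mul_rpow_measure_univ
      (show (1 : ℝ≥0∞) ≤ 2 by norm_num) ((hF n).1.sub hf.1)) _)
    rw [eLpNorm_one_eq_lintegral_enorm, ← lintegral_const_mul' _ _ ENNReal.ofReal_ne_top]
    refine lintegral_mono fun x => ?_
    simp only [← mul_sub, enorm_mul]
    refine mul_le_mul_left ?_ _
    rw [← ofReal_norm]; exact ENNReal.ofReal_le_ofReal (hM x)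
  refine tendsto_of_tendsto_of_tendsto_of_le_of_le tendsto_const_nhds ?_ (fun _ => zero_le) hb
  have h1 : Tendsto (fun n => eLpNorm (fun x => F n x - f x) 2 μ *
      μ univ ^ (1 / (1 : ℝ≥0∞).toReal - 1 / (2 : ℝ≥0∞).toReal)) atTop (𝓝 0) := by
    have := ENNReal.Tendsto.mul_const (b := μ univ ^ (1 / (1 : ℝ≥0∞).toReal -
      1 / (2 : ℝ≥0∞).toReal)) hlim (Or.inr (ENNReal.rpow_ne_top_of_nonneg (by norm_num)
        (measure_ne_top _ _)))
    simpa using this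
  simpa using ENNReal.Tendsto.const_mul h1 (Or.inr ENNReal.ofReal_ne_top)

lemma memLp_openTri_of_continuous {z : Fin 3 → Plane} (hz : area z ≠ 0) {E : Type*}
    [NormedAddCommGroup E] {f : Plane → E} (hf : Continuous f) (p : ℝ≥0∞) :
    MemLp f p (volume.restrict (openTri z)) := by
  obtain ⟨C, hC⟩ := (isCompact_closedTri hz).exists_bound_of_continuousOn hf.continuousOn
  have : IsFiniteMeasure (volume.restrict (openTri z)) := ⟨by
    rw [Measure.restrict_apply_univ]
    exact (measure_mono (openTri_subset_closedTri z)).trans_lt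
      (isCompact_closedTri hz).measure_lt_top⟩
  refine MemLp.of_bound hf.aestronglyMeasurable C ?_
  exact (ae_restrict_iff' (measurableSet_openTri z)).2
    (Eventually.of_forall fun x hx => hC x (openTri_subset_closedTri z hx))

lemma volume_openTri_lt_top {z : Fin 3 → Plane} (hz : area z ≠ 0) : volume (openTri z) < ⊤ :=
  (measure_mono (openTri_subset_closedTri z)).trans_lt (isCompact_closedTri hz).measure_lt_top

lemma dv_smul_const {φ : Plane → ℝ} {x : Plane} (hφ : DifferentiableAt ℝ φ x) (d : Plane) :
    dv (fun x => φ x • d) x = fderiv ℝ φ x d := by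
  rw [dv_smul hφ (differentiableAt_const d)]
  simp [dv]

lemma continuous_gradient {φ : Plane → ℝ} (hφ : ContDiff ℝ 1 φ) : Continuous (gradient φ) :=
  (InnerProductSpace.toDual ℝ Plane).symm.continuous.comp (hφ.continuous_fderiv one_ne_zero)

/-- The weak form of the trace vanishes if the trace vanishes. -/
lemma traceForm_eq_zero {z : Fin 3 → Plane} (hz : area z ≠ 0) {e : OEdge} {v : Plane → ℝ}
    {g : Plane → Plane} (hv : MemLp v 2 (volume.restrict (openTri z)))
    (hg : MemLp g 2 (volume.restrict (openTri z)))
    (h0 : HasZeroTrace (openTri z) (z (va e)) (z (vb e)) v g) {a : ℝ → ℝ} (ha : EdgeTest a) :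
    traceForm z e a v g = 0 := by
  obtain ⟨φ, hφ, h1, h2, h3⟩ := h0
  have : IsFiniteMeasure (volume.restrict (openTri z)) :=
    ⟨by rw [Measure.restrict_apply_univ]; exact volume_openTri_lt_top hz⟩
  set d := z (vo e) - z (va e) with hd
  set ψ := etest z e a 1 with hψ
  have hψc := contDiff_one_of_infty (contDiff_etest z e ha 1)
  have hψs : HasCompactSupport ψ := hasCompactSupport_etest hz e ha one_pos le_rfl
  have hφ1 := fun n => contDiff_one_of_infty (hφ n)
  obtain ⟨M, hM⟩ := hψc.continuous.bounded_above_of_compact_support hψs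
  obtain ⟨M', hM'⟩ := exists_bound_fderiv hψc hψs
  have hc1 : Continuous fun x => fderiv ℝ ψ x d :=
    (hψc.continuous_fderiv one_ne_zero).clm_apply continuous_const
  have mv := fun n => memLp_openTri_of_continuous hz (hφ1 n).continuous 2
  have mg := fun n => memLp_openTri_of_continuous hz (continuous_gradient (hφ1 n)) 2
  -- convergence of the pairings
  have t1 := tendsto_integral_mul_of_L2 (μ := volume.restrict (openTri z))
    (w := fun x => fderiv ℝ ψ x d) hc1.aestronglyMeasurable (M := M' * ‖d‖)
    (fun x => ((fderiv ℝ ψ x).le_opNorm d).trans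
      (mul_le_mul_of_nonneg_right (hM' x) (norm_nonneg _))) hv mv h1
  have t2 := tendsto_integral_mul_of_L2 (μ := volume.restrict (openTri z))
    (w := ψ) (f := fun x => inner ℝ (g x) d) (F := fun n x => inner ℝ (gradient (φ n) x) d)
    hψc.continuous.aestronglyMeasurable (M := M) hM
    (hg.inner_const d) (fun n => (mg n).inner_const d) (by
      refine tendsto_of_tendsto_of_tendsto_of_le_of_le tendsto_const_nhds
        (h := fun n => ENNReal.ofReal ‖d‖ * eLpNorm (fun x => gradient (φ n) x - g x) 2
          (volume.restrict (openTri z))) ?_ (fun _ => zero_le) fun n => ?_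
      · have := ENNReal.Tendsto.const_mul (a := ENNReal.ofReal ‖d‖) h2
          (Or.inr ENNReal.ofReal_ne_top)
        rwa [mul_zero] at this
      · refine eLpNorm_le_mul_eLpNorm_of_ae_le_mul (Eventually.of_forall fun x => ?_) 2
        rw [← inner_sub_left, Real.norm_eq_abs, mul_comm]
        exact abs_real_inner_le_norm _ _)
  -- convergence of the integrals over the edge, to zero
  have t3 := tendsto_integral_mul_of_L2 (μ := volume.restrict (Icc (0 : ℝ) 1))
    (w := a) (f := fun _ => 0) (F := fun n t => φ n (AffineMap.lineMap (z (va e)) (z (vb e)) t))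
    ha.1.continuous.aestronglyMeasurable
    (M := (ha.1.continuous.bounded_above_of_compact_support
      (isCompact_Icc.of_isClosed_subset (isClosed_tsupport a) ha.2)).choose)
    (ha.1.continuous.bounded_above_of_compact_support
      (isCompact_Icc.of_isClosed_subset (isClosed_tsupport a) ha.2)).choose_spec
    (by simp) (fun n => by
      have hcont : Continuous fun t : ℝ => φ n (AffineMap.lineMap (z (va e)) (z (vb e)) t) :=
        (hφ1 n).continuous.comp AffineMap.lineMap_continuous
      obtain ⟨C, hC⟩ := (isCompact_Icc (a := (0 : ℝ)) (b := 1)).exists_bound_of_continuousOn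
        hcont.continuousOn
      exact MemLp.of_bound hcont.aestronglyMeasurable C
        ((ae_restrict_iff' measurableSet_Icc).2 (Eventually.of_forall hC))) (by simpa using h3)
  -- for the smooth approximations, the pairings are integrals over the edge
  have hpair : ∀ n, pairing (openTri z) (fun x => φ n x • d)
      (fun x => inner ℝ (gradient (φ n) x) d) ψ = -(oarea z e / |area z|) *
        (cross (z (vb e) - z (va e)) d * ∫ t in Icc (0 : ℝ) 1,
          a t * φ n (AffineMap.lineMap (z (va e)) (z (vb e)) t)) := by
    intro n
    have hF : ContDiff ℝ 1 fun x => φ n x • d := (hφ1 n).smul contDiff_const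
    have e1 : (fun x => inner ℝ (gradient (φ n) x) d) = dv fun x => φ n x • d := by
      ext x; rw [dv_smul_const ((hφ1 n).differentiable one_ne_zero x), inner_gradient_left]
    rw [e1, pairing_etest_smooth hz e ha hF, integral_Icc_eq_integral_Ioc,
      ← intervalIntegral.integral_of_le zero_le_one]
    congr 1
    rw [← intervalIntegral.integral_const_mul]
    refine unitIntegral_congr fun t _ => ?_
    rw [cross_smul_right]; ring
  have hsplit : ∀ (v : Plane → ℝ) (g : Plane → Plane), MemLp v 2 (volume.restrict (openTri z)) →
      MemLp g 2 (volume.restrict (openTri z)) →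
      pairing (openTri z) (fun x => v x • d) (fun x => inner ℝ (g x) d) ψ =
      (∫ x in openTri z, fderiv ℝ ψ x d * v x) + ∫ x in openTri z, ψ x * inner ℝ (g x) d := by
    intro v g hv hg
    rw [← integral_add ((hv.integrable (by norm_num)).bdd_mul (c := M' * ‖d‖)
      hc1.aestronglyMeasurable (Eventually.of_forall fun x => ((fderiv ℝ ψ x).le_opNorm d).trans
      (mul_le_mul_of_nonneg_right (hM' x) (norm_nonneg _))))
      (((hg.inner_const (𝕜 := ℝ) d).integrable (by norm_num)).bdd_mul (c := M)
        hψc.continuous.aestronglyMeasurable (Eventually.of_forall hM))]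
    unfold pairing
    congr 1; ext x; simp [mul_comm, hψ]
  have hlim := t1.add t2
  rw [← hsplit v g hv hg] at hlim
  simp only [← fun n => hsplit (φ n) (gradient (φ n)) (mv n) (mg n), hpair] at hlim
  have hlim2 : Tendsto (fun n => -(oarea z e / |area z|) *
        (cross (z (vb e) - z (va e)) d * ∫ t in Icc (0 : ℝ) 1,
          a t * φ n (AffineMap.lineMap (z (va e)) (z (vb e)) t))) atTop (𝓝 0) := by
    have := (t3.const_mul (cross (z (vb e) - z (va e)) d)).const_mul (-(oarea z e / |area z|))
    simpa using this
  rw [traceForm, tendsto_nhds_unique hlim hlim2, mul_zero]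

/-! ### Polynomials in two variables -/

/-- Real polynomials in two variables. -/
abbrev MvP : Type := MvPolynomial (Fin 2) ℝ

/-- The function defined by a polynomial. -/
def peval (P : MvP) (x : Plane) : ℝ := MvPolynomial.eval (⇑x) P

/-- The vector field defined by a pair of polynomials. -/
def vpeval (V : Fin 2 → MvP) (x : Plane) : Plane := WithLp.toLp 2 fun i => peval (V i) x

@[simp] lemma vpeval_apply (V : Fin 2 → MvP) (x : Plane) (i : Fin 2) :
    vpeval V x i = peval (V i) x := rfl

lemma peval_add (P Q : MvP) (x : Plane) : peval (P + Q) x = peval P x + peval Q x := by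
  simp [peval]

lemma peval_sub (P Q : MvP) (x : Plane) : peval (P - Q) x = peval P x - peval Q x := by
  simp [peval]

lemma peval_mul (P Q : MvP) (x : Plane) : peval (P * Q) x = peval P x * peval Q x := by
  simp [peval]

lemma peval_C (c : ℝ) (x : Plane) : peval (MvPolynomial.C c) x = c := by simp [peval]

lemma peval_X (i : Fin 2) (x : Plane) : peval (MvPolynomial.X i) x = x i := by simp [peval]

lemma peval_smul (c : ℝ) (P : MvP) (x : Plane) : peval (c • P) x = c * peval P x := by
  simp [peval, MvPolynomial.smul_eval]

lemma peval_sum {ι : Type*} (s : Finset ι) (P : ι → MvP) (x : Plane) :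
    peval (∑ i ∈ s, P i) x = ∑ i ∈ s, peval (P i) x := by simp [peval]

lemma contDiff_peval (P : MvP) {n : WithTop ℕ∞} : ContDiff ℝ n (peval P) := by
  induction P using MvPolynomial.induction_on with
  | C c => simp only [funext (peval_C c)]; exact contDiff_const
  | add P Q hP hQ => simp only [funext (peval_add P Q)]; exact hP.add hQ
  | mul_X P i hP =>
    have : peval (P * MvPolynomial.X i) = fun x => peval P x * x i := by
      ext x; rw [peval_mul, peval_X]
    rw [this]
    exact hP.mul (EuclideanSpace.proj (𝕜 := ℝ) i).contDiff

lemma continuous_peval (P : MvP) : Continuous (peval P) := (contDiff_peval P (n := 0)).continuous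

lemma hasFDerivAt_peval (P : MvP) (x : Plane) : HasFDerivAt (peval P)
    (peval (MvPolynomial.pderiv 0 P) x • EuclideanSpace.proj (𝕜 := ℝ) (0 : Fin 2) +
      peval (MvPolynomial.pderiv 1 P) x • EuclideanSpace.proj (𝕜 := ℝ) (1 : Fin 2)) x := by
  induction P using MvPolynomial.induction_on with
  | C c => simpa [funext (peval_C c), peval] using hasFDerivAt_const c x
  | add P Q hP hQ =>
    have := hP.add hQ
    rw [show peval (P + Q) = peval P + peval Q from funext (peval_add P Q)]
    refine this.congr_fderiv ?_
    ext v
    simp [peval_add]; ring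
  | mul_X P i hP =>
    have e : peval (P * MvPolynomial.X i) = fun x => peval P x * x i := by
      ext x; rw [peval_mul, peval_X]
    rw [e]
    have h2 : HasFDerivAt (fun x : Plane => x i) (EuclideanSpace.proj (𝕜 := ℝ) i) x :=
      (EuclideanSpace.proj (𝕜 := ℝ) i).hasFDerivAt
    have := hP.mul h2
    refine this.congr_fderiv ?_
    ext v
    fin_cases i <;>
      simp [MvPolynomial.pderiv_X, peval_add, peval_mul, peval_X] <;>
      simp [peval] <;> ring

lemma fderiv_peval (P : MvP) (x v : Plane) : fderiv ℝ (peval P) x v =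
    peval (MvPolynomial.pderiv 0 P) x * v 0 + peval (MvPolynomial.pderiv 1 P) x * v 1 := by
  rw [(hasFDerivAt_peval P x).fderiv]; simp

lemma contDiff_vpeval (V : Fin 2 → MvP) {n : WithTop ℕ∞} : ContDiff ℝ n (vpeval V) := by
  rw [contDiff_euclidean]; exact fun i => contDiff_peval (V i)

lemma continuous_vpeval (V : Fin 2 → MvP) : Continuous (vpeval V) :=
  (contDiff_vpeval V (n := 0)).continuous

/-- The formal divergence. -/
def pdiv (V : Fin 2 → MvP) : MvP := MvPolynomial.pderiv 0 (V 0) + MvPolynomial.pderiv 1 (V 1)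

/-- The formal gradient. -/
def pgrad (P : MvP) : Fin 2 → MvP := fun i => MvPolynomial.pderiv i P

lemma dv_vpeval (V : Fin 2 → MvP) : dv (vpeval V) = peval (pdiv V) := by
  ext x
  have hd := (contDiff_vpeval V (n := 1)).differentiable one_ne_zero x
  have h : ∀ (i : Fin 2) (v : Plane), fderiv ℝ (vpeval V) x v i = fderiv ℝ (peval (V i)) x v :=
    fun i v => (fderiv_coord hd v i).symm
  rw [dv, trace_eq]
  simp only [ContinuousLinearMap.coe_coe, h, fderiv_peval, pdiv, peval_add]
  simp

lemma gradient_peval (P : MvP) : gradient (peval P) = vpeval (pgrad P) := by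
  ext x : 1
  refine ext_inner_right ℝ fun v => ?_
  rw [inner_gradient_left, fderiv_peval]
  simp [PiLp.inner_apply, Fin.sum_univ_two, pgrad, mul_comm]

lemma totalDegree_pderiv_le (i : Fin 2) (P : MvP) :
    (MvPolynomial.pderiv i P).totalDegree ≤ P.totalDegree - 1 := by
  classical
  conv_lhs => rw [P.as_sum, map_sum]
  refine MvPolynomial.totalDegree_finsetSum_le fun s hs => ?_
  rw [MvPolynomial.pderiv_monomial]
  by_cases h0 : s i = 0
  · simp [h0]
  refine (MvPolynomial.totalDegree_monomial_le _ _).trans ?_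
  have h1 := MvPolynomial.le_totalDegree hs
  have h2 : (s - Finsupp.single i 1) + Finsupp.single i 1 = s :=
    tsub_add_cancel_of_le (by simpa [Finsupp.single_le_iff] using Nat.one_le_iff_ne_zero.2 h0)
  have h3 : ((s - Finsupp.single i 1).sum fun _ => id) + 1 = s.sum fun _ e => e := by
    conv_rhs => rw [← h2]
    rw [Finsupp.sum_add_index' (by simp) (by simp)]; simp [Function.id_def]
  omega

lemma pderiv_eq_zero_of_totalDegree {P : MvP} (h : P.totalDegree = 0) (i : Fin 2) :
    MvPolynomial.pderiv i P = 0 := by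
  rw [MvPolynomial.totalDegree_eq_zero_iff_eq_C.1 h, MvPolynomial.pderiv_C]

/-- Substitution of affine functions does not raise the degree. -/
lemma totalDegree_bind₁_le {ℓ : Fin 2 → MvP} (hℓ : ∀ i, (ℓ i).totalDegree ≤ 1) (P : MvP) :
    (MvPolynomial.bind₁ ℓ P).totalDegree ≤ P.totalDegree := by
  conv_lhs => rw [P.as_sum, map_sum]
  refine MvPolynomial.totalDegree_finsetSum_le fun s hs => ?_
  rw [MvPolynomial.bind₁_monomial]
  refine (MvPolynomial.totalDegree_mul _ _).trans ?_
  rw [MvPolynomial.totalDegree_C, zero_add]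
  refine le_trans ?_ (MvPolynomial.le_totalDegree hs)
  refine (MvPolynomial.totalDegree_finsetProd _ _).trans ?_
  refine Finset.sum_le_sum fun i _ => ?_
  exact (MvPolynomial.totalDegree_pow _ _).trans
    ((Nat.mul_le_mul_left _ (hℓ i)).trans (by simp))

/-- The polynomial of an affine function. -/
def affPoly (c : ℝ) (u : Fin 2 → ℝ) : MvP :=
  MvPolynomial.C c + (MvPolynomial.C (u 0) * MvPolynomial.X 0 +
    MvPolynomial.C (u 1) * MvPolynomial.X 1)

lemma totalDegree_affPoly_le (c : ℝ) (u : Fin 2 → ℝ) : (affPoly c u).totalDegree ≤ 1 := by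
  have h : ∀ i : Fin 2, (MvPolynomial.C (u i) * MvPolynomial.X i : MvP).totalDegree ≤ 1 :=
    fun i => (MvPolynomial.totalDegree_mul _ _).trans (by simp)
  refine (MvPolynomial.totalDegree_add _ _).trans (max_le (by simp) ?_)
  exact (MvPolynomial.totalDegree_add _ _).trans (max_le (h 0) (h 1))

lemma peval_affPoly (c : ℝ) (u : Fin 2 → ℝ) (x : Plane) :
    peval (affPoly c u) x = c + (u 0 * x 0 + u 1 * x 1) := by simp [peval, affPoly]

lemma clm_eq (L : Plane →L[ℝ] ℝ) (x : Plane) :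
    L x = L (EuclideanSpace.single 0 1) * x 0 + L (EuclideanSpace.single 1 1) * x 1 := by
  have hx : x = x 0 • EuclideanSpace.single 0 1 + x 1 • EuclideanSpace.single 1 1 := by
    ext i; fin_cases i <;> simp
  conv_lhs => rw [hx, map_add, map_smul, map_smul]
  simp [mul_comm]

/-- Composition with an affine map of the plane. -/
lemma exists_peval_comp (c : Plane) (L : Plane →L[ℝ] Plane) : ∃ Φ : MvP →ₐ[ℝ] MvP,
    (∀ P, (Φ P).totalDegree ≤ P.totalDegree) ∧ ∀ P x, peval (Φ P) x = peval P (c + L x) := by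
  set ℓ : Fin 2 → MvP := fun i => affPoly (c i) fun k => L (EuclideanSpace.single k 1) i with hℓ
  refine ⟨MvPolynomial.bind₁ ℓ, totalDegree_bind₁_le fun i => totalDegree_affPoly_le _ _,
    fun P x => ?_⟩
  have : (fun i => peval (ℓ i) x) = ⇑(c + L x) := by
    ext i
    rw [hℓ, peval_affPoly, PiLp.add_apply]
    congr 1
    exact (clm_eq ((EuclideanSpace.proj (𝕜 := ℝ) i).comp L) x).symm
  simp only [peval] at *
  rw [← this, ← MvPolynomial.aeval_eq_eval, ← MvPolynomial.aeval_eq_eval, MvPolynomial.aeval_bind₁]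

/-- The polynomial of a barycentric coordinate. -/
def baryPoly (z : Fin 3 → Plane) (i : Fin 3) : MvP :=
  affPoly (bary z i 0) fun k => dbary z i (EuclideanSpace.single k 1)

lemma peval_baryPoly (z : Fin 3 → Plane) (i : Fin 3) (x : Plane) :
    peval (baryPoly z i) x = bary z i x := by
  rw [baryPoly, peval_affPoly, ← clm_eq, ← bary_add, zero_add]

/-- A polynomial that vanishes on a nonempty open set is zero. -/
lemma eq_zero_of_peval_eq_zero {U : Set Plane} (hU : IsOpen U) (hne : U.Nonempty) {P : MvP}
    (h : ∀ x ∈ U, peval P x = 0) : P = 0 := by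
  obtain ⟨x, hx⟩ := hne
  have hU' : IsOpen ((WithLp.toLp 2 : (Fin 2 → ℝ) → Plane) ⁻¹' U) :=
    hU.preimage (PiLp.continuous_toLp 2 _)
  obtain ⟨ε, hε, hb⟩ := Metric.isOpen_iff.1 hU' (WithLp.ofLp x) (by simpa using hx)
  refine MvPolynomial.funext_set (fun i => Metric.ball (x i) ε)
    (fun i => infinite_of_mem_nhds (x i) (Metric.ball_mem_nhds _ hε)) fun y hy => ?_
  rw [map_zero]
  refine h (WithLp.toLp 2 y) (hb ?_)
  rw [ball_pi _ hε]
  exact hy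

/-- A polynomial on an edge is determined by its integrals against the edge profiles. -/
lemma peval_edge_eq_zero {P : MvP} {a b : Plane}
    (h : ∀ φ : ℝ → ℝ, EdgeTest φ → ∫ t in (0 : ℝ)..1, φ t * peval P (AffineMap.lineMap a b t) = 0)
    (t : ℝ) : peval P (AffineMap.lineMap a b t) = 0 := by
  -- the restriction to the edge is a polynomial in one variable
  obtain ⟨Q, hQ⟩ : ∃ Q : Polynomial ℝ, ∀ t, Q.eval t = peval P (AffineMap.lineMap a b t) := by
    refine ⟨MvPolynomial.aeval (fun i => Polynomial.C (a i) +
      Polynomial.X * Polynomial.C (b i - a i)) P, fun t => ?_⟩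
    rw [← Polynomial.coe_aeval_eq_eval, ← AlgHom.comp_apply, MvPolynomial.comp_aeval, peval,
      ← MvPolynomial.aeval_eq_eval]
    congr 2
    ext i
    simp [AffineMap.lineMap_apply]; ring
  have hQc : Continuous fun t => Q.eval t := Q.continuous
  let χ : ContDiffBump (1 / 2 : ℝ) := ⟨1 / 8, 1 / 4, by norm_num, by norm_num⟩
  have hχ : EdgeTest fun t => χ t * Q.eval t := by
    have hQs : ContDiff ℝ ∞ fun t => Q.eval t := by
      simp only [hQ, AffineMap.lineMap_apply_module]
      exact (contDiff_peval P).comp (((contDiff_const.sub contDiff_id).smul contDiff_const).add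
        (contDiff_id.smul contDiff_const))
    refine ⟨χ.contDiff.mul hQs, ?_⟩
    refine (tsupport_mul_subset_left).trans ?_
    rw [χ.tsupport_eq, Real.closedBall_eq_Icc]
    refine Icc_subset_Icc ?_ ?_ <;> norm_num [χ]
  have h0 := h _ hχ
  simp only [← hQ] at h0
  have hcont : Continuous fun t => χ t * Q.eval t * Q.eval t := (χ.continuous.mul hQc).mul hQc
  have hnn : ∀ t, 0 ≤ χ t * Q.eval t * Q.eval t := fun t => by
    rw [mul_assoc]; exact mul_nonneg χ.nonneg (mul_self_nonneg _)
  have hz : ∀ t ∈ Ioo (3 / 8 : ℝ) (5 / 8), Q.eval t = 0 := by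
    intro t ht
    by_contra hne
    have hpos : 0 < ∫ t in (0 : ℝ)..1, χ t * Q.eval t * Q.eval t := by
      refine intervalIntegral.integral_pos zero_lt_one hcont.continuousOn (fun t _ => hnn t)
        ⟨t, ⟨by linarith [ht.1], by linarith [ht.2]⟩, ?_⟩
      have h1 : χ t = 1 := χ.one_of_mem_closedBall (by
        rw [Real.closedBall_eq_Icc]
        constructor <;> norm_num [χ] <;> linarith [ht.1, ht.2])
      rw [h1, one_mul]; exact mul_self_pos.2 hne
    exact hpos.ne' h0
  have hQ0 : Q = 0 := by
    refine Polynomial.eq_zero_of_infinite_isRoot _ ?_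
    exact (Ioo_infinite (by norm_num : (3 / 8 : ℝ) < 5 / 8)).mono hz
  rw [← hQ, hQ0, Polynomial.eval_zero]

/-! ### The Poincaré inequality on bounded convex sets -/

lemma sq_lintegral_le {α : Type*} [MeasurableSpace α] {μ : Measure α} [IsProbabilityMeasure μ]
    {f : α → ℝ≥0∞} (hf : AEMeasurable f μ) : (∫⁻ a, f a ∂μ) ^ 2 ≤ ∫⁻ a, f a ^ 2 ∂μ := by
  have h := ENNReal.lintegral_mul_le_Lp_mul_Lq μ (Real.HolderConjugate.two_two) hf
    (aemeasurable_const (b := (1 : ℝ≥0∞)))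
  simp only [Pi.mul_apply, mul_one, lintegral_const, measure_univ,
    ENNReal.rpow_two, one_pow, ENNReal.one_rpow] at h
  calc (∫⁻ a, f a ∂μ) ^ 2 ≤ ((∫⁻ a, f a ^ 2 ∂μ) ^ (1 / 2 : ℝ)) ^ 2 := by gcongr
    _ = ∫⁻ a, f a ^ 2 ∂μ := by
        rw [← ENNReal.rpow_two, ← ENNReal.rpow_mul]; norm_num

/-- The translates of a test function along a segment remain test functions on a convex set. -/
lemma IsTest.translate {D : Set Plane} (hc : Convex ℝ D) {h : Plane} {φ : Plane → ℝ}
    (hφ : IsTest (D ∩ (fun x => x + h) ⁻¹' D) φ) {t : ℝ} (ht : t ∈ Icc (0 : ℝ) 1) :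
    IsTest D (fun x => φ (x - t • h)) := by
  obtain ⟨h1, h2, h3⟩ := hφ
  refine ⟨h1.comp (contDiff_id.sub contDiff_const), ?_, ?_⟩
  · exact h2.comp_homeomorph (Homeomorph.subRight (t • h))
  · intro x hx
    have : x - t • h ∈ tsupport φ :=
      tsupport_comp_subset_preimage φ (by fun_prop : Continuous fun x : Plane => x - t • h) hx
    obtain ⟨ha, hb⟩ := h3 this
    have := hc ha hb (sub_nonneg.2 ht.2) ht.1 (by ring)
    convert this using 1
    module

/-- The fundamental theorem of calculus along a segment. -/
lemma sub_translate_eq {φ : Plane → ℝ} (hφ : ContDiff ℝ 1 φ) (x h : Plane) :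
    φ (x - h) - φ x = - ∫ t in Icc (0 : ℝ) 1, fderiv ℝ φ (x - t • h) h := by
  have hd : ∀ t : ℝ, HasDerivAt (fun t : ℝ => φ (x - t • h)) (-(fderiv ℝ φ (x - t • h) h)) t := by
    intro t
    have h1 : HasDerivAt (fun t : ℝ => x - t • h) (-h) t := by
      simpa using ((hasDerivAt_id t).smul_const h).const_sub x
    have := ((hφ.differentiable one_ne_zero) (x - t • h)).hasFDerivAt.comp_hasDerivAt t h1
    rw [map_neg] at this
    exact this
  have hcont : Continuous fun t : ℝ => -(fderiv ℝ φ (x - t • h) h) :=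
    (((hφ.continuous_fderiv one_ne_zero).comp
      (by fun_prop : Continuous fun t : ℝ => x - t • h)).clm_apply continuous_const).neg
  have := intervalIntegral.integral_eq_sub_of_hasDerivAt (a := 0) (b := 1) (fun t _ => hd t)
    (hcont.intervalIntegrable 0 1)
  simp only [one_smul, zero_smul, sub_zero] at this
  rw [← this, intervalIntegral.integral_of_le zero_le_one, integral_Icc_eq_integral_Ioc,
    integral_neg]

lemma integrable_translates {g : Plane → Plane} (hg : Integrable g) (hm : StronglyMeasurable g)
    (h : Plane) :
    Integrable (fun p : Plane × ℝ => inner ℝ (g (p.1 + p.2 • h)) h)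
      ((volume : Measure Plane).prod (volume.restrict (Icc (0 : ℝ) 1))) := by
  have hm' : Measurable fun p : Plane × ℝ => g (p.1 + p.2 • h) :=
    hm.measurable.comp (by fun_prop)
  have : Integrable (fun p : Plane × ℝ => g (p.1 + p.2 • h))
      ((volume : Measure Plane).prod (volume.restrict (Icc (0 : ℝ) 1))) := by
    rw [integrable_prod_iff' hm'.aestronglyMeasurable]
    refine ⟨Eventually.of_forall fun t => hg.comp_add_right (t • h), ?_⟩
    have : (fun t : ℝ => ∫ x : Plane, ‖g (x + t • h)‖) = fun _ => ∫ x : Plane, ‖g x‖ := by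
      ext t; exact integral_add_right_eq_self (fun x => ‖g x‖) (t • h)
    simp only [this]
    exact integrable_const _
  exact this.inner_const h

/-- Weakly differentiable functions are, almost everywhere, integrals of their gradient along
segments. -/
lemma WeakGrad.translate_ae_eq {D : Set Plane} (hc : Convex ℝ D) (hD : IsOpen D)
    {v : Plane → ℝ} {g : Plane → Plane} (hv : Integrable v) (hg : Integrable g)
    (hgm : StronglyMeasurable g)
    (hW : WeakGrad D v g) (h : Plane) (hv0 : ∀ x ∉ D, v x = 0) (hg0 : ∀ x ∉ D, g x = 0) :
    ∀ᵐ x, x ∈ D ∩ (fun x => x + h) ⁻¹' D →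
      v (x + h) - v x = ∫ t in Icc (0 : ℝ) 1, inner ℝ (g (x + t • h)) h := by
  have hint := integrable_translates hg hgm h
  have hk : Integrable fun x => ∫ t in Icc (0 : ℝ) 1, inner ℝ (g (x + t • h)) h :=
    hint.integral_prod_left
  have hvh : Integrable fun x => v (x + h) := hv.comp_add_right h
  have hD' : IsOpen (D ∩ (fun x => x + h) ⁻¹' D) := hD.inter (hD.preimage (by fun_prop))
  have key := hD'.ae_eq_zero_of_integral_contDiff_smul_eq_zero
    (((hvh.sub hv).sub hk).locallyIntegrable.locallyIntegrableOn _) ?_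
  · filter_upwards [key] with x hx hxD
    have := hx hxD
    simp only [Pi.sub_apply] at this
    linarith
  intro φ h1 h2 h3
  have hφ : IsTest (D ∩ (fun x => x + h) ⁻¹' D) φ := ⟨h1, h2, h3⟩
  have h11 : ContDiff ℝ 1 φ := contDiff_one_of_infty h1
  obtain ⟨C, hC⟩ := h2.exists_bound_of_continuous h1.continuous
  obtain ⟨C', hC'⟩ := exists_bound_fderiv h11 h2
  have hφv : Integrable fun x => φ x * v x :=
    hv.bdd_mul h1.continuous.aestronglyMeasurable (Eventually.of_forall hC)
  have hφvh : Integrable fun x => φ x * v (x + h) :=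
    hvh.bdd_mul h1.continuous.aestronglyMeasurable (Eventually.of_forall hC)
  have hφvh' : Integrable fun x => φ (x - h) * v x := by
    simpa using hφvh.comp_sub_right h
  have hφk : Integrable fun x => φ x * ∫ t in Icc (0 : ℝ) 1, inner ℝ (g (x + t • h)) h :=
    hk.bdd_mul h1.continuous.aestronglyMeasurable (Eventually.of_forall hC)
  have e1 : ∫ x, φ x • (((fun x => v (x + h)) - v - fun x =>
      ∫ t in Icc (0 : ℝ) 1, inner ℝ (g (x + t • h)) h) x) =
      (∫ x, φ x * v (x + h)) - (∫ x, φ x * v x) -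
        ∫ x, φ x * ∫ t in Icc (0 : ℝ) 1, inner ℝ (g (x + t • h)) h := by
    rw [← integral_sub hφvh hφv, ← integral_sub (f := fun x => φ x * v (x + h) - φ x * v x)
      (hφvh.sub hφv) hφk]
    refine integral_congr_ae (Eventually.of_forall fun x => ?_)
    simp only [Pi.sub_apply, smul_eq_mul]; ring
  have e2 : ∫ x, φ x * v (x + h) = ∫ x, φ (x - h) * v x := by
    rw [← integral_sub_right_eq_self (fun x => φ x * v (x + h)) h]; simp
  have hFm : Continuous fun p : Plane × ℝ => fderiv ℝ φ (p.1 - p.2 • h) h :=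
    ((h11.continuous_fderiv one_ne_zero).comp
      (by fun_prop : Continuous fun p : Plane × ℝ => p.1 - p.2 • h)).clm_apply continuous_const
  have hF : Integrable (fun p : Plane × ℝ => fderiv ℝ φ (p.1 - p.2 • h) h * v p.1)
      ((volume : Measure Plane).prod (volume.restrict (Icc (0 : ℝ) 1))) := by
    refine (hv.comp_fst (volume.restrict (Icc (0 : ℝ) 1))).bdd_mul
      (c := C' * ‖h‖) hFm.aestronglyMeasurable (Eventually.of_forall fun p => ?_)
    exact (ContinuousLinearMap.le_opNorm _ _).trans (by gcongr; exact hC' _)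
  -- the translation is moved to the test function, where the fundamental theorem of calculus
  -- applies
  have e3 : (∫ x, φ (x - h) * v x) - ∫ x, φ x * v x =
      - ∫ t in Icc (0 : ℝ) 1, ∫ x, fderiv ℝ φ (x - t • h) h * v x := by
    rw [← integral_sub hφvh' hφv, ← integral_integral_swap hF, ← integral_neg]
    refine integral_congr_ae (Eventually.of_forall fun x => ?_)
    simp only [integral_mul_const]
    rw [← sub_mul, sub_translate_eq h11, neg_mul]
  -- the definition of the weak gradient, for the test function translated by `t • h`
  have e4 : ∀ t ∈ Icc (0 : ℝ) 1, ∫ x, fderiv ℝ φ (x - t • h) h * v x =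
      - ∫ x, φ x * inner ℝ (g (x + t • h)) h := by
    intro t ht
    have ht' := hφ.translate hc ht
    have hw := hW h _ ht'
    rw [pairing] at hw
    have e5 : ∀ x, fderiv ℝ (fun x => φ (x - t • h)) x = fderiv ℝ φ (x - t • h) := fun x =>
      fderiv_comp_sub (t • h)
    rw [setIntegral_eq_integral_of_forall_compl_eq_zero] at hw
    rotate_left
    · intro x hx; simp [hv0 x hx, hg0 x hx]
    have i1 : Integrable fun x => fderiv ℝ φ (x - t • h) h * v x := by
      refine hv.bdd_mul (c := C' * ‖h‖) (Continuous.aestronglyMeasurable ?_)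
        (Eventually.of_forall fun p => ?_)
      · exact hFm.comp (by fun_prop : Continuous fun x : Plane => (x, t))
      · exact (ContinuousLinearMap.le_opNorm _ _).trans (by gcongr; exact hC' _)
    have i2 : Integrable fun x => φ x * inner ℝ (g (x + t • h)) h :=
      ((hg.comp_add_right (t • h)).inner_const h).bdd_mul h1.continuous.aestronglyMeasurable
        (Eventually.of_forall hC)
    have i3 := i2.comp_sub_right (t • h)
    rw [← integral_sub_right_eq_self (fun x => φ x * inner ℝ (g (x + t • h)) h) (t • h),
      ← add_eq_zero_iff_eq_neg, ← integral_add i1 i3, ← hw]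
    refine integral_congr_ae (Eventually.of_forall fun x => ?_)
    simp only [e5, map_smul, smul_eq_mul, sub_add_cancel]
    ring
  have hint2 : Integrable (fun p : Plane × ℝ => φ p.1 * inner ℝ (g (p.1 + p.2 • h)) h)
      ((volume : Measure Plane).prod (volume.restrict (Icc (0 : ℝ) 1))) :=
    hint.bdd_mul (h1.continuous.comp continuous_fst).aestronglyMeasurable
      (Eventually.of_forall fun p => hC p.1)
  have e6 : ∫ x, φ x * ∫ t in Icc (0 : ℝ) 1, inner ℝ (g (x + t • h)) h =
      ∫ t in Icc (0 : ℝ) 1, ∫ x, φ x * inner ℝ (g (x + t • h)) h := by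
    simp_rw [← integral_const_mul]
    exact integral_integral_swap hint2
  rw [e1, e2, e3, setIntegral_congr_fun measurableSet_Icc e4, e6, integral_neg]
  ring

lemma eLpNorm_two_sq {α E : Type*} [MeasurableSpace α] [NormedAddCommGroup E] (μ : Measure α)
    (f : α → E) : eLpNorm f 2 μ ^ 2 = ∫⁻ a, ‖f a‖ₑ ^ 2 ∂μ := by
  have := eLpNorm_nnreal_pow_eq_lintegral (f := f) (μ := μ) (p := 2) two_ne_zero
  simpa using this

/-- The difference of a function and its translate by `h` is bounded in `L²` by `‖h‖` times the
norm of the gradient. -/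
lemma lintegral_translate_le {D : Set Plane} (hc : Convex ℝ D) (hD : IsOpen D)
    {v : Plane → ℝ} {g : Plane → Plane} (hv : Integrable v) (hg : Integrable g)
    (hgm : StronglyMeasurable g)
    (hW : WeakGrad D v g) (h : Plane) (hv0 : ∀ x ∉ D, v x = 0) (hg0 : ∀ x ∉ D, g x = 0) :
    ∫⁻ x in D ∩ (fun x => x + h) ⁻¹' D, ‖v (x + h) - v x‖ₑ ^ 2 ≤
      ‖h‖ₑ ^ 2 * ∫⁻ x, ‖g x‖ₑ ^ 2 := by
  have hD' : IsOpen (D ∩ (fun x => x + h) ⁻¹' D) := hD.inter (hD.preimage (by fun_prop))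
  have : IsProbabilityMeasure ((volume : Measure ℝ).restrict (Icc (0 : ℝ) 1)) :=
    ⟨by simp⟩
  have hm : Measurable fun p : Plane × ℝ => ‖g (p.1 + p.2 • h)‖ₑ :=
    (hgm.measurable.comp (by fun_prop)).enorm
  calc ∫⁻ x in D ∩ (fun x => x + h) ⁻¹' D, ‖v (x + h) - v x‖ₑ ^ 2
      = ∫⁻ x in D ∩ (fun x => x + h) ⁻¹' D,
          ‖∫ t in Icc (0 : ℝ) 1, inner ℝ (g (x + t • h)) h‖ₑ ^ 2 := by
        refine lintegral_congr_ae ?_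
        filter_upwards [(ae_restrict_iff' hD'.measurableSet).2
          (hW.translate_ae_eq hc hD hv hg hgm h hv0 hg0)] with x hx
        rw [hx]
    _ ≤ ∫⁻ x in D ∩ (fun x => x + h) ⁻¹' D,
          ∫⁻ t in Icc (0 : ℝ) 1, ‖h‖ₑ ^ 2 * ‖g (x + t • h)‖ₑ ^ 2 := by
        refine lintegral_mono fun x => ?_
        calc ‖∫ t in Icc (0 : ℝ) 1, inner ℝ (g (x + t • h)) h‖ₑ ^ 2
            ≤ (∫⁻ t in Icc (0 : ℝ) 1, ‖h‖ₑ * ‖g (x + t • h)‖ₑ) ^ 2 := by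
              gcongr
              refine (enorm_integral_le_lintegral_enorm _).trans (lintegral_mono fun t => ?_)
              rw [mul_comm]
              simpa [enorm, ← ENNReal.coe_mul] using
                nnnorm_inner_le_nnnorm (𝕜 := ℝ) (g (x + t • h)) h
          _ ≤ ∫⁻ t in Icc (0 : ℝ) 1, (‖h‖ₑ * ‖g (x + t • h)‖ₑ) ^ 2 :=
              sq_lintegral_le ((hm.comp measurable_prodMk_left).const_mul _).aemeasurable
          _ = _ := by simp only [mul_pow]
    _ ≤ ∫⁻ x, ∫⁻ t in Icc (0 : ℝ) 1, ‖h‖ₑ ^ 2 * ‖g (x + t • h)‖ₑ ^ 2 :=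
        setLIntegral_le_lintegral _ _
    _ = ∫⁻ t in Icc (0 : ℝ) 1, ∫⁻ x, ‖h‖ₑ ^ 2 * ‖g (x + t • h)‖ₑ ^ 2 :=
        lintegral_lintegral_swap ((hm.pow_const 2).const_mul _).aemeasurable
    _ = ∫⁻ t in Icc (0 : ℝ) 1, ‖h‖ₑ ^ 2 * ∫⁻ x, ‖g x‖ₑ ^ 2 := by
        refine lintegral_congr fun t => ?_
        rw [lintegral_add_right_eq_self (fun x => ‖h‖ₑ ^ 2 * ‖g x‖ₑ ^ 2) (t • h),
          lintegral_const_mul _ (hgm.measurable.enorm.pow_const 2)]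
    _ = _ := by simp

/-- Poincaré's inequality. The constant is obtained by averaging the square of `v x - v y` over
all pairs of points, translation by translation. -/
theorem exists_poincare {D : Set Plane} (hc : Convex ℝ D) (hD : IsOpen D) (hne : D.Nonempty)
    (hb : Bornology.IsBounded D) :
    ∃ C : ℝ, 0 ≤ C ∧ ∀ (v : Plane → ℝ) (g : Plane → Plane), MemLp v 2 (volume.restrict D) →
      MemLp g 2 (volume.restrict D) → WeakGrad D v g →
      ∃ c : ℝ, eLpNorm (fun x => v x - c) 2 (volume.restrict D) ≤
        ENNReal.ofReal C * eLpNorm g 2 (volume.restrict D) := by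
  obtain ⟨R, hR⟩ := Metric.isBounded_iff.1 hb
  have hvol : volume D ≠ 0 := (hD.measure_pos volume hne).ne'
  have hvol' : volume D ≠ ⊤ := hb.measure_lt_top.ne
  set B : ℝ≥0∞ := ENNReal.ofReal R ^ 2 * volume (Metric.closedBall (0 : Plane) R) with hB
  have hBt : B ≠ ⊤ := ENNReal.mul_ne_top (by simp) measure_closedBall_lt_top.ne
  refine ⟨((B / volume D) ^ (1 / 2 : ℝ)).toReal, ENNReal.toReal_nonneg, fun v g hv hg hW => ?_⟩
  rw [ENNReal.ofReal_toReal (ENNReal.rpow_ne_top_of_nonneg (by norm_num)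
    (ENNReal.div_ne_top hBt hvol))]
  -- Representatives that are measurable and vanish outside `D`.
  set v' : Plane → ℝ := D.indicator (hv.1.mk v) with hv'
  set g' : Plane → Plane := D.indicator (hg.1.mk g) with hg'
  have hvm : StronglyMeasurable v' := hv.1.stronglyMeasurable_mk.indicator hD.measurableSet
  have hgm : StronglyMeasurable g' := hg.1.stronglyMeasurable_mk.indicator hD.measurableSet
  have hvv : v =ᵐ[volume.restrict D] v' :=
    hv.1.ae_eq_mk.trans (indicator_ae_eq_restrict hD.measurableSet).symm
  have hgg : g =ᵐ[volume.restrict D] g' :=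
    hg.1.ae_eq_mk.trans (indicator_ae_eq_restrict hD.measurableSet).symm
  have hv0 : ∀ x ∉ D, v' x = 0 := fun x hx => indicator_of_notMem hx _
  have hg0 : ∀ x ∉ D, g' x = 0 := fun x hx => indicator_of_notMem hx _
  have hvi : Integrable v' := by
    rw [hv', integrable_indicator_iff hD.measurableSet]
    exact MemLp_two_integrableOn hb.measure_lt_top (hv.ae_eq hv.1.ae_eq_mk)
  have hgi : Integrable g' := by
    rw [hg', integrable_indicator_iff hD.measurableSet]
    exact MemLp_two_integrableOn hb.measure_lt_top (hg.ae_eq hg.1.ae_eq_mk)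
  have hW' : WeakGrad D v' g' := by
    intro d φ hφ
    rw [← hW d φ hφ, pairing, pairing]
    refine integral_congr_ae ?_
    filter_upwards [hvv, hgg] with x h1 h2
    simp only [h1, h2]
  have hsub : ∀ c : ℝ, eLpNorm (fun x => v x - c) 2 (volume.restrict D) =
      eLpNorm (fun x => v' x - c) 2 (volume.restrict D) := fun c =>
    eLpNorm_congr_ae (by filter_upwards [hvv] with x h1; rw [h1])
  simp only [hsub]
  rw [eLpNorm_congr_ae hgg]
  set Q : ℝ≥0∞ := ∫⁻ x, ‖g' x‖ₑ ^ 2 with hQ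
  have hQ' : eLpNorm g' 2 (volume.restrict D) ^ 2 = Q := by
    rw [eLpNorm_two_sq, hQ, ← lintegral_indicator hD.measurableSet]
    congr 1; ext x
    by_cases hx : x ∈ D
    · rw [indicator_of_mem hx]
    · rw [indicator_of_notMem hx, hg0 x hx]; simp
  have hmeas : Measurable fun p : Plane × Plane => ‖v' p.2 - v' p.1‖ₑ ^ 2 :=
    ((hvm.measurable.comp measurable_snd).sub
      (hvm.measurable.comp measurable_fst)).enorm.pow_const 2
  -- The pairs of points of `D` are parametrised by one point and the translation `h`, which is at
  -- most the diameter.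
  have key : ∫⁻ x in D, ∫⁻ y in D, ‖v' y - v' x‖ₑ ^ 2 ≤ B * Q := by
    set S : Set (Plane × Plane) := {p | p.1 ∈ D ∧ p.1 + p.2 ∈ D} with hS
    have hSm : MeasurableSet S := (measurable_fst hD.measurableSet).inter
      ((measurable_fst.add measurable_snd) hD.measurableSet)
    have hmeas2 : Measurable fun p : Plane × Plane =>
        S.indicator (fun p => ‖v' (p.1 + p.2) - v' p.1‖ₑ ^ 2) p :=
      (hmeas.comp (measurable_fst.prodMk (measurable_fst.add measurable_snd))).indicator hSm
    calc ∫⁻ x in D, ∫⁻ y in D, ‖v' y - v' x‖ₑ ^ 2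
        = ∫⁻ x, ∫⁻ h, S.indicator (fun p => ‖v' (p.1 + p.2) - v' p.1‖ₑ ^ 2) (x, h) := by
          rw [← lintegral_indicator hD.measurableSet]
          refine lintegral_congr fun x => ?_
          by_cases hx : x ∈ D
          · rw [indicator_of_mem hx, ← lintegral_indicator hD.measurableSet,
              ← lintegral_add_left_eq_self _ x]
            refine lintegral_congr fun h => ?_
            by_cases hh : x + h ∈ D
            · rw [indicator_of_mem hh, indicator_of_mem (show (x, h) ∈ S from ⟨hx, hh⟩)]
            · rw [indicator_of_notMem hh, indicator_of_notMem (fun hp => hh hp.2)]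
          · rw [indicator_of_notMem hx]
            symm
            have : ∀ h, S.indicator (fun p => ‖v' (p.1 + p.2) - v' p.1‖ₑ ^ 2) (x, h) = 0 :=
              fun h => indicator_of_notMem (fun hp => hx hp.1) _
            simp [this]
      _ = ∫⁻ h, ∫⁻ x, S.indicator (fun p => ‖v' (p.1 + p.2) - v' p.1‖ₑ ^ 2) (x, h) :=
          lintegral_lintegral_swap hmeas2.aemeasurable
      _ ≤ ∫⁻ h, (Metric.closedBall (0 : Plane) R).indicator
            (fun _ => ENNReal.ofReal R ^ 2 * Q) h := by
          refine lintegral_mono fun h => ?_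
          have e : ∫⁻ x, S.indicator (fun p => ‖v' (p.1 + p.2) - v' p.1‖ₑ ^ 2) (x, h) =
              ∫⁻ x in D ∩ (fun x => x + h) ⁻¹' D, ‖v' (x + h) - v' x‖ₑ ^ 2 := by
            rw [← lintegral_indicator
              (hD.inter (hD.preimage (by fun_prop : Continuous fun x => x + h))).measurableSet]
            rfl
          beta_reduce
          rw [e]
          by_cases hh : h ∈ Metric.closedBall (0 : Plane) R
          · rw [indicator_of_mem hh]
            refine (lintegral_translate_le hc hD hvi hgi hgm hW' h hv0 hg0).trans ?_
            gcongr
            rw [← ofReal_norm]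
            exact ENNReal.ofReal_le_ofReal (by simpa using hh)
          · have : D ∩ (fun x => x + h) ⁻¹' D = ∅ := by
              by_contra hcon
              obtain ⟨x, hx, hx'⟩ := nonempty_iff_ne_empty.2 hcon
              apply hh
              have := hR hx' hx
              simpa [dist_eq_norm] using this
            rw [this, indicator_of_notMem hh]; simp
      _ = B * Q := by
          rw [lintegral_indicator Metric.isClosed_closedBall.measurableSet, setLIntegral_const, hB]
          ring
  -- For some `x`, the integral over `y` is at most its average over `x`; then `v' x` is the
  -- constant.
  obtain ⟨x, -, hx⟩ := exists_le_setLAverage (μ := volume) hvol hvol'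
    (f := fun x => ∫⁻ y in D, ‖v' y - v' x‖ₑ ^ 2) (hmeas.lintegral_prod_right').aemeasurable
  refine ⟨v' x, ?_⟩
  have h1 : eLpNorm (fun y => v' y - v' x) 2 (volume.restrict D) ^ 2 ≤ B / volume D * Q := by
    rw [eLpNorm_two_sq]
    refine hx.trans ?_
    rw [setLAverage_eq]
    calc _ ≤ B * Q / volume D := by gcongr
      _ = _ := by rw [div_eq_mul_inv, div_eq_mul_inv]; ring
  have h2 : (((B / volume D) ^ (1 / 2 : ℝ)) * eLpNorm g' 2 (volume.restrict D)) ^ 2 =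
      B / volume D * Q := by
    rw [mul_pow, hQ', ← ENNReal.rpow_two, ← ENNReal.rpow_mul]; norm_num
  rw [← h2] at h1
  exact (ENNReal.pow_le_pow_left_iff two_ne_zero).1 h1

/-! ### Functions with polynomial weak gradient -/

/-- On the monomials of degree `n`, integration along rays is division by `n + 1`. -/
lemma exists_peval_integral (P : MvP) : ∃ Q : MvP, Q.totalDegree ≤ P.totalDegree ∧
    ∀ z : Plane, peval Q z = ∫ t in Icc (0 : ℝ) 1, peval P (t • z) := by
  refine ⟨∑ s ∈ P.support, MvPolynomial.monomial s (P.coeff s * ((s 0 + s 1 : ℕ) + 1 : ℝ)⁻¹),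
    ?_, fun z => ?_⟩
  · refine MvPolynomial.totalDegree_finsetSum_le fun s hs => ?_
    exact (MvPolynomial.totalDegree_monomial_le _ _).trans (MvPolynomial.le_totalDegree hs)
  · have hm : ∀ (s : Fin 2 →₀ ℕ) (c : ℝ) (x : Plane),
        peval (MvPolynomial.monomial s c) x = c * (x 0 ^ s 0 * x 1 ^ s 1) := by
      intro s c x
      rw [peval, MvPolynomial.eval_monomial, Finsupp.prod_fintype _ _ (by simp)]
      simp [Fin.prod_univ_two]
    have hP : ∀ t : ℝ, peval P (t • z) =
        ∑ s ∈ P.support, t ^ (s 0 + s 1) * (P.coeff s * (z 0 ^ s 0 * z 1 ^ s 1)) := by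
      intro t
      conv_lhs => rw [P.as_sum]
      rw [peval_sum]
      refine Finset.sum_congr rfl fun s _ => ?_
      rw [hm]; simp only [PiLp.smul_apply, smul_eq_mul]; ring
    simp only [hP]
    rw [integral_finsetSum]
    · rw [peval_sum]
      refine Finset.sum_congr rfl fun s _ => ?_
      rw [hm, integral_mul_const, integral_Icc_eq_integral_Ioc,
        ← intervalIntegral.integral_of_le zero_le_one, integral_pow]
      simp; ring
    · intro s _
      exact (Continuous.integrableOn_Icc (by fun_prop))

/-- The integral of a polynomial field along the segments from a point is a polynomial of
the end point. -/
lemma exists_peval_line_integral (V : Fin 2 → MvP) {q : ℕ} (hV : ∀ i, (V i).totalDegree ≤ q)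
    (x : Plane) : ∃ Q : MvP, Q.totalDegree ≤ q + 1 ∧ ∀ y : Plane,
      peval Q y = ∫ t in Icc (0 : ℝ) 1, inner ℝ (vpeval V (x + t • (y - x))) (y - x) := by
  obtain ⟨Φ, hΦ, hΦ'⟩ := exists_peval_comp x (ContinuousLinearMap.id ℝ Plane)
  obtain ⟨Ψ, hΨ, hΨ'⟩ := exists_peval_comp (-x) (ContinuousLinearMap.id ℝ Plane)
  choose Q hQ hQ' using fun i => exists_peval_integral (Φ (V i))
  refine ⟨Ψ (Q 0 * MvPolynomial.X 0 + Q 1 * MvPolynomial.X 1), ?_, fun y => ?_⟩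
  · have h : ∀ i, (Q i * MvPolynomial.X i).totalDegree ≤ q + 1 := fun i =>
      (MvPolynomial.totalDegree_mul _ _).trans (add_le_add (((hQ i).trans (hΦ _)).trans (hV i))
        (by simp))
    exact (hΨ _).trans ((MvPolynomial.totalDegree_add _ _).trans (max_le (h 0) (h 1)))
  · have e : ∀ t : ℝ, inner ℝ (vpeval V (x + t • (y - x))) (y - x) =
        peval (Φ (V 0)) (t • (y - x)) * (y - x) 0 + peval (Φ (V 1)) (t • (y - x)) * (y - x) 1 := by
      intro t
      rw [hΦ', hΦ', PiLp.inner_apply, Fin.sum_univ_two]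
      simp; ring
    have hc : ∀ i, Continuous fun t : ℝ => peval (Φ (V i)) (t • (y - x)) * (y - x) i := fun i =>
      ((continuous_peval _).comp (by fun_prop)).mul continuous_const
    simp only [e]
    rw [integral_add (hc 0).integrableOn_Icc (hc 1).integrableOn_Icc, integral_mul_const,
      integral_mul_const, ← hQ', ← hQ', hΨ']
    simp only [ContinuousLinearMap.id_apply, peval_add, peval_mul, peval_X, neg_add_eq_sub]

/-- The weak gradient is unique. -/
lemma WeakGrad.ae_eq {D : Set Plane} (hD : IsOpen D) {v : Plane → ℝ} {g g' : Plane → Plane}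
    (hv : IntegrableOn v D) (hg : IntegrableOn g D) (hg' : IntegrableOn g' D)
    (h : WeakGrad D v g) (h' : WeakGrad D v g') : ∀ᵐ x, x ∈ D → g x = g' x := by
  have key : ∀ d : Plane, ∀ᵐ x, x ∈ D → inner ℝ (g x) d - inner ℝ (g' x) d = 0 := by
    intro d
    have hi : IntegrableOn (fun x => inner ℝ (g x) d) D := hg.inner_const d
    have hi' : IntegrableOn (fun x => inner ℝ (g' x) d) D := hg'.inner_const d
    refine hD.ae_eq_zero_of_integral_contDiff_smul_eq_zero (hi.sub hi').locallyIntegrableOn ?_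
    intro φ h1 h2 h3
    have hφ : IsTest D φ := ⟨h1, h2, h3⟩
    have a := h d φ hφ
    have b := h' d φ hφ
    obtain ⟨C, hC⟩ := h2.exists_bound_of_continuous h1.continuous
    rw [← setIntegral_eq_integral_of_forall_compl_eq_zero (s := D)]
    · have i1 := integrable_pairing (hv.smul_const d) hi (contDiff_one_of_infty h1) h2
      have i2 := integrable_pairing (hv.smul_const d) hi' (contDiff_one_of_infty h1) h2
      rw [← sub_self (0 : ℝ)]
      nth_rw 1 [← a]
      rw [← b, pairing, pairing, ← integral_sub i1 i2]
      refine integral_congr_ae (Eventually.of_forall fun x => ?_)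
      simp only [smul_eq_mul]; ring
    · intro x hx
      rw [image_eq_zero_of_notMem_tsupport (fun hh => hx (h3 hh)), zero_smul]
  filter_upwards [key (EuclideanSpace.single 0 1), key (EuclideanSpace.single 1 1)] with x h0 h1 hx
  ext i
  fin_cases i
  · simpa [sub_eq_zero, EuclideanSpace.inner_single_right] using h0 hx
  · simpa [sub_eq_zero, EuclideanSpace.inner_single_right] using h1 hx

/-- On a triangle, test functions vanish on the edges, so the divergence theorem shows that the
classical divergence is a weak one. -/
lemma weakDiv_of_contDiff {z : Fin 3 → Plane} (hz : area z ≠ 0) {F : Plane → Plane}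
    (hF : ContDiff ℝ 1 F) : WeakDiv (openTri z) F (dv F) := by
  intro φ hφ
  have h1 := contDiff_one_of_infty hφ.1
  rw [pairing_eq_integral_dv h1 hF,
    setIntegral_dv hz (show ContDiff ℝ 1 fun x => φ x • F x from h1.smul hF)]
  have : ∀ e, flux z (fun x => φ x • F x) e = 0 := by
    intro e
    have h0 : ∀ t : ℝ, φ (AffineMap.lineMap (z (va e)) (z (vb e)) t) = 0 := by
      intro t
      refine image_eq_zero_of_notMem_tsupport fun hh => ?_
      have := hφ.2.2 hh (vo e)
      rw [bary_line, bary_vertex hz, bary_vertex hz] at this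
      simp [(va_ne_vo e).symm, (vb_ne_vo e).symm] at this
    simp [flux, h0, cross]
  simp [this]

lemma weakGrad_of_contDiff {z : Fin 3 → Plane} (hz : area z ≠ 0) {v : Plane → ℝ}
    (hv : ContDiff ℝ 1 v) : WeakGrad (openTri z) v (gradient v) := by
  intro d
  have h := weakDiv_of_contDiff hz
    (show ContDiff ℝ 1 fun x => v x • d from hv.smul contDiff_const)
  have e : dv (fun x => v x • d) = fun x => inner ℝ (gradient v x) d := by
    ext x
    rw [dv_smul_const (hv.differentiable one_ne_zero _), inner_gradient_left]
  rwa [e] at h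

lemma measurableSet_translate {D : Set Plane} (hD : MeasurableSet D) {v : Plane → ℝ}
    (hv : Measurable v) {k : Plane → Plane → ℝ}
    (hk : Measurable fun p : Plane × Plane => k p.1 p.2) :
    MeasurableSet {p : Plane × Plane | p.2 ∈ D → p.2 + p.1 ∈ D →
      v (p.2 + p.1) - v p.2 = k p.2 (p.2 + p.1)} := by
  have h0 : Measurable fun p : Plane × Plane => p.2 + p.1 := measurable_snd.add measurable_fst
  have h3 : MeasurableSet {p : Plane × Plane | v (p.2 + p.1) - v p.2 = k p.2 (p.2 + p.1)} :=
    measurableSet_eq_fun ((hv.comp h0).sub (hv.comp measurable_snd))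
      (hk.comp (measurable_snd.prodMk h0))
  exact (measurable_snd hD).imp ((h0 hD).imp h3)

/-- A function whose weak gradient is a polynomial field is a polynomial. -/
lemma WeakGrad.exists_peval {D : Set Plane} (hc : Convex ℝ D) (hD : IsOpen D) (hne : D.Nonempty)
    (hb : Bornology.IsBounded D) {v : Plane → ℝ} {g : Plane → Plane}
    (hv : IntegrableOn v D) (hW : WeakGrad D v g) {V : Fin 2 → MvP} {q : ℕ}
    (hV : ∀ i, (V i).totalDegree ≤ q) (hg : g =ᵐ[volume.restrict D] vpeval V) :
    ∃ Q : MvP, Q.totalDegree ≤ q + 1 ∧ v =ᵐ[volume.restrict D] peval Q := by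
  have hvm := hv.aestronglyMeasurable
  set v' : Plane → ℝ := D.indicator (hvm.mk v) with hv'
  set g' : Plane → Plane := D.indicator (vpeval V) with hg'
  have hvsm : StronglyMeasurable v' := hvm.stronglyMeasurable_mk.indicator hD.measurableSet
  have hgm : StronglyMeasurable g' :=
    (continuous_vpeval V).stronglyMeasurable.indicator hD.measurableSet
  have hvv : v =ᵐ[volume.restrict D] v' :=
    hvm.ae_eq_mk.trans (indicator_ae_eq_restrict hD.measurableSet).symm
  have hgg : g =ᵐ[volume.restrict D] g' :=
    hg.trans (indicator_ae_eq_restrict hD.measurableSet).symm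
  have hv0 : ∀ x ∉ D, v' x = 0 := fun x hx => indicator_of_notMem hx _
  have hg0 : ∀ x ∉ D, g' x = 0 := fun x hx => indicator_of_notMem hx _
  have hvi : Integrable v' := by
    rw [hv', integrable_indicator_iff hD.measurableSet]
    exact hv.congr hvm.ae_eq_mk
  have hgi : Integrable g' := by
    rw [hg', integrable_indicator_iff hD.measurableSet]
    obtain ⟨R, hR⟩ := hb.subset_closedBall 0
    exact ((continuous_vpeval V).continuousOn.integrableOn_compact
      (isCompact_closedBall (0 : Plane) R)).mono_set hR
  have hW' : WeakGrad D v' g' := by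
    intro d φ hφ
    rw [← hW d φ hφ, pairing, pairing]
    refine integral_congr_ae ?_
    filter_upwards [hvv, hgg] with x h1 h2
    simp only [h1, h2]
  -- the increment of the function from `x` to `y`, predicted by its gradient
  set k : Plane → Plane → ℝ := fun x y =>
    ∫ t in Icc (0 : ℝ) 1, inner ℝ (vpeval V (x + t • (y - x))) (y - x) with hk
  have hkc : Continuous fun p : Plane × Plane => k p.1 p.2 := by
    refine continuous_parametric_integral_of_continuous ?_ isCompact_Icc
    exact ((continuous_vpeval V).comp (by fun_prop)).inner (by fun_prop)
  have hae : ∀ h : Plane, ∀ᵐ x, x ∈ D → x + h ∈ D → v' (x + h) - v' x = k x (x + h) := by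
    intro h
    filter_upwards [hW'.translate_ae_eq hc hD hvi hgi hgm h hv0 hg0] with x hx h1 h2
    rw [hx ⟨h1, h2⟩]
    simp only [hk, add_sub_cancel_left]
    refine setIntegral_congr_fun measurableSet_Icc fun t ht => ?_
    have : x + t • h ∈ D := by
      have := hc h1 h2 (sub_nonneg.2 ht.2) ht.1 (by ring)
      convert this using 1
      module
    simp only [hg', indicator_of_mem this]
  have hmeas := measurableSet_translate hD.measurableSet hvsm.measurable hkc.measurable
  have hae2 := (Measure.ae_ae_comm (μ := volume) (ν := volume) hmeas).1 (Eventually.of_forall hae)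
  -- Any point of `D` that is good for almost every translation will do.
  obtain ⟨x, hxD, hx⟩ : ∃ x ∈ D, ∀ᵐ h, x ∈ D → x + h ∈ D → v' (x + h) - v' x = k x (x + h) := by
    by_contra hcon
    have : ∀ᵐ x, x ∉ D := by
      filter_upwards [hae2] with x hx hxD using hcon ⟨x, hxD, hx⟩
    exact (hD.measure_pos volume hne).ne' (by simpa [ae_iff] using this)
  obtain ⟨Q, hQ, hQ'⟩ := exists_peval_line_integral V hV x
  refine ⟨Q + MvPolynomial.C (v' x), ?_, ?_⟩
  · exact (MvPolynomial.totalDegree_add _ _).trans (max_le hQ (by simp))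
  · refine hvv.trans ?_
    rw [EventuallyEq, ae_restrict_iff' hD.measurableSet]
    have h4 : ∀ᵐ y, x ∈ D → x + (y - x) ∈ D → v' (x + (y - x)) - v' x = k x (x + (y - x)) :=
      (measurePreserving_sub_right volume x).quasiMeasurePreserving.ae hx
    filter_upwards [h4] with y hy hyD
    have := hy hxD (by simpa using hyD)
    rw [add_sub_cancel] at this
    rw [peval_add, peval_C, hQ']; exact eq_add_of_sub_eq this

/-! ### Closed subspaces and finite-dimensional subspaces -/

/-- Approximation from a finite-dimensional subspace `X` under a closed constraint `W`: elements
of `X` are approximated by `X ∩ W` as well as by `W`, up to a constant. The quotient map by `W`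
restricted to `X` has closed range, so it is open onto its range. -/
lemma exists_approx_inf {H : Type*} [NormedAddCommGroup H] [NormedSpace ℝ H]
    (X W : Submodule ℝ H) [FiniteDimensional ℝ X] (hW : IsClosed (W : Set H)) :
    ∃ C : ℝ, 0 ≤ C ∧ ∀ x ∈ X, ∀ w ∈ W, ∃ y ∈ X ⊓ W, ‖x - y‖ ≤ C * ‖x - w‖ := by
  have : IsClosed (W : Set H) := hW
  let L : X →ₗ[ℝ] H ⧸ W := W.mkQ ∘ₗ X.subtype
  let L' : X →L[ℝ] LinearMap.range L := LinearMap.toContinuousLinearMap L.rangeRestrict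
  have : CompleteSpace X := FiniteDimensional.complete ℝ X
  have : CompleteSpace (LinearMap.range L) := FiniteDimensional.complete ℝ _
  obtain ⟨C, hC, h⟩ := L'.exists_preimage_norm_le L.surjective_rangeRestrict
  refine ⟨C, hC.le, fun x hx w hw => ?_⟩
  obtain ⟨x', hx', hn⟩ := h (L' ⟨x, hx⟩)
  have e : W.mkQ (x' : H) = W.mkQ x := congrArg Subtype.val hx'
  refine ⟨x - x', ⟨X.sub_mem hx x'.2, ?_⟩, ?_⟩
  · exact (Submodule.Quotient.eq W).1 e.symm
  · rw [sub_sub_cancel]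
    refine hn.trans ?_
    gcongr
    have h1 : W.mkQ x = W.mkQ (x - w) := by
      symm
      refine (Submodule.Quotient.eq W).2 ?_
      simpa using W.neg_mem hw
    calc ‖L' ⟨x, hx⟩‖ = ‖W.mkQ x‖ := rfl
      _ = ‖W.mkQ (x - w)‖ := by rw [h1]
      _ ≤ ‖x - w‖ := Submodule.Quotient.norm_mk_le W _

/-- A bounded operator that is bounded below modulo its kernel has closed range. -/
lemma isClosed_range_of_bound {A B : Type*} [NormedAddCommGroup A] [NormedSpace ℝ A]
    [CompleteSpace A] [NormedAddCommGroup B] [NormedSpace ℝ B] (f : A →L[ℝ] B) {C : ℝ}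
    (h : ∀ a, ∃ k, f k = 0 ∧ ‖a - k‖ ≤ C * ‖f a‖) : IsClosed (range f) := by
  set K : Submodule ℝ A := LinearMap.ker (f : A →ₗ[ℝ] B) with hK
  have hKc : IsClosed (K : Set A) := f.isClosed_ker
  have : IsClosed (K : Set A) := hKc
  let F : A ⧸ K →ₗ[ℝ] B := K.liftQ (f : A →ₗ[ℝ] B) le_rfl
  have hF : ∀ a, F (K.mkQ a) = f a := fun a => rfl
  have hcont : Continuous F := by
    have : Continuous fun a => F (K.mkQ a) := f.continuous
    exact continuous_quot_lift _ f.continuous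
  let F' : A ⧸ K →L[ℝ] B := ⟨F, hcont⟩
  have hb : ∀ q, ‖q‖ ≤ (max C 0).toNNReal * ‖F' q‖ := by
    intro q
    obtain ⟨a, rfl⟩ := K.mkQ_surjective q
    obtain ⟨k, hk, hle⟩ := h a
    have e : K.mkQ a = K.mkQ (a - k) :=
      ((Submodule.Quotient.eq K).2 (by simpa [hK] using hk)).symm
    rw [e]
    refine (Submodule.Quotient.norm_mk_le K _).trans (hle.trans ?_)
    rw [← e, Real.coe_toNNReal _ (le_max_right _ _)]
    exact mul_le_mul_of_nonneg_right (le_max_left _ _) (norm_nonneg _)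
  have hcl := (F'.antilipschitz_of_bound hb).isClosed_range F'.uniformContinuous
  have hr : range F' = range f := by
    ext b; constructor
    · rintro ⟨q, rfl⟩
      obtain ⟨a, rfl⟩ := K.mkQ_surjective q
      exact ⟨a, rfl⟩
    · rintro ⟨a, rfl⟩
      exact ⟨K.mkQ a, rfl⟩
  rwa [hr] at hcl

/-- An abstract form of the closed range property of the gradient: if the first component of the
elements of a closed subspace `V` is controlled by the second one up to a finite-dimensional
space, then the projection of `V` to the second component is closed. -/
lemma isClosed_map_snd {E F : Type*} [NormedAddCommGroup E] [NormedSpace ℝ E] [CompleteSpace E]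
    [NormedAddCommGroup F] [NormedSpace ℝ F] [CompleteSpace F] (V : Submodule ℝ (E × F))
    (hV : IsClosed (V : Set (E × F))) (Z : Submodule ℝ E) [FiniteDimensional ℝ Z] {C : ℝ}
    (h : ∀ p ∈ V, ∃ z ∈ Z, ‖p.1 - z‖ ≤ C * ‖p.2‖) :
    IsClosed ((V.map (LinearMap.snd ℝ E F) : Submodule ℝ F) : Set F) := by
  -- Adding the finite-dimensional space to the first component changes neither the projection nor
  -- the closedness; afterwards the bound holds modulo the kernel of the projection.
  set Z' : Submodule ℝ (E × F) := Z.map (LinearMap.inl ℝ E F) with hZ'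
  set V' : Submodule ℝ (E × F) := V ⊔ Z' with hV'
  have hVc : IsClosed (V' : Set (E × F)) := Submodule.isClosed_sup_finiteDimensional _ _ hV
  have hmap : V.map (LinearMap.snd ℝ E F) = V'.map (LinearMap.snd ℝ E F) := by
    rw [hV', Submodule.map_sup, hZ', ← Submodule.map_comp, LinearMap.snd_comp_inl,
      Submodule.map_zero, sup_bot_eq]
  have : CompleteSpace V' := hVc.completeSpace_coe
  let f : V' →L[ℝ] F := (ContinuousLinearMap.snd ℝ E F).comp V'.subtypeL
  have hr : range f = ((V.map (LinearMap.snd ℝ E F) : Submodule ℝ F) : Set F) := by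
    rw [hmap]
    ext b; constructor
    · rintro ⟨a, rfl⟩; exact ⟨a, a.2, rfl⟩
    · rintro ⟨a, ha, rfl⟩; exact ⟨⟨a, ha⟩, rfl⟩
  rw [← hr]
  refine isClosed_range_of_bound f (C := max C 1) ?_
  rintro ⟨p, hp⟩
  obtain ⟨q, hq, z', hz', rfl⟩ := Submodule.mem_sup.1 hp
  obtain ⟨z₁, hz₁, rfl⟩ := hz'
  obtain ⟨z₂, hz₂, hle⟩ := h q hq
  refine ⟨⟨LinearMap.inl ℝ E F (z₁ + z₂), Submodule.mem_sup_right
    ⟨_, Z.add_mem hz₁ hz₂, rfl⟩⟩, rfl, ?_⟩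
  have e1 : q + LinearMap.inl ℝ E F z₁ - LinearMap.inl ℝ E F (z₁ + z₂) = (q.1 - z₂, q.2) :=
    Prod.ext (by simp; abel) (by simp)
  have e2 : f ⟨q + LinearMap.inl ℝ E F z₁, hp⟩ = q.2 := by simp [f]
  rw [e2]
  change ‖q + LinearMap.inl ℝ E F z₁ - LinearMap.inl ℝ E F (z₁ + z₂)‖ ≤ _
  rw [e1, Prod.norm_mk]
  refine max_le (hle.trans ?_) ?_
  · exact mul_le_mul_of_nonneg_right (le_max_left _ _) (norm_nonneg _)
  · simpa using mul_le_mul_of_nonneg_right (le_max_right C 1) (norm_nonneg q.2)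

/-- The distance to a closed convex set of a Hilbert space is attained. -/
lemma exists_isLeast_norm_add {H : Type*} [NormedAddCommGroup H] [InnerProductSpace ℝ H]
    [CompleteSpace H] {S : Set H} (hne : S.Nonempty) (hc : Convex ℝ S) (hS : IsClosed S) (G : H) :
    ∃ s ∈ S, ∀ s' ∈ S, ‖s + G‖ ≤ ‖s' + G‖ := by
  obtain ⟨s, hs, h⟩ := exists_norm_eq_iInf_of_complete_convex hne hS.isComplete hc (-G)
  refine ⟨s, hs, fun s' hs' => ?_⟩
  have h1 : ‖-G - s‖ ≤ ‖-G - s'‖ := by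
    rw [h]
    exact ciInf_le ⟨0, by rintro _ ⟨i, rfl⟩; exact norm_nonneg _⟩ (⟨s', hs'⟩ : S)
  rw [← norm_neg (s + G), ← norm_neg (s' + G)]
  rwa [neg_add_rev, neg_add_rev, ← sub_eq_add_neg, ← sub_eq_add_neg]

/-! ### Stable approximation for a fixed way of gluing reference triangles -/

lemma pairing_congr {D : Set Plane} {σ σ' : Plane → Plane} {ρ ρ' : Plane → ℝ}
    (hσ : σ =ᵐ[volume.restrict D] σ') (hρ : ρ =ᵐ[volume.restrict D] ρ') (φ : Plane → ℝ) :
    pairing D σ ρ φ = pairing D σ' ρ' φ := by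
  refine integral_congr_ae ?_
  filter_upwards [hσ, hρ] with x h1 h2
  simp only [h1, h2]

lemma WeakDiv.congr {D : Set Plane} {σ σ' : Plane → Plane} {ρ ρ' : Plane → ℝ}
    (h : WeakDiv D σ ρ) (hσ : σ =ᵐ[volume.restrict D] σ') (hρ : ρ =ᵐ[volume.restrict D] ρ') :
    WeakDiv D σ' ρ' := fun φ hφ => by rw [← pairing_congr hσ hρ, h φ hφ]

lemma pairing_grad_congr {D : Set Plane} {v v' : Plane → ℝ} {g g' : Plane → Plane}
    (hv : v =ᵐ[volume.restrict D] v') (hg : g =ᵐ[volume.restrict D] g') (d : Plane)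
    (φ : Plane → ℝ) : pairing D (fun x => v x • d) (fun x => inner ℝ (g x) d) φ =
      pairing D (fun x => v' x • d) (fun x => inner ℝ (g' x) d) φ :=
  pairing_congr (by filter_upwards [hv] with x hx; rw [hx])
    (by filter_upwards [hg] with x hx; rw [hx]) φ

lemma WeakGrad.congr {D : Set Plane} {v v' : Plane → ℝ} {g g' : Plane → Plane}
    (h : WeakGrad D v g) (hv : v =ᵐ[volume.restrict D] v') (hg : g =ᵐ[volume.restrict D] g') :
    WeakGrad D v' g' := fun d φ hφ => by rw [← pairing_grad_congr hv hg, h d φ hφ]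

lemma traceForm_congr {z : Fin 3 → Plane} {v v' : Plane → ℝ} {g g' : Plane → Plane}
    (hv : v =ᵐ[volume.restrict (openTri z)] v') (hg : g =ᵐ[volume.restrict (openTri z)] g')
    (e : OEdge) (a : ℝ → ℝ) : traceForm z e a v g = traceForm z e a v' g' := by
  rw [traceForm, traceForm, pairing_grad_congr hv hg]

lemma norm_gradient (φ : Plane → ℝ) (x : Plane) : ‖gradient φ x‖ = ‖fderiv ℝ φ x‖ :=
  LinearIsometryEquiv.norm_map _ _

lemma memLp_gradient {D : Set Plane} (hD : volume D < ⊤) {φ : Plane → ℝ} (hφ : ContDiff ℝ 1 φ)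
    (hc : HasCompactSupport φ) : MemLp (gradient φ) 2 (volume.restrict D) := by
  have : IsFiniteMeasure (volume.restrict D) := ⟨by simpa using hD⟩
  obtain ⟨C, hC⟩ := exists_bound_fderiv hφ hc
  exact MemLp.of_bound (continuous_gradient hφ).aestronglyMeasurable C
    (Eventually.of_forall fun x => by rw [norm_gradient]; exact hC x)

lemma memLp_test {D : Set Plane} (hD : volume D < ⊤) {φ : Plane → ℝ} (hφ : Continuous φ)
    (hc : HasCompactSupport φ) : MemLp φ 2 (volume.restrict D) := by
  have : IsFiniteMeasure (volume.restrict D) := ⟨by simpa using hD⟩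
  obtain ⟨C, hC⟩ := hc.exists_bound_of_continuous hφ
  exact MemLp.of_bound hφ.aestronglyMeasurable C (Eventually.of_forall hC)

/-- The pairing of a field with a fixed function, as a continuous functional on `L²`. -/
lemma exists_clm_pairing_div {D : Set Plane} (hD : volume D < ⊤) {φ : Plane → ℝ}
    (hφ : ContDiff ℝ 1 φ) (hc : HasCompactSupport φ) :
    ∃ L : Lp Plane 2 (volume.restrict D) →L[ℝ] ℝ, ∀ τ, L τ = pairing D τ 0 φ := by
  have hm := memLp_gradient hD hφ hc
  refine ⟨innerSL ℝ (hm.toLp _), fun τ => ?_⟩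
  rw [innerSL_apply_apply, L2.inner_def]
  refine integral_congr_ae ?_
  filter_upwards [hm.coeFn_toLp] with x hx
  rw [hx, inner_gradient_left]; simp

/-- The pairing of a function and its gradient with a fixed function, as a continuous functional
on `L² × L²`. -/
lemma exists_clm_pairing_grad {D : Set Plane} (hD : volume D < ⊤) {φ : Plane → ℝ}
    (hφ : ContDiff ℝ 1 φ) (hc : HasCompactSupport φ) (d : Plane) :
    ∃ L : Lp ℝ 2 (volume.restrict D) × Lp Plane 2 (volume.restrict D) →L[ℝ] ℝ, ∀ p, L p =
      pairing D (fun x => p.1 x • d) (fun x => inner ℝ (p.2 x) d) φ := by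
  have hm : MemLp (fun x => inner ℝ (gradient φ x) d) 2 (volume.restrict D) :=
    (memLp_gradient hD hφ hc).inner_const d
  have hm' : MemLp (fun x => φ x • d) 2 (volume.restrict D) := by
    have := (ContinuousLinearMap.toSpanSingleton ℝ d).comp_memLp' (memLp_test hD hφ.continuous hc)
    simpa [Function.comp_def] using this
  refine ⟨(innerSL ℝ (hm.toLp _)).comp (ContinuousLinearMap.fst ℝ _ _) +
    (innerSL ℝ (hm'.toLp _)).comp (ContinuousLinearMap.snd ℝ _ _), fun p => ?_⟩
  simp only [add_apply, ContinuousLinearMap.comp_apply,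
    ContinuousLinearMap.coe_fst', ContinuousLinearMap.coe_snd', innerSL_apply_apply]
  rw [L2.inner_def, L2.inner_def, pairing, ← integral_add (L2.integrable_inner _ _)
    (L2.integrable_inner _ _)]
  refine integral_congr_ae ?_
  filter_upwards [hm.coeFn_toLp, hm'.coeFn_toLp] with x h1 h2
  rw [h1, h2, inner_gradient_left, inner_smul_left, real_inner_comm d]
  simp [mul_comm]

/-- Lebesgue measure on the reference triangle. -/
abbrev μref : Measure Plane := volume.restrict refTri

lemma volume_refTri_lt_top : volume refTri < ⊤ := volume_openTri_lt_top area_zref_ne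

instance : IsFiniteMeasure μref := ⟨by simpa using volume_refTri_lt_top⟩

lemma memLp_vpeval (V : Fin 2 → MvP) : MemLp (vpeval V) 2 μref :=
  memLp_openTri_of_continuous area_zref_ne (continuous_vpeval V) 2

lemma memLp_peval (P : MvP) : MemLp (peval P) 2 μref :=
  memLp_openTri_of_continuous area_zref_ne (continuous_peval P) 2

/-- Polynomial fields as elements of `L²` of the reference triangle. -/
def toL2 : (Fin 2 → MvP) →ₗ[ℝ] Lp Plane 2 μref where
  toFun V := (memLp_vpeval V).toLp _
  map_add' V W := by
    rw [← MemLp.toLp_add]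
    congr 1; ext x i; simp [peval_add]
  map_smul' c V := by
    rw [RingHom.id_apply, ← MemLp.toLp_const_smul]
    congr 1; ext x i; simp [peval_smul]

lemma coeFn_toL2 (V : Fin 2 → MvP) : toL2 V =ᵐ[μref] vpeval V := (memLp_vpeval V).coeFn_toLp

/-- `exists_approx_inf` for families of polynomial fields on the reference triangle. -/
lemma exists_const_of_isClosed (m : ℕ) (S : Submodule ℝ (Fin 2 → MvP)) [FiniteDimensional ℝ S]
    (W : Submodule ℝ (Fin m → Lp Plane 2 μref))
    (hW : IsClosed (W : Set (Fin m → Lp Plane 2 μref))) :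
    ∃ C : ℝ, 0 ≤ C ∧ ∀ x : Fin m → Fin 2 → MvP, (∀ j, x j ∈ S) → ∀ w ∈ W,
      ∃ y : Fin m → Fin 2 → MvP, (∀ j, y j ∈ S) ∧ (fun j => toL2 (y j)) ∈ W ∧
        ∀ j, ‖toL2 (x j) - toL2 (y j)‖ ≤ C * ∑ i, ‖toL2 (x i) - w i‖ := by
  let L : (Fin m → S) →ₗ[ℝ] (Fin m → Lp Plane 2 μref) :=
    LinearMap.pi fun j => (toL2 ∘ₗ S.subtype) ∘ₗ LinearMap.proj j
  obtain ⟨C, hC, h⟩ := exists_approx_inf (LinearMap.range L) W hW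
  refine ⟨C, hC, fun x hx w hw => ?_⟩
  obtain ⟨_, ⟨⟨y, rfl⟩, hyW⟩, hle⟩ := h (L fun j => ⟨x j, hx j⟩) ⟨_, rfl⟩ w hw
  refine ⟨fun j => y j, fun j => (y j).2, hyW, fun j => ?_⟩
  refine (norm_le_pi_norm (L (fun j => ⟨x j, hx j⟩) - L y) j).trans (hle.trans ?_)
  gcongr
  refine (pi_norm_le_iff_of_nonneg (Finset.sum_nonneg fun _ _ => norm_nonneg _)).2 fun j => ?_
  exact Finset.single_le_sum (f := fun i => ‖toL2 (x i) - w i‖) (fun _ _ => norm_nonneg _)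
    (Finset.mem_univ j)

lemma ofReal_norm_toL2_sub (V : Fin 2 → MvP) (w : Lp Plane 2 μref) {w' : Plane → Plane}
    (h : w =ᵐ[μref] w') : ENNReal.ofReal ‖toL2 V - w‖ =
      eLpNorm (fun x => vpeval V x - w' x) 2 μref := by
  rw [Lp.norm_def, ENNReal.ofReal_toReal (Lp.eLpNorm_ne_top _)]
  refine eLpNorm_congr_ae ?_
  filter_upwards [Lp.coeFn_sub (toL2 V) w, coeFn_toL2 V, h] with x h1 h2 h3
  rw [h1, Pi.sub_apply, h2, h3]

lemma eLpNorm_le_of_norm_le {m : ℕ} {x y : Fin m → Fin 2 → MvP} {w : Fin m → Lp Plane 2 μref}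
    {y' w' : Fin m → Plane → Plane} (hy : ∀ j, toL2 (y j) =ᵐ[μref] y' j)
    (hw : ∀ j, w j =ᵐ[μref] w' j) {C : ℝ} (hC : 0 ≤ C) {j : Fin m}
    (h : ‖toL2 (x j) - toL2 (y j)‖ ≤ C * ∑ i, ‖toL2 (x i) - w i‖) :
    eLpNorm (fun t => vpeval (x j) t - y' j t) 2 μref ≤
      ENNReal.ofReal C * ∑ i, eLpNorm (fun t => vpeval (x i) t - w' i t) 2 μref := by
  have := ENNReal.ofReal_le_ofReal h
  rw [ENNReal.ofReal_mul hC, ENNReal.ofReal_sum_of_nonneg fun _ _ => norm_nonneg _,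
    ofReal_norm_toL2_sub _ _ (hy j)] at this
  simpa only [fun i => ofReal_norm_toL2_sub (x i) _ (hw i)] using this

/-- Pairs of oriented edges of `m` reference triangles; a set of such pairs prescribes a way of
gluing the triangles. -/
abbrev Gluing (m : ℕ) : Type := Set ((Fin m × OEdge) × (Fin m × OEdge))

/-- Divergence-free fields on `m` reference triangles whose normal fluxes cancel, in the weak
sense, across the edges that are glued. -/
def DivCond {m : ℕ} (glue : Gluing m) (τ : Fin m → Plane → Plane) : Prop :=
  (∀ j, WeakDiv refTri (τ j) 0) ∧ ∀ f f', (f, f') ∈ glue → ∀ a, EdgeTest a →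
    pairing refTri (τ f.1) 0 (etest zref f.2 a 1) +
      pairing refTri (τ f'.1) 0 (etest zref f'.2 a 1) = 0

/-- Functions with a weak gradient on `m` reference triangles whose weak traces agree on the edges
that are glued and vanish on the edges of `dir`. -/
def GradCond {m : ℕ} (glue : Gluing m) (dir : Set (Fin m × OEdge)) (v : Fin m → Plane → ℝ)
    (g : Fin m → Plane → Plane) : Prop :=
  (∀ j, WeakGrad refTri (v j) (g j)) ∧
  (∀ f f', (f, f') ∈ glue → ∀ a, EdgeTest a →
    traceForm zref f.2 a (v f.1) (g f.1) = traceForm zref f'.2 a (v f'.1) (g f'.1)) ∧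
  ∀ f ∈ dir, ∀ a, EdgeTest a → traceForm zref f.2 a (v f.1) (g f.1) = 0

lemma DivCond.congr {m : ℕ} {glue : Gluing m} {τ τ' : Fin m → Plane → Plane}
    (h : DivCond glue τ) (hτ : ∀ j, τ j =ᵐ[μref] τ' j) : DivCond glue τ' := by
  refine ⟨fun j => (h.1 j).congr (hτ j) (EventuallyEq.refl _ _), fun f f' hf a ha => ?_⟩
  rw [← pairing_congr (hτ f.1) (EventuallyEq.refl _ _),
    ← pairing_congr (hτ f'.1) (EventuallyEq.refl _ _), h.2 f f' hf a ha]

lemma GradCond.congr {m : ℕ} {glue : Gluing m} {dir : Set (Fin m × OEdge)}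
    {v v' : Fin m → Plane → ℝ} {g g' : Fin m → Plane → Plane}
    (h : GradCond glue dir v g) (hv : ∀ j, v j =ᵐ[μref] v' j) (hg : ∀ j, g j =ᵐ[μref] g' j) :
    GradCond glue dir v' g' := by
  refine ⟨fun j => (h.1 j).congr (hv j) (hg j), fun f f' hf a ha => ?_, fun f hf a ha => ?_⟩
  · rw [← traceForm_congr (hv f.1) (hg f.1), ← traceForm_congr (hv f'.1) (hg f'.1),
      h.2.1 f f' hf a ha]
  · rw [← traceForm_congr (hv f.1) (hg f.1), h.2.2 f hf a ha]

/-- The conditions are the vanishing of continuous functionals on `L²`. -/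
lemma exists_closed_divCond {m : ℕ} (glue : Gluing m) :
    ∃ W : Submodule ℝ (Fin m → Lp Plane 2 μref), IsClosed (W : Set (Fin m → Lp Plane 2 μref)) ∧
      ∀ w, w ∈ W ↔ DivCond glue fun j => w j := by
  have hE : ∀ (e : OEdge) {a : ℝ → ℝ}, EdgeTest a → ContDiff ℝ 1 (etest zref e a 1) ∧
      HasCompactSupport (etest zref e a 1) := fun e a ha =>
    ⟨contDiff_one_of_infty (contDiff_etest zref e ha 1),
      hasCompactSupport_etest area_zref_ne e ha one_pos le_rfl⟩
  choose L hL using fun φ : {φ : Plane → ℝ // ContDiff ℝ 1 φ ∧ HasCompactSupport φ} =>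
    exists_clm_pairing_div volume_refTri_lt_top φ.2.1 φ.2.2
  let pr : ∀ j, (Fin m → Lp Plane 2 μref) →L[ℝ] Lp Plane 2 μref := fun j =>
    ContinuousLinearMap.proj j
  let W₁ : Submodule ℝ (Fin m → Lp Plane 2 μref) := ⨅ (j : Fin m) (φ : {φ // IsTest refTri φ}),
    LinearMap.ker ((L ⟨φ, contDiff_one_of_infty φ.2.1, φ.2.2.1⟩).comp (pr j)).toLinearMap
  let W₂ : Submodule ℝ (Fin m → Lp Plane 2 μref) := ⨅ (k : glue) (a : {a // EdgeTest a}),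
    LinearMap.ker ((L ⟨_, hE k.1.1.2 a.2⟩).comp (pr k.1.1.1) +
      (L ⟨_, hE k.1.2.2 a.2⟩).comp (pr k.1.2.1)).toLinearMap
  refine ⟨W₁ ⊓ W₂, ?_, fun w => ?_⟩
  · rw [Submodule.coe_inf]
    refine IsClosed.inter ?_ ?_
    · simp only [W₁, Submodule.coe_iInf]
      exact isClosed_iInter fun j => isClosed_iInter fun φ => ContinuousLinearMap.isClosed_ker _
    · simp only [W₂, Submodule.coe_iInf]
      exact isClosed_iInter fun j => isClosed_iInter fun φ => ContinuousLinearMap.isClosed_ker _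
  · simp only [Submodule.mem_inf, W₁, W₂, Submodule.mem_iInf, LinearMap.mem_ker,
      ContinuousLinearMap.coe_coe, add_apply, ContinuousLinearMap.comp_apply,
      hL, DivCond, WeakDiv, Subtype.forall, Prod.forall]
    rfl

/-- The conditions are the vanishing of continuous functionals on `L² × L²`; on `L²` alone, the
traces would not be continuous. -/
lemma exists_closed_gradCond {m : ℕ} (glue : Gluing m) (dir : Set (Fin m × OEdge)) :
    ∃ V : Submodule ℝ ((Fin m → Lp ℝ 2 μref) × (Fin m → Lp Plane 2 μref)),
      IsClosed (V : Set ((Fin m → Lp ℝ 2 μref) × (Fin m → Lp Plane 2 μref))) ∧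
      ∀ p, p ∈ V ↔ GradCond glue dir (fun j => p.1 j) (fun j => p.2 j) := by
  have hE : ∀ (e : OEdge) {a : ℝ → ℝ}, EdgeTest a → ContDiff ℝ 1 (etest zref e a 1) ∧
      HasCompactSupport (etest zref e a 1) := fun e a ha =>
    ⟨contDiff_one_of_infty (contDiff_etest zref e ha 1),
      hasCompactSupport_etest area_zref_ne e ha one_pos le_rfl⟩
  choose L hL using fun (φ : {φ : Plane → ℝ // ContDiff ℝ 1 φ ∧ HasCompactSupport φ})
    (d : Plane) => exists_clm_pairing_grad volume_refTri_lt_top φ.2.1 φ.2.2 d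
  let pr : ∀ j, (Fin m → Lp ℝ 2 μref) × (Fin m → Lp Plane 2 μref) →L[ℝ]
      Lp ℝ 2 μref × Lp Plane 2 μref := fun j =>
    ((ContinuousLinearMap.proj j).comp (ContinuousLinearMap.fst ℝ _ _)).prod
      ((ContinuousLinearMap.proj j).comp (ContinuousLinearMap.snd ℝ _ _))
  let tr : ∀ (f : Fin m × OEdge) (a : {a // EdgeTest a}),
      (Fin m → Lp ℝ 2 μref) × (Fin m → Lp Plane 2 μref) →L[ℝ] ℝ := fun f a =>
    |area zref|⁻¹ • (L ⟨_, hE f.2 a.2⟩ (zref (vo f.2) - zref (va f.2))).comp (pr f.1)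
  have htr : ∀ f a p, tr f a p = traceForm zref f.2 a (p.1 f.1) (p.2 f.1) := by
    intro f a p
    simp only [tr, smul_apply, ContinuousLinearMap.comp_apply, hL, traceForm,
      smul_eq_mul]
    rfl
  let V₁ : Submodule ℝ ((Fin m → Lp ℝ 2 μref) × (Fin m → Lp Plane 2 μref)) :=
    ⨅ (j : Fin m) (d : Plane) (φ : {φ // IsTest refTri φ}),
    LinearMap.ker ((L ⟨φ, contDiff_one_of_infty φ.2.1, φ.2.2.1⟩ d).comp (pr j)).toLinearMap
  let V₂ : Submodule ℝ ((Fin m → Lp ℝ 2 μref) × (Fin m → Lp Plane 2 μref)) :=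
    ⨅ (k : glue) (a : {a // EdgeTest a}), LinearMap.ker (tr k.1.1 a - tr k.1.2 a).toLinearMap
  let V₃ : Submodule ℝ ((Fin m → Lp ℝ 2 μref) × (Fin m → Lp Plane 2 μref)) :=
    ⨅ (k : dir) (a : {a // EdgeTest a}), LinearMap.ker (tr k.1 a).toLinearMap
  refine ⟨V₁ ⊓ (V₂ ⊓ V₃), ?_, fun p => ?_⟩
  · rw [Submodule.coe_inf, Submodule.coe_inf]
    refine IsClosed.inter ?_ (IsClosed.inter ?_ ?_)
    · simp only [V₁, Submodule.coe_iInf]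
      exact isClosed_iInter fun j => isClosed_iInter fun d => isClosed_iInter fun φ =>
        ContinuousLinearMap.isClosed_ker _
    · simp only [V₂, Submodule.coe_iInf]
      exact isClosed_iInter fun j => isClosed_iInter fun φ => ContinuousLinearMap.isClosed_ker _
    · simp only [V₃, Submodule.coe_iInf]
      exact isClosed_iInter fun j => isClosed_iInter fun φ => ContinuousLinearMap.isClosed_ker _
  · simp only [Submodule.mem_inf, V₁, V₂, V₃, Submodule.mem_iInf, LinearMap.mem_ker,
      ContinuousLinearMap.coe_coe, sub_apply, ContinuousLinearMap.comp_apply,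
      hL, htr, GradCond, WeakGrad, WeakDiv, Subtype.forall, Prod.forall, sub_eq_zero]
    rfl

/-- For a fixed gluing: polynomial fields that are divergence-free and match across the glued edges
approximate a given polynomial field as well as general fields with these properties do. -/
theorem exists_div_const (m : ℕ) (S : Submodule ℝ (Fin 2 → MvP)) [FiniteDimensional ℝ S]
    (glue : Gluing m) :
    ∃ C : ℝ, 0 ≤ C ∧ ∀ (x : Fin m → Fin 2 → MvP), (∀ j, x j ∈ S) →
      ∀ w : Fin m → Plane → Plane, (∀ j, MemLp (w j) 2 μref) → DivCond glue w →
      ∃ y : Fin m → Fin 2 → MvP, (∀ j, y j ∈ S) ∧ DivCond glue (fun j => vpeval (y j)) ∧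
        ∀ j, eLpNorm (fun t => vpeval (x j) t - vpeval (y j) t) 2 μref ≤
          ENNReal.ofReal C * ∑ i, eLpNorm (fun t => vpeval (x i) t - w i t) 2 μref := by
  obtain ⟨W, hW, hmem⟩ := exists_closed_divCond glue
  obtain ⟨C, hC, h⟩ := exists_const_of_isClosed m S W hW
  refine ⟨C, hC, fun x hx w hw hcond => ?_⟩
  obtain ⟨y, hy, hyW, hle⟩ := h x hx (fun j => (hw j).toLp _)
    ((hmem _).2 (hcond.congr fun j => (hw j).coeFn_toLp.symm))
  refine ⟨y, hy, ((hmem _).1 hyW).congr fun j => coeFn_toL2 _, fun j => ?_⟩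
  exact eLpNorm_le_of_norm_le (fun j => coeFn_toL2 _) (fun j => (hw j).coeFn_toLp) hC (hle j)

/-- For a fixed gluing: gradients of polynomials that match across the glued edges and vanish on
`dir` approximate a given polynomial field as well as general gradients of this kind do. -/
theorem exists_grad_const (m q : ℕ) (S : Submodule ℝ (Fin 2 → MvP)) [FiniteDimensional ℝ S]
    (hS : ∀ V ∈ S, ∀ i, (V i).totalDegree ≤ q) (glue : Gluing m) (dir : Set (Fin m × OEdge)) :
    ∃ C : ℝ, 0 ≤ C ∧ ∀ (x : Fin m → Fin 2 → MvP), (∀ j, x j ∈ S) →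
      ∀ (v : Fin m → Plane → ℝ) (g : Fin m → Plane → Plane), (∀ j, MemLp (v j) 2 μref) →
      (∀ j, MemLp (g j) 2 μref) → GradCond glue dir v g →
      ∃ Y : Fin m → MvP, (∀ j, (Y j).totalDegree ≤ q + 1) ∧
        GradCond glue dir (fun j => peval (Y j)) (fun j => vpeval (pgrad (Y j))) ∧
        ∀ j, eLpNorm (fun t => vpeval (x j) t - vpeval (pgrad (Y j)) t) 2 μref ≤
          ENNReal.ofReal C * ∑ i, eLpNorm (fun t => vpeval (x i) t - g i t) 2 μref := by
  obtain ⟨V, hV, hmem⟩ := exists_closed_gradCond glue dir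
  have hne : refTri.Nonempty :=
    ⟨!₂[1 / 4, 1 / 4], (mem_refTri _).2 (by norm_num)⟩
  have hop : IsOpen refTri := isOpen_openTri _
  have hcv : Convex ℝ refTri := convex_openTri _
  have hbd : Bornology.IsBounded refTri :=
    (isCompact_closedTri area_zref_ne).isBounded.subset (openTri_subset_closedTri _)
  -- The range of the gradient is closed because of Poincaré's inequality on each triangle.
  obtain ⟨K, hK, hP⟩ := exists_poincare hcv hop hne hbd
  let one : Lp ℝ 2 μref := (memLp_const (1 : ℝ)).toLp _
  have hone : one =ᵐ[μref] fun _ => (1 : ℝ) := (memLp_const (1 : ℝ)).coeFn_toLp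
  let Z : Submodule ℝ (Fin m → Lp ℝ 2 μref) :=
    LinearMap.range (LinearMap.pi fun j => (LinearMap.toSpanSingleton ℝ _ one) ∘ₗ
      (LinearMap.proj j : (Fin m → ℝ) →ₗ[ℝ] ℝ))
  have hWc := isClosed_map_snd V hV Z (C := K) (by
    rintro ⟨v, g⟩ hp
    have hc := (hmem _).1 hp
    choose c hc' using fun j => hP (v j) (g j) (Lp.memLp _) (Lp.memLp _) (hc.1 j)
    refine ⟨fun j => c j • one, ⟨c, rfl⟩, ?_⟩
    refine (pi_norm_le_iff_of_nonneg (mul_nonneg hK (norm_nonneg _))).2 fun j => ?_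
    refine le_trans ?_ (mul_le_mul_of_nonneg_left (norm_le_pi_norm g j) hK)
    have h1 := hc' j
    have h2 : eLpNorm (fun x => v j x - c j) 2 μref =
        eLpNorm (v j - c j • one : Lp ℝ 2 μref) 2 μref := by
      refine eLpNorm_congr_ae ?_
      filter_upwards [Lp.coeFn_sub (v j) (c j • one), Lp.coeFn_smul (c j) one, hone] with x h1 h2 h3
      rw [h1, Pi.sub_apply, h2, Pi.smul_apply, h3]; simp
    rw [h2] at h1
    have h3 := ENNReal.toReal_mono
      (ENNReal.mul_ne_top ENNReal.ofReal_ne_top (Lp.eLpNorm_ne_top _)) h1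
    rw [ENNReal.toReal_mul, ENNReal.toReal_ofReal hK] at h3
    exact h3)
  obtain ⟨C, hC, h⟩ := exists_const_of_isClosed m S _ hWc
  refine ⟨C, hC, fun x hx v g hv hg hcond => ?_⟩
  obtain ⟨y, hy, ⟨⟨u, y'⟩, hyV, hy'⟩, hle⟩ := h x hx (fun j => (hg j).toLp _)
    ⟨(fun j => (hv j).toLp _, fun j => (hg j).toLp _), (hmem _).2 (hcond.congr
      (fun j => (hv j).coeFn_toLp.symm) (fun j => (hg j).coeFn_toLp.symm)), rfl⟩
  have hy'' : y' = fun j => toL2 (y j) := hy'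
  subst hy''
  have hc := (hmem _).1 hyV
  have hui : ∀ j, IntegrableOn (u j) refTri := fun j =>
    MemLp_two_integrableOn volume_refTri_lt_top (Lp.memLp _)
  -- The approximation is a gradient and a polynomial field, so it is the gradient of polynomials.
  choose Y hY hY' using fun j => (hc.1 j).exists_peval hcv hop hne hbd (hui j)
    (hS _ (hy j)) (coeFn_toL2 (y j))
  have hgr : ∀ j, toL2 (y j) =ᵐ[μref] vpeval (pgrad (Y j)) := by
    intro j
    have h1 : WeakGrad refTri (u j) (vpeval (pgrad (Y j))) := by
      rw [← gradient_peval]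
      exact (weakGrad_of_contDiff area_zref_ne (contDiff_peval (Y j))).congr (hY' j).symm
        (EventuallyEq.refl _ _)
    rw [EventuallyEq, ae_restrict_iff' hop.measurableSet]
    exact (hc.1 j).ae_eq hop (hui j)
      (MemLp_two_integrableOn volume_refTri_lt_top (Lp.memLp _))
      (MemLp_two_integrableOn volume_refTri_lt_top (memLp_vpeval _)) h1
  refine ⟨Y, hY, hc.congr hY' hgr, fun j => ?_⟩
  exact eLpNorm_le_of_norm_le hgr (fun j => (hg j).coeFn_toLp) hC (hle j)

/-! ### Pasting smooth and polynomial pieces -/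

namespace Triangulation

variable {m : ℕ} (T : Triangulation m)

/-- The function that coincides with `F j` on the `j`-th open triangle. -/
def paste {E : Type*} [AddCommMonoid E] (F : Fin m → Plane → E) (x : Plane) : E :=
  ∑ j, (openTri (T.z j)).indicator (F j) x

variable {T}

lemma paste_eq {E : Type*} [AddCommMonoid E] (F : Fin m → Plane → E) {j : Fin m} {x : Plane}
    (hx : x ∈ openTri (T.z j)) : T.paste F x = F j x := by
  rw [paste, Finset.sum_eq_single j, indicator_of_mem hx]
  · intro k _ hk
    exact indicator_of_notMem (fun h => Set.disjoint_left.1 (T.disj k j hk) h hx) _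
  · simp

lemma memLp_paste {E : Type*} [NormedAddCommGroup E] [SecondCountableTopologyEither Plane E]
    {F : Fin m → Plane → E} (hF : ∀ j, Continuous (F j)) :
    MemLp (T.paste F) 2 (volume.restrict T.region) := by
  refine memLp_finsetSum _ fun j _ => ?_
  rw [memLp_indicator_iff_restrict (measurableSet_openTri _)]
  rw [Measure.restrict_restrict_of_subset (openTri_subset_region j)]
  exact memLp_openTri_of_continuous (T.area_ne j) (hF j) 2

/-- Piecewise smooth fields with continuous normal components have a weak divergence. -/
lemma weakDiv_paste {F : Fin m → Plane → Plane} (hF : ∀ j, ContDiff ℝ 1 (F j))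
    (hglue : ∀ f f', T.Glue f f' → ∀ x ∈ openEdge (T.z f.1) f.2,
      cross (T.z f.1 (vb f.2) - T.z f.1 (va f.2)) (F f.1 x) =
      cross (T.z f.1 (vb f.2) - T.z f.1 (va f.2)) (F f'.1 x)) :
    WeakDiv T.region (T.paste F) (T.paste fun j => dv (F j)) := by
  intro φ hφ
  have h1 := contDiff_one_of_infty hφ.1
  have hi := integrable_pairing
    (MemLp_two_integrableOn T.volume_region_lt_top
      (T.memLp_paste fun j => (hF j).continuous))
    (MemLp_two_integrableOn T.volume_region_lt_top
      (T.memLp_paste fun j => continuous_dv (hF j))) h1 hφ.2.1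
  rw [pairing, setIntegral_region hi]
  rw [← sum_integral_dv_eq_zero (T := T) (F := fun j x => φ x • F j x)
    (fun j => h1.smul (hF j))]
  · refine Finset.sum_congr rfl fun j _ => ?_
    refine setIntegral_congr_fun (measurableSet_openTri _) fun x hx => ?_
    simp only [paste_eq _ hx]
    rw [dv_smul (h1.differentiable one_ne_zero x) ((hF j).differentiable one_ne_zero x)]
  · intro f f' h x hx
    simp only [cross_smul_right, hglue f f' h x hx]
  · intro f hf x hx
    -- by `exists_glue`, an edge that is not glued does not meet the region
    have : φ x = 0 := image_eq_zero_of_notMem_tsupport fun hh =>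
      hf (exists_glue hx (hφ.2.2 hh))
    simp [this, cross]

/-- Piecewise smooth continuous functions have a weak gradient. -/
lemma weakGrad_paste {v : Fin m → Plane → ℝ} (hv : ∀ j, ContDiff ℝ 1 (v j))
    (hglue : ∀ f f', T.Glue f f' → ∀ x ∈ openEdge (T.z f.1) f.2, v f.1 x = v f'.1 x) :
    WeakGrad T.region (T.paste v) (T.paste fun j => gradient (v j)) := by
  intro d
  have h := T.weakDiv_paste (F := fun j x => v j x • d) (fun j => (hv j).smul contDiff_const)
    fun f f' hf x hx => by simp only [hglue f f' hf x hx]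
  have e : ∀ x, x ∈ (⋃ j, openTri (T.z j)) →
      T.paste (fun j x => v j x • d) x = T.paste v x • d ∧
      T.paste (fun j => dv fun x => v j x • d) x =
        inner ℝ (T.paste (fun j => gradient (v j)) x) d := by
    intro x hx
    obtain ⟨j, hj⟩ := mem_iUnion.1 hx
    rw [paste_eq _ hj, paste_eq _ hj, paste_eq _ hj, paste_eq _ hj,
      dv_smul_const ((hv j).differentiable one_ne_zero x), inner_gradient_left]
    exact ⟨rfl, rfl⟩
  have hae : ∀ᵐ x ∂(volume.restrict T.region), x ∈ ⋃ j, openTri (T.z j) := by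
    rw [restrict_region]
    exact ae_restrict_mem (MeasurableSet.iUnion fun j => measurableSet_openTri _)
  exact h.congr (hae.mono fun x hx => (e x hx).1) (hae.mono fun x hx => (e x hx).2)

lemma cross_vpeval (u : Plane) (V : Fin 2 → MvP) (x : Plane) :
    cross u (vpeval V x) = peval (MvPolynomial.C (u 0) * V 1 - MvPolynomial.C (u 1) * V 0) x := by
  simp [cross, peval_sub, peval_mul, peval_C]

/-- Neighbouring triangles induce opposite orientations on their common edge. -/
lemma Glue.sign_eq {f f' : Fin m × OEdge} (h : T.Glue f f') :
    oarea (T.z f'.1) f'.2 / |area (T.z f'.1)| = -(oarea (T.z f.1) f.2 / |area (T.z f.1)|) := by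
  have h1 := h.opposite
  rw [← abs_oarea (T.z f.1) f.2, ← abs_oarea (T.z f'.1) f'.2]
  have ha := oarea_ne (T.area_ne f.1) f.2
  have hb := oarea_ne (T.area_ne f'.1) f'.2
  rcases lt_or_gt_of_ne ha with ha' | ha' <;> rcases lt_or_gt_of_ne hb with hb' | hb'
  · exact absurd h1 (not_lt.2 (div_pos_of_neg_of_neg ha' hb').le)
  · rw [abs_of_neg ha', abs_of_pos hb', div_self hb, div_neg, div_self ha, neg_neg]
  · rw [abs_of_pos ha', abs_of_neg hb', div_self ha, div_neg, div_self hb]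
  · exact absurd h1 (not_lt.2 (div_pos ha' hb').le)

/-- Polynomial fields with matching weak normal traces have matching normal components. -/
lemma Glue.cross_eq {f f' : Fin m × OEdge} (h : T.Glue f f') {V V' : Fin 2 → MvP}
    (hp : ∀ a, EdgeTest a →
      pairing (openTri (T.z f.1)) (vpeval V) (dv (vpeval V)) (etest (T.z f.1) f.2 a 1) +
      pairing (openTri (T.z f'.1)) (vpeval V') (dv (vpeval V')) (etest (T.z f'.1) f'.2 a 1) = 0) :
    ∀ x ∈ openEdge (T.z f.1) f.2,
      cross (T.z f.1 (vb f.2) - T.z f.1 (va f.2)) (vpeval V x) =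
      cross (T.z f.1 (vb f.2) - T.z f.1 (va f.2)) (vpeval V' x) := by
  set u := T.z f.1 (vb f.2) - T.z f.1 (va f.2) with hu
  have hsgn := h.sign_eq
  have hne : oarea (T.z f.1) f.2 / |area (T.z f.1)| ≠ 0 :=
    div_ne_zero (oarea_ne (T.area_ne _) _) (abs_ne_zero.2 (T.area_ne _))
  set P : MvP := (MvPolynomial.C (u 0) * V 1 - MvPolynomial.C (u 1) * V 0) -
    (MvPolynomial.C (u 0) * V' 1 - MvPolynomial.C (u 1) * V' 0) with hP
  have hPe : ∀ x, peval P x = cross u (vpeval V x) - cross u (vpeval V' x) := fun x => by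
    rw [hP, peval_sub, cross_vpeval, cross_vpeval]
  have key : ∀ t : ℝ, peval P (AffineMap.lineMap (T.z f.1 (va f.2)) (T.z f.1 (vb f.2)) t) = 0 := by
    refine peval_edge_eq_zero fun a ha => ?_
    have h1 := hp a ha
    rw [pairing_etest_smooth (T.area_ne _) _ ha (contDiff_vpeval V),
      pairing_etest_smooth (T.area_ne _) _ ha (contDiff_vpeval V'), hsgn, ← h.2.1, ← h.2.2,
      ← hu] at h1
    have hc : ∀ U : Fin 2 → MvP, Continuous fun t : ℝ => a t *
        cross u (vpeval U (AffineMap.lineMap (T.z f.1 (va f.2)) (T.z f.1 (vb f.2)) t)) := by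
      intro U
      simp only [cross_vpeval]
      exact ha.1.continuous.mul ((continuous_peval _).comp AffineMap.lineMap_continuous)
    simp only [hPe, mul_sub]
    rw [intervalIntegral.integral_sub ((hc V).intervalIntegrable _ _)
      ((hc V').intervalIntegrable _ _)]
    refine (mul_eq_zero.1 ?_).resolve_left hne
    linarith
  rintro x ⟨t, -, rfl⟩
  exact sub_eq_zero.1 ((hPe _).symm.trans (key t))

end Triangulation

/-- For polynomials the weak trace is, up to sign, integration along the edge against the
profile. -/
lemma traceForm_peval {z : Fin 3 → Plane} (hz : area z ≠ 0) (e : OEdge) {a : ℝ → ℝ}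
    (ha : EdgeTest a) (P : MvP) : traceForm z e a (peval P) (vpeval (pgrad P)) =
      -∫ t in (0 : ℝ)..1, a t * peval P (AffineMap.lineMap (z (va e)) (z (vb e)) t) := by
  set d := z (vo e) - z (va e) with hd
  have hF : ContDiff ℝ 1 fun x => peval P x • d := (contDiff_peval P).smul contDiff_const
  have e1 : dv (fun x => peval P x • d) = fun x => inner ℝ (vpeval (pgrad P) x) d := by
    ext x
    rw [dv_smul_const ((contDiff_peval P (n := 1)).differentiable one_ne_zero x),
      ← inner_gradient_left, gradient_peval]
  have e2 : cross (z (vb e) - z (va e)) d = oarea z e := by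
    have := bary_vo_eq hz e (z (vo e))
    rw [bary_vertex hz, if_pos rfl, eq_div_iff (oarea_ne hz e), one_mul] at this
    exact this.symm
  rw [traceForm, ← e1, pairing_etest_smooth hz e ha hF]
  simp only [cross_smul_right, e2]
  simp only [← mul_assoc]
  rw [intervalIntegral.integral_mul_const]
  have h1 := abs_ne_zero.2 hz
  have h2 : oarea z e * oarea z e = |area z| * |area z| := by
    rw [← abs_oarea z e, abs_mul_abs_self]
  field_simp
  rw [sq, sq, h2]

lemma intervalIntegrable_edge {a : ℝ → ℝ} (ha : EdgeTest a) (P : MvP) (x y : Plane) :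
    IntervalIntegrable (fun t => a t * peval P (AffineMap.lineMap x y t)) volume 0 1 :=
  (ha.1.continuous.mul ((continuous_peval _).comp
    AffineMap.lineMap_continuous)).intervalIntegrable _ _

/-- Polynomials with matching weak traces coincide on the common edge. -/
lemma Triangulation.Glue.peval_eq {m : ℕ} {T : Triangulation m} {f f' : Fin m × OEdge}
    (h : T.Glue f f') {P P' : MvP}
    (hp : ∀ a, EdgeTest a → traceForm (T.z f.1) f.2 a (peval P) (vpeval (pgrad P)) =
      traceForm (T.z f'.1) f'.2 a (peval P') (vpeval (pgrad P'))) :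
    ∀ x ∈ openEdge (T.z f.1) f.2, peval P x = peval P' x := by
  have key : ∀ t : ℝ,
      peval (P - P') (AffineMap.lineMap (T.z f.1 (va f.2)) (T.z f.1 (vb f.2)) t) = 0 := by
    refine peval_edge_eq_zero fun a ha => ?_
    have h1 := hp a ha
    rw [traceForm_peval (T.area_ne _) _ ha, traceForm_peval (T.area_ne _) _ ha, ← h.2.1,
      ← h.2.2] at h1
    simp only [peval_sub, mul_sub]
    rw [intervalIntegral.integral_sub (intervalIntegrable_edge ha _ _ _)
      (intervalIntegrable_edge ha _ _ _)]
    linarith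
  rintro x ⟨t, -, rfl⟩
  exact sub_eq_zero.1 ((peval_sub _ _ _).symm.trans (key t))

/-- Polynomials with vanishing weak trace on an edge vanish there. -/
lemma peval_eq_zero_of_traceForm {z : Fin 3 → Plane} (hz : area z ≠ 0) {e : OEdge} {P : MvP}
    (hp : ∀ a, EdgeTest a → traceForm z e a (peval P) (vpeval (pgrad P)) = 0) (t : ℝ) :
    peval P (AffineMap.lineMap (z (va e)) (z (vb e)) t) = 0 := by
  refine peval_edge_eq_zero (fun a ha => ?_) t
  have h1 := hp a ha
  rw [traceForm_peval hz _ ha] at h1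
  linarith

/-! ### Polynomial and Raviart-Thomas spaces -/

/-- Pairs of polynomials of degree at most `q`. -/
def polySpace (q : ℕ) : Submodule ℝ (Fin 2 → MvP) :=
  LinearMap.range ((MvPolynomial.restrictTotalDegree (Fin 2) ℝ q).subtype.compLeft (Fin 2))

/-- The Raviart-Thomas space of order `q`. -/
def rtSpace (q : ℕ) : Submodule ℝ (Fin 2 → MvP) :=
  polySpace q ⊔ LinearMap.range ((LinearMap.pi fun i => LinearMap.mulLeft ℝ
    (MvPolynomial.X i : MvP)) ∘ₗ (MvPolynomial.restrictTotalDegree (Fin 2) ℝ q).subtype)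

instance (q : ℕ) : FiniteDimensional ℝ (polySpace q) := by
  unfold polySpace; infer_instance

instance (q : ℕ) : FiniteDimensional ℝ (rtSpace q) := by
  unfold rtSpace; infer_instance

lemma mem_polySpace {q : ℕ} {V : Fin 2 → MvP} :
    V ∈ polySpace q ↔ ∀ i, (V i).totalDegree ≤ q := by
  constructor
  · rintro ⟨A, rfl⟩ i
    exact (MvPolynomial.mem_restrictTotalDegree _ _ _).1 (A i).2
  · intro h
    exact ⟨fun i => ⟨V i, (MvPolynomial.mem_restrictTotalDegree _ _ _).2 (h i)⟩, rfl⟩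

lemma mem_rtSpace {q : ℕ} {V : Fin 2 → MvP} :
    V ∈ rtSpace q ↔ ∃ (A : Fin 2 → MvP) (B : MvP), (∀ i, (A i).totalDegree ≤ q) ∧
      B.totalDegree ≤ q ∧ ∀ i, V i = A i + MvPolynomial.X i * B := by
  rw [rtSpace, Submodule.mem_sup]
  constructor
  · rintro ⟨A, hA, _, ⟨B, rfl⟩, rfl⟩
    exact ⟨A, B, mem_polySpace.1 hA, (MvPolynomial.mem_restrictTotalDegree _ _ _).1 B.2,
      fun i => rfl⟩
  · rintro ⟨A, B, hA, hB, h⟩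
    exact ⟨A, mem_polySpace.2 hA, _, ⟨⟨B, (MvPolynomial.mem_restrictTotalDegree _ _ _).2 hB⟩, rfl⟩,
      (funext h).symm⟩

lemma totalDegree_add_X_mul_le {q : ℕ} {A B : MvP} (hA : A.totalDegree ≤ q)
    (hB : B.totalDegree ≤ q) (i : Fin 2) :
    (A + MvPolynomial.X i * B).totalDegree ≤ q + 1 := by
  refine (MvPolynomial.totalDegree_add _ _).trans (max_le (hA.trans (Nat.le_succ _)) ?_)
  exact (MvPolynomial.totalDegree_mul _ _).trans (by simp; omega)

lemma rtSpace_le_polySpace (q : ℕ) : rtSpace q ≤ polySpace (q + 1) := by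
  intro V hV
  obtain ⟨A, B, hA, hB, h⟩ := mem_rtSpace.1 hV
  exact mem_polySpace.2 fun i => by rw [h]; exact totalDegree_add_X_mul_le (hA i) hB i

lemma totalDegree_C_mul_le {q : ℕ} {A : MvP} (hA : A.totalDegree ≤ q) (c : ℝ) :
    (MvPolynomial.C c * A).totalDegree ≤ q :=
  (MvPolynomial.totalDegree_mul _ _).trans (by simpa using hA)

lemma exists_vpeval_clm (M : Plane →L[ℝ] Plane) {q : ℕ} {V : Fin 2 → MvP} (hV : V ∈ polySpace q) :
    ∃ V' ∈ polySpace q, ∀ x, vpeval V' x = M (vpeval V x) := by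
  rw [mem_polySpace] at hV
  refine ⟨fun i => MvPolynomial.C (M (EuclideanSpace.single 0 1) i) * V 0 +
    MvPolynomial.C (M (EuclideanSpace.single 1 1) i) * V 1, mem_polySpace.2 fun i => ?_,
    fun x => ?_⟩
  · exact (MvPolynomial.totalDegree_add _ _).trans
      (max_le (totalDegree_C_mul_le (hV 0) _) (totalDegree_C_mul_le (hV 1) _))
  · ext i
    have := clm_eq ((EuclideanSpace.proj (𝕜 := ℝ) i).comp M) (vpeval V x)
    simp only [ContinuousLinearMap.comp_apply, PiLp.proj_apply, vpeval_apply] at this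
    rw [this, vpeval_apply, peval_add, peval_mul, peval_mul, peval_C, peval_C]

lemma exists_vpeval_comp (c : Plane) (L M : Plane →L[ℝ] Plane) {q : ℕ} {V : Fin 2 → MvP}
    (hV : V ∈ polySpace q) : ∃ V' ∈ polySpace q, ∀ x, vpeval V' x = M (vpeval V (c + L x)) := by
  obtain ⟨Φ, hΦ, hΦ'⟩ := exists_peval_comp c L
  rw [mem_polySpace] at hV
  obtain ⟨V', hV', h⟩ := exists_vpeval_clm M (V := fun i => Φ (V i))
    (mem_polySpace.2 fun i => (hΦ _).trans (hV i))
  refine ⟨V', hV', fun x => ?_⟩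
  rw [h]
  congr 1
  ext i
  exact hΦ' _ _

/-- Raviart-Thomas spaces are invariant under Piola maps. -/
lemma exists_vpeval_piola (c : Plane) (L M : Plane →L[ℝ] Plane) {s : ℝ}
    (hML : ∀ x, M (L x) = s • x) {q : ℕ} {V : Fin 2 → MvP}
    (hV : V ∈ rtSpace q) : ∃ V' ∈ rtSpace q, ∀ x, vpeval V' x = M (vpeval V (c + L x)) := by
  obtain ⟨A, B, hA, hB, h⟩ := mem_rtSpace.1 hV
  obtain ⟨Φ, hΦ, hΦ'⟩ := exists_peval_comp c L
  obtain ⟨A', hA', h1⟩ := exists_vpeval_comp c L M (mem_polySpace.2 hA)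
  have hB' := (hΦ B).trans hB
  refine ⟨fun i => (A' i + MvPolynomial.C (M c i) * Φ B) + MvPolynomial.X i *
    (MvPolynomial.C s * Φ B), mem_rtSpace.2 ⟨_, _, fun i => ?_, ?_, fun i => rfl⟩, fun x => ?_⟩
  · exact (MvPolynomial.totalDegree_add _ _).trans
      (max_le (mem_polySpace.1 hA' i) (totalDegree_C_mul_le hB' _))
  · exact totalDegree_C_mul_le hB' _
  · have e : vpeval V (c + L x) = vpeval A (c + L x) + peval B (c + L x) • (c + L x) := by
      ext i
      simp [h, peval_add, peval_mul, peval_X]; ring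
    rw [e, map_add, map_smul, map_add, hML, ← h1]
    ext i
    simp only [vpeval_apply, peval_add, peval_mul, peval_C, peval_X, hΦ', PiLp.add_apply,
      PiLp.smul_apply, smul_eq_mul]
    ring

/-! ### Comparison with the reference triangle -/

/-- The edges of a triangle are comparable with the square root of its area. -/
def ShapeRegular (κ : ℝ) (z : Fin 3 → Plane) : Prop := ∀ i k, dist (z i) (z k) ^ 2 ≤ κ * |area z|

lemma eLpNorm_openTri {E : Type*} [NormedAddCommGroup E] {z : Fin 3 → Plane} (hz : area z ≠ 0)
    (f : Plane → E) : eLpNorm f 2 (volume.restrict (openTri z)) =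
      ENNReal.ofReal √|area z| * eLpNorm (fun y => f (affMap z y)) 2 μref := by
  refine (ENNReal.pow_right_strictMono two_ne_zero).injective ?_
  beta_reduce
  rw [mul_pow, eLpNorm_two_sq, eLpNorm_two_sq,
    ← ENNReal.ofReal_pow (Real.sqrt_nonneg _), Real.sq_sqrt (abs_nonneg _), ← image_affMap hz,
    lintegral_image_eq_lintegral_abs_det_fderiv_mul volume (measurableSet_openTri _)
      (fun y _ => (hasFDerivAt_affMap z y).hasFDerivWithinAt) (affMap_injective hz).injOn,
    det_edgeMap, lintegral_const_mul' _ _ ENNReal.ofReal_ne_top]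

lemma ShapeRegular.norm_sub_le {κ : ℝ} {z : Fin 3 → Plane} (h : ShapeRegular κ z) (i k : Fin 3) :
    ‖z i - z k‖ ≤ √(κ * |area z|) := by
  rw [← dist_eq_norm]; exact Real.le_sqrt_of_sq_le (h i k)

lemma ShapeRegular.norm_edgeMap_le {κ : ℝ} {z : Fin 3 → Plane} (h : ShapeRegular κ z) :
    ‖edgeMap z‖ ≤ 2 * √(κ * |area z|) := by
  refine ContinuousLinearMap.opNorm_le_bound _ (by positivity) fun v => ?_
  have hv : ∀ i, |v i| ≤ ‖v‖ := fun i => PiLp.norm_apply_le v i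
  rw [edgeMap_apply]
  refine (norm_add_le _ _).trans ?_
  rw [norm_smul, norm_smul, Real.norm_eq_abs, Real.norm_eq_abs]
  nlinarith [mul_le_mul (hv 0) (h.norm_sub_le 1 0) (norm_nonneg _) (norm_nonneg _),
    mul_le_mul (hv 1) (h.norm_sub_le 2 0) (norm_nonneg _) (norm_nonneg _)]

lemma ShapeRegular.norm_invMap_le {κ : ℝ} {z : Fin 3 → Plane} (h : ShapeRegular κ z)
    (hz : area z ≠ 0) : |area z| * ‖invMap z‖ ≤ 2 * √(κ * |area z|) := by
  have hp := abs_pos.2 hz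
  rw [mul_comm, ← le_div_iff₀ hp]
  refine ContinuousLinearMap.opNorm_le_bound _ (by positivity) fun v => ?_
  have hd : ∀ i, |dbary z i v| ≤ √(κ * |area z|) / |area z| * ‖v‖ := by
    intro i
    rw [dbary, smul_apply, smul_eq_mul, crossL_apply, abs_mul, abs_inv, div_eq_inv_mul, mul_assoc]
    gcongr
    exact (abs_cross_le _ _).trans (by gcongr; exact h.norm_sub_le _ _)
  have e : invMap z v = dbary z 1 v • EuclideanSpace.single 0 1 +
      dbary z 2 v • EuclideanSpace.single 1 1 := by simp [invMap]
  rw [e]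
  refine (norm_add_le _ _).trans ?_
  rw [norm_smul, norm_smul, PiLp.norm_single, PiLp.norm_single]
  simp only [Real.norm_eq_abs, abs_one, mul_one]
  calc _ ≤ √(κ * |area z|) / |area z| * ‖v‖ + √(κ * |area z|) / |area z| * ‖v‖ :=
        add_le_add (hd 1) (hd 2)
    _ = _ := by ring

/-- Comparison of the norms of a field and of its pull-back; `A` is bounded by the factor `2 √κ`,
up to the scaling of the pull-back, which is compensated by the change of variables. -/
lemma eLpNorm_ref_le {κ : ℝ} {z : Fin 3 → Plane} (hκ : 0 ≤ κ) (hz : area z ≠ 0)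
    {A : Plane →L[ℝ] Plane} (hA : ‖A‖ ≤ 2 * √(κ * |area z|)) (f : Plane → Plane) :
    eLpNorm (fun y => A (f (affMap z y))) 2 μref ≤
      ENNReal.ofReal (2 * √κ) * eLpNorm f 2 (volume.restrict (openTri z)) := by
  rw [eLpNorm_openTri hz, ← mul_assoc, ← ENNReal.ofReal_mul (by positivity), mul_assoc,
    ← Real.sqrt_mul hκ]
  exact eLpNorm_le_mul_eLpNorm_of_ae_le_mul (Eventually.of_forall fun y =>
    (A.le_opNorm _).trans (by gcongr)) 2

/-- The converse of `eLpNorm_ref_le`, for the inverse of a pull-back. -/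
lemma eLpNorm_openTri_le {κ : ℝ} {z : Fin 3 → Plane} (hκ : 0 ≤ κ) (hz : area z ≠ 0)
    {A : Plane →L[ℝ] Plane} (hA : |area z| * ‖A‖ ≤ 2 * √(κ * |area z|)) (f h : Plane → Plane)
    (hf : ∀ y, f (affMap z y) = A (h y)) :
    eLpNorm f 2 (volume.restrict (openTri z)) ≤ ENNReal.ofReal (2 * √κ) * eLpNorm h 2 μref := by
  have hp := abs_pos.2 hz
  have hA' : √|area z| * ‖A‖ ≤ 2 * √κ := by
    rw [Real.sqrt_mul hκ] at hA
    have h1 := Real.mul_self_sqrt hp.le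
    have h2 := Real.sqrt_pos.2 hp
    refine le_of_mul_le_mul_left ?_ h2
    calc √|area z| * (√|area z| * ‖A‖) = |area z| * ‖A‖ := by rw [← mul_assoc, h1]
      _ ≤ _ := hA
      _ = _ := by ring
  rw [eLpNorm_openTri hz]
  calc _ ≤ ENNReal.ofReal √|area z| * (ENNReal.ofReal ‖A‖ * eLpNorm h 2 μref) := by
        gcongr
        refine eLpNorm_le_mul_eLpNorm_of_ae_le_mul (Eventually.of_forall fun y => ?_) 2
        rw [hf]; exact A.le_opNorm _
    _ = ENNReal.ofReal (√|area z| * ‖A‖) * eLpNorm h 2 μref := by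
        rw [ENNReal.ofReal_mul (Real.sqrt_nonneg _), mul_assoc]
    _ ≤ _ := by gcongr

lemma eLpNorm_gradPull_le {κ : ℝ} {z : Fin 3 → Plane} (hκ : 0 ≤ κ) (hz : area z ≠ 0)
    (h : ShapeRegular κ z) (f : Plane → Plane) : eLpNorm (gradPull z f) 2 μref ≤
      ENNReal.ofReal (2 * √κ) * eLpNorm f 2 (volume.restrict (openTri z)) :=
  eLpNorm_ref_le hκ hz (A := ContinuousLinearMap.adjoint (edgeMap z))
    (by rw [LinearIsometryEquiv.norm_map]; exact h.norm_edgeMap_le) f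

lemma eLpNorm_le_gradPull {κ : ℝ} {z : Fin 3 → Plane} (hκ : 0 ≤ κ) (hz : area z ≠ 0)
    (h : ShapeRegular κ z) (f : Plane → Plane) : eLpNorm f 2 (volume.restrict (openTri z)) ≤
      ENNReal.ofReal (2 * √κ) * eLpNorm (gradPull z f) 2 μref := by
  refine eLpNorm_openTri_le hκ hz (A := ContinuousLinearMap.adjoint (invMap z))
    (by rw [LinearIsometryEquiv.norm_map]; exact h.norm_invMap_le hz) f _ fun y => ?_
  refine ext_inner_right ℝ fun d => ?_
  rw [ContinuousLinearMap.adjoint_inner_left, inner_gradPull, edgeMap_invMap hz]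

lemma eLpNorm_piolaPull_le {κ : ℝ} {z : Fin 3 → Plane} (hκ : 0 ≤ κ) (hz : area z ≠ 0)
    (h : ShapeRegular κ z) (f : Plane → Plane) : eLpNorm (piolaPull z f) 2 μref ≤
      ENNReal.ofReal (2 * √κ) * eLpNorm f 2 (volume.restrict (openTri z)) :=
  eLpNorm_ref_le hκ hz (A := |area z| • invMap z)
    (by rw [norm_smul, Real.norm_eq_abs, abs_abs]; exact h.norm_invMap_le hz) f

lemma eLpNorm_le_piolaPull {κ : ℝ} {z : Fin 3 → Plane} (hκ : 0 ≤ κ) (hz : area z ≠ 0)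
    (h : ShapeRegular κ z) (f : Plane → Plane) : eLpNorm f 2 (volume.restrict (openTri z)) ≤
      ENNReal.ofReal (2 * √κ) * eLpNorm (piolaPull z f) 2 μref := by
  have hp := (abs_pos.2 hz).ne'
  refine eLpNorm_openTri_le hκ hz (A := |area z|⁻¹ • edgeMap z) ?_ f _ fun y => ?_
  · rw [norm_smul, norm_inv, Real.norm_eq_abs, abs_abs, mul_inv_cancel_left₀ hp]
    exact h.norm_edgeMap_le
  · rw [piolaPull, smul_apply, map_smul, inv_smul_smul₀ hp, edgeMap_invMap hz]

lemma memLp_comp_affMap {E : Type*} [NormedAddCommGroup E] [NormedSpace ℝ E]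
    {z : Fin 3 → Plane} (hz : area z ≠ 0) {f : Plane → E}
    (hf : MemLp f 2 (volume.restrict (openTri z))) :
    MemLp (fun y => f (affMap z y)) 2 μref := by
  have hm : AEStronglyMeasurable (fun y => f (affMap z y)) μref :=
    ((integrableOn_openTri_iff hz f).1
      (MemLp_two_integrableOn (volume_openTri_lt_top hz) hf)).aestronglyMeasurable
  refine ⟨hm, ?_⟩
  have h1 := hf.2
  rw [eLpNorm_openTri hz] at h1
  have h2 : ENNReal.ofReal √|area z| ≠ 0 := by
    simpa using abs_pos.2 hz
  exact (ENNReal.mul_lt_top_iff.1 h1).elim (fun h => h.2) (fun h => h.elim (fun h => absurd h h2)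
    fun h => by rw [h]; exact ENNReal.zero_lt_top)

namespace Triangulation

variable {m : ℕ} {T : Triangulation m}

lemma eLpNorm_region_le {E : Type*} [NormedAddCommGroup E] (f : Plane → E) :
    eLpNorm f 2 (volume.restrict T.region) ≤
      ∑ j, eLpNorm f 2 (volume.restrict (openTri (T.z j))) := by
  have hsq : ∀ (s : Finset (Fin m)) (a : Fin m → ℝ≥0∞), ∑ j ∈ s, a j ^ 2 ≤ (∑ j ∈ s, a j) ^ 2 := by
    intro s a
    classical
    induction s using Finset.induction_on with
    | empty => simp
    | insert j s hj ih =>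
      rw [Finset.sum_insert hj, Finset.sum_insert hj, add_sq, add_assoc]
      gcongr
      exact ih.trans le_add_self
  rw [← ENNReal.pow_le_pow_left_iff two_ne_zero, eLpNorm_two_sq, restrict_region_eq_sum,
    lintegral_sum_measure, tsum_fintype]
  simp only [← eLpNorm_two_sq]
  exact hsq _ _

/-- The gluing of the reference triangles prescribed by a triangulation. -/
def gluing (T : Triangulation m) : Gluing m := {p | T.Glue p.1 p.2}

/-- The Piola map preserves normal fluxes. -/
lemma pairing_piolaPull {z : Fin 3 → Plane} (hz : area z ≠ 0) (τ : Plane → Plane)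
    (e : OEdge) {a : ℝ → ℝ} (ha : EdgeTest a) :
    pairing (openTri z) τ 0 (etest z e a 1) =
      pairing refTri (piolaPull z τ) 0 (etest zref e a 1) := by
  rw [pairing_pullback hz _ _ (contDiff_one_of_infty (contDiff_etest z e ha 1))]
  simp only [etest_affMap hz]
  unfold pairing
  rw [← integral_const_mul]
  congr 1; ext y
  simp [piolaPull]

/-- The Piola pull-backs of a divergence-free field satisfy the conditions of the gluing. -/
lemma divCond_piolaPull {τ : Plane → Plane} (hτ : MemLp τ 2 (volume.restrict T.region))
    (hW : WeakDiv T.region τ 0) : DivCond T.gluing fun j => piolaPull (T.z j) τ := by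
  refine ⟨fun j φ hφ => ?_, fun f f' h a ha => ?_⟩
  · have h := (hW.mono measurableSet_region (openTri_subset_region j)).pullback (T.area_ne j) φ hφ
    unfold pairing at h ⊢
    rw [← mul_zero |area (T.z j)|, ← h, ← integral_const_mul]
    congr 1; ext y
    simp [piolaPull]
  · have hi := MemLp_two_integrableOn volume_region_lt_top hτ
    have h1 := pairing_etest_add_eq_zero hi (integrable_zero _ _ _) hW h ha
    rwa [pairing_piolaPull (T.area_ne _) _ _ ha, pairing_piolaPull (T.area_ne _) _ _ ha] at h1

end Triangulation

/-! ### Stable approximation on a triangulation -/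

/-- The weak divergence is unique, and a polynomial is determined by its values on an open set. -/
lemma pdiv_eq_zero_of_weakDiv {V : Fin 2 → MvP} (h : WeakDiv refTri (vpeval V) 0) :
    pdiv V = 0 := by
  have hop : IsOpen refTri := isOpen_openTri _
  have h' := weakDiv_of_contDiff area_zref_ne (contDiff_vpeval V)
  rw [dv_vpeval] at h'
  have hV : IntegrableOn (vpeval V) refTri :=
    MemLp_two_integrableOn volume_refTri_lt_top (memLp_vpeval V)
  have hP : IntegrableOn (peval (pdiv V)) refTri :=
    MemLp_two_integrableOn volume_refTri_lt_top (memLp_peval _)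
  have key : ∀ᵐ x, x ∈ refTri → peval (pdiv V) x = 0 := by
    refine hop.ae_eq_zero_of_integral_contDiff_smul_eq_zero hP.locallyIntegrableOn ?_
    intro φ h1 h2 h3
    have hφ : IsTest refTri φ := ⟨h1, h2, h3⟩
    have h11 := contDiff_one_of_infty h1
    rw [← setIntegral_eq_integral_of_forall_compl_eq_zero (s := refTri)]
    · rw [← sub_self (0 : ℝ)]
      nth_rw 1 [← h' φ hφ]
      rw [← h φ hφ, pairing, pairing, ← integral_sub (integrable_pairing hV hP h11 h2)
        (integrable_pairing hV (integrable_zero _ _ _) h11 h2)]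
      refine integral_congr_ae (Eventually.of_forall fun x => ?_)
      simp; ring
    · intro x hx
      rw [image_eq_zero_of_notMem_tsupport (fun hh => hx (h3 hh)), zero_smul]
  refine eq_zero_of_peval_eq_zero hop ⟨!₂[1 / 4, 1 / 4], (mem_refTri _).2 (by norm_num)⟩ ?_
  have hae : peval (pdiv V) =ᵐ[volume.restrict refTri] fun _ => 0 :=
    (ae_restrict_iff' hop.measurableSet).2 key
  exact Measure.eqOn_of_ae_eq hae (continuous_peval _).continuousOn continuousOn_const
    (by rw [hop.interior_eq]; exact subset_closure)

lemma affInv_eq (z : Fin 3 → Plane) (x : Plane) : affInv z x = -invMap z (z 0) + invMap z x := by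
  rw [affInv, map_sub]; abel

/-- Raviart-Thomas fields on the reference triangle are Piola pull-backs. -/
lemma exists_piolaPull_eq {z : Fin 3 → Plane} (hz : area z ≠ 0) {q : ℕ} {V : Fin 2 → MvP}
    (hV : V ∈ rtSpace q) : ∃ U ∈ rtSpace q, piolaPull z (vpeval U) = vpeval V := by
  have hp := (abs_pos.2 hz).ne'
  obtain ⟨U, hU, h⟩ := exists_vpeval_piola (-invMap z (z 0)) (invMap z) (|area z|⁻¹ • edgeMap z)
    (s := |area z|⁻¹) (fun x => by rw [smul_apply, edgeMap_invMap hz]) hV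
  refine ⟨U, hU, funext fun y => ?_⟩
  rw [piolaPull, h, ← affInv_eq, affInv_affMap hz, smul_apply, map_smul, smul_inv_smul₀ hp,
    invMap_edgeMap hz]

lemma exists_vpeval_eq_piolaPull {z : Fin 3 → Plane} (hz : area z ≠ 0) {q : ℕ} {V : Fin 2 → MvP}
    (hV : V ∈ rtSpace q) : ∃ U ∈ rtSpace q, vpeval U = piolaPull z (vpeval V) := by
  obtain ⟨U, hU, h⟩ := exists_vpeval_piola (z 0) (edgeMap z) (|area z| • invMap z)
    (s := |area z|) (fun x => by rw [smul_apply, invMap_edgeMap hz]) hV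
  exact ⟨U, hU, funext h⟩

lemma exists_vpeval_eq_gradPull {z : Fin 3 → Plane} {q : ℕ} {V : Fin 2 → MvP}
    (hV : V ∈ polySpace q) : ∃ U ∈ polySpace q, vpeval U = gradPull z (vpeval V) := by
  obtain ⟨U, hU, h⟩ := exists_vpeval_comp (z 0) (edgeMap z)
    (ContinuousLinearMap.adjoint (edgeMap z)) hV
  exact ⟨U, hU, funext h⟩

/-- Polynomials on the reference triangle are pull-backs. -/
lemma exists_peval_affMap_eq {z : Fin 3 → Plane} (hz : area z ≠ 0) (P : MvP) :
    ∃ Q : MvP, Q.totalDegree ≤ P.totalDegree ∧ (∀ y, peval Q (affMap z y) = peval P y) ∧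
      gradPull z (vpeval (pgrad Q)) = vpeval (pgrad P) := by
  obtain ⟨Φ, hΦ, h⟩ := exists_peval_comp (-invMap z (z 0)) (invMap z)
  have h1 : ∀ y, peval (Φ P) (affMap z y) = peval P y := fun y => by
    rw [h, ← affInv_eq, affInv_affMap hz]
  refine ⟨Φ P, hΦ P, h1, funext fun y => ?_⟩
  refine ext_inner_right ℝ fun d => ?_
  rw [inner_gradPull, ← gradient_peval, ← gradient_peval, inner_gradient_left, inner_gradient_left]
  have h2 : HasFDerivAt (fun y => peval (Φ P) (affMap z y))
      ((fderiv ℝ (peval (Φ P)) (affMap z y)).comp (edgeMap z)) y :=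
    ((contDiff_peval _ (n := 1)).differentiable one_ne_zero _).hasFDerivAt.comp y
      (hasFDerivAt_affMap z y)
  rw [funext h1] at h2
  rw [h2.fderiv, ContinuousLinearMap.comp_apply]

lemma gradPull_sub (z : Fin 3 → Plane) (f g : Plane → Plane) :
    gradPull z (fun x => f x - g x) = fun y => gradPull z f y - gradPull z g y := by
  ext y : 1; simp [gradPull]

lemma piolaPull_sub (z : Fin 3 → Plane) (f g : Plane → Plane) :
    piolaPull z (fun x => f x - g x) = fun y => piolaPull z f y - piolaPull z g y := by
  ext y : 1; simp [piolaPull, smul_sub]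

namespace Triangulation

variable {m : ℕ} {T : Triangulation m}

lemma ae_mem_iUnion : ∀ᵐ x ∂(volume.restrict T.region), x ∈ ⋃ j, openTri (T.z j) := by
  rw [restrict_region]
  exact ae_restrict_mem (MeasurableSet.iUnion fun j => measurableSet_openTri _)

/-- Polynomial fields on the reference triangles that satisfy the conditions of the gluing are
Piola pull-backs of divergence-free fields. -/
lemma weakDiv_paste_of_divCond {U Y : Fin m → Fin 2 → MvP}
    (hY : DivCond T.gluing fun j => vpeval (Y j))
    (hU : ∀ j, piolaPull (T.z j) (vpeval (U j)) = vpeval (Y j)) :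
    WeakDiv T.region (T.paste fun j => vpeval (U j)) 0 := by
  have h0 : ∀ j, dv (vpeval (U j)) = 0 := by
    intro j
    ext x
    have hz := T.area_ne j
    have h1 : dv (vpeval (Y j)) = 0 := by
      rw [dv_vpeval, pdiv_eq_zero_of_weakDiv (hY.1 j)]; ext x; simp [peval]
    have h2 : (fun y => invMap (T.z j) (vpeval (U j) (affMap (T.z j) y))) =
        fun y => |area (T.z j)|⁻¹ • vpeval (Y j) y := by
      ext y : 1
      rw [← hU j, piolaPull, inv_smul_smul₀ (abs_pos.2 hz).ne']
    have h3 := dv_pullback hz (F := vpeval (U j)) (y := affInv (T.z j) x)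
      ((contDiff_vpeval _ (n := 1)).differentiable one_ne_zero _)
    rw [h2, affMap_affInv hz] at h3
    rw [← h3]
    have h4 := dv_smul (φ := fun _ => |area (T.z j)|⁻¹) (F := vpeval (Y j))
      (x := affInv (T.z j) x) (differentiableAt_const _)
      ((contDiff_vpeval _ (n := 1)).differentiable one_ne_zero _)
    rw [h4, h1]; simp
  have h := T.weakDiv_paste (F := fun j => vpeval (U j)) (fun j => contDiff_vpeval _)
    fun f f' hf => hf.cross_eq fun a ha => by
      rw [h0, h0]
      rw [pairing_piolaPull (T.area_ne _) _ _ ha, pairing_piolaPull (T.area_ne _) _ _ ha, hU, hU]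
      exact hY.2 f f' hf a ha
  refine h.congr (EventuallyEq.refl _ _) (ae_mem_iUnion.mono fun x hx => ?_)
  obtain ⟨j, hj⟩ := mem_iUnion.1 hx
  rw [paste_eq _ hj, h0]

/-- Functions with a weak gradient satisfy the conditions of the gluing. -/
lemma gradCond_pull {v : Plane → ℝ} {g : Plane → Plane} (hv : MemLp v 2 (volume.restrict T.region))
    (hg : MemLp g 2 (volume.restrict T.region)) (hW : WeakGrad T.region v g)
    {dir : Set (Fin m × OEdge)} (hdir : ∀ f ∈ dir, HasZeroTrace (openTri (T.z f.1))
      (T.z f.1 (va f.2)) (T.z f.1 (vb f.2)) v g) :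
    GradCond T.gluing dir (fun j y => v (affMap (T.z j) y)) fun j => gradPull (T.z j) g := by
  refine ⟨fun j => ?_, fun f f' h a ha => ?_, fun f hf a ha => ?_⟩
  · exact WeakGrad.pullback (T.area_ne j)
      fun d => (hW d).mono measurableSet_region (openTri_subset_region j)
  · rw [← traceForm_pullback (T.area_ne _) _ ha, ← traceForm_pullback (T.area_ne _) _ ha]
    exact traceForm_eq (MemLp_two_integrableOn volume_region_lt_top hv)
      (MemLp_two_integrableOn volume_region_lt_top hg) hW h ha
  · rw [← traceForm_pullback (T.area_ne _) _ ha]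
    have hle := Measure.restrict_mono (μ := volume) (openTri_subset_region (T := T) f.1) le_rfl
    exact traceForm_eq_zero (T.area_ne _) (hv.mono_measure hle) (hg.mono_measure hle)
      (hdir f hf) ha

lemma traceForm_of_pull {z : Fin 3 → Plane} (hz : area z ≠ 0) (e : OEdge) {a : ℝ → ℝ}
    (ha : EdgeTest a) {P Y : MvP} (h1 : ∀ y, peval P (affMap z y) = peval Y y)
    (h2 : gradPull z (vpeval (pgrad P)) = vpeval (pgrad Y)) :
    traceForm z e a (peval P) (vpeval (pgrad P)) =
      traceForm zref e a (peval Y) (vpeval (pgrad Y)) := by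
  rw [traceForm_pullback hz _ ha, funext h1, h2]

/-- Estimates on the reference triangles, up to the sum over all of them, give an estimate on the
region; `hpull` and `hpush` compare the norms of a field and of its pull-back. -/
lemma eLpNorm_region_le_of_ref {κ C : ℝ} (hC : 0 ≤ C)
    {pull : (Fin 3 → Plane) → (Plane → Plane) → Plane → Plane}
    (hpull : ∀ j f, eLpNorm (pull (T.z j) f) 2 μref ≤
      ENNReal.ofReal (2 * √κ) * eLpNorm f 2 (volume.restrict (openTri (T.z j))))
    (hpush : ∀ j f, eLpNorm f 2 (volume.restrict (openTri (T.z j))) ≤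
      ENNReal.ofReal (2 * √κ) * eLpNorm (pull (T.z j) f) 2 μref)
    {F E : Fin m → Plane → Plane} {f e : Plane → Plane}
    (hF : ∀ j, EqOn f (F j) (openTri (T.z j))) (hE : ∀ j, EqOn e (E j) (openTri (T.z j)))
    (h : ∀ j, eLpNorm (pull (T.z j) (F j)) 2 μref ≤
      ENNReal.ofReal C * ∑ i, eLpNorm (pull (T.z i) (E i)) 2 μref) :
    eLpNorm f 2 (volume.restrict T.region) ≤ ENNReal.ofReal (m * (2 * √κ) * C * (m * (2 * √κ))) *
      eLpNorm e 2 (volume.restrict T.region) := by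
  have hcongr : ∀ {f : Plane → Plane} {F : Fin m → Plane → Plane} (j : Fin m),
      (∀ j, EqOn f (F j) (openTri (T.z j))) → eLpNorm f 2 (volume.restrict (openTri (T.z j))) =
      eLpNorm (F j) 2 (volume.restrict (openTri (T.z j))) := fun j hf =>
    eLpNorm_congr_ae ((ae_restrict_iff' (measurableSet_openTri _)).2
      (Eventually.of_forall fun x hx => hf j hx))
  have h2κ : 0 ≤ 2 * √κ := by positivity
  set S := ∑ i, eLpNorm (pull (T.z i) (E i)) 2 μref with hS
  have hSle : S ≤ ENNReal.ofReal (m * (2 * √κ)) * eLpNorm e 2 (volume.restrict T.region) := by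
    calc S ≤ ∑ _i : Fin m, ENNReal.ofReal (2 * √κ) * eLpNorm e 2 (volume.restrict T.region) := by
          refine Finset.sum_le_sum fun i _ => (hpull i _).trans ?_
          rw [← hcongr i hE]
          gcongr
          exact openTri_subset_region i
      _ = _ := by
          rw [Finset.sum_const, Finset.card_univ, Fintype.card_fin, nsmul_eq_mul, ← mul_assoc,
            ENNReal.ofReal_mul (Nat.cast_nonneg m), ENNReal.ofReal_natCast]
  calc eLpNorm f 2 (volume.restrict T.region)
      ≤ ∑ j, eLpNorm f 2 (volume.restrict (openTri (T.z j))) := eLpNorm_region_le f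
    _ ≤ ∑ _j : Fin m, ENNReal.ofReal (2 * √κ) * (ENNReal.ofReal C * S) := by
        refine Finset.sum_le_sum fun j _ => ?_
        rw [hcongr j hF]
        refine (hpush j _).trans ?_
        gcongr
        exact h j
    _ = ENNReal.ofReal (m * (2 * √κ) * C) * S := by
        rw [Finset.sum_const, Finset.card_univ, Fintype.card_fin, nsmul_eq_mul, ← mul_assoc,
          ← mul_assoc, ENNReal.ofReal_mul (p := m * (2 * √κ)) (by positivity),
          ENNReal.ofReal_mul (p := m) (by positivity), ENNReal.ofReal_natCast]
    _ ≤ ENNReal.ofReal (m * (2 * √κ) * C) * (ENNReal.ofReal (m * (2 * √κ)) *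
          eLpNorm e 2 (volume.restrict T.region)) := by gcongr
    _ = _ := by rw [← mul_assoc, ← ENNReal.ofReal_mul (by positivity)]

end Triangulation

/-- Divergence-free fields: Raviart-Thomas fields approximate a given Raviart-Thomas field as well
as general ones do, up to a constant that depends only on the number of triangles, their shape and
the order. -/
theorem exists_div_stable (m p : ℕ) {κ : ℝ} (hκ : 0 ≤ κ) : ∃ C : ℝ, 0 ≤ C ∧
    ∀ T : Triangulation m, (∀ j, ShapeRegular κ (T.z j)) →
    ∀ V : Fin m → Fin 2 → MvP, (∀ j, V j ∈ rtSpace p) →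
    ∀ τ : Plane → Plane, MemLp τ 2 (volume.restrict T.region) → WeakDiv T.region τ 0 →
    ∃ U : Fin m → Fin 2 → MvP, (∀ j, U j ∈ rtSpace p) ∧
      WeakDiv T.region (T.paste fun j => vpeval (U j)) 0 ∧
      eLpNorm (fun x => T.paste (fun j => vpeval (V j)) x - T.paste (fun j => vpeval (U j)) x) 2
        (volume.restrict T.region) ≤ ENNReal.ofReal C *
        eLpNorm (fun x => T.paste (fun j => vpeval (V j)) x - τ x) 2
          (volume.restrict T.region) := by
  -- There are only finitely many ways to glue `m` triangles.
  choose c hc h using fun glue : Gluing m => exists_div_const m (rtSpace p) glue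
  obtain ⟨C, hC⟩ := Finite.exists_le c
  have hC0 : 0 ≤ C := (hc ∅).trans (hC ∅)
  refine ⟨m * (2 * √κ) * C * (m * (2 * √κ)), by positivity, fun T hT V hV τ hτ hW => ?_⟩
  choose x hx hx' using fun j => exists_vpeval_eq_piolaPull (T.area_ne j) (hV j)
  have hmem : ∀ j, MemLp (piolaPull (T.z j) τ) 2 μref := fun j =>
    (|area (T.z j)| • invMap (T.z j)).comp_memLp' (memLp_comp_affMap (T.area_ne j)
      (hτ.mono_measure (Measure.restrict_mono (Triangulation.openTri_subset_region j) le_rfl)))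
  obtain ⟨Y, hY, hYc, hle⟩ := h T.gluing x hx _ hmem (Triangulation.divCond_piolaPull hτ hW)
  choose U hU hU' using fun j => exists_piolaPull_eq (T.area_ne j) (hY j)
  refine ⟨U, hU, Triangulation.weakDiv_paste_of_divCond hYc hU', ?_⟩
  refine Triangulation.eLpNorm_region_le_of_ref hC0 (pull := piolaPull)
    (fun j => eLpNorm_piolaPull_le hκ (T.area_ne j) (hT j))
    (fun j => eLpNorm_le_piolaPull hκ (T.area_ne j) (hT j))
    (F := fun j t => vpeval (V j) t - vpeval (U j) t) (E := fun j t => vpeval (V j) t - τ t)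
    (fun j t ht => by simp only [Triangulation.paste_eq _ ht])
    (fun j t ht => by simp only [Triangulation.paste_eq _ ht]) fun j => ?_
  simp only [piolaPull_sub, ← hx', hU']
  exact (hle j).trans (by gcongr; exact hC _)

/-- Gradients: piecewise polynomials approximate a given piecewise polynomial field as well as
general functions do, up to a constant that depends only on the number of triangles, their shape
and the degree. -/
theorem exists_grad_stable (m q : ℕ) {κ : ℝ} (hκ : 0 ≤ κ) : ∃ C : ℝ, 0 ≤ C ∧
    ∀ T : Triangulation m, (∀ j, ShapeRegular κ (T.z j)) → ∀ dir : Set (Fin m × OEdge),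
    ∀ V : Fin m → Fin 2 → MvP, (∀ j, V j ∈ polySpace q) →
    ∀ (v : Plane → ℝ) (g : Plane → Plane), MemLp v 2 (volume.restrict T.region) →
      MemLp g 2 (volume.restrict T.region) → WeakGrad T.region v g →
      (∀ f ∈ dir, HasZeroTrace (openTri (T.z f.1)) (T.z f.1 (va f.2)) (T.z f.1 (vb f.2)) v g) →
    ∃ P : Fin m → MvP, (∀ j, (P j).totalDegree ≤ q + 1) ∧
      WeakGrad T.region (T.paste fun j => peval (P j)) (T.paste fun j => vpeval (pgrad (P j))) ∧
      (∀ f ∈ dir, ∀ t : ℝ,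
        peval (P f.1) (AffineMap.lineMap (T.z f.1 (va f.2)) (T.z f.1 (vb f.2)) t) = 0) ∧
      eLpNorm (fun x => T.paste (fun j => vpeval (V j)) x -
        T.paste (fun j => vpeval (pgrad (P j))) x) 2 (volume.restrict T.region) ≤
        ENNReal.ofReal C *
        eLpNorm (fun x => T.paste (fun j => vpeval (V j)) x - g x) 2
          (volume.restrict T.region) := by
  -- There are only finitely many ways to glue `m` triangles and to select edges.
  choose c hc h using fun k : Gluing m × Set (Fin m × OEdge) => exists_grad_const m q (polySpace q)
    (fun V hV => mem_polySpace.1 hV) k.1 k.2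
  obtain ⟨C, hC⟩ := Finite.exists_le c
  have hC0 : 0 ≤ C := (hc (∅, ∅)).trans (hC _)
  refine ⟨m * (2 * √κ) * C * (m * (2 * √κ)), by positivity,
    fun T hT dir V hV v g hv hg hW hdir => ?_⟩
  choose x hx hx' using fun j => exists_vpeval_eq_gradPull (z := T.z j) (hV j)
  have hres : ∀ j, volume.restrict (openTri (T.z j)) ≤ volume.restrict T.region := fun j =>
    Measure.restrict_mono (Triangulation.openTri_subset_region j) le_rfl
  have hmem : ∀ j, MemLp (gradPull (T.z j) g) 2 μref := fun j =>
    (ContinuousLinearMap.adjoint (edgeMap (T.z j))).comp_memLp'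
      (memLp_comp_affMap (T.area_ne j) (hg.mono_measure (hres j)))
  obtain ⟨Y, hY, hYc, hle⟩ := h (T.gluing, dir) x hx _ _
    (fun j => memLp_comp_affMap (T.area_ne j) (hv.mono_measure (hres j))) hmem
    (Triangulation.gradCond_pull hv hg hW hdir)
  choose P hP h1 h2 using fun j => exists_peval_affMap_eq (T.area_ne j) (Y j)
  refine ⟨P, fun j => (hP j).trans (hY j), ?_, fun f hf t => ?_, ?_⟩
  · have := T.weakGrad_paste (v := fun j => peval (P j)) (fun j => contDiff_peval _)
      fun f f' hf => hf.peval_eq fun a ha => by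
        rw [Triangulation.traceForm_of_pull (T.area_ne _) _ ha (h1 _) (h2 _),
          Triangulation.traceForm_of_pull (T.area_ne _) _ ha (h1 _) (h2 _)]
        exact hYc.2.1 f f' hf a ha
    simpa only [gradient_peval] using this
  · refine peval_eq_zero_of_traceForm (T.area_ne _) (fun a ha => ?_) t
    rw [Triangulation.traceForm_of_pull (T.area_ne _) _ ha (h1 _) (h2 _)]
    exact hYc.2.2 f hf a ha
  · refine Triangulation.eLpNorm_region_le_of_ref hC0 (pull := gradPull)
      (fun j => eLpNorm_gradPull_le hκ (T.area_ne j) (hT j))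
      (fun j => eLpNorm_le_gradPull hκ (T.area_ne j) (hT j))
      (F := fun j t => vpeval (V j) t - vpeval (pgrad (P j)) t)
      (E := fun j t => vpeval (V j) t - g t)
      (fun j t ht => by simp only [Triangulation.paste_eq _ ht])
      (fun j t ht => by simp only [Triangulation.paste_eq _ ht]) fun j => ?_
    simp only [gradPull_sub, ← hx', h2]
    exact (hle j).trans (by gcongr; exact hC _)

/-! ### Surjectivity of the divergence on conforming Raviart-Thomas fields -/

/-- The field `B(x) (x - c)`. -/
def posField (B : MvP) (c : Plane) : Fin 2 → MvP := fun i =>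
  (MvPolynomial.C (-c i) * B) + MvPolynomial.X i * B

lemma vpeval_posField (B : MvP) (c x : Plane) : vpeval (posField B c) x = peval B x • (x - c) := by
  ext i; simp [posField, peval]; ring

lemma posField_mem {q : ℕ} {B : MvP} (hB : B.totalDegree ≤ q) (c : Plane) :
    posField B c ∈ rtSpace q :=
  mem_rtSpace.2 ⟨_, B, fun _ => totalDegree_C_mul_le hB _, hB, fun _ => rfl⟩

lemma vpeval_add (V W : Fin 2 → MvP) (x : Plane) : vpeval (V + W) x = vpeval V x + vpeval W x := by
  ext i; simp [peval_add]

lemma vpeval_smul (c : ℝ) (V : Fin 2 → MvP) (x : Plane) : vpeval (c • V) x = c • vpeval V x := by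
  ext i; simp [peval_smul]

lemma vpeval_zero (x : Plane) : vpeval 0 x = 0 := by ext i; simp [peval]

lemma vpeval_sum {ι : Type*} (s : Finset ι) (V : ι → Fin 2 → MvP) (x : Plane) :
    vpeval (∑ i ∈ s, V i) x = ∑ i ∈ s, vpeval (V i) x := by
  classical
  induction s using Finset.induction_on with
  | empty => simp [vpeval_zero]
  | insert i s hi ih => rw [Finset.sum_insert hi, Finset.sum_insert hi, vpeval_add, ih]

/-- The formal divergence as a linear map. -/
def pdivL : (Fin 2 → MvP) →ₗ[ℝ] MvP :=
  (MvPolynomial.pderiv (0 : Fin 2)).toLinearMap ∘ₗ LinearMap.proj 0 +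
    (MvPolynomial.pderiv (1 : Fin 2)).toLinearMap ∘ₗ LinearMap.proj 1

lemma pdivL_apply (V : Fin 2 → MvP) : pdivL V = pdiv V := rfl

lemma totalDegree_pdiv_le {q : ℕ} {V : Fin 2 → MvP} (hV : V ∈ rtSpace q) :
    (pdiv V).totalDegree ≤ q := by
  have := mem_polySpace.1 (rtSpace_le_polySpace q hV)
  have h : ∀ i, (MvPolynomial.pderiv i (V i)).totalDegree ≤ q := fun i =>
    (totalDegree_pderiv_le i _).trans (by have := this i; omega)
  exact (MvPolynomial.totalDegree_add _ _).trans (max_le (h 0) (h 1))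

lemma eqOn_zero_of_setIntegral {z : Fin 3 → Plane} (hz : area z ≠ 0) {f : Plane → ℝ}
    (hf : Continuous f) (h0 : ∀ x ∈ openTri z, 0 ≤ f x) (hi : ∫ x in openTri z, f x = 0) :
    ∀ x ∈ openTri z, f x = 0 := by
  have hae := (setIntegral_eq_zero_iff_of_nonneg_ae
    ((ae_restrict_iff' (measurableSet_openTri z)).2 (Eventually.of_forall h0))
    (integrableOn_openTri_of_continuous hz hf)).1 hi
  exact Measure.eqOn_of_ae_eq hae hf.continuousOn continuousOn_const
    (by rw [(isOpen_openTri z).interior_eq]; exact subset_closure)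

/-- The reversed oriented edge. -/
def OEdge.rev (e : OEdge) : OEdge := (e.1, !e.2)

lemma va_rev (e : OEdge) : va e.rev = vb e := by obtain ⟨i, b⟩ := e; cases b <;> rfl
lemma vb_rev (e : OEdge) : vb e.rev = va e := by obtain ⟨i, b⟩ := e; cases b <;> rfl

/-- The field `x - z (vo e)` is tangential to the two edges at the vertex `vo e`, and on the edge
`e` its normal component is constant. -/
lemma cross_sub_vo (z : Fin 3 → Plane) (e g : OEdge) (t : ℝ) :
    cross (z (vb g) - z (va g)) (AffineMap.lineMap (z (va g)) (z (vb g)) t - z (vo e)) =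
      oarea z e * ((if g = e then -1 else 0) + if g.rev = e then 1 else 0) := by
  obtain ⟨i, b⟩ := e
  obtain ⟨k, d⟩ := g
  fin_cases i <;> fin_cases k <;> cases b <;> cases d <;>
    simp [OEdge.rev, oarea, va, vb, vo, cross, AffineMap.lineMap_apply] <;> ring

lemma setIntegral_const_openTri {z : Fin 3 → Plane} (hz : area z ≠ 0) (c : ℝ) :
    ∫ _ in openTri z, c = c * (|area z| / 2) := by
  rw [setIntegral_openTri hz, setIntegral_refTri continuous_const]
  simp only [intervalIntegral.integral_const, sub_zero, smul_eq_mul]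
  rw [intervalIntegral.integral_mul_const, intervalIntegral.integral_sub (by simp) (by simp)]
  simp; ring

namespace Triangulation

variable {m : ℕ} (T : Triangulation m)

/-- Piecewise Raviart-Thomas fields with continuous normal components. -/
def rtConf (p : ℕ) : Submodule ℝ (Fin m → Fin 2 → MvP) where
  carrier := {V | (∀ j, V j ∈ rtSpace p) ∧ ∀ f f', T.Glue f f' → ∀ x ∈ openEdge (T.z f.1) f.2,
    cross (T.z f.1 (vb f.2) - T.z f.1 (va f.2)) (vpeval (V f.1) x) =
    cross (T.z f.1 (vb f.2) - T.z f.1 (va f.2)) (vpeval (V f'.1) x)}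
  zero_mem' := ⟨fun j => zero_mem _, fun f f' _ x _ => rfl⟩
  add_mem' := by
    rintro V W ⟨hV, hV'⟩ ⟨hW, hW'⟩
    refine ⟨fun j => add_mem (hV j) (hW j), fun f f' h x hx => ?_⟩
    simp only [Pi.add_apply, vpeval_add, cross_add_right, hV' f f' h x hx, hW' f f' h x hx]
  smul_mem' := by
    rintro c V ⟨hV, hV'⟩
    refine ⟨fun j => Submodule.smul_mem _ _ (hV j), fun f f' h x hx => ?_⟩
    simp only [Pi.smul_apply, vpeval_smul, cross_smul_right, hV' f f' h x hx]

variable {T}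

/-- A polynomial that is orthogonal to the divergences of the Raviart-Thomas fields with vanishing
normal component on the boundary of a triangle is constant. The test field is
`∑ λ_c (∇q ⬝ z_c) (x - z_c)`, for which the product with `∇q` is minus a variance. -/
lemma fderiv_eq_zero_of_orthogonal {p : ℕ} {Q : Fin m → MvP} (hQ : ∀ j, (Q j).totalDegree ≤ p)
    (h : ∀ V ∈ T.rtConf p,
      ∑ j, ∫ x in openTri (T.z j), peval (Q j) x * peval (pdiv (V j)) x = 0)
    (j : Fin m) (x : Plane) : fderiv ℝ (peval (Q j)) x = 0 := by
  classical
  set z := T.z j with hzdef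
  have hz : area z ≠ 0 := T.area_ne j
  set q := Q j with hq
  set D : Fin 3 → MvP := fun c => MvPolynomial.C (z c 0) * MvPolynomial.pderiv 0 q +
    MvPolynomial.C (z c 1) * MvPolynomial.pderiv 1 q with hD
  have hDe : ∀ c x, peval (D c) x = fderiv ℝ (peval q) x (z c) := fun c x => by
    rw [fderiv_peval, hD]; simp only [peval_add, peval_mul, peval_C]; ring
  -- the test field; each summand lies in the Raviart-Thomas space because `∇q` has a lower degree
  -- than `q`
  set w : Fin 2 → MvP := ∑ c, posField (baryPoly z c * D c) (z c) with hw
  have hwe : ∀ x, vpeval w x = ∑ c, (bary z c x * fderiv ℝ (peval q) x (z c)) • (x - z c) :=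
    fun x => by
      rw [hw, vpeval_sum]
      simp only [vpeval_posField, peval_mul, peval_baryPoly, hDe]
  have hdeg : ∀ c, (baryPoly z c * D c).totalDegree ≤ p := by
    intro c
    by_cases h0 : q.totalDegree = 0
    · have : D c = 0 := by simp [hD, pderiv_eq_zero_of_totalDegree h0]
      simp [this]
    · have h1 : (D c).totalDegree ≤ q.totalDegree - 1 :=
        (MvPolynomial.totalDegree_add _ _).trans (max_le
          (totalDegree_C_mul_le (totalDegree_pderiv_le 0 q) _)
          (totalDegree_C_mul_le (totalDegree_pderiv_le 1 q) _))
      have h2 : (baryPoly z c).totalDegree ≤ 1 := totalDegree_affPoly_le _ _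
      have h3 := MvPolynomial.totalDegree_mul (baryPoly z c) (D c)
      have h4 := hQ j
      rw [← hq] at h4
      omega
  have hwmem : w ∈ rtSpace p := Submodule.sum_mem _ fun c _ => posField_mem (hdeg c) _
  -- the normal components vanish on all edges
  have hn : ∀ (e : OEdge) (t : ℝ), cross (z (vb e) - z (va e))
      (vpeval w (AffineMap.lineMap (z (va e)) (z (vb e)) t)) = 0 := by
    intro e t
    rw [hwe, Fin.sum_univ_three, sum_oedge e fun c =>
      (bary z c (AffineMap.lineMap (z (va e)) (z (vb e)) t) *
      fderiv ℝ (peval q) (AffineMap.lineMap (z (va e)) (z (vb e)) t) (z c)) •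
      (AffineMap.lineMap (z (va e)) (z (vb e)) t - z c)]
    have ho : bary z (vo e) (AffineMap.lineMap (z (va e)) (z (vb e)) t) = 0 := by
      rw [bary_line, bary_vertex hz, bary_vertex hz]
      simp [(va_ne_vo e).symm, (vb_ne_vo e).symm]
    have c1 : cross (z (vb e) - z (va e))
        (AffineMap.lineMap (z (va e)) (z (vb e)) t - z (va e)) = 0 := by
      simp [cross, AffineMap.lineMap_apply]; ring
    have c2 : cross (z (vb e) - z (va e))
        (AffineMap.lineMap (z (va e)) (z (vb e)) t - z (vb e)) = 0 := by
      simp [cross, AffineMap.lineMap_apply]; ring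
    rw [ho]
    simp only [cross_add_right, cross_smul_right, c1, c2]
    simp [cross]
  have hVmem : (Pi.single j w : Fin m → Fin 2 → MvP) ∈ T.rtConf p := by
    have h0 : ∀ f : Fin m × OEdge, ∀ x ∈ openEdge (T.z f.1) f.2,
        cross (T.z f.1 (vb f.2) - T.z f.1 (va f.2))
          (vpeval ((Pi.single j w : Fin m → Fin 2 → MvP) f.1) x) = 0 := by
      rintro ⟨k, e⟩ x ⟨t, -, rfl⟩
      by_cases hk : k = j
      · subst hk; simp only [Pi.single_eq_same]; exact hn e t
      · simp only [Pi.single_eq_of_ne hk, vpeval_zero]; simp [cross]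
    refine ⟨fun k => ?_, fun f f' hf x hx => ?_⟩
    · by_cases hk : k = j
      · subst hk; rwa [Pi.single_eq_same]
      · rw [Pi.single_eq_of_ne hk]; exact zero_mem _
    · have h1 := h0 f' x (hf.openEdge_eq ▸ hx)
      rw [← hf.2.1, ← hf.2.2] at h1
      rw [h0 f x hx, h1]
  have h1 := h _ hVmem
  rw [Finset.sum_eq_single j] at h1
  rotate_left
  · intro k _ hk
    simp [Pi.single_eq_of_ne hk, pdiv, peval]
  · simp
  rw [Pi.single_eq_same] at h1
  have hqc : ContDiff ℝ 1 (peval q) := contDiff_peval q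
  -- integration by parts moves the divergence to `q`, without boundary terms
  have h2 : ∫ x in openTri z, dv (fun x => peval q x • vpeval w x) x = 0 := by
    rw [setIntegral_dv hz (F := fun x => peval q x • vpeval w x) (hqc.smul (contDiff_vpeval w))]
    simp [flux, cross_smul_right, hn]
  have hfc : Continuous fun x => fderiv ℝ (peval q) x (vpeval w x) :=
    (hqc.continuous_fderiv one_ne_zero).clm_apply (continuous_vpeval w)
  have h3 : ∫ x in openTri z, fderiv ℝ (peval q) x (vpeval w x) = 0 := by
    have e : ∀ x, dv (fun x => peval q x • vpeval w x) x =
        fderiv ℝ (peval q) x (vpeval w x) + peval q x * peval (pdiv w) x := fun x => by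
      rw [dv_smul (hqc.differentiable one_ne_zero x)
        ((contDiff_vpeval w (n := 1)).differentiable one_ne_zero x), dv_vpeval,
        mul_comm (peval q x)]
    simp only [e] at h2
    rw [integral_add (integrableOn_openTri_of_continuous hz hfc)
      (integrableOn_openTri_of_continuous hz
        (show Continuous fun x => peval q x * peval (pdiv w) x from
          (continuous_peval _).mul (continuous_peval _))), h1, add_zero] at h2
    exact h2
  -- the variance of the values `∇q ⬝ z_c` with respect to the weights `λ_c`, whose mean is `∇q ⬝
  -- x`
  set N : Plane → ℝ := fun x => ∑ c, bary z c x *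
    (fderiv ℝ (peval q) x (z c) - fderiv ℝ (peval q) x x) ^ 2 with hN
  have hNe : ∀ x, fderiv ℝ (peval q) x (vpeval w x) = -N x := by
    intro x
    have hx : fderiv ℝ (peval q) x x = ∑ c, bary z c x * fderiv ℝ (peval q) x (z c) := by
      have := congrArg (fderiv ℝ (peval q) x) (sum_bary_smul hz x)
      simpa [Fin.sum_univ_three] using this.symm
    have hs := sum_bary hz x
    rw [hwe, map_sum, hN]
    simp only [map_smul, map_sub, smul_eq_mul, Fin.sum_univ_three] at hx hs ⊢
    set M := fderiv ℝ (peval q) x x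
    linear_combination M * hx + M ^ 2 * hs
  have hNc : Continuous N := by
    have : N = fun x => -fderiv ℝ (peval q) x (vpeval w x) := by ext x; rw [hNe, neg_neg]
    rw [this]; exact hfc.neg
  have hN0 := eqOn_zero_of_setIntegral hz hNc
    (fun x hx => Finset.sum_nonneg fun c _ => mul_nonneg (hx c).le (sq_nonneg _)) (by
      simp only [hNe, integral_neg, neg_eq_zero] at h3; exact h3)
  have hgrad : ∀ x ∈ openTri z, fderiv ℝ (peval q) x = 0 := by
    intro x hx
    have hc : ∀ c, fderiv ℝ (peval q) x (z c) = fderiv ℝ (peval q) x x := by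
      intro c
      have := (Finset.sum_eq_zero_iff_of_nonneg (fun c _ =>
        mul_nonneg (hx c).le (sq_nonneg _))).1 (hN0 x hx) c (Finset.mem_univ _)
      have := (mul_eq_zero.1 this).resolve_left (hx c).ne'
      exact sub_eq_zero.1 (pow_eq_zero_iff two_ne_zero |>.1 this)
    ext v
    rw [← edgeMap_invMap hz v, edgeMap_apply]
    simp [hc]
  have hp : ∀ i, MvPolynomial.pderiv i q = 0 := by
    intro i
    have hne : (openTri z).Nonempty :=
      ⟨affMap z !₂[1 / 4, 1 / 4], (affMap_mem hz _).2 ((mem_refTri _).2 (by norm_num))⟩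
    refine eq_zero_of_peval_eq_zero (isOpen_openTri z) hne fun x hx => ?_
    have := fderiv_peval q x (EuclideanSpace.single i 1)
    rw [hgrad x hx] at this
    fin_cases i <;> simpa using this.symm
  ext v
  rw [fderiv_peval, hp, hp]; simp [peval]

/-- The basic Raviart-Thomas field attached to the oriented edge `(a, b)`, on the `j`-th triangle.
Its normal component on an oriented edge depends on the end points of this edge only. -/
def edgeField (T : Triangulation m) (a b : Plane) (j : Fin m) : Fin 2 → MvP :=
  open Classical in
  ∑ e : OEdge, if T.z j (va e) = a ∧ T.z j (vb e) = b then
    posField (MvPolynomial.C (oarea (T.z j) e)⁻¹) (T.z j (vo e)) else 0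

/-- The right-hand side depends on the end points of the edge only, so it is the same from both
sides of a common edge. -/
lemma cross_edgeField (a b : Plane) (f : Fin m × OEdge) {x : Plane}
    (hx : x ∈ openEdge (T.z f.1) f.2) :
    cross (T.z f.1 (vb f.2) - T.z f.1 (va f.2)) (vpeval (edgeField T a b f.1) x) =
      open Classical in
      (if T.z f.1 (va f.2) = a ∧ T.z f.1 (vb f.2) = b then -1 else 0) +
        if T.z f.1 (vb f.2) = a ∧ T.z f.1 (va f.2) = b then 1 else 0 := by
  classical
  obtain ⟨j, g⟩ := f
  obtain ⟨t, -, rfl⟩ := hx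
  simp only
  set z := T.z j with hz
  have hsum : ∀ (s : Finset OEdge) (F : OEdge → Plane) (u : Plane),
      cross u (∑ e ∈ s, F e) = ∑ e ∈ s, cross u (F e) := fun s F u => by
    simp only [← crossL_apply, map_sum]
  have hterm : ∀ e : OEdge, cross (z (vb g) - z (va g)) (vpeval
      (if z (va e) = a ∧ z (vb e) = b then
        posField (MvPolynomial.C (oarea z e)⁻¹) (z (vo e)) else 0)
      (AffineMap.lineMap (z (va g)) (z (vb g)) t)) =
      (if g = e then (if z (va e) = a ∧ z (vb e) = b then -1 else 0) else 0) +
      (if g.rev = e then (if z (va e) = a ∧ z (vb e) = b then 1 else 0) else 0) := by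
    intro e
    by_cases he : z (va e) = a ∧ z (vb e) = b
    · simp only [if_pos he]
      rw [vpeval_posField, peval_C, cross_smul_right, cross_sub_vo, inv_mul_cancel_left₀]
      exact oarea_ne (T.area_ne j) e
    · simp only [if_neg he, vpeval_zero, ite_self]
      simp [cross]
  rw [edgeField, vpeval_sum, hsum, Finset.sum_congr rfl fun e _ => hterm e,
    Finset.sum_add_distrib, Finset.sum_ite_eq, Finset.sum_ite_eq]
  simp only [Finset.mem_univ, if_true, va_rev, vb_rev]

lemma edgeField_mem (p : ℕ) (a b : Plane) : edgeField T a b ∈ T.rtConf p := by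
  classical
  refine ⟨fun j => Submodule.sum_mem _ fun e _ => ?_, fun f f' h x hx => ?_⟩
  · split_ifs
    · exact posField_mem (by simp) _
    · exact zero_mem _
  · have h1 := cross_edgeField a b f' (h.openEdge_eq ▸ hx)
    rw [← h.2.1, ← h.2.2] at h1
    rw [h1, cross_edgeField a b f hx]

lemma pdiv_edgeField (a b : Plane) (j : Fin m) (x : Plane) :
    peval (pdiv (edgeField T a b j)) x =
      open Classical in
      ∑ e : OEdge, if T.z j (va e) = a ∧ T.z j (vb e) = b then 2 / oarea (T.z j) e else 0 := by
  classical
  rw [edgeField, ← pdivL_apply, map_sum, peval_sum]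
  refine Finset.sum_congr rfl fun e _ => ?_
  split_ifs
  · rw [pdivL_apply, pdiv, peval_add]
    simp [posField, peval, MvPolynomial.pderiv_X]
    ring
  · simp [peval]

/-- The only field that is piecewise constant and orthogonal to the divergences of the conforming
Raviart-Thomas fields is zero: testing with `edgeField` shows that the constants of neighbouring
triangles agree and that those of triangles with a boundary edge vanish, so that `c ^ 2 • x` has
continuous normal components. -/
lemma const_eq_zero_of_orthogonal {p : ℕ} {c : Fin m → ℝ}
    (h : ∀ V ∈ T.rtConf p, ∑ j, ∫ x in openTri (T.z j), c j * peval (pdiv (V j)) x = 0)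
    (j : Fin m) : c j = 0 := by
  classical
  have h1 : ∀ a b : Plane, ∑ f : Fin m × OEdge,
      (if T.z f.1 (va f.2) = a ∧ T.z f.1 (vb f.2) = b then
        c f.1 * (|area (T.z f.1)| / oarea (T.z f.1) f.2) else 0) = 0 := by
    intro a b
    refine Eq.trans ?_ (h _ (edgeField_mem p a b))
    rw [Fintype.sum_prod_type]
    refine Finset.sum_congr rfl fun j _ => ?_
    simp only [pdiv_edgeField]
    rw [setIntegral_const_openTri (T.area_ne j), Finset.mul_sum, Finset.sum_mul]
    refine Finset.sum_congr rfl fun e _ => ?_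
    split_ifs <;> ring
  have hne : ∀ f : Fin m × OEdge, |area (T.z f.1)| / oarea (T.z f.1) f.2 ≠ 0 := fun f =>
    div_ne_zero (abs_ne_zero.2 (T.area_ne _)) (oarea_ne (T.area_ne _) _)
  have hends : ∀ f g : Fin m × OEdge, T.z g.1 (va g.2) = T.z f.1 (va f.2) →
      T.z g.1 (vb g.2) = T.z f.1 (vb f.2) → g = f ∨ T.Glue f g := by
    intro f g ha hb
    by_cases hj : g.1 = f.1
    · left
      obtain ⟨j, e⟩ := f; obtain ⟨k, e'⟩ := g
      simp only at hj; subst hj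
      have hinj := vertex_injective (T.area_ne k)
      rw [oedge_ext e' e (hinj ha) (hinj hb)]
    · exact Or.inr ⟨fun h => hj h.symm, ha.symm, hb.symm⟩
  -- on an edge without a neighbour, the test field is supported in one triangle
  have hbd : ∀ f : Fin m × OEdge, (¬ ∃ f', T.Glue f f') → c f.1 = 0 := by
    intro f hf
    have h2 := h1 (T.z f.1 (va f.2)) (T.z f.1 (vb f.2))
    rw [Finset.sum_eq_single f] at h2
    · rw [if_pos ⟨rfl, rfl⟩] at h2
      exact (mul_eq_zero.1 h2).resolve_right (hne f)
    · intro g _ hg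
      refine if_neg fun hh => ?_
      exact (hends f g hh.1 hh.2).elim hg fun hh => hf ⟨g, hh⟩
    · simp
  have hgl : ∀ f f' : Fin m × OEdge, T.Glue f f' → c f.1 = c f'.1 := by
    intro f f' hf
    have h2 := h1 (T.z f.1 (va f.2)) (T.z f.1 (vb f.2))
    have hff : f ≠ f' := fun h => hf.1 (by rw [h])
    rw [Fintype.sum_eq_add f f' hff] at h2
    · rw [if_pos ⟨rfl, rfl⟩, if_pos ⟨hf.2.1.symm, hf.2.2.symm⟩] at h2
      have hs : |area (T.z f'.1)| / oarea (T.z f'.1) f'.2 =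
          -(|area (T.z f.1)| / oarea (T.z f.1) f.2) := by
        have := hf.sign_eq
        rw [← inv_div, this, ← inv_div (oarea _ _), inv_neg]
      rw [hs] at h2
      have h3 : (c f.1 - c f'.1) * (|area (T.z f.1)| / oarea (T.z f.1) f.2) = 0 := by linarith
      exact sub_eq_zero.1 ((mul_eq_zero.1 h3).resolve_right (hne f))
    · intro g hg
      refine if_neg fun hh => ?_
      rcases hends f g hh.1 hh.2 with h3 | h3
      · exact hg.1 h3
      · exact hg.2 (hf.unique h3).symm
  -- the divergence of `c ^ 2 • x` is nonnegative and has integral zero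
  have h4 := sum_integral_dv_eq_zero (T := T) (F := fun j x => c j ^ 2 • x)
    (fun j => contDiff_id.const_smul (c j ^ 2))
    (fun f f' hf x _ => by simp only [hgl f f' hf])
    (fun f hf x _ => by simp [hbd f hf, cross])
  have h5 : ∀ j, ∫ x in openTri (T.z j), dv (fun x : Plane => c j ^ 2 • x) x =
      c j ^ 2 * |area (T.z j)| := by
    intro j
    have : dv (fun x : Plane => c j ^ 2 • x) = fun _ => 2 * c j ^ 2 := by
      ext x
      have : HasFDerivAt (fun x : Plane => c j ^ 2 • x)
          (c j ^ 2 • ContinuousLinearMap.id ℝ Plane) x :=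
        (hasFDerivAt_id x).const_smul (c j ^ 2)
      rw [dv, this.fderiv, trace_eq]
      simp; ring
    rw [this, setIntegral_const_openTri (T.area_ne j)]; ring
  simp only [h5] at h4
  have h6 := (Finset.sum_eq_zero_iff_of_nonneg fun j _ =>
    mul_nonneg (sq_nonneg (c j)) (abs_nonneg (area (T.z j)))).1 h4 j (Finset.mem_univ j)
  exact pow_eq_zero_iff two_ne_zero |>.1
    ((mul_eq_zero.1 h6).resolve_right (abs_ne_zero.2 (T.area_ne j)))

/-- The polynomials are constant by `fderiv_eq_zero_of_orthogonal`, and zero by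
`const_eq_zero_of_orthogonal`. -/
lemma eq_zero_of_orthogonal {p : ℕ} {Q : Fin m → MvP} (hQ : ∀ j, (Q j).totalDegree ≤ p)
    (h : ∀ V ∈ T.rtConf p,
      ∑ j, ∫ x in openTri (T.z j), peval (Q j) x * peval (pdiv (V j)) x = 0) (j : Fin m) :
    Q j = 0 := by
  have hc : ∀ j x, peval (Q j) x = peval (Q j) 0 := fun j x =>
    is_const_of_fderiv_eq_zero ((contDiff_peval (Q j) (n := 1)).differentiable one_ne_zero)
      (fun y => fderiv_eq_zero_of_orthogonal hQ h j y) x 0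
  have h0 := const_eq_zero_of_orthogonal (T := T) (c := fun j => peval (Q j) 0) (p := p)
    (fun V hV => by
      rw [← h V hV]
      refine Finset.sum_congr rfl fun j _ => ?_
      simp only [hc j])
  exact eq_zero_of_peval_eq_zero isOpen_univ univ_nonempty fun x _ => by rw [hc, h0]

/-- Pasted polynomials as elements of `L²`. -/
def pasteL2 (T : Triangulation m) : (Fin m → MvP) →ₗ[ℝ] Lp ℝ 2 (volume.restrict T.region) where
  toFun Q := (T.memLp_paste (F := fun j => peval (Q j)) fun j => continuous_peval _).toLp _
  map_add' Q R := by
    rw [← MemLp.toLp_add]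
    congr 1; ext x
    simp only [paste, Pi.add_apply, ← Finset.sum_add_distrib]
    refine Finset.sum_congr rfl fun j _ => ?_
    by_cases hx : x ∈ openTri (T.z j) <;> simp [hx, peval_add]
  map_smul' c Q := by
    rw [RingHom.id_apply, ← MemLp.toLp_const_smul]
    congr 1; ext x
    simp only [paste, Pi.smul_apply, Finset.smul_sum]
    refine Finset.sum_congr rfl fun j _ => ?_
    by_cases hx : x ∈ openTri (T.z j) <;> simp [hx, peval_smul]

lemma inner_pasteL2 (Q R : Fin m → MvP) : inner ℝ (T.pasteL2 Q) (T.pasteL2 R) =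
    ∑ j, ∫ x in openTri (T.z j), peval (Q j) x * peval (R j) x := by
  have h1 : ∀ Q : Fin m → MvP,
      T.pasteL2 Q =ᵐ[volume.restrict T.region] T.paste fun j => peval (Q j) := fun Q =>
    (T.memLp_paste (F := fun j => peval (Q j)) fun j => continuous_peval _).coeFn_toLp
  have hi : IntegrableOn (fun x => T.paste (fun j => peval (Q j)) x *
      T.paste (fun j => peval (R j)) x) T.region := MemLp.integrable_mul
    (T.memLp_paste (F := fun j => peval (Q j)) fun j => continuous_peval _)
    (T.memLp_paste (F := fun j => peval (R j)) fun j => continuous_peval _)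
  rw [L2.inner_def]
  refine Eq.trans ?_ ((setIntegral_region hi).trans ?_)
  · refine integral_congr_ae ?_
    filter_upwards [h1 Q, h1 R] with x e1 e2
    rw [e1, e2]; simp [mul_comm]
  · refine Finset.sum_congr rfl fun j _ => ?_
    refine setIntegral_congr_fun (measurableSet_openTri _) fun x hx => ?_
    simp only [paste_eq _ hx]

/-- The divergence maps the conforming Raviart-Thomas fields of order `p` onto the piecewise
polynomials of degree at most `p`. -/
theorem exists_pdiv_eq {p : ℕ} (Q : Fin m → MvP) (hQ : ∀ j, (Q j).totalDegree ≤ p) :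
    ∃ V ∈ T.rtConf p, ∀ j, pdiv (V j) = Q j := by
  let δ : (Fin m → Fin 2 → MvP) →ₗ[ℝ] (Fin m → MvP) :=
    LinearMap.pi fun j => pdivL ∘ₗ LinearMap.proj j
  let R : Submodule ℝ (Lp ℝ 2 (volume.restrict T.region)) :=
    ((T.rtConf p).map δ).map T.pasteL2
  have hfin : FiniteDimensional ℝ (T.rtConf p) := by
    let L : (Fin m → rtSpace p) →ₗ[ℝ] (Fin m → Fin 2 → MvP) := (rtSpace p).subtype.compLeft (Fin m)
    have hle : T.rtConf p ≤ LinearMap.range L := fun V hV => ⟨fun j => ⟨V j, hV.1 j⟩, rfl⟩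
    exact Submodule.finiteDimensional_of_le hle
  have : FiniteDimensional ℝ R := by infer_instance
  -- The part of `Q` orthogonal to the range of the divergence is a piecewise polynomial, so it is
  -- zero.
  obtain ⟨y, hy, w, hw, he⟩ := R.exists_add_mem_mem_orthogonal (T.pasteL2 Q)
  obtain ⟨_, ⟨V, hV, rfl⟩, rfl⟩ := hy
  refine ⟨V, hV, fun j => ?_⟩
  have hwe : w = T.pasteL2 (Q - δ V) := by rw [map_sub, he]; abel
  have h0 := eq_zero_of_orthogonal (T := T) (p := p) (Q := Q - δ V) (fun j => ?_) (fun W hW => ?_) j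
  · exact (sub_eq_zero.1 h0).symm
  · exact (MvPolynomial.totalDegree_sub _ _).trans
      (max_le (hQ j) (totalDegree_pdiv_le (hV.1 j)))
  · have h1 := hw (T.pasteL2 (δ W)) ⟨_, ⟨W, hW, rfl⟩, rfl⟩
    rw [hwe, real_inner_comm, inner_pasteL2] at h1
    exact h1

end Triangulation

/-! ### Functions with zero trace -/

/-- Approximation up to every tolerance, instead of a sequence. -/
lemma hasZeroTrace_iff {D : Set Plane} {a b : Plane} {v : Plane → ℝ} {g : Plane → Plane} :
    HasZeroTrace D a b v g ↔ ∀ ε : ℝ, 0 < ε → ∃ φ : Plane → ℝ, ContDiff ℝ ∞ φ ∧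
      eLpNorm (fun x => φ x - v x) 2 (volume.restrict D) ≤ ENNReal.ofReal ε ∧
      eLpNorm (fun x => gradient φ x - g x) 2 (volume.restrict D) ≤ ENNReal.ofReal ε ∧
      eLpNorm (fun t : ℝ => φ (AffineMap.lineMap a b t)) 2 (volume.restrict (Icc (0 : ℝ) 1)) ≤
        ENNReal.ofReal ε := by
  constructor
  · rintro ⟨φ, h, h1, h2, h3⟩ ε hε
    have hε' : 0 < ENNReal.ofReal ε := by simpa using hε
    obtain ⟨n, a1, a2, a3⟩ := ((h1.eventually (ge_mem_nhds hε')).and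
      ((h2.eventually (ge_mem_nhds hε')).and (h3.eventually (ge_mem_nhds hε')))).exists
    exact ⟨φ n, h n, a1, a2, a3⟩
  · intro h
    choose φ h0 h1 h2 h3 using fun n : ℕ => h (1 / (n + 1)) (by positivity)
    have hlim : Tendsto (fun n : ℕ => ENNReal.ofReal (1 / (n + 1))) atTop (𝓝 0) := by
      have := (ENNReal.continuous_ofReal.tendsto 0).comp
        (tendsto_one_div_add_atTop_nhds_zero_nat (𝕜 := ℝ))
      simpa [Function.comp_def] using this
    exact ⟨φ, h0, tendsto_of_tendsto_of_tendsto_of_le_of_le tendsto_const_nhds hlim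
        (fun _ => zero_le) h1,
      tendsto_of_tendsto_of_tendsto_of_le_of_le tendsto_const_nhds hlim (fun _ => zero_le) h2,
      tendsto_of_tendsto_of_tendsto_of_le_of_le tendsto_const_nhds hlim (fun _ => zero_le) h3⟩

lemma HasZeroTrace.congr {D : Set Plane} {a b : Plane} {v v' : Plane → ℝ} {g g' : Plane → Plane}
    (h : HasZeroTrace D a b v g) (hv : v =ᵐ[volume.restrict D] v')
    (hg : g =ᵐ[volume.restrict D] g') : HasZeroTrace D a b v' g' := by
  obtain ⟨φ, h0, h1, h2, h3⟩ := h
  refine ⟨φ, h0, ?_, ?_, h3⟩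
  · refine h1.congr fun n => eLpNorm_congr_ae ?_
    filter_upwards [hv] with x hx; rw [hx]
  · refine h2.congr fun n => eLpNorm_congr_ae ?_
    filter_upwards [hg] with x hx; rw [hx]

lemma gradient_add {φ ψ : Plane → ℝ} (hφ : ContDiff ℝ 1 φ) (hψ : ContDiff ℝ 1 ψ) (x : Plane) :
    gradient (fun x => φ x + ψ x) x = gradient φ x + gradient ψ x := by
  refine ext_inner_right ℝ fun d => ?_
  rw [inner_add_left, inner_gradient_left, inner_gradient_left, inner_gradient_left,
    fderiv_fun_add (hφ.differentiable one_ne_zero x) (hψ.differentiable one_ne_zero x)]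
  rfl

lemma gradient_const_mul {φ : Plane → ℝ} (hφ : ContDiff ℝ 1 φ) (c : ℝ) (x : Plane) :
    gradient (fun x => c * φ x) x = c • gradient φ x := by
  refine ext_inner_right ℝ fun d => ?_
  rw [inner_smul_left, inner_gradient_left, inner_gradient_left,
    fderiv_const_mul (hφ.differentiable one_ne_zero x)]
  rfl

lemma HasZeroTrace.add {D : Set Plane} {a b : Plane} {v v' : Plane → ℝ} {g g' : Plane → Plane}
    (h : HasZeroTrace D a b v g) (h' : HasZeroTrace D a b v' g')
    (hv : AEStronglyMeasurable v (volume.restrict D))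
    (hv' : AEStronglyMeasurable v' (volume.restrict D))
    (hg : AEStronglyMeasurable g (volume.restrict D))
    (hg' : AEStronglyMeasurable g' (volume.restrict D)) :
    HasZeroTrace D a b (fun x => v x + v' x) (fun x => g x + g' x) := by
  rw [hasZeroTrace_iff] at h h' ⊢
  intro ε hε
  obtain ⟨φ, c, h1, h2, h3⟩ := h (ε / 2) (by positivity)
  obtain ⟨φ', c', h1', h2', h3'⟩ := h' (ε / 2) (by positivity)
  have hsum : ENNReal.ofReal ε = ENNReal.ofReal (ε / 2) + ENNReal.ofReal (ε / 2) := by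
    rw [← ENNReal.ofReal_add (by positivity) (by positivity), add_halves]
  have g1 := contDiff_one_of_infty c
  have g1' := contDiff_one_of_infty c'
  refine ⟨fun x => φ x + φ' x, c.add c', ?_, ?_, ?_⟩
  · rw [hsum]
    refine le_trans (le_of_eq ?_) ((eLpNorm_add_le (c.continuous.aestronglyMeasurable.sub hv)
      (c'.continuous.aestronglyMeasurable.sub hv') one_le_two).trans (add_le_add h1 h1'))
    congr 1; ext x; simp only [Pi.add_apply, Pi.sub_apply]; ring
  · rw [hsum]
    refine le_trans (le_of_eq ?_) ((eLpNorm_add_le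
      ((continuous_gradient g1).aestronglyMeasurable.sub hg)
      ((continuous_gradient g1').aestronglyMeasurable.sub hg') one_le_two).trans
        (add_le_add h2 h2'))
    congr 1; ext x : 1
    simp only [Pi.add_apply, Pi.sub_apply, gradient_add g1 g1']; abel
  · rw [hsum]
    exact (eLpNorm_add_le (c.continuous.comp AffineMap.lineMap_continuous).aestronglyMeasurable
      (c'.continuous.comp AffineMap.lineMap_continuous).aestronglyMeasurable one_le_two).trans
        (add_le_add h3 h3')

lemma HasZeroTrace.const_smul {D : Set Plane} {a b : Plane} {v : Plane → ℝ} {g : Plane → Plane}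
    (h : HasZeroTrace D a b v g) (c : ℝ) :
    HasZeroTrace D a b (fun x => c * v x) (fun x => c • g x) := by
  obtain ⟨φ, h0, h1, h2, h3⟩ := h
  have hc : ∀ {u : ℕ → ℝ≥0∞}, Tendsto u atTop (𝓝 0) →
      Tendsto (fun n => ‖c‖ₑ * u n) atTop (𝓝 0) := fun hu => by
    simpa using ENNReal.Tendsto.const_mul hu (Or.inr enorm_ne_top)
  refine ⟨fun n x => c * φ n x, fun n => contDiff_const.mul (h0 n), ?_, ?_, ?_⟩
  · refine (hc h1).congr fun n => ?_
    rw [← eLpNorm_const_smul]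
    congr 1; ext x; simp; ring
  · refine (hc h2).congr fun n => ?_
    rw [← eLpNorm_const_smul]
    congr 1; ext x : 1
    simp [gradient_const_mul (contDiff_one_of_infty (h0 n)), smul_sub]
  · refine (hc h3).congr fun n => ?_
    rw [← eLpNorm_const_smul]
    rfl

lemma hasZeroTrace_of_contDiff {D : Set Plane} {a b : Plane} {v : Plane → ℝ}
    (hv : ContDiff ℝ ∞ v) (h0 : ∀ t : ℝ, v (AffineMap.lineMap a b t) = 0) :
    HasZeroTrace D a b v (gradient v) :=
  ⟨fun _ => v, fun _ => hv, by simp, by simp, by simp [h0]⟩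

lemma eLpNorm_sub_le_norm {D D' : Set Plane} (hD : D ⊆ D') {E : Type*} [NormedAddCommGroup E]
    (u w : Lp E 2 (volume.restrict D')) {ε : ℝ} (h : ‖u - w‖ ≤ ε) :
    eLpNorm (fun x => u x - w x) 2 (volume.restrict D) ≤ ENNReal.ofReal ε := by
  refine (eLpNorm_mono_measure _ (Measure.restrict_mono hD le_rfl)).trans ?_
  have e : eLpNorm (fun x => u x - w x) 2 (volume.restrict D') =
      eLpNorm (u - w : Lp E 2 (volume.restrict D')) 2 (volume.restrict D') :=
    eLpNorm_congr_ae (Lp.coeFn_sub u w).symm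
  rw [e, ← ENNReal.ofReal_toReal (Lp.eLpNorm_ne_top (u - w))]
  exact ENNReal.ofReal_le_ofReal h

/-- Functions with zero trace, as a closed subspace. -/
lemma exists_closed_zeroTrace {D D' : Set Plane} (hD : D ⊆ D') (a b : Plane) :
    ∃ V : Submodule ℝ (Lp ℝ 2 (volume.restrict D') × Lp Plane 2 (volume.restrict D')),
      IsClosed (V : Set (Lp ℝ 2 (volume.restrict D') × Lp Plane 2 (volume.restrict D'))) ∧
      ∀ p, p ∈ V ↔ HasZeroTrace D a b p.1 p.2 := by
  have hle := Measure.restrict_mono (μ := volume) hD le_rfl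
  have hae : ∀ {E : Type} {f g : Plane → E}, f =ᵐ[volume.restrict D'] g →
      f =ᵐ[volume.restrict D] g := fun h => ae_mono hle h
  have hm : ∀ {E : Type} [NormedAddCommGroup E] (u : Lp E 2 (volume.restrict D')),
      AEStronglyMeasurable u (volume.restrict D) := fun u =>
    (Lp.aestronglyMeasurable u).mono_measure hle
  let V : Submodule ℝ (Lp ℝ 2 (volume.restrict D') × Lp Plane 2 (volume.restrict D')) :=
    { carrier := {p | HasZeroTrace D a b p.1 p.2}
      zero_mem' := by
        have h := hasZeroTrace_of_contDiff (D := D) (a := a) (b := b) (v := fun _ => 0)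
          contDiff_const fun _ => rfl
        refine h.congr (hae (Lp.coeFn_zero _ _ _).symm) (hae ?_)
        have : gradient (fun _ : Plane => (0 : ℝ)) = 0 := by
          ext x : 1; simp [gradient]
        rw [this]; exact (Lp.coeFn_zero _ _ _).symm
      add_mem' := by
        intro p q hp hq
        exact (HasZeroTrace.add hp hq (hm _) (hm _) (hm _) (hm _)).congr
          (hae (Lp.coeFn_add _ _).symm) (hae (Lp.coeFn_add _ _).symm)
      smul_mem' := by
        intro c p hp
        exact (HasZeroTrace.const_smul hp c).congr (hae (Lp.coeFn_smul c p.1).symm)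
          (hae (Lp.coeFn_smul c p.2).symm) }
  refine ⟨V, ?_, fun p => Iff.rfl⟩
  refine isClosed_of_closure_subset fun p hp => ?_
  change HasZeroTrace D a b p.1 p.2
  rw [hasZeroTrace_iff]
  intro ε hε
  obtain ⟨q, hq, hpq⟩ := Metric.mem_closure_iff.1 hp (ε / 2) (by positivity)
  obtain ⟨φ, c, h1, h2, h3⟩ := hasZeroTrace_iff.1 hq (ε / 2) (by positivity)
  have hsum : ENNReal.ofReal ε = ENNReal.ofReal (ε / 2) + ENNReal.ofReal (ε / 2) := by
    rw [← ENNReal.ofReal_add (by positivity) (by positivity), add_halves]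
  have hn : ‖q - p‖ ≤ ε / 2 := by rw [← dist_eq_norm, dist_comm]; exact hpq.le
  have k1 := eLpNorm_sub_le_norm hD q.1 p.1 ((norm_fst_le (q - p)).trans hn)
  have k2 := eLpNorm_sub_le_norm hD q.2 p.2 ((norm_snd_le (q - p)).trans hn)
  refine ⟨φ, c, ?_, ?_, h3.trans (ENNReal.ofReal_le_ofReal (by linarith))⟩
  · rw [hsum]
    refine le_trans (le_of_eq ?_) ((eLpNorm_add_le (c.continuous.aestronglyMeasurable.sub (hm q.1))
      ((hm q.1).sub (hm p.1)) one_le_two).trans (add_le_add h1 k1))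
    congr 1; ext x; simp
  · rw [hsum]
    refine le_trans (le_of_eq ?_) ((eLpNorm_add_le
      ((continuous_gradient (contDiff_one_of_infty c)).aestronglyMeasurable.sub (hm q.2))
      ((hm q.2).sub (hm p.2)) one_le_two).trans (add_le_add h2 k2))
    congr 1; ext x : 1; simp

/-! ### The minimisation problems over a triangulation -/

lemma l2norm_eq_norm {D : Set Plane} {f : Plane → Plane} {u : Lp Plane 2 (volume.restrict D)}
    (h : f =ᵐ[volume.restrict D] u) : l2norm D f = ‖u‖ := by
  rw [l2norm, Lp.norm_def, eLpNorm_congr_ae h]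

lemma isRTOn_iff {q : ℕ} {D : Set Plane} {τ : Plane → Plane} :
    IsRTOn q D τ ↔ ∃ V ∈ rtSpace q, EqOn τ (vpeval V) D := by
  constructor
  · rintro ⟨A, B, hA, hB, h⟩
    refine ⟨fun i => A i + MvPolynomial.X i * B, mem_rtSpace.2 ⟨A, B, hA, hB, fun _ => rfl⟩,
      fun x hx => ?_⟩
    ext i
    simp [h x hx i, peval]
  · rintro ⟨V, hV, h⟩
    obtain ⟨A, B, hA, hB, hAB⟩ := mem_rtSpace.1 hV
    refine ⟨A, B, hA, hB, fun x hx i => ?_⟩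
    rw [h hx, vpeval_apply, hAB]
    simp [peval]

lemma WeakDiv.add_smul {D : Set Plane} {σ σ' : Plane → Plane} {ρ ρ' : Plane → ℝ}
    (h : WeakDiv D σ ρ) (h' : WeakDiv D σ' ρ') (hσ : IntegrableOn σ D) (hρ : IntegrableOn ρ D)
    (hσ' : IntegrableOn σ' D) (hρ' : IntegrableOn ρ' D) (c : ℝ) :
    WeakDiv D (fun x => σ x + c • σ' x) (fun x => ρ x + c * ρ' x) := by
  intro φ hφ
  have h1 := contDiff_one_of_infty hφ.1
  have e : pairing D (fun x => σ x + c • σ' x) (fun x => ρ x + c * ρ' x) φ =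
      pairing D σ ρ φ + c * pairing D σ' ρ' φ := by
    rw [pairing, pairing, pairing, ← integral_const_mul, ← integral_add
      (integrable_pairing hσ hρ h1 hφ.2.1) ((integrable_pairing hσ' hρ' h1 hφ.2.1).const_mul c)]
    refine integral_congr_ae (Eventually.of_forall fun x => ?_)
    simp only [map_add, map_smul, smul_eq_mul]; ring
  rw [e, h φ hφ, h' φ hφ]; simp

lemma WeakGrad.add_smul {D : Set Plane} {v v' : Plane → ℝ} {g g' : Plane → Plane}
    (h : WeakGrad D v g) (h' : WeakGrad D v' g') (hv : IntegrableOn v D) (hg : IntegrableOn g D)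
    (hv' : IntegrableOn v' D) (hg' : IntegrableOn g' D) (c : ℝ) :
    WeakGrad D (fun x => v x + c * v' x) (fun x => g x + c • g' x) := by
  intro d
  have := (h d).add_smul (h' d) (hv.smul_const d) (hg.inner_const d) (hv'.smul_const d)
    (hg'.inner_const d) c
  simpa only [inner_add_left, inner_smul_left, _root_.add_smul, smul_smul, conj_trivial] using this

namespace Triangulation

variable {m : ℕ} {T : Triangulation m}

lemma ae_eq_paste {E : Type*} [AddCommMonoid E] {f : Plane → E} {F : Fin m → Plane → E}
    (h : ∀ j, EqOn f (F j) (openTri (T.z j))) : f =ᵐ[volume.restrict T.region] T.paste F := by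
  filter_upwards [T.ae_mem_iUnion] with x hx
  obtain ⟨j, hj⟩ := mem_iUnion.1 hx
  rw [paste_eq F hj, h j hj]

/-- Pasted polynomial fields as elements of `L²`. -/
def pasteVL2 (T : Triangulation m) :
    (Fin m → Fin 2 → MvP) →ₗ[ℝ] Lp Plane 2 (volume.restrict T.region) where
  toFun Q := (T.memLp_paste (F := fun j => vpeval (Q j)) fun j => continuous_vpeval _).toLp _
  map_add' Q R := by
    rw [← MemLp.toLp_add]
    congr 1; ext x : 1
    simp only [paste, Pi.add_apply, ← Finset.sum_add_distrib]
    refine Finset.sum_congr rfl fun j _ => ?_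
    by_cases hx : x ∈ openTri (T.z j) <;> simp [hx, vpeval_add]
  map_smul' c Q := by
    rw [RingHom.id_apply, ← MemLp.toLp_const_smul]
    congr 1; ext x : 1
    simp only [paste, Pi.smul_apply, Finset.smul_sum]
    refine Finset.sum_congr rfl fun j _ => ?_
    by_cases hx : x ∈ openTri (T.z j) <;> simp [hx, vpeval_smul]

lemma coeFn_pasteVL2 (Q : Fin m → Fin 2 → MvP) :
    T.pasteVL2 Q =ᵐ[volume.restrict T.region] T.paste fun j => vpeval (Q j) :=
  (T.memLp_paste (F := fun j => vpeval (Q j)) fun _ => continuous_vpeval _).coeFn_toLp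

lemma coeFn_pasteL2 (Q : Fin m → MvP) :
    T.pasteL2 Q =ᵐ[volume.restrict T.region] T.paste fun j => peval (Q j) :=
  (T.memLp_paste (F := fun j => peval (Q j)) fun _ => continuous_peval _).coeFn_toLp

end Triangulation

/-- The families with values in a subspace. -/
def familySpace (m : ℕ) {E : Type*} [AddCommGroup E] [Module ℝ E] (S : Submodule ℝ E) :
    Submodule ℝ (Fin m → E) := Submodule.pi univ fun _ => S

lemma mem_familySpace {m : ℕ} {E : Type*} [AddCommGroup E] [Module ℝ E] {S : Submodule ℝ E}
    {x : Fin m → E} : x ∈ familySpace m S ↔ ∀ j, x j ∈ S := by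
  simp [familySpace, Submodule.mem_pi]

instance (m : ℕ) {E : Type*} [AddCommGroup E] [Module ℝ E] (S : Submodule ℝ E)
    [FiniteDimensional ℝ S] : FiniteDimensional ℝ (familySpace m S) := by
  have hle : familySpace m S ≤ LinearMap.range (S.subtype.compLeft (Fin m)) := fun x hx =>
    ⟨fun j => ⟨x j, mem_familySpace.1 hx j⟩, rfl⟩
  exact Submodule.finiteDimensional_of_le hle

lemma exists_affine_pairing {D : Set Plane} (hD : volume D < ⊤) {r : Plane → ℝ}
    (hr : IntegrableOn r D) {φ : Plane → ℝ} (hφ : ContDiff ℝ 1 φ) (hc : HasCompactSupport φ) :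
    ∃ (L : Lp Plane 2 (volume.restrict D) →L[ℝ] ℝ) (c : ℝ),
      ∀ τ : Lp Plane 2 (volume.restrict D), pairing D τ r φ = L τ + c := by
  obtain ⟨L, hL⟩ := exists_clm_pairing_div hD hφ hc
  refine ⟨L, ∫ x in D, r x * φ x, fun τ => ?_⟩
  rw [hL, pairing, pairing, integral_add (integrable_fderiv_apply
    (MemLp_two_integrableOn hD (Lp.memLp τ)) hφ hc) (integrable_mul_test hr hφ.continuous hc)]
  simp

/-- An intersection of closed hyperplanes, one for each test function. -/
lemma isClosed_convex_weakDiv {D : Set Plane} (hD : volume D < ⊤) {r : Plane → ℝ}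
    (hr : IntegrableOn r D) :
    IsClosed {τ : Lp Plane 2 (volume.restrict D) | WeakDiv D τ r} ∧
      Convex ℝ {τ : Lp Plane 2 (volume.restrict D) | WeakDiv D τ r} := by
  choose! L c h using fun (φ : Plane → ℝ) (hφ : IsTest D φ) =>
    exists_affine_pairing hD hr (contDiff_one_of_infty hφ.1) hφ.2.1
  have e : {τ : Lp Plane 2 (volume.restrict D) | WeakDiv D τ r} =
      ⋂ (φ) (_ : IsTest D φ), {τ | L φ τ = -c φ} := by
    ext τ
    simp only [mem_ofPred_eq, WeakDiv, mem_iInter]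
    refine forall₂_congr fun φ hφ => ?_
    rw [h φ hφ, add_eq_zero_iff_eq_neg]
  rw [e]
  exact ⟨isClosed_iInter fun φ => isClosed_iInter fun _ =>
      isClosed_eq (L φ).continuous continuous_const,
    convex_iInter fun φ => convex_iInter fun _ =>
      convex_hyperplane (L φ).toLinearMap.isLinear _⟩

/-- The two minimisation problems over fields with prescribed divergence. -/
theorem exists_div_minima (m p : ℕ) {κ : ℝ} (hκ : 0 ≤ κ) : ∃ C : ℝ, 0 ≤ C ∧
    ∀ T : Triangulation m, (∀ j, ShapeRegular κ (T.z j)) →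
    ∀ G : Plane → Plane, (∀ j, IsRTOn p (openTri (T.z j)) G) →
    ∀ r : Plane → ℝ, (∀ j, IsPolyOn p (openTri (T.z j)) r) → ∃ a b : ℝ,
      IsLeast {t | ∃ τ, IsHdiv T.region τ r ∧ t = l2norm T.region fun x => τ x + G x} a ∧
      IsLeast {t | ∃ τ, IsHdiv T.region τ r ∧ (∀ j, IsRTOn p (openTri (T.z j)) τ) ∧
        t = l2norm T.region fun x => τ x + G x} b ∧ b ≤ C * a := by
  obtain ⟨C, hC, hst⟩ := exists_div_stable m p hκ
  refine ⟨C, hC, fun T hT G hG r hr => ?_⟩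
  have hD := T.volume_region_lt_top
  choose VG hVG hG' using fun j => isRTOn_iff.1 (hG j)
  choose Q hQ hr' using hr
  obtain ⟨V0, hV0, hdiv⟩ := T.exists_pdiv_eq Q hQ
  have er : r =ᵐ[volume.restrict T.region] T.paste fun j => peval (Q j) :=
    Triangulation.ae_eq_paste hr'
  have hrm : MemLp r 2 (volume.restrict T.region) :=
    (memLp_congr_ae er).2 (T.memLp_paste fun j => continuous_peval _)
  have hri := MemLp_two_integrableOn hD hrm
  have eG : G =ᵐ[volume.restrict T.region] T.pasteVL2 VG :=
    (Triangulation.ae_eq_paste hG').trans (T.coeFn_pasteVL2 VG).symm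
  have hW0 : WeakDiv T.region (T.paste fun j => vpeval (V0 j)) r := by
    have := T.weakDiv_paste (F := fun j => vpeval (V0 j)) (fun j => contDiff_vpeval _) hV0.2
    simp only [dv_vpeval, hdiv] at this
    exact this.congr (EventuallyEq.refl _ _) er.symm
  obtain ⟨hcl, hcv⟩ := isClosed_convex_weakDiv hD hri
  set S := {τ : Lp Plane 2 (volume.restrict T.region) | WeakDiv T.region τ r}
  set R := (familySpace m (rtSpace p)).map T.pasteVL2
  have h0S : T.pasteVL2 V0 ∈ S := hW0.congr (T.coeFn_pasteVL2 V0).symm (EventuallyEq.refl _ _)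
  have h0R : T.pasteVL2 V0 ∈ R := ⟨V0, mem_familySpace.2 hV0.1, rfl⟩
  set g := T.pasteVL2 VG
  obtain ⟨s, hs, hmin⟩ := exists_isLeast_norm_add ⟨_, h0S⟩ hcv hcl g
  obtain ⟨s', ⟨hs', V', hV', hVs'⟩, hmin'⟩ := exists_isLeast_norm_add (S := S ∩ R)
    ⟨_, h0S, h0R⟩ (hcv.inter R.convex) (hcl.inter R.closed_of_finiteDimensional) g
  -- classes of fields and their norms
  have hnorm : ∀ (τ : Plane → Plane) (u : Lp Plane 2 (volume.restrict T.region)),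
      τ =ᵐ[volume.restrict T.region] u → l2norm T.region (fun x => τ x + G x) = ‖u + g‖ := by
    intro τ u h
    refine l2norm_eq_norm ?_
    filter_upwards [h, eG, Lp.coeFn_add u g] with x h1 h2 h3
    rw [h1, h2, h3]; rfl
  have hlow : ∀ τ, IsHdiv T.region τ r → ∃ u ∈ S, τ =ᵐ[volume.restrict T.region] u := by
    intro τ h
    obtain ⟨h1, -, h3⟩ := (isHdiv_iff hD).1 h
    exact ⟨h1.toLp τ, h3.congr h1.coeFn_toLp.symm (EventuallyEq.refl _ _), h1.coeFn_toLp.symm⟩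
  have hpaste : ∀ V : Fin m → Fin 2 → MvP, (∀ j, V j ∈ rtSpace p) →
      ∀ j, IsRTOn p (openTri (T.z j)) (T.paste fun j => vpeval (V j)) := fun V hV j =>
    isRTOn_iff.2 ⟨V j, hV j, fun x hx => T.paste_eq _ hx⟩
  have hleast' : IsLeast {t | ∃ τ, IsHdiv T.region τ r ∧ (∀ j, IsRTOn p (openTri (T.z j)) τ) ∧
        t = l2norm T.region fun x => τ x + G x} ‖s' + g‖ := by
    have e' := T.coeFn_pasteVL2 V'
    rw [hVs'] at e'
    refine ⟨⟨T.paste fun j => vpeval (V' j), (isHdiv_iff hD).2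
      ⟨T.memLp_paste fun j => continuous_vpeval _, hrm, hs'.congr e' (EventuallyEq.refl _ _)⟩,
      hpaste V' (mem_familySpace.1 hV'), (hnorm _ _ e'.symm).symm⟩, ?_⟩
    rintro _ ⟨τ, hτ, hτ', rfl⟩
    obtain ⟨u, hu, e⟩ := hlow τ hτ
    rw [hnorm τ u e]
    choose V hV hVe using fun j => isRTOn_iff.1 (hτ' j)
    refine hmin' u ⟨hu, V, mem_familySpace.2 hV, ?_⟩
    exact Lp.ext ((T.coeFn_pasteVL2 V).trans ((Triangulation.ae_eq_paste hVe).symm.trans e))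
  refine ⟨‖s + g‖, ‖s' + g‖, ⟨⟨s, (isHdiv_iff hD).2 ⟨Lp.memLp s, hrm, hs⟩,
    (hnorm s s (EventuallyEq.refl _ _)).symm⟩, ?_⟩, hleast', ?_⟩
  · rintro _ ⟨τ, hτ, rfl⟩
    obtain ⟨u, hu, e⟩ := hlow τ hτ
    rw [hnorm τ u e]
    exact hmin u hu
  -- `s - V0` is divergence-free; correcting `V0` by a stable approximation `U` of it gives a
  -- competitor for the discrete minimum
  have hm0 : MemLp (T.paste fun j => vpeval (V0 j)) 2 (volume.restrict T.region) :=
    T.memLp_paste fun j => continuous_vpeval _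
  have hi0 := MemLp_two_integrableOn hD hm0
  have hdf : WeakDiv T.region (fun x => s x - T.paste (fun j => vpeval (V0 j)) x) 0 := by
    refine (hs.add_smul hW0 (MemLp_two_integrableOn hD (Lp.memLp s)) hri hi0 hri (-1)).congr ?_ ?_
    · exact Eventually.of_forall fun x => by simp [sub_eq_add_neg]
    · exact Eventually.of_forall fun x => by simp
  obtain ⟨U, hU, hWU, hle⟩ := hst T hT (fun j => -(VG j + V0 j))
    (fun j => neg_mem (add_mem (hVG j) (hV0.1 j))) _ ((Lp.memLp s).sub hm0) hdf
  have hmU : MemLp (T.paste fun j => vpeval (U j)) 2 (volume.restrict T.region) :=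
    T.memLp_paste fun j => continuous_vpeval _
  have hsum : T.pasteVL2 (V0 + U) =ᵐ[volume.restrict T.region] fun x =>
      T.paste (fun j => vpeval (V0 j)) x + (1 : ℝ) • T.paste (fun j => vpeval (U j)) x := by
    rw [map_add]
    filter_upwards [Lp.coeFn_add (T.pasteVL2 V0) (T.pasteVL2 U), T.coeFn_pasteVL2 V0,
      T.coeFn_pasteVL2 U] with x h1 h2 h3
    rw [h1, Pi.add_apply, h2, h3, one_smul]
  have hWh := hW0.add_smul hWU hi0 hri (MemLp_two_integrableOn hD hmU) (integrable_zero _ _ _) 1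
  have hvs : ∀ V : Fin m → Fin 2 → MvP, V ∈ familySpace m (rtSpace p) →
      WeakDiv T.region (T.pasteVL2 V) r → ‖s' + g‖ ≤ ‖T.pasteVL2 V + g‖ := fun V h1 h2 =>
    hmin' _ ⟨h2, V, h1, rfl⟩
  refine (hvs (V0 + U) (mem_familySpace.2 fun j => add_mem (hV0.1 j) (hU j)) (hWh.congr hsum.symm
    (Eventually.of_forall fun x => by simp))).trans ?_
  have hneg : (T.paste fun j => vpeval (-(VG j + V0 j))) =ᵐ[volume.restrict T.region]
      fun x => -(g x + T.paste (fun j => vpeval (V0 j)) x) := by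
    filter_upwards [T.coeFn_pasteVL2 (-(VG + V0)), Lp.coeFn_neg (T.pasteVL2 (VG + V0)),
      Lp.coeFn_add (T.pasteVL2 VG) (T.pasteVL2 V0), T.coeFn_pasteVL2 V0] with x h1 h2 h3 h4
    rw [map_neg, h2, Pi.neg_apply, map_add, h3, Pi.add_apply, h4] at h1
    exact h1.symm
  have e1 : eLpNorm (fun x => T.paste (fun j => vpeval (-(VG j + V0 j))) x -
      T.paste (fun j => vpeval (U j)) x) 2 (volume.restrict T.region) =
      eLpNorm (T.pasteVL2 (V0 + U) + g : Lp Plane 2 (volume.restrict T.region)) 2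
        (volume.restrict T.region) := by
    rw [← eLpNorm_neg]
    refine eLpNorm_congr_ae ?_
    filter_upwards [hneg, hsum, Lp.coeFn_add (T.pasteVL2 (V0 + U)) g] with x h1 h2 h3
    rw [Pi.neg_apply, h1, h3, Pi.add_apply, h2, one_smul]; abel
  have e2 : eLpNorm (fun x => T.paste (fun j => vpeval (-(VG j + V0 j))) x -
      (s x - T.paste (fun j => vpeval (V0 j)) x)) 2 (volume.restrict T.region) =
      eLpNorm (s + g : Lp Plane 2 (volume.restrict T.region)) 2 (volume.restrict T.region) := by
    rw [← eLpNorm_neg]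
    refine eLpNorm_congr_ae ?_
    filter_upwards [hneg, Lp.coeFn_add s g] with x h1 h3
    rw [Pi.neg_apply, h1, h3, Pi.add_apply]; abel
  replace hle := hle.trans_eq (congrArg _ e2)
  rw [e1] at hle
  rw [Lp.norm_def, Lp.norm_def, ← ENNReal.toReal_ofReal hC, ← ENNReal.toReal_mul]
  exact ENNReal.toReal_mono (ENNReal.mul_ne_top ENNReal.ofReal_ne_top (Lp.eLpNorm_ne_top _)) hle

/-- `v`, with weak gradient `g`, belongs to `H¹(D)`, has mean value zero if `mean` holds, and has
zero trace on the given edges of the given triangles. -/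
def IsHt {m : ℕ} (T : Triangulation m) (mean : Prop) (dir : Set (Fin m × OEdge)) (v : Plane → ℝ)
    (g : Plane → Plane) : Prop :=
  IsH1 T.region v g ∧ (mean → ∫ x in T.region, v x = 0) ∧
    ∀ f ∈ dir, HasZeroTrace (openTri (T.z f.1)) (T.z f.1 (va f.2)) (T.z f.1 (vb f.2)) v g

section

variable {m : ℕ} {T : Triangulation m} {mean : Prop} {dir : Set (Fin m × OEdge)}

lemma IsHt.congr {v v' : Plane → ℝ} {g g' : Plane → Plane} (h : IsHt T mean dir v g)
    (hv : v =ᵐ[volume.restrict T.region] v') (hg : g =ᵐ[volume.restrict T.region] g') :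
    IsHt T mean dir v' g' := by
  have hD := T.volume_region_lt_top
  obtain ⟨h1, h2, h3⟩ := h
  obtain ⟨a, b, c⟩ := (isH1_iff hD).1 h1
  have hle : ∀ j, volume.restrict (openTri (T.z j)) ≤ volume.restrict T.region := fun j =>
    Measure.restrict_mono (T.openTri_subset_region j) le_rfl
  exact ⟨(isH1_iff hD).2 ⟨(memLp_congr_ae hv).1 a, (memLp_congr_ae hg).1 b, c.congr hv hg⟩,
    fun hm => by rw [← integral_congr_ae hv, h2 hm],
    fun f hf => (h3 f hf).congr (ae_mono (hle _) hv) (ae_mono (hle _) hg)⟩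

/-- All the conditions pass to limits in `L² × L²`. -/
lemma exists_closed_isHt (T : Triangulation m) (mean : Prop) (dir : Set (Fin m × OEdge)) :
    ∃ V : Submodule ℝ (Lp ℝ 2 (volume.restrict T.region) × Lp Plane 2 (volume.restrict T.region)),
      IsClosed (V : Set (Lp ℝ 2 (volume.restrict T.region) ×
        Lp Plane 2 (volume.restrict T.region))) ∧ ∀ p, p ∈ V ↔ IsHt T mean dir p.1 p.2 := by
  have hD := T.volume_region_lt_top
  choose! L hL using fun (d : Plane) (φ : Plane → ℝ) (hφ : IsTest T.region φ) =>
    exists_clm_pairing_grad hD (contDiff_one_of_infty hφ.1) hφ.2.1 d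
  choose W hW hW' using fun f : Fin m × OEdge => exists_closed_zeroTrace
    (T.openTri_subset_region f.1) (T.z f.1 (va f.2)) (T.z f.1 (vb f.2))
  have h1m : MemLp (fun _ : Plane => (1 : ℝ)) 2 (volume.restrict T.region) := memLp_const 1
  let I : Lp ℝ 2 (volume.restrict T.region) →L[ℝ] ℝ := innerSL ℝ (h1m.toLp _)
  have hI : ∀ u, I u = ∫ x in T.region, u x := by
    intro u
    change inner ℝ (h1m.toLp _) u = _
    rw [L2.inner_def]
    refine integral_congr_ae ?_
    filter_upwards [h1m.coeFn_toLp] with x hx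
    rw [hx]; simp
  let I' := I.comp (ContinuousLinearMap.fst ℝ (Lp ℝ 2 (volume.restrict T.region))
    (Lp Plane 2 (volume.restrict T.region)))
  refine ⟨(⨅ (d : Plane) (φ) (_ : IsTest T.region φ), (L d φ).ker) ⊓
    ((⨅ _ : mean, I'.ker) ⊓ ⨅ f ∈ dir, W f), ?_, fun p => ?_⟩
  · simp only [Submodule.coe_inf, Submodule.coe_iInf]
    exact (isClosed_iInter fun d => isClosed_iInter fun φ => isClosed_iInter fun _ =>
      (L d φ).isClosed_ker).inter ((isClosed_iInter fun _ => I'.isClosed_ker).inter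
        (isClosed_iInter fun f => isClosed_iInter fun _ => hW f))
  · simp only [Submodule.mem_inf, Submodule.mem_iInf, LinearMap.mem_ker, IsHt, isH1_iff hD, hW']
    refine and_congr ⟨fun h => ⟨Lp.memLp _, Lp.memLp _, fun d φ hφ => ?_⟩, fun h d φ hφ => ?_⟩
      (and_congr (forall_congr' fun _ => ?_) Iff.rfl)
    · rw [← hL d φ hφ]; exact h d φ hφ
    · exact (hL d φ hφ p).trans (h.2.2 d φ hφ)
    · exact (hI p.1).congr_left

lemma IsHt.exists_mem {V : Submodule ℝ (Lp ℝ 2 (volume.restrict T.region) ×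
      Lp Plane 2 (volume.restrict T.region))} (hV : ∀ p, p ∈ V ↔ IsHt T mean dir p.1 p.2)
    {v : Plane → ℝ} {g : Plane → Plane} (h : IsHt T mean dir v g) :
    ∃ p ∈ V, v =ᵐ[volume.restrict T.region] p.1 ∧ g =ᵐ[volume.restrict T.region] p.2 := by
  have e1 := h.1.memLp.coeFn_toLp.symm
  have e2 := h.1.memLp_grad.coeFn_toLp.symm
  exact ⟨(h.1.memLp.toLp v, h.1.memLp_grad.toLp g), (hV _).2 (h.congr e1 e2), e1, e2⟩

/-- The pasted polynomials of degree at most `q`, as a subspace of `L²`. -/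
def pastedPoly (T : Triangulation m) (q : ℕ) : Submodule ℝ (Lp ℝ 2 (volume.restrict T.region)) :=
  (familySpace m (MvPolynomial.restrictTotalDegree (Fin 2) ℝ q)).map T.pasteL2

lemma mem_pastedPoly {q : ℕ} {u : Lp ℝ 2 (volume.restrict T.region)} : u ∈ pastedPoly T q ↔
    ∃ P : Fin m → MvP, (∀ j, (P j).totalDegree ≤ q) ∧ T.pasteL2 P = u := by
  simp only [pastedPoly, Submodule.mem_map, mem_familySpace,
    MvPolynomial.mem_restrictTotalDegree]

instance (q : ℕ) : FiniteDimensional ℝ (pastedPoly T q) := by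
  unfold pastedPoly; infer_instance

/-- Poincaré inequalities on the triangles: functions with a weak gradient are piecewise constant up
to a term that the gradient controls. -/
lemma exists_poincare_region (T : Triangulation m) : ∃ C : ℝ,
    ∀ (v : Lp ℝ 2 (volume.restrict T.region)) (g : Lp Plane 2 (volume.restrict T.region)),
      WeakGrad T.region v g → ∃ z ∈ pastedPoly T 0, ‖v - z‖ ≤ C * ‖g‖ := by
  choose C hC h using fun j => exists_poincare (convex_openTri (T.z j)) (isOpen_openTri _)
    ⟨affMap (T.z j) !₂[1 / 4, 1 / 4],
      (affMap_mem (T.area_ne j) _).2 ((mem_refTri _).2 (by norm_num))⟩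
    ((isCompact_closedTri (T.area_ne j)).isBounded.subset (openTri_subset_closedTri _))
  have hle : ∀ j, volume.restrict (openTri (T.z j)) ≤ volume.restrict T.region := fun j =>
    Measure.restrict_mono (T.openTri_subset_region j) le_rfl
  refine ⟨∑ j, C j, fun v g hW => ?_⟩
  choose c hc using fun j => h j v g ((Lp.memLp v).mono_measure (hle j))
    ((Lp.memLp g).mono_measure (hle j)) fun d => (hW d).mono T.measurableSet_region
      (T.openTri_subset_region j)
  refine ⟨T.pasteL2 fun j => MvPolynomial.C (c j), mem_pastedPoly.2 ⟨_, fun j => by simp, rfl⟩, ?_⟩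
  have hC0 : 0 ≤ ∑ j, C j := Finset.sum_nonneg fun j _ => hC j
  rw [Lp.norm_def, Lp.norm_def, ← ENNReal.toReal_ofReal hC0, ← ENNReal.toReal_mul]
  refine ENNReal.toReal_mono (ENNReal.mul_ne_top ENNReal.ofReal_ne_top (Lp.eLpNorm_ne_top _)) ?_
  rw [ENNReal.ofReal_sum_of_nonneg fun j _ => hC j, Finset.sum_mul]
  refine (Triangulation.eLpNorm_region_le _).trans (Finset.sum_le_sum fun j _ => ?_)
  refine le_trans (le_of_eq (eLpNorm_congr_ae ?_))
    ((hc j).trans (mul_le_mul_right (eLpNorm_mono_measure _ (hle j)) _))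
  filter_upwards [ae_mono (hle j) (Lp.coeFn_sub v (T.pasteL2 fun j => MvPolynomial.C (c j))),
    ae_mono (hle j) (T.coeFn_pasteL2 fun j => MvPolynomial.C (c j)),
    ae_restrict_mem (measurableSet_openTri _)] with x h1 h2 hx
  rw [h1, Pi.sub_apply, h2, T.paste_eq _ hx, peval_C]

/-- The gradients of a closed space of functions in `H¹` form a closed space. -/
lemma isClosed_map_snd_weakGrad {V : Submodule ℝ (Lp ℝ 2 (volume.restrict T.region) ×
      Lp Plane 2 (volume.restrict T.region))}
    (hV : IsClosed (V : Set (Lp ℝ 2 (volume.restrict T.region) ×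
      Lp Plane 2 (volume.restrict T.region)))) (h : ∀ p ∈ V, WeakGrad T.region p.1 p.2) :
    IsClosed ((V.map (LinearMap.snd ℝ _ _) : Submodule ℝ (Lp Plane 2 (volume.restrict T.region))) :
      Set (Lp Plane 2 (volume.restrict T.region))) := by
  obtain ⟨C, hC⟩ := exists_poincare_region T
  exact isClosed_map_snd V hV (pastedPoly T 0) (C := C) fun p hp => hC p.1 p.2 (h p hp)

lemma weakGrad_const (c : ℝ) : WeakGrad T.region (fun _ => c) 0 := by
  have := T.weakGrad_paste (v := fun _ _ => c) (fun _ => contDiff_const) fun _ _ _ _ _ => rfl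
  refine this.congr (Triangulation.ae_eq_paste fun j x _ => rfl).symm
    (Triangulation.ae_eq_paste fun j x _ => ?_).symm
  simp [gradient]

end

/-- The two minimisation problems over gradients. -/
theorem exists_grad_minima (m p : ℕ) {κ : ℝ} (hκ : 0 ≤ κ) : ∃ C : ℝ, 0 ≤ C ∧
    ∀ T : Triangulation m, (∀ j, ShapeRegular κ (T.z j)) →
    ∀ (mean : Prop) (dir : Set (Fin m × OEdge)), (mean → dir = ∅) →
    ∀ G : Plane → Plane, (∀ j, IsRTOn p (openTri (T.z j)) G) → ∃ a b : ℝ,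
      IsLeast {t | ∃ v g, IsHt T mean dir v g ∧ t = l2norm T.region fun x => G x - g x} a ∧
      IsLeast {t | ∃ v g, IsHt T mean dir v g ∧ (∀ j, IsPolyOn (p + 2) (openTri (T.z j)) v) ∧
        t = l2norm T.region fun x => G x - g x} b ∧ b ≤ C * a := by
  obtain ⟨C, hC, hst⟩ := exists_grad_stable m (p + 1) hκ
  refine ⟨C, hC, fun T hT mean dir hmd G hG => ?_⟩
  have hD := T.volume_region_lt_top
  choose VG hVG hG' using fun j => isRTOn_iff.1 (hG j)
  set u := T.pasteVL2 VG
  have eG : G =ᵐ[volume.restrict T.region] u :=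
    (Triangulation.ae_eq_paste hG').trans (T.coeFn_pasteVL2 VG).symm
  obtain ⟨V, hVc, hV⟩ := exists_closed_isHt T mean dir
  have hVW : ∀ p ∈ V, WeakGrad T.region p.1 p.2 := fun p hp =>
    ((isH1_iff hD).1 ((hV p).1 hp).1).2.2
  -- the admissible pairs with a polynomial first component, for which the gradients need not be
  -- prescribed to be polynomials
  set Y := V ⊓ (pastedPoly T (p + 2)).comap (LinearMap.fst ℝ (Lp ℝ 2 (volume.restrict T.region))
    (Lp Plane 2 (volume.restrict T.region)))
  have hYc : IsClosed (Y : Set (Lp ℝ 2 (volume.restrict T.region) ×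
      Lp Plane 2 (volume.restrict T.region))) :=
    hVc.inter ((Submodule.closed_of_finiteDimensional (pastedPoly T (p + 2))).preimage
      continuous_fst)
  obtain ⟨_, ⟨s, hs, rfl⟩, hmin⟩ := exists_isLeast_norm_add ⟨0, zero_mem _⟩
    (V.map (LinearMap.snd ℝ _ _)).convex (isClosed_map_snd_weakGrad hVc hVW) (-u)
  obtain ⟨_, ⟨s', hs', rfl⟩, hmin'⟩ := exists_isLeast_norm_add ⟨0, zero_mem _⟩
    (Y.map (LinearMap.snd ℝ _ _)).convex
    (isClosed_map_snd_weakGrad hYc fun p hp => hVW p hp.1) (-u)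
  simp only [LinearMap.snd_apply] at hmin hmin'
  have hnorm : ∀ (τ : Plane → Plane) (w : Lp Plane 2 (volume.restrict T.region)),
      τ =ᵐ[volume.restrict T.region] w → l2norm T.region (fun x => G x - τ x) = ‖w + -u‖ := by
    intro τ w h
    rw [← norm_neg, neg_add, neg_neg, neg_add_eq_sub]
    refine l2norm_eq_norm ?_
    filter_upwards [h, eG, Lp.coeFn_sub u w] with x h1 h2 h3
    rw [h1, h2, h3]; rfl
  have hlow : ∀ v g, IsHt T mean dir v g → (∀ j, IsPolyOn (p + 2) (openTri (T.z j)) v) →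
      ‖s'.2 + -u‖ ≤ l2norm T.region fun x => G x - g x := by
    intro v g h hv
    obtain ⟨q, hq, e1, e2⟩ := h.exists_mem hV
    rw [hnorm g _ e2]
    choose P hP hPe using hv
    refine hmin' _ ⟨q, ⟨hq, mem_pastedPoly.2 ⟨P, hP, ?_⟩⟩, rfl⟩
    exact Lp.ext ((T.coeFn_pasteL2 P).trans ((Triangulation.ae_eq_paste hPe).symm.trans e1))
  refine ⟨‖s.2 + -u‖, ‖s'.2 + -u‖, ⟨⟨s.1, s.2, (hV s).1 hs,
    (hnorm _ _ (EventuallyEq.refl _ _)).symm⟩, ?_⟩, ⟨?_, ?_⟩, ?_⟩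
  · rintro _ ⟨v, g, h, rfl⟩
    obtain ⟨q, hq, e1, e2⟩ := h.exists_mem hV
    rw [hnorm g _ e2]
    exact hmin _ ⟨q, hq, rfl⟩
  · obtain ⟨P, hP, hPs⟩ := mem_pastedPoly.1 hs'.2
    have e := T.coeFn_pasteL2 P
    rw [hPs] at e
    exact ⟨_, _, ((hV s').1 hs'.1).congr e (EventuallyEq.refl _ _),
      fun j => ⟨P j, hP j, fun x hx => T.paste_eq _ hx⟩,
      (hnorm _ _ (EventuallyEq.refl _ _)).symm⟩
  · rintro _ ⟨v, g, h, hv, rfl⟩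
    exact hlow v g h hv
  -- The stable approximation of the minimiser is a competitor for the discrete minimum, once its
  -- mean value is removed; where this is required, no boundary conditions are imposed.
  have hsH := (hV s).1 hs
  obtain ⟨P, hP, hPW, hPd, hle⟩ := hst T hT dir VG (fun j => rtSpace_le_polySpace p (hVG j))
    s.1 s.2 (Lp.memLp _) (Lp.memLp _) (hVW s hs) hsH.2.2
  have hPm : MemLp (T.paste fun j => peval (P j)) 2 (volume.restrict T.region) :=
    T.memLp_paste fun j => continuous_peval _
  have hPgm : MemLp (T.paste fun j => vpeval (pgrad (P j))) 2 (volume.restrict T.region) :=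
    T.memLp_paste fun j => continuous_vpeval _
  have hPi := MemLp_two_integrableOn hD hPm
  obtain ⟨c, hc1, hc2⟩ : ∃ c : ℝ,
      (mean → ∫ x in T.region, (T.paste (fun j => peval (P j)) x - c) = 0) ∧ (¬ mean → c = 0) := by
    by_cases hm : mean
    · refine ⟨⨍ x in T.region, T.paste (fun j => peval (P j)) x, fun _ => ?_, fun h => (h hm).elim⟩
      exact integral_sub_average _ _
    · exact ⟨0, fun h => (hm h).elim, fun _ => rfl⟩
  have hW : WeakGrad T.region (fun x => T.paste (fun j => peval (P j)) x - c)
      (T.paste fun j => vpeval (pgrad (P j))) := by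
    refine (hPW.add_smul (weakGrad_const (T := T) c) hPi (MemLp_two_integrableOn hD hPgm)
      (integrable_const c) (integrable_zero _ _ _) (-1)).congr ?_ ?_
    · exact Eventually.of_forall fun x => by simp [sub_eq_add_neg]
    · exact Eventually.of_forall fun x => by simp
  refine (hlow _ _ ⟨(isH1_iff hD).2 ⟨hPm.sub (memLp_const c), hPgm, hW⟩, hc1, fun f hf => ?_⟩
    fun j => ⟨P j - MvPolynomial.C c, ?_, fun x hx => ?_⟩).trans ?_
  · have hc : c = 0 := hc2 fun h => by rw [hmd h] at hf; exact hf
    have h := hasZeroTrace_of_contDiff (D := openTri (T.z f.1)) (contDiff_peval (P f.1)) (hPd f hf)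
    rw [gradient_peval] at h
    refine h.congr ?_ ?_ <;>
    · filter_upwards [ae_restrict_mem (measurableSet_openTri (T.z f.1))] with x hx
      simp [T.paste_eq _ hx, hc]
  · exact (MvPolynomial.totalDegree_sub_C_le _ _).trans (hP j)
  · simp only [Pi.sub_apply, T.paste_eq _ hx]; simp [peval]
  · rw [l2norm, Lp.norm_def, ← ENNReal.toReal_ofReal hC, ← ENNReal.toReal_mul]
    refine ENNReal.toReal_mono (ENNReal.mul_ne_top ENNReal.ofReal_ne_top (Lp.eLpNorm_ne_top _)) ?_
    have eV := (Triangulation.ae_eq_paste hG')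
    refine le_trans (le_of_eq (eLpNorm_congr_ae ?_)) (hle.trans (le_of_eq ?_))
    · filter_upwards [eV] with x hx
      rw [hx]
    · congr 1
      rw [← eLpNorm_neg]
      refine eLpNorm_congr_ae ?_
      filter_upwards [Lp.coeFn_add s.2 (-u), Lp.coeFn_neg u, T.coeFn_pasteVL2 VG] with x h1 h2 h3
      rw [h1, Pi.add_apply, h2, Pi.neg_apply, Pi.neg_apply, h3]; abel

/-! ### Star-shaped polygons -/

lemma exists_smul_of_cross_eq_zero {u w : Plane} (hu : u ≠ 0) (h : cross u w = 0) :
    ∃ s : ℝ, w = s • u := by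
  have h' : u 0 * w 1 = u 1 * w 0 := by unfold cross at h; linarith
  by_cases h0 : u 0 = 0
  · have h1 : u 1 ≠ 0 := fun h1 => hu (by ext i; fin_cases i <;> simp [h0, h1])
    refine ⟨w 1 / u 1, ?_⟩
    have : w 0 = 0 := by simpa [h0, h1] using h'
    ext i; fin_cases i
    · simp [h0, this]
    · simp [h1]
  · refine ⟨w 0 / u 0, ?_⟩
    ext i; fin_cases i
    · simp [h0]
    · simp; field_simp; linarith

/-- A segment determines its end points up to order. -/
lemma eq_and_eq_of_affineSegment_eq {a b a' b' : Plane} (hab : a ≠ b)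
    (h : affineSegment ℝ a b = affineSegment ℝ a' b') : (a' = a ∧ b' = b) ∨ (a' = b ∧ b' = a) := by
  obtain ⟨s, hs, rfl⟩ : a' ∈ affineSegment ℝ a b := h ▸ left_mem_affineSegment ℝ _ _
  obtain ⟨t, ht, rfl⟩ : b' ∈ affineSegment ℝ a b := h ▸ right_mem_affineSegment ℝ _ _
  obtain ⟨u, hu, hu'⟩ := h ▸ left_mem_affineSegment ℝ a b
  obtain ⟨w, hw, hw'⟩ := h ▸ right_mem_affineSegment ℝ a b
  have key : ∀ r : ℝ, AffineMap.lineMap (AffineMap.lineMap a b s : Plane)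
      (AffineMap.lineMap a b t) r = AffineMap.lineMap a b ((1 - r) * s + r * t) := by
    intro r
    simp only [AffineMap.lineMap_apply_module]; module
  rw [key] at hu' hw'
  have inj := AffineMap.lineMap_injective ℝ hab
  have e0 : (1 - u) * s + u * t = 0 := inj (hu'.trans (AffineMap.lineMap_apply_zero a b).symm)
  have e1 : (1 - w) * s + w * t = 1 := inj (hw'.trans (AffineMap.lineMap_apply_one a b).symm)
  have h1 : (1 - u) * s = 0 := by
    nlinarith [mul_nonneg (sub_nonneg.2 hu.2) hs.1, mul_nonneg hu.1 ht.1]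
  have h2 : u * t = 0 := by linarith
  rcases mul_eq_zero.1 h1 with h1 | rfl
  · have : t = 0 := by
      rcases mul_eq_zero.1 h2 with h2 | h2
      · linarith
      · exact h2
    subst this
    have : s = 1 := by nlinarith [hs.2, hw.1, hw.2, hs.1]
    subst this
    right; simp
  · have : t = 1 := by nlinarith [ht.2, hw.1, hw.2, ht.1]
    subst this
    left; simp

namespace Element

variable (K : Element)

lemma src_ne_tgt (i : Fin K.n) : K.src i ≠ K.tgt i := by
  intro h
  have h1 : i = finRotate K.n i := K.vertices_injective h
  have h3 := K.three_le
  have : NeZero K.n := ⟨by omega⟩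
  rw [finRotate_apply] at h1
  have h2 := congrArg Fin.val (add_eq_left.1 h1.symm)
  rw [Fin.val_one', Nat.mod_eq_of_lt (by omega)] at h2
  simp at h2

lemma mem_frontier_iff {x : Plane} : x ∈ frontier K.carrier ↔ ∃ i, x ∈ K.edge i := by
  rw [K.frontier_eq, Polygon.boundary, mem_iUnion]; rfl

lemma src_mem_edge (i : Fin K.n) : K.src i ∈ K.edge i := left_mem_affineSegment ℝ _ _

lemma tgt_mem_edge (i : Fin K.n) : K.tgt i ∈ K.edge i := right_mem_affineSegment ℝ _ _

lemma edge_subset_frontier (i : Fin K.n) : K.edge i ⊆ frontier K.carrier := fun _ hx =>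
  K.mem_frontier_iff.2 ⟨i, hx⟩

lemma edge_subset_closure (i : Fin K.n) : K.edge i ⊆ closure K.carrier :=
  (K.edge_subset_frontier i).trans frontier_subset_closure

lemma notMem_of_mem_frontier {x : Plane} (hx : x ∈ frontier K.carrier) : x ∉ K.carrier := by
  rw [K.isOpen.frontier_eq] at hx; exact hx.2

end Element

namespace Mesh

variable {Ω : Set Plane} {γ : ℝ} (M : Mesh Ω γ)

/-- The half-open segments that join the ball of an element to the points of its closure are
contained in the element. -/
lemma lineMap_mem {k : Fin M.N} {x y : Plane} (hy : y ∈ Metric.ball (M.center k) (M.radius k))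
    (hx : x ∈ closure (M.elem k).carrier) {t : ℝ} (ht0 : 0 ≤ t) (ht1 : t < 1) :
    AffineMap.lineMap y x t ∈ (M.elem k).carrier := by
  have h1 : 0 < 1 - t := by linarith
  -- the point of the ball is moved to compensate for an approximation of `x` from the element
  let f : Plane → Plane := fun x' => y + (t / (1 - t)) • (x - x')
  have hf : Continuous f := by fun_prop
  have hfx : f x = y := by simp [f]
  have hn : f ⁻¹' Metric.ball (M.center k) (M.radius k) ∈ 𝓝 x :=
    hf.continuousAt.preimage_mem_nhds (by rw [hfx]; exact Metric.isOpen_ball.mem_nhds hy)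
  obtain ⟨x', hx', hxK⟩ := mem_closure_iff_nhds.1 hx _ hn
  have h := M.starShaped k _ hx' hxK h1.le ht0 (by ring)
  convert h using 1
  simp only [f, AffineMap.lineMap_apply_module, smul_add, smul_smul, smul_sub,
    mul_div_cancel₀ _ h1.ne']
  module

lemma center_mem_ball (k : Fin M.N) : M.center k ∈ Metric.ball (M.center k) (M.radius k) :=
  Metric.mem_ball_self (M.radius_pos k)

lemma ball_subset (k : Fin M.N) : Metric.ball (M.center k) (M.radius k) ⊆ (M.elem k).carrier :=
  fun y hy => (M.starShaped k y hy).mem (M.elem k).nonempty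

/-- The line through an edge does not meet the ball of the element. -/
lemma cross_ne_zero {k : Fin M.N} (i : Fin (M.elem k).n) {y : Plane}
    (hy : y ∈ Metric.ball (M.center k) (M.radius k)) :
    cross ((M.elem k).tgt i - (M.elem k).src i) (y - (M.elem k).src i) ≠ 0 := by
  set a := (M.elem k).src i with ha
  set b := (M.elem k).tgt i with hb
  intro h0
  obtain ⟨s, hs⟩ := exists_smul_of_cross_eq_zero (sub_ne_zero.2 ((M.elem k).src_ne_tgt i).symm) h0
  have hy' : y = a + s • (b - a) := by rw [← hs]; abel
  have hne : ∀ {x}, x ∈ (M.elem k).edge i → x ∉ (M.elem k).carrier := fun hx =>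
    (M.elem k).notMem_of_mem_frontier ((M.elem k).edge_subset_frontier i hx)
  -- If `y` lies on the line before the edge, on the edge, or behind it, then `src`, `y` or `tgt`
  -- belongs both to the element and to its boundary.
  rcases lt_or_ge s 0 with h | h
  · refine hne ((M.elem k).src_mem_edge i) ?_
    have h1 : 0 < 1 - s := by linarith
    convert M.lineMap_mem hy
      ((M.elem k).edge_subset_closure i ((M.elem k).tgt_mem_edge i)) (t := -s / (1 - s))
      (div_nonneg (by linarith) h1.le) (by rw [div_lt_one h1]; linarith) using 1
    rw [AffineMap.lineMap_apply_module', ← hb, ← ha, hy']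
    have : b - (a + s • (b - a)) = (1 - s) • (b - a) := by module
    rw [this, smul_smul, div_mul_cancel₀ _ h1.ne']; module
  · rcases le_or_gt s 1 with h' | h'
    · refine hne (x := y) ⟨s, ⟨h, h'⟩, ?_⟩ (M.ball_subset k hy)
      rw [AffineMap.lineMap_apply_module', hy', add_comm]; rfl
    · refine hne ((M.elem k).tgt_mem_edge i) ?_
      have h1 : 0 < s := by linarith
      convert M.lineMap_mem hy
        ((M.elem k).edge_subset_closure i ((M.elem k).src_mem_edge i)) (t := (s - 1) / s)
        (div_nonneg (by linarith) h1.le) (by rw [div_lt_one h1]; linarith) using 1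
      rw [AffineMap.lineMap_apply_module', ← hb, ← ha, hy']
      have : a - (a + s • (b - a)) = (-s) • (b - a) := by module
      rw [this, smul_smul, mul_neg, div_mul_cancel₀ _ h1.ne']; module

/-- The vertices of a triangle of the subtriangulation. -/
def tz (k : Fin M.N) (i : Fin (M.elem k).n) : Fin 3 → Plane :=
  ![M.center k, (M.elem k).src i, (M.elem k).tgt i]

lemma area_tz (k : Fin M.N) (i : Fin (M.elem k).n) : area (M.tz k i) =
    cross ((M.elem k).tgt i - (M.elem k).src i) (M.center k - (M.elem k).src i) := by
  simp [area, tz, cross]; ring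

lemma area_tz_ne (k : Fin M.N) (i : Fin (M.elem k).n) : area (M.tz k i) ≠ 0 := by
  rw [area_tz]; exact M.cross_ne_zero i (M.center_mem_ball k)

lemma tri_eq (k : Fin M.N) (i : Fin (M.elem k).n) : M.tri k i = openTri (M.tz k i) :=
  interior_convexHull_triple (M.area_tz_ne k i)

/-- The distance between the centre and the line through an edge is at least the radius. -/
lemma radius_mul_le_area (k : Fin M.N) (i : Fin (M.elem k).n) :
    M.radius k * dist ((M.elem k).src i) ((M.elem k).tgt i) ≤ |area (M.tz k i)| := by
  by_contra! hlt
  rw [dist_comm, dist_eq_norm, M.area_tz] at hlt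
  set a := (M.elem k).src i with ha
  set u := (M.elem k).tgt i - a with hu
  set A := cross u (M.center k - a) with hA
  have hu0 : u ≠ 0 := sub_ne_zero.2 ((M.elem k).src_ne_tgt i).symm
  have hn : 0 < ‖u‖ := norm_pos_iff.2 hu0
  -- the normal direction, along which the centre is projected onto the line
  let w : Plane := !₂[-u 1, u 0]
  have hw : ‖w‖ = ‖u‖ := by
    simp [EuclideanSpace.norm_eq, Fin.sum_univ_two, w, add_comm]
  have hcw : cross u w = ‖u‖ ^ 2 := by
    rw [EuclideanSpace.real_norm_sq_eq, Fin.sum_univ_two]; simp [cross, w]; ring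
  refine M.cross_ne_zero i (y := M.center k + (-A / ‖u‖ ^ 2) • w) ?_ ?_
  · rw [mem_ball_iff_norm, add_sub_cancel_left, norm_smul, hw, Real.norm_eq_abs, abs_div, abs_neg,
      abs_of_pos (pow_pos hn 2), div_mul_eq_mul_div, div_lt_iff₀ (pow_pos hn 2)]
    nlinarith
  · rw [← hu, add_sub_right_comm, cross_add_right, cross_smul_right, hcw,
      div_mul_cancel₀ _ (pow_pos hn 2).ne']
    ring

lemma mem_closedTri_iff {k : Fin M.N} {i : Fin (M.elem k).n} {x : Plane} :
    x ∈ closedTri (M.tz k i) ↔ ∃ e ∈ (M.elem k).edge i, ∃ t ∈ Icc (0 : ℝ) 1,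
      x = AffineMap.lineMap (M.center k) e t := by
  have hr : range (M.tz k i) = {M.center k, (M.elem k).src i, (M.elem k).tgt i} := by
    ext x; simp [tz]; tauto
  rw [closedTri_eq_convexHull (M.area_tz_ne k i), hr, convexHull_insert (by simp), convexHull_pair,
    mem_convexJoin]
  simp only [mem_singleton_iff, exists_eq_left]
  have he : (M.elem k).edge i = segment ℝ ((M.elem k).src i) ((M.elem k).tgt i) :=
    affineSegment_eq_segment ..
  rw [he]
  refine exists_congr fun e => and_congr_right fun _ => ?_
  rw [← affineSegment_eq_segment]
  exact ⟨fun ⟨t, h1, h2⟩ => ⟨t, h1, h2.symm⟩, fun ⟨t, h1, h2⟩ => ⟨t, h1, h2.symm⟩⟩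

/-- A ray from the centre meets the boundary only once. -/
lemma ray_unique {k : Fin M.N} {x y : Plane} (hx : x ∈ frontier (M.elem k).carrier)
    (hy : y ∈ frontier (M.elem k).carrier) {s t : ℝ} (hs : 0 < s) (ht : 0 < t)
    (h : AffineMap.lineMap (M.center k) x s = AffineMap.lineMap (M.center k) y t) : x = y := by
  have key : ∀ {x y : Plane}, x ∈ frontier (M.elem k).carrier → y ∈ frontier (M.elem k).carrier →
      ∀ {s t : ℝ}, 0 < s → 0 < t → AffineMap.lineMap (M.center k) x s =
        AffineMap.lineMap (M.center k) y t → s ≤ t := by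
    intro x y hx hy s t hs ht h
    by_contra! hlt
    refine (M.elem k).notMem_of_mem_frontier hx ?_
    convert M.lineMap_mem (M.center_mem_ball k) (frontier_subset_closure hy) (t := t / s)
      (by positivity) ((div_lt_one hs).2 hlt) using 1
    simp only [AffineMap.lineMap_apply_module', add_left_inj] at h ⊢
    rw [div_eq_inv_mul, mul_smul, ← h, smul_smul, inv_mul_cancel₀ hs.ne']; simp
  have hst := le_antisymm (key hx hy hs ht h) (key hy hx ht hs h.symm)
  subst hst
  simp only [AffineMap.lineMap_apply_module', add_left_inj] at h
  exact sub_left_injective (smul_right_injective _ hs.ne' h)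

lemma closedTri_subset (k : Fin M.N) (i : Fin (M.elem k).n) :
    closedTri (M.tz k i) ⊆ closure (M.elem k).carrier := by
  intro x hx
  obtain ⟨e, he, t, ht, rfl⟩ := M.mem_closedTri_iff.1 hx
  rcases ht.2.eq_or_lt with rfl | h1
  · rw [AffineMap.lineMap_apply_one]; exact (M.elem k).edge_subset_closure i he
  · exact subset_closure (M.lineMap_mem (M.center_mem_ball k)
      ((M.elem k).edge_subset_closure i he) ht.1 h1)

/-- The triangles cover the closed element: a ray from the centre leaves the bounded element
through a boundary point, which lies on an edge. -/
lemma closure_eq (k : Fin M.N) :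
    closure (M.elem k).carrier = ⋃ i, closedTri (M.tz k i) := by
  refine Subset.antisymm (fun x hx => ?_) (iUnion_subset fun i => M.closedTri_subset k i)
  simp only [mem_iUnion, M.mem_closedTri_iff]
  set K := M.elem k
  set c := M.center k
  by_cases hxc : x = c
  · exact ⟨⟨0, by have := K.three_le; omega⟩, _, K.src_mem_edge _, 0, by simp, by simp [hxc]⟩
  -- it suffices to find a boundary point on the ray, not before `x`
  suffices ∃ T : ℝ, 1 ≤ T ∧ AffineMap.lineMap c x T ∈ frontier K.carrier by
    obtain ⟨T, hT, hf⟩ := this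
    obtain ⟨i, hi⟩ := K.mem_frontier_iff.1 hf
    have hT0 : T ≠ 0 := by linarith
    refine ⟨i, _, hi, T⁻¹, ⟨by positivity, inv_le_one_of_one_le₀ hT⟩, ?_⟩
    simp [AffineMap.lineMap_apply_module', smul_smul, hT0]
  by_cases hxf : x ∈ frontier K.carrier
  · exact ⟨1, le_rfl, by simpa using hxf⟩
  have hxK : x ∈ K.carrier := by
    rw [K.isOpen.frontier_eq] at hxf; by_contra h; exact hxf ⟨hx, h⟩
  obtain ⟨r, hr⟩ := K.isBounded.subset_closedBall c
  have hd : 0 < ‖x - c‖ := norm_pos_iff.2 (sub_ne_zero.2 hxc)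
  -- The part of the ray behind `x` is connected, and it meets the element as well as the exterior.
  have hpre : IsPreconnected ((fun T : ℝ => (AffineMap.lineMap c x T : Plane)) '' Ici 1) :=
    isPreconnected_Ici.image _ AffineMap.lineMap_continuous.continuousOn
  have h1 : x ∈ (fun T : ℝ => (AffineMap.lineMap c x T : Plane)) '' Ici 1 :=
    ⟨1, by simp, by simp⟩
  have hcl : closure K.carrier ⊆ Metric.closedBall c r :=
    closure_minimal hr Metric.isClosed_closedBall
  by_contra! hno
  have hsub : (fun T : ℝ => (AffineMap.lineMap c x T : Plane)) '' Ici 1 ⊆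
      K.carrier ∪ (closure K.carrier)ᶜ := by
    rintro _ ⟨T, hT, rfl⟩
    have := hno T hT
    rw [K.isOpen.frontier_eq] at this
    by_cases h : AffineMap.lineMap c x T ∈ K.carrier
    · exact Or.inl h
    · exact Or.inr fun h' => this ⟨h', h⟩
  obtain ⟨y, -, hy1, hy2⟩ := hpre K.carrier (closure K.carrier)ᶜ K.isOpen
    isClosed_closure.isOpen_compl hsub ⟨x, h1, hxK⟩
    ⟨AffineMap.lineMap c x (1 + |r| / ‖x - c‖), ⟨_, by simp; positivity, rfl⟩, fun hmem => by
      have := hcl hmem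
      rw [mem_closedBall_iff_norm, AffineMap.lineMap_apply_module', add_sub_cancel_right, norm_smul,
        Real.norm_of_nonneg (by positivity), add_mul, div_mul_cancel₀ _ hd.ne'] at this
      linarith [le_abs_self r]⟩
  exact hy2 (subset_closure hy1)

/-- Polar coordinates around the centre. -/
lemma exists_of_mem_openTri {k : Fin M.N} {i : Fin (M.elem k).n} {x : Plane}
    (hx : x ∈ openTri (M.tz k i)) : ∃ s ∈ Ioo (0 : ℝ) 1, ∃ t ∈ Ioo (0 : ℝ) 1,
      x = AffineMap.lineMap (M.center k)
        (AffineMap.lineMap ((M.elem k).src i) ((M.elem k).tgt i) s : Plane) t := by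
  have h := sum_bary (M.area_tz_ne k i) x
  have h' := sum_bary_smul (M.area_tz_ne k i) x
  have h0 := hx 0
  have h1 := hx 1
  have h2 := hx 2
  set p := bary (M.tz k i) 0 x
  set q := bary (M.tz k i) 1 x
  set r := bary (M.tz k i) 2 x
  have hqr : 0 < q + r := by positivity
  refine ⟨r / (q + r), ⟨by positivity, by rw [div_lt_one hqr]; linarith⟩, q + r,
    ⟨hqr, by linarith⟩, ?_⟩
  have e1 : 1 - r / (q + r) = q / (q + r) := by field_simp; ring
  rw [AffineMap.lineMap_apply_module, AffineMap.lineMap_apply_module, e1, smul_add, smul_smul,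
    smul_smul, mul_div_cancel₀ _ hqr.ne', mul_div_cancel₀ _ hqr.ne', ← h',
    show 1 - (q + r) = p by linarith, ← add_assoc]
  rfl

lemma openTri_subset (k : Fin M.N) (i : Fin (M.elem k).n) :
    openTri (M.tz k i) ⊆ (M.elem k).carrier := by
  intro x hx
  obtain ⟨s, hs, t, ht, rfl⟩ := M.exists_of_mem_openTri hx
  exact M.lineMap_mem (M.center_mem_ball k) ((M.elem k).edge_subset_closure i
    ⟨s, ⟨hs.1.le, hs.2.le⟩, rfl⟩) ht.1.le ht.2

lemma openEdge_ne {k : Fin M.N} {i : Fin (M.elem k).n} {s : ℝ} (hs : s ∈ Ioo (0 : ℝ) 1) :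
    (AffineMap.lineMap ((M.elem k).src i) ((M.elem k).tgt i) s : Plane) ∉
      ({(M.elem k).src i, (M.elem k).tgt i} : Set Plane) := by
  have inj := AffineMap.lineMap_injective ℝ ((M.elem k).src_ne_tgt i)
  rintro (h | h)
  · exact hs.1.ne' (inj (h.trans (AffineMap.lineMap_apply_zero _ _).symm))
  · exact hs.2.ne (inj (h.trans (AffineMap.lineMap_apply_one _ _).symm))

/-- Within an element, a ray from the centre determines the edge that it meets; different elements
are disjoint. -/
lemma disjoint_openTri {k l : Fin M.N} {i : Fin (M.elem k).n} {j : Fin (M.elem l).n}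
    (h : (⟨k, i⟩ : Σ k, Fin (M.elem k).n) ≠ ⟨l, j⟩) :
    Disjoint (openTri (M.tz k i)) (openTri (M.tz l j)) := by
  by_cases hkl : k = l
  · subst hkl
    have hij : i ≠ j := fun e => h (by rw [e])
    rw [Set.disjoint_left]
    intro x hx hx'
    obtain ⟨s, hs, t, ht, rfl⟩ := M.exists_of_mem_openTri hx
    obtain ⟨s', hs', t', ht', he⟩ := M.exists_of_mem_openTri hx'
    have m1 : (AffineMap.lineMap ((M.elem k).src i) ((M.elem k).tgt i) s : Plane) ∈
      (M.elem k).edge i := ⟨s, ⟨hs.1.le, hs.2.le⟩, rfl⟩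
    have m2 : (AffineMap.lineMap ((M.elem k).src j) ((M.elem k).tgt j) s' : Plane) ∈
      (M.elem k).edge j := ⟨s', ⟨hs'.1.le, hs'.2.le⟩, rfl⟩
    have e := M.ray_unique ((M.elem k).edge_subset_frontier i m1)
      ((M.elem k).edge_subset_frontier j m2) ht.1 ht'.1 he
    exact M.openEdge_ne hs ((M.elem k).simple i j hij ⟨m1, e ▸ m2⟩).1
  · exact (M.disjoint k l hkl).mono (M.openTri_subset k i) (M.openTri_subset l j)

end Mesh

/-! ### The triangulation of a vertex patch -/

namespace Mesh

variable {Ω : Set Plane} {γ : ℝ} (M : Mesh Ω γ)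

lemma notMem_closure {k l : Fin M.N} (h : k ≠ l) {x : Plane} (hx : x ∈ (M.elem k).carrier) :
    x ∉ closure (M.elem l).carrier := fun hx' => by
  obtain ⟨y, hy, hy'⟩ := mem_closure_iff.1 hx' _ (M.elem k).isOpen hx
  exact Set.disjoint_left.1 (M.disjoint k l h) hy hy'

/-- A boundary point of an element lies on the mesh edge of any closed triangle that contains it. -/
lemma mem_edge_of_mem_closedTri {k l : Fin M.N} {j : Fin (M.elem l).n} {x : Plane}
    (hx : x ∈ frontier (M.elem k).carrier) (h : x ∈ closedTri (M.tz l j)) :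
    x ∈ (M.elem l).edge j := by
  obtain ⟨e, he, t, ht, rfl⟩ := M.mem_closedTri_iff.1 h
  rcases ht.2.eq_or_lt with rfl | h1
  · rwa [AffineMap.lineMap_apply_one]
  · have hm := M.lineMap_mem (M.center_mem_ball l) ((M.elem l).edge_subset_closure j he) ht.1 h1
    by_cases hlk : l = k
    · subst hlk; exact ((M.elem l).notMem_of_mem_frontier hx hm).elim
    · exact (M.notMem_closure hlk hm (frontier_subset_closure hx)).elim

/-- The triangles of the subtriangulation meet edge to edge at the mesh edges. -/
lemma conf_edge {k l : Fin M.N} {i : Fin (M.elem k).n} {j : Fin (M.elem l).n} {s : ℝ}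
    (hs : s ∈ Ioo (0 : ℝ) 1)
    (h : (AffineMap.lineMap ((M.elem k).src i) ((M.elem k).tgt i) s : Plane) ∈
      closedTri (M.tz l j)) :
    (M.tz l j 1 = M.tz k i 1 ∧ M.tz l j 2 = M.tz k i 2) ∨
      (M.tz l j 1 = M.tz k i 2 ∧ M.tz l j 2 = M.tz k i 1) := by
  have m1 : (AffineMap.lineMap ((M.elem k).src i) ((M.elem k).tgt i) s : Plane) ∈
    (M.elem k).edge i := ⟨s, ⟨hs.1.le, hs.2.le⟩, rfl⟩
  have m2 := M.mem_edge_of_mem_closedTri ((M.elem k).edge_subset_frontier i m1) h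
  rcases M.conforming k l i j with he | he
  · exact eq_and_eq_of_affineSegment_eq ((M.elem k).src_ne_tgt i) he
  · exact (M.openEdge_ne hs (he ⟨m1, m2⟩).1).elim

/-- The triangles of the subtriangulation meet edge to edge at the edges inside an element. -/
lemma conf_inner {k l : Fin M.N} {i : Fin (M.elem k).n} {j : Fin (M.elem l).n}
    (hne : (⟨l, j⟩ : Σ k, Fin (M.elem k).n) ≠ ⟨k, i⟩) {q : Fin 3} (hq : q ≠ 0) {s : ℝ}
    (hs : s ∈ Ioo (0 : ℝ) 1)
    (h : (AffineMap.lineMap (M.center k) (M.tz k i q) s : Plane) ∈ closedTri (M.tz l j)) :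
    M.tz l j 0 = M.tz k i 0 ∧ ∃ q', q' ≠ 0 ∧ M.tz l j q' = M.tz k i q := by
  have hv : M.tz k i q ∈ (M.elem k).edge i := by
    fin_cases q
    · exact (hq rfl).elim
    · exact (M.elem k).src_mem_edge i
    · exact (M.elem k).tgt_mem_edge i
  have hvf := (M.elem k).edge_subset_frontier i hv
  have hm := M.lineMap_mem (M.center_mem_ball k) (frontier_subset_closure hvf) hs.1.le hs.2
  have hkl : k = l := by
    by_contra hkl
    exact M.notMem_closure hkl hm (M.closedTri_subset l j h)
  subst hkl
  refine ⟨rfl, ?_⟩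
  have hij : i ≠ j := fun e => hne (by rw [e])
  obtain ⟨e, he, t, ht, hx⟩ := M.mem_closedTri_iff.1 h
  have hef := (M.elem k).edge_subset_frontier j he
  have ht0 : 0 < t := by
    refine ht.1.lt_of_ne fun h0 => ?_
    rw [← h0, AffineMap.lineMap_apply_zero] at hx
    have inj := AffineMap.lineMap_injective ℝ (show M.center k ≠ M.tz k i q from fun hc =>
      (M.elem k).notMem_of_mem_frontier hvf (hc ▸ M.ball_subset k (M.center_mem_ball k)))
    exact hs.1.ne' (inj (hx.trans (AffineMap.lineMap_apply_zero _ _).symm))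
  have hev : M.tz k i q = e := M.ray_unique hvf hef hs.1 ht0 hx
  rcases ((M.elem k).simple i j hij ⟨hv, hev ▸ he⟩).2 with h1 | h1
  · exact ⟨1, by decide, h1.symm⟩
  · exact ⟨2, by decide, h1.symm⟩

/-- The triangles of the subtriangulation of the patch of `ν`. -/
abbrev PatchIndex (ν : Plane) : Type := Σ k : M.patch ν, Fin (M.elem k).n

/-- The subtriangulation of the patch of `ν`. -/
def triangulation (ν : Plane) {m : ℕ} (e : Fin m ≃ M.PatchIndex ν) : Triangulation m where
  z j := M.tz (e j).1 (e j).2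
  area_ne j := M.area_tz_ne _ _
  disj j k h := M.disjoint_openTri fun h' => h (e.injective (by
    obtain ⟨h1, h2⟩ := Sigma.mk.inj_iff.1 h'
    exact Sigma.ext (Subtype.ext h1) h2))
  conf := by
    rintro j ⟨q, b⟩ x ⟨t, ht, rfl⟩ k hkj hx
    have hne : (⟨(e k).1, (e k).2⟩ : Σ k, Fin (M.elem k).n) ≠ ⟨(e j).1, (e j).2⟩ := fun h' =>
      hkj (e.injective (by
        obtain ⟨h1, h2⟩ := Sigma.mk.inj_iff.1 h'
        exact Sigma.ext (Subtype.ext h1) h2))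
    have ht' : 1 - t ∈ Ioo (0 : ℝ) 1 := ⟨by linarith [ht.2], by linarith [ht.1]⟩
    -- it suffices to find the two vertices in the other triangle
    suffices ∃ r s : Fin 3, r ≠ s ∧
        M.tz (e k).1 (e k).2 r = M.tz (e j).1 (e j).2 (va (q, b)) ∧
        M.tz (e k).1 (e k).2 s = M.tz (e j).1 (e j).2 (vb (q, b)) by
      obtain ⟨r, s, hrs, h1, h2⟩ := this
      obtain ⟨e', rfl, rfl⟩ := exists_oedge r s hrs
      exact ⟨e', h1, h2⟩
    have swap := AffineMap.lineMap_apply_one_sub (M.tz (e j).1 (e j).2 (vb (q, b)))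
      (M.tz (e j).1 (e j).2 (va (q, b))) t
    rw [← swap] at hx
    fin_cases q <;> cases b
    · rcases M.conf_edge ht' hx with ⟨h1, h2⟩ | ⟨h1, h2⟩
      · exact ⟨2, 1, by decide, h2, h1⟩
      · exact ⟨1, 2, by decide, h1, h2⟩
    · rw [swap] at hx
      rcases M.conf_edge ht hx with ⟨h1, h2⟩ | ⟨h1, h2⟩
      · exact ⟨1, 2, by decide, h1, h2⟩
      · exact ⟨2, 1, by decide, h2, h1⟩
    · rw [swap] at hx
      obtain ⟨h0, q', hq', h⟩ := M.conf_inner hne (q := 2) (by decide) ht hx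
      exact ⟨0, q', hq'.symm, h0, h⟩
    · obtain ⟨h0, q', hq', h⟩ := M.conf_inner hne (q := 2) (by decide) ht' hx
      exact ⟨q', 0, hq', h, h0⟩
    · obtain ⟨h0, q', hq', h⟩ := M.conf_inner hne (q := 1) (by decide) ht' hx
      exact ⟨q', 0, hq', h, h0⟩
    · rw [swap] at hx
      obtain ⟨h0, q', hq', h⟩ := M.conf_inner hne (q := 1) (by decide) ht hx
      exact ⟨0, q', hq'.symm, h0, h⟩

/-- The patch is the interior of the union of the closed triangles. -/
lemma region_triangulation (ν : Plane) {m : ℕ} (e : Fin m ≃ M.PatchIndex ν) :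
    (M.triangulation ν e).region = M.omega ν := by
  rw [Triangulation.region, omega]
  congr 1
  simp only [M.closure_eq]
  ext x
  simp only [mem_iUnion]
  constructor
  · rintro ⟨j, hj⟩
    exact ⟨_, (e j).1.2, _, hj⟩
  · rintro ⟨k, hk, i, hi⟩
    refine ⟨e.symm ⟨⟨k, hk⟩, i⟩, ?_⟩
    have h : ∀ a : M.PatchIndex ν, a = ⟨⟨k, hk⟩, i⟩ → x ∈ closedTri (M.tz a.1 a.2) := by
      rintro _ rfl; exact hi
    exact h _ (e.apply_symm_apply _)

/-! ### Shape regularity and the number of triangles -/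

lemma dist_tz_le (k : Fin M.N) (i : Fin (M.elem k).n) (p q : Fin 3) :
    dist (M.tz k i p) (M.tz k i q) ≤ Metric.diam (M.elem k).carrier := by
  rw [← Metric.diam_closure]
  exact Metric.dist_le_diam_of_mem (M.elem k).isBounded.closure
    (M.closedTri_subset k i (mem_closedTri_vertex (M.area_tz_ne k i) p))
    (M.closedTri_subset k i (mem_closedTri_vertex (M.area_tz_ne k i) q))

lemma diam_pos (k : Fin M.N) : 0 < Metric.diam (M.elem k).carrier := by
  have i : Fin (M.elem k).n := ⟨0, by have := (M.elem k).three_le; omega⟩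
  exact (dist_pos.2 ((M.elem k).src_ne_tgt i)).trans_le (M.dist_tz_le k i 1 2)

/-- The length of an edge and the radius of the ball are both comparable with the diameter. -/
lemma sq_diam_le_area (hγ : 0 < γ) (k : Fin M.N) (i : Fin (M.elem k).n) :
    γ ^ 2 * Metric.diam (M.elem k).carrier ^ 2 ≤ |area (M.tz k i)| := by
  refine le_trans ?_ (M.radius_mul_le_area k i)
  have := mul_le_mul (M.radius_ge k) (M.edge_ge k i) (mul_nonneg hγ.le Metric.diam_nonneg)
    (M.radius_pos k).le
  linarith

lemma shapeRegular_tz (hγ : 0 < γ) (k : Fin M.N) (i : Fin (M.elem k).n) :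
    ShapeRegular (1 / γ ^ 2) (M.tz k i) := by
  intro p q
  have h := M.sq_diam_le_area hγ k i
  rw [div_mul_eq_mul_div, one_mul, le_div_iff₀ (by positivity), mul_comm]
  refine le_trans ?_ h
  gcongr
  exact M.dist_tz_le k i p q

end Mesh

lemma volume_openTri {z : Fin 3 → Plane} (hz : area z ≠ 0) :
    volume.real (openTri z) = |area z| / 2 := by
  have := setIntegral_const_openTri hz 1
  simpa using this

/-- Disjoint triangles in a disc whose area is at least a fixed part of that of the disc. -/
lemma card_mul_le_of_disjoint {ι : Type*} [Fintype ι] {z : ι → Fin 3 → Plane}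
    (hz : ∀ j, area (z j) ≠ 0) (hd : Pairwise fun j k => Disjoint (openTri (z j)) (openTri (z k)))
    {x : Plane} {ρ δ : ℝ} (hρ : 0 < ρ) (hsub : ∀ j, openTri (z j) ⊆ Metric.closedBall x ρ)
    (hδ : ∀ j, δ * ρ ^ 2 ≤ |area (z j)|) : Fintype.card ι * δ ≤ 2 * Real.pi := by
  have h1 : volume.real (⋃ j, openTri (z j)) = ∑ j, |area (z j)| / 2 := by
    rw [measureReal_iUnion_fintype hd (fun j => measurableSet_openTri _)
      fun j => (volume_openTri_lt_top (hz j)).ne]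
    exact Finset.sum_congr rfl fun j _ => volume_openTri (hz j)
  have h2 : volume.real (⋃ j, openTri (z j)) ≤ volume.real (Metric.closedBall x ρ) :=
    measureReal_mono (iUnion_subset hsub) measure_closedBall_lt_top.ne
  have h3 : volume.real (Metric.closedBall x ρ) = Real.pi * ρ ^ 2 := by
    rw [measureReal_def, EuclideanSpace.volume_closedBall_fin_two, ENNReal.toReal_mul,
      ENNReal.toReal_pow, ENNReal.toReal_ofReal hρ.le]
    simp [mul_comm, Real.pi_nonneg]
  have h4 : (Fintype.card ι : ℝ) * (δ * ρ ^ 2 / 2) ≤ ∑ j, |area (z j)| / 2 := by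
    rw [← nsmul_eq_mul, ← Finset.card_univ]
    exact Finset.card_nsmul_le_sum _ _ _ fun j _ => by linarith [hδ j]
  have h5 : ρ ^ 2 * (Fintype.card ι * δ) ≤ ρ ^ 2 * (2 * Real.pi) := by linarith
  exact le_of_mul_le_mul_left h5 (by positivity)

lemma closedTri_subset_of_vertices {z : Fin 3 → Plane} (hz : area z ≠ 0) {S : Set Plane}
    (hS : Convex ℝ S) (h : ∀ i, z i ∈ S) : closedTri z ⊆ S := by
  rw [closedTri_eq_convexHull hz]
  exact convexHull_min (range_subset_iff.2 h) hS

namespace Mesh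

variable {Ω : Set Plane} {γ : ℝ} (M : Mesh Ω γ)

/-- The number of edges of an element: its triangles fill a disc of radius `h_K` at most. -/
lemma card_edges_mul_le (hγ : 0 < γ) (k : Fin M.N) :
    ((M.elem k).n : ℝ) * γ ^ 2 ≤ 2 * Real.pi := by
  have := card_mul_le_of_disjoint (z := M.tz k) (M.area_tz_ne k)
    (fun i j h => M.disjoint_openTri fun h' => h (by simpa using h'))
    (x := M.center k) (M.diam_pos k) (fun i => ?_) (fun i => M.sq_diam_le_area hγ k i)
  · simpa using this
  · exact (openTri_subset_closedTri _).trans (closedTri_subset_of_vertices (M.area_tz_ne k i)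
      (convex_closedBall _ _) fun q => Metric.mem_closedBall.2 (M.dist_tz_le k i q 0))

/-- The number of elements at a vertex: near the vertex, each contains a triangle whose area is
comparable to the square of the distance. -/
lemma card_patch_mul_le (hγ : 0 < γ) (ν : Plane) :
    (Nat.card (M.patch ν) : ℝ) * γ ^ 2 ≤ 2 * Real.pi := by
  have : Fintype (M.patch ν) := Fintype.ofFinite _
  have hi : ∀ k : M.patch ν, ∃ i, (M.elem k).src i = ν := fun k => k.2
  choose i hi using hi
  -- a scale below all the diameters
  obtain ⟨ρ, hρ, hle⟩ : ∃ ρ : ℝ, 0 < ρ ∧ ∀ k, ρ ≤ Metric.diam (M.elem k).carrier := by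
    obtain ⟨C, hC⟩ := Finite.exists_le fun k => (Metric.diam (M.elem k).carrier)⁻¹
    refine ⟨(max C 1)⁻¹, by positivity, fun k => ?_⟩
    exact inv_le_of_inv_le₀ (M.diam_pos k) ((hC k).trans (le_max_left _ _))
  let s : M.patch ν → ℝ := fun k => ρ / Metric.diam (M.elem k).carrier
  have hs0 : ∀ k : M.patch ν, 0 < s k := fun k => div_pos hρ (M.diam_pos k)
  have hs1 : ∀ k : M.patch ν, s k ≤ 1 := fun k => (div_le_one (M.diam_pos k)).2 (hle k)
  -- one triangle at `ν` from each element, scaled down to the size `ρ`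
  let z : M.patch ν → Fin 3 → Plane := fun k q => AffineMap.lineMap ν (M.tz k (i k) q) (s k)
  have hν : ∀ k : M.patch ν, M.tz k (i k) 1 = ν := hi
  have hz : ∀ k : M.patch ν, area (z k) = s k ^ 2 * area (M.tz k (i k)) := fun k => by
    simp only [z, area, cross, AffineMap.lineMap_apply_module, PiLp.sub_apply, PiLp.add_apply,
      PiLp.smul_apply, smul_eq_mul]
    ring
  have hz0 : ∀ k : M.patch ν, area (z k) ≠ 0 := fun k => by
    rw [hz]; exact mul_ne_zero (pow_pos (hs0 k) 2).ne' (M.area_tz_ne _ _)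
  have hsub : ∀ k : M.patch ν, openTri (z k) ⊆ openTri (M.tz k (i k)) := fun k => by
    rw [← interior_closedTri (hz0 k), ← interior_closedTri (M.area_tz_ne _ _)]
    refine interior_mono (closedTri_subset_of_vertices (hz0 k) (convex_closedTri _) fun q => ?_)
    have hm := mem_closedTri_vertex (M.area_tz_ne k (i k))
    have hm1 := hm 1
    rw [hν] at hm1
    exact (convex_closedTri _).lineMap_mem hm1 (hm q) ⟨(hs0 k).le, hs1 k⟩
  have := card_mul_le_of_disjoint hz0 (fun k l h => (M.disjoint_openTri fun h' => h
    (Subtype.ext (Sigma.mk.inj_iff.1 h').1)).mono (hsub k) (hsub l)) (x := ν) hρ (fun k => ?_)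
    (δ := γ ^ 2) (fun k => ?_)
  · rwa [Nat.card_eq_fintype_card]
  · refine (openTri_subset_closedTri _).trans (closedTri_subset_of_vertices (hz0 k)
      (convex_closedBall _ _) fun q => ?_)
    rw [Metric.mem_closedBall, dist_lineMap_left, Real.norm_of_nonneg (hs0 k).le]
    have h1 := M.dist_tz_le k (i k) 1 q
    rw [hν] at h1
    calc s k * dist ν (M.tz k (i k) q) ≤ s k * Metric.diam (M.elem k).carrier := by
          gcongr
      _ = ρ := div_mul_cancel₀ _ (M.diam_pos k).ne'
  · rw [hz, abs_mul, abs_of_pos (pow_pos (hs0 k) 2)]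
    have h1 := M.sq_diam_le_area hγ k (i k)
    calc γ ^ 2 * ρ ^ 2 = s k ^ 2 * (γ ^ 2 * Metric.diam (M.elem k).carrier ^ 2) := by
          have := (M.diam_pos k).ne'
          simp only [s]; field_simp
      _ ≤ _ := by gcongr

lemma card_patchIndex_le (hγ : 0 < γ) (ν : Plane) :
    Nat.card (M.PatchIndex ν) ≤ ⌊2 * Real.pi / γ ^ 2⌋₊ * ⌊2 * Real.pi / γ ^ 2⌋₊ := by
  have : Fintype (M.patch ν) := Fintype.ofFinite _
  have hγ2 : 0 < γ ^ 2 := by positivity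
  rw [Nat.card_sigma]
  refine (Finset.sum_le_card_nsmul _ _ ⌊2 * Real.pi / γ ^ 2⌋₊ fun k _ => ?_).trans ?_
  · rw [Nat.card_fin]
    exact Nat.le_floor ((le_div_iff₀ hγ2).2 (M.card_edges_mul_le hγ k))
  · rw [smul_eq_mul, Finset.card_univ, ← Nat.card_eq_fintype_card]
    gcongr
    exact Nat.le_floor ((le_div_iff₀ hγ2).2 (M.card_patch_mul_le hγ ν))

end Mesh

/-! ### The minimisation problems on a patch -/

namespace Mesh

variable {Ω : Set Plane} {γ : ℝ} (M : Mesh Ω γ)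

section

variable {ν : Plane} {m : ℕ} (e : Fin m ≃ M.PatchIndex ν)

lemma forall_patch_iff {P : Set Plane → Prop} :
    (∀ k ∈ M.patch ν, ∀ i, P (M.tri k i)) ↔ ∀ j, P (openTri ((M.triangulation ν e).z j)) := by
  constructor
  · intro h j
    have := h _ (e j).1.2 (e j).2
    rwa [M.tri_eq] at this
  · intro h k hk i
    have h' : ∀ a : M.PatchIndex ν, P (openTri (M.tz a.1 a.2)) := fun a => by
      have := h (e.symm a)
      change P (openTri (M.tz (e (e.symm a)).1 (e (e.symm a)).2)) at this
      rwa [e.apply_symm_apply] at this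
    rw [M.tri_eq]; exact h' ⟨⟨k, hk⟩, i⟩

lemma isPiecewiseRT_iff {q : ℕ} {τ : Plane → Plane} : M.IsPiecewiseRT q ν τ ↔
    ∀ j, IsRTOn q (openTri ((M.triangulation ν e).z j)) τ :=
  M.forall_patch_iff e (P := fun D => IsRTOn q D τ)

lemma isPiecewisePoly_iff {q : ℕ} {v : Plane → ℝ} : M.IsPiecewisePoly q ν v ↔
    ∀ j, IsPolyOn q (openTri ((M.triangulation ν e).z j)) v :=
  M.forall_patch_iff e (P := fun D => IsPolyOn q D v)

/-- The boundary edges at `ν`, as edges of the subtriangulation; none if `ν` is not on the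
boundary. -/
def dirEdges : Set (Fin m × OEdge) :=
  {f | ν ∈ frontier Ω ∧ f.2 = (0, true) ∧
    ((M.elem (e f.1).1).src (e f.1).2 = ν ∨ (M.elem (e f.1).1).tgt (e f.1).2 = ν) ∧
    (M.elem (e f.1).1).edge (e f.1).2 ⊆ frontier Ω}

lemma isHtilde_iff {v : Plane → ℝ} {g : Plane → Plane} :
    M.IsHtilde ν v g ↔ IsHt (M.triangulation ν e) (ν ∈ Ω) (M.dirEdges e) v g := by
  rw [IsHtilde, IsHt, M.region_triangulation]
  refine and_congr_right fun _ => and_congr_right fun _ => ⟨?_, ?_⟩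
  · rintro h ⟨j, _⟩ ⟨hν, rfl, h1, h2⟩
    have := h hν _ _ h1 h2
    rwa [M.tri_eq] at this
  · intro h hν k i h1 h2
    have hk : k ∈ M.patch ν := by
      rcases h1 with h1 | h1
      · exact ⟨_, h1⟩
      · exact ⟨_, h1⟩
    have key : ∀ a : M.PatchIndex ν, ((M.elem a.1).src a.2 = ν ∨ (M.elem a.1).tgt a.2 = ν) →
        (M.elem a.1).edge a.2 ⊆ frontier Ω → HasZeroTrace (openTri (M.tz a.1 a.2))
          ((M.elem a.1).src a.2) ((M.elem a.1).tgt a.2) v g := fun a h1 h2 => by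
      obtain ⟨j, rfl⟩ := e.surjective a
      exact h (j, (0, true)) ⟨hν, rfl, h1, h2⟩
    rw [M.tri_eq]
    exact key ⟨⟨k, hk⟩, i⟩ h1 h2

end

/-- Shape regularity bounds the number of triangles of a patch, so that one constant serves for all
patches. -/
lemma exists_forall_triangulation {γ : ℝ} (hγ : 0 < γ) {P : (m : ℕ) → ℝ → Triangulation m → Prop}
    (hmono : ∀ m C C' T, C ≤ C' → P m C T → P m C' T)
    (h : ∀ m, ∃ C, ∀ T : Triangulation m, (∀ j, ShapeRegular (1 / γ ^ 2) (T.z j)) → P m C T) :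
    ∃ C : ℝ, 0 < C ∧ ∀ (Ω : Set Plane) (M : Mesh Ω γ) (ν : Plane),
      ∃ (m : ℕ) (e : Fin m ≃ M.PatchIndex ν), P m C (M.triangulation ν e) := by
  choose c hc using h
  let N := ⌊2 * Real.pi / γ ^ 2⌋₊ * ⌊2 * Real.pi / γ ^ 2⌋₊
  obtain ⟨C, hC⟩ := Finite.exists_le fun m : Fin (N + 1) => c m
  refine ⟨max C 1, by positivity, fun Ω M ν => ?_⟩
  have hm := M.card_patchIndex_le hγ ν
  refine ⟨_, (Finite.equivFin (M.PatchIndex ν)).symm, ?_⟩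
  exact hmono _ _ _ _ ((hC ⟨_, Nat.lt_succ_of_le hm⟩).trans (le_max_left _ _))
    (hc _ _ fun j => M.shapeRegular_tz hγ _ _)

/-- The comparison of the two minima over fields with prescribed divergence. -/
theorem exists_div_bound (p : ℕ) {γ : ℝ} (hγ : 0 < γ) : ∃ C : ℝ, 0 < C ∧
    ∀ (Ω : Set Plane) (M : Mesh Ω γ) (ν : Plane) (G : Plane → Plane), M.IsPiecewiseRT p ν G →
    ∀ r : Plane → ℝ, M.IsPiecewisePoly p ν r → IsLeast (M.contDiv ν G r) (M.md ν G r) ∧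
      IsLeast (M.discDiv p ν G r) (M.mdh p ν G r) ∧ M.mdh p ν G r ≤ C * M.md ν G r := by
  have hκ : 0 ≤ 1 / γ ^ 2 := by positivity
  obtain ⟨C, hC, h⟩ := exists_forall_triangulation hγ
    (P := fun m C T => ∀ G : Plane → Plane, (∀ j, IsRTOn p (openTri (T.z j)) G) →
      ∀ r : Plane → ℝ, (∀ j, IsPolyOn p (openTri (T.z j)) r) → ∃ a b : ℝ,
      IsLeast {t | ∃ τ, IsHdiv T.region τ r ∧ t = l2norm T.region fun x => τ x + G x} a ∧
      IsLeast {t | ∃ τ, IsHdiv T.region τ r ∧ (∀ j, IsRTOn p (openTri (T.z j)) τ) ∧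
        t = l2norm T.region fun x => τ x + G x} b ∧ b ≤ C * a)
    (fun m C C' T hCC h G hG r hr => by
      obtain ⟨a, b, ha, hb, hab⟩ := h G hG r hr
      refine ⟨a, b, ha, hb, hab.trans (mul_le_mul_of_nonneg_right hCC ?_)⟩
      obtain ⟨τ, -, rfl⟩ := ha.1
      exact ENNReal.toReal_nonneg)
    fun m => (exists_div_minima m p hκ).imp fun C h => h.2
  refine ⟨C, hC, fun Ω M ν G hG r hr => ?_⟩
  obtain ⟨m, e, h⟩ := h Ω M ν
  obtain ⟨a, b, ha, hb, hab⟩ := h G ((M.isPiecewiseRT_iff e).1 hG) r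
    ((M.isPiecewisePoly_iff e).1 hr)
  simp only [M.region_triangulation, ← M.isPiecewiseRT_iff e] at ha hb
  change IsLeast (M.contDiv ν G r) a at ha
  change IsLeast (M.discDiv p ν G r) b at hb
  have ea : M.md ν G r = a := ha.csInf_eq
  have eb : M.mdh p ν G r = b := hb.csInf_eq
  rw [ea, eb]
  exact ⟨ha, hb, hab⟩

/-- The comparison of the two minima over gradients. -/
theorem exists_grad_bound (p : ℕ) {γ : ℝ} (hγ : 0 < γ) : ∃ C : ℝ, 0 < C ∧
    ∀ (Ω : Set Plane), IsOpen Ω →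
    ∀ (M : Mesh Ω γ) (ν : Plane) (G : Plane → Plane), M.IsPiecewiseRT p ν G →
      IsLeast (M.contGrad ν G) (M.mg ν G) ∧ IsLeast (M.discGrad p ν G) (M.mgh p ν G) ∧
      M.mgh p ν G ≤ C * M.mg ν G := by
  have hκ : 0 ≤ 1 / γ ^ 2 := by positivity
  obtain ⟨C, hC, h⟩ := exists_forall_triangulation hγ
    (P := fun m C T => ∀ (mean : Prop) (dir : Set (Fin m × OEdge)), (mean → dir = ∅) →
      ∀ G : Plane → Plane, (∀ j, IsRTOn p (openTri (T.z j)) G) → ∃ a b : ℝ,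
      IsLeast {t | ∃ v g, IsHt T mean dir v g ∧ t = l2norm T.region fun x => G x - g x} a ∧
      IsLeast {t | ∃ v g, IsHt T mean dir v g ∧ (∀ j, IsPolyOn (p + 2) (openTri (T.z j)) v) ∧
        t = l2norm T.region fun x => G x - g x} b ∧ b ≤ C * a)
    (fun m C C' T hCC h mean dir hmd G hG => by
      obtain ⟨a, b, ha, hb, hab⟩ := h mean dir hmd G hG
      refine ⟨a, b, ha, hb, hab.trans (mul_le_mul_of_nonneg_right hCC ?_)⟩
      obtain ⟨v, g, -, rfl⟩ := ha.1
      exact ENNReal.toReal_nonneg)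
    fun m => (exists_grad_minima m p hκ).imp fun C h => h.2
  refine ⟨C, hC, fun Ω hΩ M ν G hG => ?_⟩
  obtain ⟨m, e, h⟩ := h Ω M ν
  have hdir : ν ∈ Ω → M.dirEdges e = ∅ := fun hν => by
    refine eq_empty_of_forall_notMem fun f hf => ?_
    have := hf.1
    rw [hΩ.frontier_eq] at this
    exact this.2 hν
  obtain ⟨a, b, ha, hb, hab⟩ := h _ _ hdir G ((M.isPiecewiseRT_iff e).1 hG)
  simp only [M.region_triangulation, ← M.isHtilde_iff e, ← M.isPiecewisePoly_iff e] at ha hb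
  change IsLeast (M.contGrad ν G) a at ha
  change IsLeast (M.discGrad p ν G) b at hb
  have ea : M.mg ν G = a := ha.csInf_eq
  have eb : M.mgh p ν G = b := hb.csInf_eq
  rw [ea, eb]
  exact ⟨ha, hb, hab⟩

end Mesh

end PatchMin

end

theorem mainTheorem4 (p : ℕ) (γ : ℝ) (hγ : 0 < γ) (hγ1 : γ ≤ 1) :
    ∃ C : ℝ, 0 < C ∧
      ∀ (Ω : Set PatchMin.Plane), PatchMin.IsLipschitzDomain Ω →
      ∀ (M : PatchMin.Mesh Ω γ) (ν : PatchMin.Plane), ν ∈ M.vertexSet →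
      ∀ G : PatchMin.Plane → PatchMin.Plane, M.IsPiecewiseRT p ν G →
      ∀ r : PatchMin.Plane → ℝ, M.IsPiecewisePoly p ν r →
        IsLeast (M.contGrad ν G) (M.mg ν G) ∧
        IsLeast (M.discGrad p ν G) (M.mgh p ν G) ∧
        IsLeast (M.contDiv ν G r) (M.md ν G r) ∧
        IsLeast (M.discDiv p ν G r) (M.mdh p ν G r) ∧
        M.mgh p ν G ≤ C * M.mg ν G ∧
        M.mdh p ν G r ≤ C * M.md ν G r := by
  obtain ⟨C, hC, h⟩ := PatchMin.Mesh.exists_grad_bound p hγ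
  obtain ⟨C', hC', h'⟩ := PatchMin.Mesh.exists_div_bound p hγ
  refine ⟨max C C', lt_max_of_lt_left hC, fun Ω hΩ M ν _ G hG r hr => ?_⟩
  obtain ⟨h1, h2, h3⟩ := h Ω hΩ.isOpen M ν G hG
  obtain ⟨h4, h5, h6⟩ := h' Ω M ν G hG r hr
  have h7 : 0 ≤ M.mg ν G := by
    obtain ⟨v, g, -, e⟩ := h1.1
    rw [e]; exact ENNReal.toReal_nonneg
  have h8 : 0 ≤ M.md ν G r := by
    obtain ⟨τ, -, e⟩ := h4.1
    rw [e]; exact ENNReal.toReal_nonneg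
  exact ⟨h1, h2, h4, h5, h3.trans (by gcongr; exact le_max_left _ _),
    h6.trans (by gcongr; exact le_max_right _ _)⟩
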